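/- **Setting.** Let $a<b$, $c<d$, $\Omega=[a,b]\times[c,d]$, $n_0,n_1,n_2\in\mathbb N$. $L_2[x]$, $L_2[y]$, $L_2[x,y]$ are the (real, vector- or matrix-valued) $L_2$ spaces on $[a,b]$, $[c,d]$, $\Omega$; functions are identified if they agree almost everywhere. $H_k$ is the set of $u\in L_2[x,y]$ all of whose weak derivatives $\partial_x^i\partial_y^ju$ with $\max(i,j)\le k$ lie in $L_2[x,y]$. Put $RL^{m_0,m_1}=\mathbb R^{m_0}\times L_2^{m_1}[x]\times L_2^{m_1}[y]$. **PI operators.** 1D-PI parameters $\{N_0,N_1,N_2\}$ on $[s,t]$ consist of an essentially bounded measurable matrix function $N_0$ and matrix functions $N_1,N_2\in L_2([s,t]^2)$; they define $(\mathcal P[N]v)(x)=N_0(x)v(x)+\int_s^xN_1(x,\theta)v(\theta)d\theta+\int_x^tN_2(x,\theta)v(\theta)d\theta$, and are separable if $N_1=N_2$. 011-PI parameters $B=(B_{ij})_{0\le i,j\le 2}$ consist of a matrix $B_{00}$, of $B_{01},B_{10}\in L_2[x]$, $B_{02},B_{20}\in L_2[y]$, $B_{12},B_{21}\in L_2[x,y]$,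 and of 1D-PI parameters $B_{11}=\{B_{11}^0,B_{11}^1,B_{11}^2\}$ on $[a,b]$ and $B_{22}=\{B_{22}^0,B_{22}^1,B_{22}^2\}$ on $[c,d]$; for $v=(v_0,v_1,v_2)\in RL$, $$\mathcal P[B]v=\begin{pmatrix}B_{00}v_0+\int_a^bB_{01}(x)v_1(x)dx+\int_c^dB_{02}(y)v_2(y)dy\\ B_{10}(x)v_0+(\mathcal P[B_{11}]v_1)(x)+\int_c^dB_{12}(x,y)v_2(y)dy\\ B_{20}(y)v_0+\int_a^bB_{21}(x,y)v_1(x)dx+(\mathcal P[B_{22}]v_2)(y)\end{pmatrix}.$$ 2D-PI parameters are $N=(N_{ij})_{0\le i,j\le2}$, with $N_{00}$ essentially bounded and the others square-integrable in their variables; $\mathcal P[N]u$ is the sum over $i,j$ of the terms $\int\!\!\int N_{ij}\,u$, where $i=0,1,2$ means that the first argument of $u$ is $x$, is integrated as $\theta\in[a,x]$, or as $\theta\in[x,b]$, and $j=0,1,2$ means that the second one is $y$, is integrated as $\nu\in[c,y]$, or as $\nu\in[y,d]$; $N_{ij}$ depends on $x$, $y$ and the integration variables. **Boundary values.** For $u=(u_0,u_1,u_2)\in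 L_2^{n_0}\times H_1^{n_1}\times H_2^{n_2}$ let $\Lambda_{\rm bf}u\in RL^{4n_1+16n_2,\,2n_1+4n_2}$ be the list consisting of: (i) the values at $(a,c),(b,c),(a,d),(b,d)$, in this order, of $u_1$, $u_2$, $\partial_xu_2$, $\partial_yu_2$, $\partial_x\partial_yu_2$; (ii) the restrictions to $y=c$ and $y=d$ of $\partial_xu_1$, $\partial_x^2u_2$, $\partial_x^2\partial_yu_2$; (iii) the restrictions to $x=a$ and $x=b$ of $\partial_yu_1$, $\partial_y^2u_2$, $\partial_x\partial_y^2u_2$. (Point values are those of the continuous representative; restrictions to $y=c,d$ are those of the representative that is continuous in $y$ for a.e. $x$, and likewise for $x=a,b$.) Let $B$ be 011-PI parameters with $\mathcal B=\mathcal P[B]:RL^{4n_1+16n_2,\,2n_1+4n_2}\to RL^{n_1+4n_2,\,n_1+2n_2}$ and with separable diagonal parts $B_{11}=\{B_{11}^0,B_{11}^1,B_{11}^1\}$, $B_{22}=\{B_{22}^0,B_{22}^1,B_{22}^1\}$. Put $$X(\mathcal B)=\{u\in L_2^{n_0}\times H_1^{n_1}\times H_2^{n_2}:\ \mathcal B\Lambda_{\rm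 bf}u=0\},\qquad \mathcal D=\mathrm{diag}(I,\ \partial_x\partial_y,\ \partial_x^2\partial_y^2).$$ **The matrices $H$, $K$.** Write $X=b-a$, $Y=d-c$. Blocks act on $\mathbb R^{n_1}$, $\mathbb R^{n_2}$, and scalars stand for multiples of identity matrices. For a column $p$ and a matrix $q$ let $p\oplus q=\begin{pmatrix}p&0\\0&q\end{pmatrix}$ ($p$ acting on the $n_1$-block, $q$ on the $n_2$-blocks), and for columns $p,q$ let $[0,p\oplus q]$ have in addition a zero block for $\mathbb R^{n_0}$. Then $$H_{00}=\begin{pmatrix}1\\1\\1\\1\end{pmatrix}\oplus\begin{pmatrix}1&0&0&0\\1&X&0&0\\1&0&Y&0\\1&X&Y&XY\\0&1&0&0\\0&1&0&0\\0&1&0&Y\\0&1&0&Y\\0&0&1&0\\0&0&1&X\\0&0&1&0\\0&0&1&X\\0&0&0&1\\0&0&0&1\\0&0&0&1\\0&0&0&1\end{pmatrix},\quad H_{01}(x)=\begin{pmatrix}0\\1\\0\\1\end{pmatrix}\oplus\begin{pmatrix}0&0\\b-x&0\\0&0\\b-x&Y(b-x)\\0&0\\1&0\\0&0\\1&Y\\0&0\\0&b-x\\0&0\\0&b-x\\0&0\\0&1\\0&0\\0&1\end{pmatrix},\quad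 H_{02}(y)=\begin{pmatrix}0\\0\\1\\1\end{pmatrix}\oplus\begin{pmatrix}0&0\\0&0\\d-y&0\\d-y&X(d-y)\\0&0\\0&0\\0&d-y\\0&d-y\\0&0\\0&0\\1&0\\1&X\\0&0\\0&0\\0&1\\0&1\end{pmatrix},$$ $$H_{11}=\begin{pmatrix}1\\1\end{pmatrix}\oplus\begin{pmatrix}1&0\\1&Y\\0&1\\0&1\end{pmatrix},\quad H_{22}=\begin{pmatrix}1\\1\end{pmatrix}\oplus\begin{pmatrix}1&0\\1&X\\0&1\\0&1\end{pmatrix},$$ $$H_{13}(y)=[0,(0,1)^T\oplus(0,d-y,0,1)^T],\quad H_{23}(x)=[0,(0,1)^T\oplus(0,b-x,0,1)^T],$$ $$H_{03}(x,y)=[0,(0,0,0,1)^T\oplus(0,0,0,(d-y)(b-x),0,0,0,d-y,0,0,0,b-x,0,0,0,1)^T],$$ $H_1=\begin{pmatrix}H_{00}&H_{01}&H_{02}\\0&\{H_{11},0,0\}&0\\0&0&\{H_{22},0,0\}\end{pmatrix}$, $\mathcal H_1=\mathcal P[H_1]:RL^{n_1+4n_2,\,n_1+2n_2}\to RL^{4n_1+16n_2,\,2n_1+4n_2}$.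 Moreover (rows: $\mathbb R^{n_0},\mathbb R^{n_1},\mathbb R^{n_2}$) $$K_{30}(x,y)=\begin{pmatrix}0&0&0&0&0\\1&0&0&0&0\\0&1&x-a&y-c&(y-c)(x-a)\end{pmatrix},\quad K_{31}(x,y,\theta)=\begin{pmatrix}0&0&0\\1&0&0\\0&x-\theta&(y-c)(x-\theta)\end{pmatrix},$$ $$K_{32}(x,y,\nu)=\begin{pmatrix}0&0&0\\1&0&0\\0&y-\nu&(x-a)(y-\nu)\end{pmatrix},\quad K_{33}(x,y,\theta,\nu)=\mathrm{diag}(0,\,1,\,(x-\theta)(y-\nu)).$$ **Hypothesis.** The boundary conditions are well-posed: $\mathcal B\mathcal H_1$ is invertible (bijective) on $RL^{n_1+4n_2,\,n_1+2n_2}$. **The parameters $T$.** For 011-PI parameters $\hat E$ with separable diagonal parts such that $\mathcal P[\hat E]=(\mathcal B\mathcal H_1)^{-1}$, define $$F_0(x,y)=B_{00}H_{03}(x,y)+B_{01}(x)H_{13}(y)+B_{02}(y)H_{23}(x),\quad F_1^0(x,y)=B_{11}^0(x)H_{13}(y),\quad F_2^0(x,y)=B_{22}^0(y)H_{23}(x),$$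 $$F_1^1(x,y,\theta)=B_{10}(x)H_{03}(\theta,y)+B_{11}^1(x,\theta)H_{13}(y)+B_{12}(x,y)H_{23}(\theta),$$ $$F_2^1(x,y,\nu)=B_{20}(y)H_{03}(x,\nu)+B_{22}^1(y,\nu)H_{23}(x)+B_{21}(x,y)H_{13}(\nu),$$ $$G_0(x,y)=\hat E_{00}F_0(x,y)+\hat E_{01}(x)F_1^0(x,y)+\int_a^b\hat E_{01}(\theta)F_1^1(\theta,y,x)d\theta+\hat E_{02}(y)F_2^0(x,y)+\int_c^d\hat E_{02}(\nu)F_2^1(x,\nu,y)d\nu,$$ $G_1^0(x,y)=\hat E_{11}^0(x)F_1^0(x,y)$, $G_2^0(x,y)=\hat E_{22}^0(y)F_2^0(x,y)$, $$G_1^1(x,y,\theta)=\hat E_{10}(x)F_0(\theta,y)+\hat E_{11}^0(x)F_1^1(x,y,\theta)+\hat E_{11}^1(x,\theta)F_1^0(\theta,y)+\int_a^b\hat E_{11}^1(x,\eta)F_1^1(\eta,y,\theta)d\eta+\hat E_{12}(x,y)F_2^0(\theta,y)+\int_c^d\hat E_{12}(x,\nu)F_2^1(\theta,\nu,y)d\nu,$$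 $$G_2^1(x,y,\nu)=\hat E_{20}(y)F_0(x,\nu)+\hat E_{22}^0(y)F_2^1(x,y,\nu)+\hat E_{22}^1(y,\nu)F_2^0(x,\nu)+\int_c^d\hat E_{22}^1(y,\mu)F_2^1(x,\mu,\nu)d\mu+\hat E_{21}(x,y)F_1^0(x,\nu)+\int_a^b\hat E_{21}(\theta,y)F_1^1(\theta,\nu,x)d\theta,$$ $$T_{22}(x,y,\theta,\nu)=-K_{30}(x,y)G_0(\theta,\nu)-\int_a^xK_{31}(x,y,\eta)G_1^1(\eta,\nu,\theta)d\eta-\int_c^yK_{32}(x,y,\mu)G_2^1(\theta,\mu,\nu)d\mu,$$ $$T_{12}=-K_{31}(x,y,\theta)G_1^0(\theta,\nu)+T_{22},\quad T_{21}=-K_{32}(x,y,\nu)G_2^0(\theta,\nu)+T_{22},\quad T_{11}=K_{33}+T_{21}+T_{12}-T_{22},$$ $T_{00}=\mathrm{diag}(I_{n_0},0,0)$, all other $T_{ij}=0$, and $\mathcal T=\mathcal P[T]$. **Theorem.** 1. Parameters $\hat E$ as above exist. 2. Let $E$ be the parameters of $\mathcal B\mathcal H_1$: $E_{00}=B_{00}H_{00}$,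 $E_{01}=B_{00}H_{01}+B_{01}H_{11}$, $E_{02}=B_{00}H_{02}+B_{02}H_{22}$, $E_{10}=B_{10}H_{00}$, $E_{20}=B_{20}H_{00}$, $E_{11}^0=B_{11}^0H_{11}$, $E_{22}^0=B_{22}^0H_{22}$, $E_{11}^1(x,\theta)=B_{10}(x)H_{01}(\theta)+B_{11}^1(x,\theta)H_{11}$, $E_{22}^1(y,\nu)=B_{20}(y)H_{02}(\nu)+B_{22}^1(y,\nu)H_{22}$, $E_{12}(x,y)=B_{10}(x)H_{02}(y)+B_{12}(x,y)H_{22}$, $E_{21}(x,y)=B_{20}(y)H_{01}(x)+B_{21}(x,y)H_{11}$. Suppose that for some $q\in\mathbb N$, some $q\times(n_1+2n_2)$ matrix function $Z$ that is $L_2$ on $[a,b]$ and on $[c,d]$, and constant matrices $h_{\cdot\cdot}$, $\Gamma_{\cdot\cdot}$, almost everywhere: $E_{01}(x)=h_{0x}Z(x)$, $E_{02}(y)=h_{0y}Z(y)$, $E_{10}(x)=Z(x)^Th_{x0}$, $E_{20}(y)=Z(y)^Th_{y0}$, $E_{11}^1(x,\theta)=Z(x)^T\Gamma_{xx}Z(\theta)$,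 $E_{12}(x,y)=Z(x)^T\Gamma_{xy}Z(y)$, $E_{21}(x,y)=Z(y)^T\Gamma_{yx}Z(x)$, $E_{22}^1(y,\nu)=Z(y)^T\Gamma_{yy}Z(\nu)$. With $i,j\in\{x,y\}$ put $\Pi_{ij}=\Gamma_{ij}-h_{i0}E_{00}^{-1}h_{0j}$, $K_{xx}=\int_a^bZ(E_{11}^0)^{-1}Z^Tdx$, $K_{yy}=\int_c^dZ(E_{22}^0)^{-1}Z^Tdy$, $\Sigma_x=I+K_{xx}\Pi_{xx}$, $\Sigma_y=I+K_{yy}\Pi_{yy}$, $\mathrm E_{xy}=\Sigma_x^{-1}K_{xx}\Pi_{xy}$, $\mathrm E_{yx}=\Sigma_y^{-1}K_{yy}\Pi_{yx}$, $\Delta_x=\Sigma_x-K_{xx}\Pi_{xy}\mathrm E_{yx}$, $\Delta_y=\Sigma_y-K_{yy}\Pi_{yx}\mathrm E_{xy}$, and assume that $E_{00}$, $E_{11}^0(x)$ and $E_{22}^0(y)$ (almost everywhere), $\Sigma_x,\Sigma_y,\Delta_x,\Delta_y$ are nonsingular. Put $$\hat\Gamma_{yx}=-(\Pi_{yx}-\Pi_{yy}\mathrm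 E_{yx})\Delta_x^{-1},\quad\hat\Gamma_{xy}=-(\Pi_{xy}-\Pi_{xx}\mathrm E_{xy})\Delta_y^{-1},$$ $$\hat\Gamma_{yy}=-(\Pi_{yy}+\hat\Gamma_{yx}K_{xx}\Pi_{xy})\Sigma_y^{-1},\quad\hat\Gamma_{xx}=-(\Pi_{xx}+\hat\Gamma_{xy}K_{yy}\Pi_{yx})\Sigma_x^{-1},$$ $$\hat h_{y0}=-(h_{y0}+\hat\Gamma_{yy}K_{yy}h_{y0}+\hat\Gamma_{yx}K_{xx}h_{x0})E_{00}^{-1},\quad\hat h_{x0}=-(h_{x0}+\hat\Gamma_{xx}K_{xx}h_{x0}+\hat\Gamma_{xy}K_{yy}h_{y0})E_{00}^{-1},$$ $$\hat h_{0y}=-(E_{00}^{-1}h_{0y}-E_{00}^{-1}h_{0x}\mathrm E_{xy})\Delta_y^{-1},\quad\hat h_{0x}=-(E_{00}^{-1}h_{0x}+\hat h_{0y}K_{yy}\Pi_{yx})\Sigma_x^{-1}.$$ Then the parameters $\hat E=\mathcal L_{\rm inv}(E)$ given, with $U_x=Z(E_{11}^0)^{-1}$, $V_x=(E_{11}^0)^{-1}Z^T$,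 $U_y=Z(E_{22}^0)^{-1}$, $V_y=(E_{22}^0)^{-1}Z^T$, by $\hat E_{00}=(I-\hat h_{0x}K_{xx}h_{x0}-\hat h_{0y}K_{yy}h_{y0})E_{00}^{-1}$, $\hat E_{11}^0=(E_{11}^0)^{-1}$, $\hat E_{22}^0=(E_{22}^0)^{-1}$, $\hat E_{01}=\hat h_{0x}U_x(x)$, $\hat E_{02}=\hat h_{0y}U_y(y)$, $\hat E_{10}=V_x(x)\hat h_{x0}$, $\hat E_{20}=V_y(y)\hat h_{y0}$, $\hat E_{11}^1=V_x(x)\hat\Gamma_{xx}U_x(\theta)$, $\hat E_{12}=V_x(x)\hat\Gamma_{xy}U_y(y)$, $\hat E_{21}=V_y(y)\hat\Gamma_{yx}U_x(x)$, $\hat E_{22}^1=V_y(y)\hat\Gamma_{yy}U_y(\nu)$ are admissible in the definition of $T$. 3. For all $\hat E$ as above, $T$ are 2D-PI parameters; $\mathcal Du\in L_2$ exists and $u=\mathcal T\mathcal Du$ for every $u\in X(\mathcal B)$; and $\mathcal T\hat u\in X(\mathcal B)$ and $\hat u=\mathcal D\mathcal T\hat u$ for every $\hat u\in L_2^{n_0+n_1+n_2}[x,y]$.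 -/

import Mathlib

open MeasureTheory Set Filter Topology

open scoped ContDiff Matrix

noncomputable section

namespace PI2D

/-! ## Domain and function spaces -/

/-- The spatial domain `[a,b] × [c,d]`. -/
structure Rect where
  a : ℝ
  b : ℝ
  c : ℝ
  d : ℝ
  hab : a < b
  hcd : c < d

/-- Lebesgue measure on the interval `[s,t]`. -/
def muI (s t : ℝ) : Measure ℝ := volume.restrict (Icc s t)

/-- Lebesgue measure on `[a,b]`. -/
def Rect.mux (R : Rect) : Measure ℝ := muI R.a R.b

/-- Lebesgue measure on `[c,d]`. -/
def Rect.muy (R : Rect) : Measure ℝ := muI R.c R.d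

/-- Lebesgue measure on `[a,b] × [c,d]`. -/
def Rect.mu (R : Rect) : Measure (ℝ × ℝ) := R.mux.prod R.muy

/-- Vector-valued functions with square-integrable components. -/
def MemL2 {α κ : Type*} [MeasurableSpace α] (μ : Measure α) (u : α → κ → ℝ) : Prop :=
  ∀ i, MemLp (fun p => u p i) 2 μ

/-- Matrix-valued functions with square-integrable entries. -/
def MatL2 {α ι κ : Type*} [MeasurableSpace α] (μ : Measure α) (N : α → Matrix ι κ ℝ) : Prop :=
  ∀ i j, MemLp (fun p => N p i j) 2 μ

/-- Matrix-valued functions with (measurable) essentially bounded entries. -/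
def MatLinf {α ι κ : Type*} [MeasurableSpace α] (μ : Measure α) (N : α → Matrix ι κ ℝ) : Prop :=
  ∀ i j, MemLp (fun p => N p i j) ⊤ μ

/-- Partial derivative in the first variable. -/
def pdx (φ : ℝ × ℝ → ℝ) : ℝ × ℝ → ℝ := fun p => deriv (fun s => φ (s, p.2)) p.1

/-- Partial derivative in the second variable. -/
def pdy (φ : ℝ × ℝ → ℝ) : ℝ × ℝ → ℝ := fun p => deriv (fun s => φ (p.1, s)) p.2

/-- Smooth functions with compact support in the open rectangle `(a,b) × (c,d)`. -/
def IsTest (R : Rect) (φ : ℝ × ℝ → ℝ) : Prop :=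
  ContDiff ℝ ∞ φ ∧ HasCompactSupport φ ∧ tsupport φ ⊆ Ioo R.a R.b ×ˢ Ioo R.c R.d

/-- `v` is a weak derivative `∂x^i ∂y^j u` in `L2[x,y]`. -/
def HasWeakDeriv (R : Rect) (i j : ℕ) (u v : ℝ × ℝ → ℝ) : Prop :=
  MemLp v 2 R.mu ∧
    ∀ φ, IsTest R φ →
      ∫ p, u p * (pdx^[i] (pdy^[j] φ)) p ∂ R.mu = (-1) ^ (i + j) * ∫ p, v p * φ p ∂ R.mu

/-- The Sobolev space `H_k[x,y]`: all weak derivatives `∂x^i ∂y^j u` with `max i j ≤ k` exist in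
`L2[x,y]`. -/
def MemH (R : Rect) (k : ℕ) (u : ℝ × ℝ → ℝ) : Prop :=
  MemLp u 2 R.mu ∧ ∀ i j, i ≤ k → j ≤ k → ∃ v, HasWeakDeriv R i j u v

/-! ## PI operators -/

/-- The space `ℝ^{κ₀} × L2^{κ₁}[x] × L2^{κ₁}[y]`: underlying triples of functions. -/
abbrev RL (κ₀ κ₁ : Type*) := (κ₀ → ℝ) × (ℝ → κ₁ → ℝ) × (ℝ → κ₁ → ℝ)

/-- Square-integrability of the function components. -/
def MemRL (R : Rect) {κ₀ κ₁ : Type*} (g : RL κ₀ κ₁) : Prop :=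
  MemL2 R.mux g.2.1 ∧ MemL2 R.muy g.2.2

/-- Equality in `ℝ^{κ₀} × L2^{κ₁}[x] × L2^{κ₁}[y]`. -/
def EqRL (R : Rect) {κ₀ κ₁ : Type*} (f g : RL κ₀ κ₁) : Prop :=
  f.1 = g.1 ∧ f.2.1 =ᵐ[R.mux] g.2.1 ∧ f.2.2 =ᵐ[R.muy] g.2.2

/-- Parameters `{N₀, N₁, N₂}` of a 1D-PI operator. -/
structure N1D (ι κ : Type*) where
  r0 : ℝ → Matrix ι κ ℝ
  r1 : ℝ → ℝ → Matrix ι κ ℝ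
  r2 : ℝ → ℝ → Matrix ι κ ℝ

/-- The parameter class for 1D-PI operators on `L2[s,t]`: square-integrable kernels and an
essentially bounded multiplier. -/
def IsN1D (s t : ℝ) {ι κ : Type*} (N : N1D ι κ) : Prop :=
  MatLinf (muI s t) N.r0 ∧
    MatL2 ((muI s t).prod (muI s t)) (fun p => N.r1 p.1 p.2) ∧
    MatL2 ((muI s t).prod (muI s t)) (fun p => N.r2 p.1 p.2)

/-- Separability of 1D-PI parameters: they are of the form `{N₀, N₁, N₁}`. -/
def N1D.Separable (s t : ℝ) {ι κ : Type*} (N : N1D ι κ) : Prop :=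
  (fun p : ℝ × ℝ => N.r1 p.1 p.2) =ᵐ[(muI s t).prod (muI s t)] fun p => N.r2 p.1 p.2

/-- The 1D-PI operator
`(P[N]u)(x) = N₀(x)u(x) + ∫_s^x N₁(x,θ)u(θ)dθ + ∫_x^t N₂(x,θ)u(θ)dθ`. -/
def P1D (s t : ℝ) {ι κ : Type*} [Fintype ι] [Fintype κ] (N : N1D ι κ) (u : ℝ → κ → ℝ) :
    ℝ → ι → ℝ := fun x =>
  N.r0 x *ᵥ u x + (∫ θ in s..x, N.r1 x θ *ᵥ u θ) + ∫ θ in x..t, N.r2 x θ *ᵥ u θ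

/-- Parameters of a 011-PI operator. In `xy` and in `yx` alike the first argument is the variable
`x ∈ [a,b]` and the second one is `y ∈ [c,d]`. -/
structure N011 (ι₀ ι₁ κ₀ κ₁ : Type*) where
  z00 : Matrix ι₀ κ₀ ℝ
  z0x : ℝ → Matrix ι₀ κ₁ ℝ
  z0y : ℝ → Matrix ι₀ κ₁ ℝ
  x0 : ℝ → Matrix ι₁ κ₀ ℝ
  xx : N1D ι₁ κ₁
  xy : ℝ → ℝ → Matrix ι₁ κ₁ ℝ
  y0 : ℝ → Matrix ι₁ κ₀ ℝ
  yx : ℝ → ℝ → Matrix ι₁ κ₁ ℝ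
  yy : N1D ι₁ κ₁

/-- The parameter class for 011-PI operators. -/
structure IsN011 (R : Rect) {ι₀ ι₁ κ₀ κ₁ : Type*} (N : N011 ι₀ ι₁ κ₀ κ₁) : Prop where
  z0x : MatL2 R.mux N.z0x
  z0y : MatL2 R.muy N.z0y
  x0 : MatL2 R.mux N.x0
  xx : IsN1D R.a R.b N.xx
  xy : MatL2 R.mu fun p => N.xy p.1 p.2
  y0 : MatL2 R.muy N.y0
  yx : MatL2 R.mu fun p => N.yx p.1 p.2
  yy : IsN1D R.c R.d N.yy

/-- The diagonal 1D-PI parts are separable. -/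
def N011.Separable (R : Rect) {ι₀ ι₁ κ₀ κ₁ : Type*} (N : N011 ι₀ ι₁ κ₀ κ₁) : Prop :=
  N.xx.Separable R.a R.b ∧ N.yy.Separable R.c R.d

/-- The 011-PI operator with parameters `N`. -/
def P011 (R : Rect) {ι₀ ι₁ κ₀ κ₁ : Type*} [Fintype ι₀] [Fintype ι₁] [Fintype κ₀] [Fintype κ₁]
    (N : N011 ι₀ ι₁ κ₀ κ₁) (g : RL κ₀ κ₁) : RL ι₀ ι₁ :=
  (N.z00 *ᵥ g.1 + (∫ x in R.a..R.b, N.z0x x *ᵥ g.2.1 x) + ∫ y in R.c..R.d, N.z0y y *ᵥ g.2.2 y,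
   fun x => N.x0 x *ᵥ g.1 + P1D R.a R.b N.xx g.2.1 x + ∫ y in R.c..R.d, N.xy x y *ᵥ g.2.2 y,
   fun y => N.y0 y *ᵥ g.1 + (∫ x in R.a..R.b, N.yx x y *ᵥ g.2.1 x) + P1D R.c R.d N.yy g.2.2 y)

/-- Parameters of a 2D-PI operator. -/
structure N2D (ι κ : Type*) where
  n00 : ℝ → ℝ → Matrix ι κ ℝ
  n10 : ℝ → ℝ → ℝ → Matrix ι κ ℝ
  n20 : ℝ → ℝ → ℝ → Matrix ι κ ℝ
  n01 : ℝ → ℝ → ℝ → Matrix ι κ ℝ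
  n02 : ℝ → ℝ → ℝ → Matrix ι κ ℝ
  n11 : ℝ → ℝ → ℝ → ℝ → Matrix ι κ ℝ
  n21 : ℝ → ℝ → ℝ → ℝ → Matrix ι κ ℝ
  n12 : ℝ → ℝ → ℝ → ℝ → Matrix ι κ ℝ
  n22 : ℝ → ℝ → ℝ → ℝ → Matrix ι κ ℝ

/-- The parameter class for 2D-PI operators: `n10, n20` depend on `(x,y,θ)`, `n01, n02` on
`(x,y,ν)`, and `n11, n21, n12, n22` on `(x,y,θ,ν)`. -/
structure IsN2D (R : Rect) {ι κ : Type*} (N : N2D ι κ) : Prop where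
  n00 : MatLinf R.mu fun p => N.n00 p.1 p.2
  n10 : MatL2 (R.mu.prod R.mux) fun p => N.n10 p.1.1 p.1.2 p.2
  n20 : MatL2 (R.mu.prod R.mux) fun p => N.n20 p.1.1 p.1.2 p.2
  n01 : MatL2 (R.mu.prod R.muy) fun p => N.n01 p.1.1 p.1.2 p.2
  n02 : MatL2 (R.mu.prod R.muy) fun p => N.n02 p.1.1 p.1.2 p.2
  n11 : MatL2 (R.mu.prod R.mu) fun p => N.n11 p.1.1 p.1.2 p.2.1 p.2.2
  n21 : MatL2 (R.mu.prod R.mu) fun p => N.n21 p.1.1 p.1.2 p.2.1 p.2.2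
  n12 : MatL2 (R.mu.prod R.mu) fun p => N.n12 p.1.1 p.1.2 p.2.1 p.2.2
  n22 : MatL2 (R.mu.prod R.mu) fun p => N.n22 p.1.1 p.1.2 p.2.1 p.2.2

/-- The 2D-PI operator with parameters `N`. -/
def P2D (R : Rect) {ι κ : Type*} [Fintype ι] [Fintype κ] (N : N2D ι κ) (u : ℝ × ℝ → κ → ℝ) :
    ℝ × ℝ → ι → ℝ := fun p =>
  let x := p.1
  let y := p.2
  N.n00 x y *ᵥ u (x, y)
    + (∫ θ in R.a..x, N.n10 x y θ *ᵥ u (θ, y))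
    + (∫ θ in x..R.b, N.n20 x y θ *ᵥ u (θ, y))
    + (∫ ν in R.c..y, N.n01 x y ν *ᵥ u (x, ν))
    + (∫ ν in y..R.d, N.n02 x y ν *ᵥ u (x, ν))
    + (∫ θ in R.a..x, ∫ ν in R.c..y, N.n11 x y θ ν *ᵥ u (θ, ν))
    + (∫ θ in x..R.b, ∫ ν in R.c..y, N.n21 x y θ ν *ᵥ u (θ, ν))
    + (∫ θ in R.a..x, ∫ ν in y..R.d, N.n12 x y θ ν *ᵥ u (θ, ν))
    + (∫ θ in x..R.b, ∫ ν in y..R.d, N.n22 x y θ ν *ᵥ u (θ, ν))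

/-- Entrywise integral of a matrix-valued function over `[s,t]`. -/
def matInt {ι κ : Type*} (s t : ℝ) (M : ℝ → Matrix ι κ ℝ) : Matrix ι κ ℝ :=
  Matrix.of fun i j => ∫ τ in s..t, M τ i j

/-! ## States, boundary values, and boundary conditions -/

/-- Index set of the PDE state `(u₀, u₁, u₂)`, of dimension `n0 + n1 + n2`. -/
abbrev State (n0 n1 n2 : ℕ) := Fin n0 ⊕ (Fin n1 ⊕ Fin n2)

/-- Index set of size `n1 + r * n2`, ordered in blocks: one block of size `n1`, then `r` blocks of
size `n2`. Core boundary values live on `Core 4` (corner) and `Core 2` (edges). -/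
abbrev Core (r n1 n2 : ℕ) := Fin n1 ⊕ (Fin r × Fin n2)

/-- Index set of size `k * n1 + r * n2`, ordered in blocks: `k` blocks of size `n1`, then `r` blocks
of size `n2`. All boundary values live on `Full 4 16` (corners) and `Full 2 4` (edges). -/
abbrev Full (k r n1 n2 : ℕ) := (Fin k × Fin n1) ⊕ (Fin r × Fin n2)

/-- The component `u₀`. -/
def comp0 {n0 n1 n2 : ℕ} (u : ℝ × ℝ → State n0 n1 n2 → ℝ) (i : Fin n0) : ℝ × ℝ → ℝ :=
  fun p => u p (Sum.inl i)

/-- The component `u₁`. -/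
def comp1 {n0 n1 n2 : ℕ} (u : ℝ × ℝ → State n0 n1 n2 → ℝ) (i : Fin n1) : ℝ × ℝ → ℝ :=
  fun p => u p (Sum.inr (Sum.inl i))

/-- The component `u₂`. -/
def comp2 {n0 n1 n2 : ℕ} (u : ℝ × ℝ → State n0 n1 n2 → ℝ) (i : Fin n2) : ℝ × ℝ → ℝ :=
  fun p => u p (Sum.inr (Sum.inr i))

/-- `uh = D u` in `L2`, where `D = diag(I, ∂x∂y, ∂x²∂y²)`. -/
def IsD (R : Rect) {n0 n1 n2 : ℕ} (u uh : ℝ × ℝ → State n0 n1 n2 → ℝ) : Prop :=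
  MemL2 R.mu uh ∧
    (∀ i, comp0 uh i =ᵐ[R.mu] comp0 u i) ∧
    (∀ i, HasWeakDeriv R 1 1 (comp1 u i) (comp1 uh i)) ∧
    (∀ i, HasWeakDeriv R 2 2 (comp2 u i) (comp2 uh i))

/-- The value of `∂x^i ∂y^j u` at the point `p` is `z`: the weak derivative has a representative
that is continuous on `[a,b] × [c,d]` and takes the value `z` at `p`. -/
def PointVal (R : Rect) (i j : ℕ) (u : ℝ × ℝ → ℝ) (p : ℝ × ℝ) (z : ℝ) : Prop :=
  ∃ w, HasWeakDeriv R i j u w ∧ ContinuousOn w (Icc R.a R.b ×ˢ Icc R.c R.d) ∧ w p = z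

/-- `x ↦ (∂x^i ∂y^j u)(x,y₀)` is `g`: the weak derivative has a representative that, for almost every
`x`, is continuous in `y ∈ [c,d]` and takes the value `g x` at `y = y₀`. -/
def EdgeValX (R : Rect) (i j : ℕ) (u : ℝ × ℝ → ℝ) (y₀ : ℝ) (g : ℝ → ℝ) : Prop :=
  ∃ w, HasWeakDeriv R i j u w ∧
    ∀ᵐ x ∂ R.mux, ContinuousOn (fun y => w (x, y)) (Icc R.c R.d) ∧ w (x, y₀) = g x

/-- `y ↦ (∂x^i ∂y^j u)(x₀,y)` is `g`. -/
def EdgeValY (R : Rect) (i j : ℕ) (u : ℝ × ℝ → ℝ) (x₀ : ℝ) (g : ℝ → ℝ) : Prop :=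
  ∃ w, HasWeakDeriv R i j u w ∧
    ∀ᵐ y ∂ R.muy, ContinuousOn (fun x => w (x, y)) (Icc R.a R.b) ∧ w (x₀, y) = g y

/-- The corners, in the order `(a,c), (b,c), (a,d), (b,d)`. -/
def Rect.corner (R : Rect) : Fin 4 → ℝ × ℝ := ![(R.a, R.c), (R.b, R.c), (R.a, R.d), (R.b, R.d)]

/-- Derivatives of `u₂` that are evaluated at the corners: `1, ∂x, ∂y, ∂x∂y`. -/
def cornerOrder : Fin 4 → ℕ × ℕ := ![(0, 0), (1, 0), (0, 1), (1, 1)]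

/-- Derivatives of `u₂` that are evaluated at `y = c` and `y = d`: `∂x², ∂x²∂y`. -/
def xEdgeOrder : Fin 2 → ℕ × ℕ := ![(2, 0), (2, 1)]

/-- Derivatives of `u₂` that are evaluated at `x = a` and `x = b`: `∂y², ∂x∂y²`. -/
def yEdgeOrder : Fin 2 → ℕ × ℕ := ![(0, 2), (1, 2)]

/-- `β = Λ_bf u`, the list of all boundary values of `u`. The pair `(m,l)` (derivative, position) is
in block number `l + 4 m` (corners) or `l + 2 m` (edges), by `finProdFinEquiv`. -/
structure IsBoundary (R : Rect) {n0 n1 n2 : ℕ} (u : ℝ × ℝ → State n0 n1 n2 → ℝ)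
    (β : RL (Full 4 16 n1 n2) (Full 2 4 n1 n2)) : Prop where
  mem : MemRL R β
  corner1 : ∀ (l : Fin 4) (i : Fin n1),
    PointVal R 0 0 (comp1 u i) (R.corner l) (β.1 (Sum.inl (l, i)))
  corner2 : ∀ (m l : Fin 4) (i : Fin n2),
    PointVal R (cornerOrder m).1 (cornerOrder m).2 (comp2 u i) (R.corner l)
      (β.1 (Sum.inr (finProdFinEquiv (m, l), i)))
  xEdge1 : ∀ (l : Fin 2) (i : Fin n1),
    EdgeValX R 1 0 (comp1 u i) (![R.c, R.d] l) (fun x => β.2.1 x (Sum.inl (l, i)))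
  xEdge2 : ∀ (m l : Fin 2) (i : Fin n2),
    EdgeValX R (xEdgeOrder m).1 (xEdgeOrder m).2 (comp2 u i) (![R.c, R.d] l)
      (fun x => β.2.1 x (Sum.inr (finProdFinEquiv (m, l), i)))
  yEdge1 : ∀ (l : Fin 2) (i : Fin n1),
    EdgeValY R 0 1 (comp1 u i) (![R.a, R.b] l) (fun y => β.2.2 y (Sum.inl (l, i)))
  yEdge2 : ∀ (m l : Fin 2) (i : Fin n2),
    EdgeValY R (yEdgeOrder m).1 (yEdgeOrder m).2 (comp2 u i) (![R.a, R.b] l)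
      (fun y => β.2.2 y (Sum.inr (finProdFinEquiv (m, l), i)))

/-- Parameters of the boundary operator: `n1 + 4 n2` scalar conditions, `n1 + 2 n2` conditions on
functions of `x`, and `n1 + 2 n2` conditions on functions of `y`. The rows are indexed by the sets
`Core 4`, `Core 2` of these sizes. -/
abbrev BCParam (n1 n2 : ℕ) :=
  N011 (Core 4 n1 n2) (Core 2 n1 n2) (Full 4 16 n1 n2) (Full 2 4 n1 n2)

/-- The set `X(B)`: `u ∈ L2 × H_1 × H_2` with `P[B] Λ_bf u = 0`. -/
def MemX (R : Rect) {n0 n1 n2 : ℕ} (B : BCParam n1 n2) (u : ℝ × ℝ → State n0 n1 n2 → ℝ) : Prop :=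
  (∀ i, MemLp (comp0 u i) 2 R.mu) ∧ (∀ i, MemH R 1 (comp1 u i)) ∧ (∀ i, MemH R 2 (comp2 u i)) ∧
    ∃ β, IsBoundary R u β ∧ EqRL R (P011 R B β) 0

/-! ## The matrices `K` and `H` -/

/-- Block matrix from core values to the state: block row `u₁` is `[p I, 0, …, 0]`, and block row
`u₂` is `[0, q₁ I, …, q_r I]`. -/
def stateCore {r n0 n1 n2 : ℕ} (p : ℝ) (q : Fin r → ℝ) :
    Matrix (State n0 n1 n2) (Core r n1 n2) ℝ :=
  Matrix.of fun
    | .inr (.inl i), .inl j => if i = j then p else 0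
    | .inr (.inr i), .inr (k, j) => if i = j then q k else 0
    | _, _ => 0

/-- Block matrix from core values to full boundary values: block `(k,·)` of the `u₁` part is
`[p k I, 0, …, 0]`, and block `(k,·)` of the `u₂` part is `[0, q k 0 I, …, q k (s-1) I]`. -/
def fullCore {k r s n1 n2 : ℕ} (p : Fin k → ℝ) (q : Matrix (Fin r) (Fin s) ℝ) :
    Matrix (Full k r n1 n2) (Core s n1 n2) ℝ :=
  Matrix.of fun
    | .inl (l, i), .inl j => if i = j then p l else 0
    | .inr (l, i), .inr (m, j) => if i = j then q l m else 0
    | _, _ => 0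

/-- Block matrix from the state to full boundary values: `[0, p l I, 0]` in the `u₁` blocks and
`[0, 0, q l I]` in the `u₂` blocks. -/
def fullState {k r n0 n1 n2 : ℕ} (p : Fin k → ℝ) (q : Fin r → ℝ) :
    Matrix (Full k r n1 n2) (State n0 n1 n2) ℝ :=
  Matrix.of fun
    | .inl (l, i), .inr (.inl j) => if i = j then p l else 0
    | .inr (l, i), .inr (.inr j) => if i = j then q l else 0
    | _, _ => 0

/-- `diag(p I, q I, r I)` on the state. -/
def stateDiag {n0 n1 n2 : ℕ} (p q r : ℝ) : Matrix (State n0 n1 n2) (State n0 n1 n2) ℝ :=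
  Matrix.diagonal fun
    | .inl _ => p
    | .inr (.inl _) => q
    | .inr (.inr _) => r

section matrices

variable (R : Rect) {n0 n1 n2 : ℕ}

def K30 (x y : ℝ) : Matrix (State n0 n1 n2) (Core 4 n1 n2) ℝ :=
  stateCore 1 ![1, x - R.a, y - R.c, (y - R.c) * (x - R.a)]

def K31 (x y θ : ℝ) : Matrix (State n0 n1 n2) (Core 2 n1 n2) ℝ :=
  stateCore 1 ![x - θ, (y - R.c) * (x - θ)]

def K32 (x y ν : ℝ) : Matrix (State n0 n1 n2) (Core 2 n1 n2) ℝ :=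
  stateCore 1 ![y - ν, (x - R.a) * (y - ν)]

def K33 (x y θ ν : ℝ) : Matrix (State n0 n1 n2) (State n0 n1 n2) ℝ :=
  stateDiag 0 1 ((x - θ) * (y - ν))

def H00 : Matrix (Full 4 16 n1 n2) (Core 4 n1 n2) ℝ :=
  let X := R.b - R.a
  let Y := R.d - R.c
  fullCore ![1, 1, 1, 1]
    !![1, 0, 0, 0;
       1, X, 0, 0;
       1, 0, Y, 0;
       1, X, Y, Y * X;
       0, 1, 0, 0;
       0, 1, 0, 0;
       0, 1, 0, Y;
       0, 1, 0, Y;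
       0, 0, 1, 0;
       0, 0, 1, X;
       0, 0, 1, 0;
       0, 0, 1, X;
       0, 0, 0, 1;
       0, 0, 0, 1;
       0, 0, 0, 1;
       0, 0, 0, 1]

def H01 (x : ℝ) : Matrix (Full 4 16 n1 n2) (Core 2 n1 n2) ℝ :=
  let X := R.b - x
  let Y := R.d - R.c
  fullCore ![0, 1, 0, 1]
    !![0, 0;
       X, 0;
       0, 0;
       X, Y * X;
       0, 0;
       1, 0;
       0, 0;
       1, Y;
       0, 0;
       0, X;
       0, 0;
       0, X;
       0, 0;
       0, 1;
       0, 0;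
       0, 1]

def H02 (y : ℝ) : Matrix (Full 4 16 n1 n2) (Core 2 n1 n2) ℝ :=
  let X := R.b - R.a
  let Y := R.d - y
  fullCore ![0, 0, 1, 1]
    !![0, 0;
       0, 0;
       Y, 0;
       Y, X * Y;
       0, 0;
       0, 0;
       0, Y;
       0, Y;
       0, 0;
       0, 0;
       1, 0;
       1, X;
       0, 0;
       0, 0;
       0, 1;
       0, 1]

def H11 : Matrix (Full 2 4 n1 n2) (Core 2 n1 n2) ℝ :=
  fullCore ![1, 1] !![1, 0; 1, R.d - R.c; 0, 1; 0, 1]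

def H22 : Matrix (Full 2 4 n1 n2) (Core 2 n1 n2) ℝ :=
  fullCore ![1, 1] !![1, 0; 1, R.b - R.a; 0, 1; 0, 1]

def H13 (y : ℝ) : Matrix (Full 2 4 n1 n2) (State n0 n1 n2) ℝ :=
  fullState ![0, 1] ![0, R.d - y, 0, 1]

def H23 (x : ℝ) : Matrix (Full 2 4 n1 n2) (State n0 n1 n2) ℝ :=
  fullState ![0, 1] ![0, R.b - x, 0, 1]

def H03 (x y : ℝ) : Matrix (Full 4 16 n1 n2) (State n0 n1 n2) ℝ :=
  fullState ![0, 0, 0, 1]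
    ![0, 0, 0, (R.d - y) * (R.b - x), 0, 0, 0, R.d - y, 0, 0, 0, R.b - x, 0, 0, 0, 1]

/-- Parameters `H₁` of the 011-PI operator from core to full boundary values. -/
def H1 : N011 (Full 4 16 n1 n2) (Full 2 4 n1 n2) (Core 4 n1 n2) (Core 2 n1 n2) where
  z00 := H00 R
  z0x := H01 R
  z0y := H02 R
  x0 := 0
  xx := ⟨fun _ => H11 R, 0, 0⟩
  xy := 0
  y0 := 0
  yx := 0
  yy := ⟨fun _ => H22 R, 0, 0⟩

end matrices

/-! ## Well-posedness and the inverse -/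

/-- Square 011-PI parameters on core boundary values. -/
abbrev CoreParam (n1 n2 : ℕ) :=
  N011 (Core 4 n1 n2) (Core 2 n1 n2) (Core 4 n1 n2) (Core 2 n1 n2)

/-- The operator `P[B] ∘ P[H₁]`. -/
def BH1 (R : Rect) {n1 n2 : ℕ} (B : BCParam n1 n2) (g : RL (Core 4 n1 n2) (Core 2 n1 n2)) :
    RL (Core 4 n1 n2) (Core 2 n1 n2) :=
  P011 R B (P011 R (H1 R) g)

/-- Well-posed boundary conditions: `P[B] ∘ P[H₁]` is invertible (bijective) on
`ℝ^{n1+4n2} × L2^{n1+2n2}[x] × L2^{n1+2n2}[y]`. -/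
def WellPosed (R : Rect) {n1 n2 : ℕ} (B : BCParam n1 n2) : Prop :=
  (∀ g, MemRL R g → EqRL R (BH1 R B g) 0 → EqRL R g 0) ∧
    ∀ f, MemRL R f → ∃ g, MemRL R g ∧ EqRL R (BH1 R B g) f

/-- `Eh` are 011-PI parameters, with separable diagonal parts, of the inverse of
`P[B] ∘ P[H₁]`. -/
structure IsInverse (R : Rect) {n1 n2 : ℕ} (B : BCParam n1 n2) (Eh : CoreParam n1 n2) :
    Prop where
  mem : IsN011 R Eh
  sep : Eh.Separable R
  left : ∀ g, MemRL R g → EqRL R (P011 R Eh (BH1 R B g)) g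
  right : ∀ f, MemRL R f → EqRL R (BH1 R B (P011 R Eh f)) f

/-- The parameters `E` of the composition `P[B] ∘ P[H₁]`, for `B` with separable diagonal parts. -/
def EMat (R : Rect) {n1 n2 : ℕ} (B : BCParam n1 n2) : CoreParam n1 n2 where
  z00 := B.z00 * H00 R
  z0x x := B.z00 * H01 R x + B.z0x x * H11 R
  z0y y := B.z00 * H02 R y + B.z0y y * H22 R
  x0 x := B.x0 x * H00 R
  xx :=
    { r0 := fun x => B.xx.r0 x * H11 R
      r1 := fun x θ => B.x0 x * H01 R θ + B.xx.r1 x θ * H11 R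
      r2 := fun x θ => B.x0 x * H01 R θ + B.xx.r1 x θ * H11 R }
  xy x y := B.x0 x * H02 R y + B.xy x y * H22 R
  y0 y := B.y0 y * H00 R
  yx x y := B.y0 y * H01 R x + B.yx x y * H11 R
  yy :=
    { r0 := fun y => B.yy.r0 y * H22 R
      r1 := fun y ν => B.y0 y * H02 R ν + B.yy.r1 y ν * H22 R
      r2 := fun y ν => B.y0 y * H02 R ν + B.yy.r1 y ν * H22 R }

/-- Data of a finite-dimensional decomposition of the off-diagonal and integral parameters of a
square 011-PI operator. -/
structure SepData (q : ℕ) (ι₀ ι₁ : Type*) where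
  Z : ℝ → Matrix (Fin q) ι₁ ℝ
  H0x : Matrix ι₀ (Fin q) ℝ
  H0y : Matrix ι₀ (Fin q) ℝ
  Hx0 : Matrix (Fin q) ι₀ ℝ
  Hy0 : Matrix (Fin q) ι₀ ℝ
  Gxx : Matrix (Fin q) (Fin q) ℝ
  Gxy : Matrix (Fin q) (Fin q) ℝ
  Gyx : Matrix (Fin q) (Fin q) ℝ
  Gyy : Matrix (Fin q) (Fin q) ℝ

/-- The parameters `Q` (with separable diagonal parts) decompose according to `S`. -/
structure IsDecomp (R : Rect) {q : ℕ} {ι₀ ι₁ : Type*} (Q : N011 ι₀ ι₁ ι₀ ι₁)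
    (S : SepData q ι₀ ι₁) : Prop where
  Zx : MatL2 R.mux S.Z
  Zy : MatL2 R.muy S.Z
  z0x : ∀ᵐ x ∂ R.mux, Q.z0x x = S.H0x * S.Z x
  z0y : ∀ᵐ y ∂ R.muy, Q.z0y y = S.H0y * S.Z y
  x0 : ∀ᵐ x ∂ R.mux, Q.x0 x = (S.Z x)ᵀ * S.Hx0
  xx : ∀ᵐ p ∂(R.mux.prod R.mux), Q.xx.r1 p.1 p.2 = (S.Z p.1)ᵀ * S.Gxx * S.Z p.2
  xy : ∀ᵐ p ∂ R.mu, Q.xy p.1 p.2 = (S.Z p.1)ᵀ * S.Gxy * S.Z p.2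
  y0 : ∀ᵐ y ∂ R.muy, Q.y0 y = (S.Z y)ᵀ * S.Hy0
  yx : ∀ᵐ p ∂ R.mu, Q.yx p.1 p.2 = (S.Z p.2)ᵀ * S.Gyx * S.Z p.1
  yy : ∀ᵐ p ∂(R.muy.prod R.muy), Q.yy.r1 p.1 p.2 = (S.Z p.1)ᵀ * S.Gyy * S.Z p.2

section inverse

variable (R : Rect) {q : ℕ} {ι₀ ι₁ : Type*} [Fintype ι₀] [Fintype ι₁] [DecidableEq ι₀]
  [DecidableEq ι₁] (Q : N011 ι₀ ι₁ ι₀ ι₁) (S : SepData q ι₀ ι₁)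

def Kxx : Matrix (Fin q) (Fin q) ℝ :=
  matInt R.a R.b fun x => S.Z x * (Q.xx.r0 x)⁻¹ * (S.Z x)ᵀ

def Kyy : Matrix (Fin q) (Fin q) ℝ :=
  matInt R.c R.d fun y => S.Z y * (Q.yy.r0 y)⁻¹ * (S.Z y)ᵀ

def PIxx : Matrix (Fin q) (Fin q) ℝ := S.Gxx - S.Hx0 * Q.z00⁻¹ * S.H0x

def PIxy : Matrix (Fin q) (Fin q) ℝ := S.Gxy - S.Hx0 * Q.z00⁻¹ * S.H0y

def PIyx : Matrix (Fin q) (Fin q) ℝ := S.Gyx - S.Hy0 * Q.z00⁻¹ * S.H0x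

def PIyy : Matrix (Fin q) (Fin q) ℝ := S.Gyy - S.Hy0 * Q.z00⁻¹ * S.H0y

def SigmaX : Matrix (Fin q) (Fin q) ℝ := 1 + Kxx R Q S * PIxx Q S

def SigmaY : Matrix (Fin q) (Fin q) ℝ := 1 + Kyy R Q S * PIyy Q S

def Exy : Matrix (Fin q) (Fin q) ℝ := (SigmaX R Q S)⁻¹ * Kxx R Q S * PIxy Q S

def Eyx : Matrix (Fin q) (Fin q) ℝ := (SigmaY R Q S)⁻¹ * Kyy R Q S * PIyx Q S

def DeltaX : Matrix (Fin q) (Fin q) ℝ := SigmaX R Q S - Kxx R Q S * PIxy Q S * Eyx R Q S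

def DeltaY : Matrix (Fin q) (Fin q) ℝ := SigmaY R Q S - Kyy R Q S * PIyx Q S * Exy R Q S

/-- All inverse matrices that occur in the explicit formula for the inverse exist. -/
structure LinvDefined : Prop where
  z00 : IsUnit Q.z00.det
  xx : ∀ᵐ x ∂ R.mux, IsUnit (Q.xx.r0 x).det
  yy : ∀ᵐ y ∂ R.muy, IsUnit (Q.yy.r0 y).det
  sigmaX : IsUnit (SigmaX R Q S).det
  sigmaY : IsUnit (SigmaY R Q S).det
  deltaX : IsUnit (DeltaX R Q S).det
  deltaY : IsUnit (DeltaY R Q S).det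

def Gyxh : Matrix (Fin q) (Fin q) ℝ := -(PIyx Q S - PIyy Q S * Eyx R Q S) * (DeltaX R Q S)⁻¹

def Gxyh : Matrix (Fin q) (Fin q) ℝ := -(PIxy Q S - PIxx Q S * Exy R Q S) * (DeltaY R Q S)⁻¹

def Gyyh : Matrix (Fin q) (Fin q) ℝ :=
  -(PIyy Q S + Gyxh R Q S * Kxx R Q S * PIxy Q S) * (SigmaY R Q S)⁻¹

def Gxxh : Matrix (Fin q) (Fin q) ℝ :=
  -(PIxx Q S + Gxyh R Q S * Kyy R Q S * PIyx Q S) * (SigmaX R Q S)⁻¹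

def Hy0h : Matrix (Fin q) ι₀ ℝ :=
  -(S.Hy0 + Gyyh R Q S * Kyy R Q S * S.Hy0 + Gyxh R Q S * Kxx R Q S * S.Hx0) * Q.z00⁻¹

def Hx0h : Matrix (Fin q) ι₀ ℝ :=
  -(S.Hx0 + Gxxh R Q S * Kxx R Q S * S.Hx0 + Gxyh R Q S * Kyy R Q S * S.Hy0) * Q.z00⁻¹

def H0yh : Matrix ι₀ (Fin q) ℝ :=
  -(Q.z00⁻¹ * S.H0y - Q.z00⁻¹ * S.H0x * Exy R Q S) * (DeltaY R Q S)⁻¹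

def H0xh : Matrix ι₀ (Fin q) ℝ :=
  -(Q.z00⁻¹ * S.H0x + H0yh R Q S * Kyy R Q S * PIyx Q S) * (SigmaX R Q S)⁻¹

/-- The explicit inverse parameters `L_inv(Q)`. The factors `Ẑ_{x0}ᵀ = Q̂_xx⁰ Zᵀ` and
`Ẑ_{0x} = Z Q̂_xx⁰`, with `Q̂_xx⁰ = (Q_xx⁰)⁻¹`, are written out, and likewise in `y`. -/
def Linv : N011 ι₀ ι₁ ι₀ ι₁ where
  z00 := (1 - H0xh R Q S * Kxx R Q S * S.Hx0 - H0yh R Q S * Kyy R Q S * S.Hy0) * Q.z00⁻¹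
  z0x x := H0xh R Q S * (S.Z x * (Q.xx.r0 x)⁻¹)
  z0y y := H0yh R Q S * (S.Z y * (Q.yy.r0 y)⁻¹)
  x0 x := ((Q.xx.r0 x)⁻¹ * (S.Z x)ᵀ) * Hx0h R Q S
  xx :=
    { r0 := fun x => (Q.xx.r0 x)⁻¹
      r1 := fun x θ => ((Q.xx.r0 x)⁻¹ * (S.Z x)ᵀ) * Gxxh R Q S * (S.Z θ * (Q.xx.r0 θ)⁻¹)
      r2 := fun x θ => ((Q.xx.r0 x)⁻¹ * (S.Z x)ᵀ) * Gxxh R Q S * (S.Z θ * (Q.xx.r0 θ)⁻¹) }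
  xy x y := ((Q.xx.r0 x)⁻¹ * (S.Z x)ᵀ) * Gxyh R Q S * (S.Z y * (Q.yy.r0 y)⁻¹)
  y0 y := ((Q.yy.r0 y)⁻¹ * (S.Z y)ᵀ) * Hy0h R Q S
  yx x y := ((Q.yy.r0 y)⁻¹ * (S.Z y)ᵀ) * Gyxh R Q S * (S.Z x * (Q.xx.r0 x)⁻¹)
  yy :=
    { r0 := fun y => (Q.yy.r0 y)⁻¹
      r1 := fun y ν => ((Q.yy.r0 y)⁻¹ * (S.Z y)ᵀ) * Gyyh R Q S * (S.Z ν * (Q.yy.r0 ν)⁻¹)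
      r2 := fun y ν => ((Q.yy.r0 y)⁻¹ * (S.Z y)ᵀ) * Gyyh R Q S * (S.Z ν * (Q.yy.r0 ν)⁻¹) }

end inverse

/-! ## The parameters `F`, `G` and `T` -/

section params

variable (R : Rect) {n0 n1 n2 : ℕ} (B : BCParam n1 n2) (Eh : CoreParam n1 n2)

def F0 (x y : ℝ) : Matrix (Core 4 n1 n2) (State n0 n1 n2) ℝ :=
  B.z00 * H03 R x y + B.z0x x * H13 R y + B.z0y y * H23 R x

/-- `F₁⁰(x,y)`. -/
def F10 (x y : ℝ) : Matrix (Core 2 n1 n2) (State n0 n1 n2) ℝ := B.xx.r0 x * H13 R y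

/-- `F₁¹(x,y,θ)`. -/
def F11 (x y θ : ℝ) : Matrix (Core 2 n1 n2) (State n0 n1 n2) ℝ :=
  B.x0 x * H03 R θ y + B.xx.r1 x θ * H13 R y + B.xy x y * H23 R θ

/-- `F₂⁰(x,y)`. -/
def F20 (x y : ℝ) : Matrix (Core 2 n1 n2) (State n0 n1 n2) ℝ := B.yy.r0 y * H23 R x

/-- `F₂¹(x,y,ν)`. -/
def F21 (x y ν : ℝ) : Matrix (Core 2 n1 n2) (State n0 n1 n2) ℝ :=
  B.y0 y * H03 R x ν + B.yy.r1 y ν * H23 R x + B.yx x y * H13 R ν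

def G0 (x y : ℝ) : Matrix (Core 4 n1 n2) (State n0 n1 n2) ℝ :=
  Eh.z00 * F0 R B x y
    + Eh.z0x x * F10 R B x y + matInt R.a R.b (fun θ => Eh.z0x θ * F11 R B θ y x)
    + Eh.z0y y * F20 R B x y + matInt R.c R.d (fun ν => Eh.z0y ν * F21 R B x ν y)

/-- `G₁⁰(x,y)`. -/
def G10 (x y : ℝ) : Matrix (Core 2 n1 n2) (State n0 n1 n2) ℝ := Eh.xx.r0 x * F10 R B x y

/-- `G₁¹(x,y,θ)`. -/
def G11 (x y θ : ℝ) : Matrix (Core 2 n1 n2) (State n0 n1 n2) ℝ :=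
  Eh.x0 x * F0 R B θ y + Eh.xx.r0 x * F11 R B x y θ
    + Eh.xx.r1 x θ * F10 R B θ y + matInt R.a R.b (fun η => Eh.xx.r1 x η * F11 R B η y θ)
    + Eh.xy x y * F20 R B θ y + matInt R.c R.d (fun ν => Eh.xy x ν * F21 R B θ ν y)

/-- `G₂⁰(x,y)`. -/
def G20 (x y : ℝ) : Matrix (Core 2 n1 n2) (State n0 n1 n2) ℝ := Eh.yy.r0 y * F20 R B x y

/-- `G₂¹(x,y,ν)`. -/
def G21 (x y ν : ℝ) : Matrix (Core 2 n1 n2) (State n0 n1 n2) ℝ :=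
  Eh.y0 y * F0 R B x ν + Eh.yy.r0 y * F21 R B x y ν
    + Eh.yy.r1 y ν * F20 R B x ν + matInt R.c R.d (fun μ => Eh.yy.r1 y μ * F21 R B x μ ν)
    + Eh.yx x y * F10 R B x ν + matInt R.a R.b (fun θ => Eh.yx θ y * F11 R B θ ν x)

def T22 (x y θ ν : ℝ) : Matrix (State n0 n1 n2) (State n0 n1 n2) ℝ :=
  -(K30 R x y * G0 R B Eh θ ν)
    - matInt R.a x (fun η => K31 R x y η * G11 R B Eh η ν θ)
    - matInt R.c y (fun μ => K32 R x y μ * G21 R B Eh θ μ ν)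

def T12 (x y θ ν : ℝ) : Matrix (State n0 n1 n2) (State n0 n1 n2) ℝ :=
  -(K31 R x y θ * G10 R B Eh θ ν) + T22 R B Eh x y θ ν

def T21 (x y θ ν : ℝ) : Matrix (State n0 n1 n2) (State n0 n1 n2) ℝ :=
  -(K32 R x y ν * G20 R B Eh θ ν) + T22 R B Eh x y θ ν

def T11 (x y θ ν : ℝ) : Matrix (State n0 n1 n2) (State n0 n1 n2) ℝ :=
  K33 x y θ ν + T21 R B Eh x y θ ν + T12 R B Eh x y θ ν - T22 R B Eh x y θ ν

/-- The parameters `T` of the map from the fundamental state to the PDE state, built from `B` and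
from parameters `Eh` of the inverse of `P[B] ∘ P[H₁]`. -/
def TMat : N2D (State n0 n1 n2) (State n0 n1 n2) where
  n00 _ _ := stateDiag 1 0 0
  n10 := 0
  n20 := 0
  n01 := 0
  n02 := 0
  n11 := T11 R B Eh
  n21 := T21 R B Eh
  n12 := T12 R B Eh
  n22 := T22 R B Eh

end params

end PI2D

end

open MeasureTheory Set Filter Topology

open scoped ContDiff Matrix

noncomputable section

namespace PI2D

/-! ## Square-integrable functions on product spaces -/

section L2

variable {α β γ : Type*} [MeasurableSpace α] [MeasurableSpace β] [MeasurableSpace γ]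

/-! The theorem rests on Taylor's formula with integral remainder, in both variables at once. A
function with square-integrable derivatives of order at most `k` in each variable is determined by
its top mixed derivative and by core data. These are the values at `(a,c)` of the derivatives of
order below `k` in each variable, and the traces on `y = c` and `x = a` of the derivatives of order
`k` in the tangential variable and of lower order in the other one. For the whole state, with `û =
Du` and core data `v = (v₀, v₁, v₂)`, this reads `u = T₀₀û + K₃₀v₀ + ∫K₃₁v₁ + ∫K₃₂v₂ + ∫∫K₃₃û`
(`exists_stateRep`, `stateRep_ae`), and every pair `(v, û)` occurs.

Evaluating the formula at the remaining corners and edges gives `Λ_bf u = H₁v + H₃û`, where `H₃` has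
the blocks `H03`, `H13`, `H23` (`isBoundary_stateRep`). The boundary condition is therefore the
linear equation `(BH₁)v = -Fû` with `F = BH₃`. With `Ê` the inverse of `BH₁`, its unique solution is
`v = -Gû`, `G = ÊF`. Inserting this in Taylor's formula and merging all integrals by Fubini gives `u
= Tû` (`stateRep_ae_eq_P2D`). Conversely, any `û` and this `v` yield a state that satisfies the
boundary conditions (`memX_P2D`).

For weak derivatives, Taylor's formula follows from the du Bois-Reymond lemma in one variable with
the other as a parameter (`HasWeakDeriv.exists_x`). It is applied to `u` and its lower derivatives,
whose edge data must then be shown to be consistent (`exists_rep1`, `exists_rep2`).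

That `Ê` exists within the parameter class is a statement on bijective operators `M + K`, with `M` a
multiplication on the edge components and `K` Hilbert-Schmidt. By the open mapping theorem such an
operator is bounded below. On vectors times the indicator of a set of small measure `K` is
negligible, so the multipliers are bounded below uniformly almost everywhere
(`exists_norm_le_mulVec_xx`) and have essentially bounded inverses. Dividing by them leaves `1 + K`.
Its inverse `L` satisfies `L = 1 - K + KLK`, and the kernel of `KLK` is the inner product of a row
of `K` with `L` applied to a column of `K`, hence square-integrable (`exists_kernel_inverse`).

In the explicit case the integral part has finite rank. The operator then acts on the edge functions
through the multipliers and two vectors of moments against `Z`, and the inversion is block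
elimination for matrices (`block_elimination`, `row_mulVec`). -/

instance fact_two_ne_top : Fact ((2 : ENNReal) ≠ ⊤) := ⟨by simp⟩

/-- By the Lindelöf property an open set is a countable union of balls, and the preimage of a ball
is a sublevel set of a distance function. This is how functions with values in `L2` are shown to be
measurable. -/
theorem measurable_of_measurable_edist {X : Type*} [PseudoEMetricSpace X]
    [SecondCountableTopology X] [MeasurableSpace X] [BorelSpace X] {a : α → X}
    (h : ∀ f, Measurable fun s => edist (a s) f) : Measurable a := by
  refine measurable_of_isOpen fun U hU => ?_
  have hr : ∀ x : U, ∃ r : ENNReal, 0 < r ∧ Metric.eball (x : X) r ⊆ U := fun x => by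
    obtain ⟨r, hr, h⟩ := EMetric.isOpen_iff.1 hU x x.2
    exact ⟨r, hr, h⟩
  choose r hr0 hr using hr
  obtain ⟨T, hT, hTU⟩ := TopologicalSpace.isOpen_iUnion_countable
    (fun x : U => Metric.eball (x : X) (r x)) fun x => Metric.isOpen_eball
  have hU' : U = ⋃ i ∈ T, Metric.eball (i : X) (r i) := by
    rw [hTU]
    refine Subset.antisymm (fun x hx => mem_iUnion.2 ⟨⟨x, hx⟩, Metric.mem_eball_self (hr0 _)⟩) ?_
    exact iUnion_subset hr
  rw [hU', preimage_iUnion₂]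
  refine MeasurableSet.biUnion hT fun i _ => ?_
  exact measurableSet_lt (h i) measurable_const

theorem memLp_two_mul_integrable {μ : Measure α} {f g : α → ℝ} (hf : MemLp f 2 μ)
    (hg : MemLp g 2 μ) : Integrable (fun x => f x * g x) μ :=
  hf.integrable_mul hg

theorem memLp_two_tensor {μ : Measure α} {ν : Measure β} [SFinite μ] [SFinite ν] {f : α → ℝ}
    {g : β → ℝ} (hf : MemLp f 2 μ) (hg : MemLp g 2 ν) :
    MemLp (fun p : α × β => f p.1 * g p.2) 2 (μ.prod ν) := by
  have hm : AEStronglyMeasurable (fun p : α × β => f p.1 * g p.2) (μ.prod ν) :=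
    hf.1.comp_fst.mul hg.1.comp_snd
  rw [memLp_two_iff_integrable_sq hm]
  simpa only [mul_pow] using hf.integrable_sq.mul_prod hg.integrable_sq

theorem memLp_two_swap {μ : Measure α} {ν : Measure β} [SFinite μ] [SFinite ν]
    {f : α × β → ℝ} (hf : MemLp f 2 (μ.prod ν)) :
    MemLp (fun p : β × α => f (p.2, p.1)) 2 (ν.prod μ) :=
  hf.comp_measurePreserving (Measure.measurePreserving_swap (μ := ν) (ν := μ))

theorem memLp_two_fiber {μ : Measure α} {ν : Measure β} [SFinite μ] [SFinite ν]
    {f : α × β → ℝ} (hf : MemLp f 2 (μ.prod ν)) :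
    ∀ᵐ s ∂μ, MemLp (fun t => f (s, t)) 2 ν := by
  filter_upwards [hf.integrable_sq.prod_right_ae, hf.1.prodMk_left] with s h1 h2
  exact (memLp_two_iff_integrable_sq h2).2 h1

/-- A square-integrable kernel is a square-integrable function with values in `L2`. -/
theorem exists_curry [MeasurableSpace.CountablyGenerated β] {μ : Measure α} {ν : Measure β}
    [SFinite μ] [SFinite ν] {k : α × β → ℝ} (hk : MemLp k 2 (μ.prod ν)) :
    ∃ a : α → Lp ℝ 2 ν, MemLp a 2 μ ∧ ∀ᵐ s ∂μ, a s =ᵐ[ν] fun t => k (s, t) := by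
  classical
  -- A measurable version of the kernel: all its fibres are measurable, and their norms depend
  -- measurably on the parameter by Tonelli.
  set k' := hk.1.mk k with hk'def
  have hk'm : Measurable k' := hk.1.stronglyMeasurable_mk.measurable
  have hkk : k =ᵐ[μ.prod ν] k' := hk.1.ae_eq_mk
  have hk' : MemLp k' 2 (μ.prod ν) := hk.ae_eq hkk
  have hsm : ∀ s, AEStronglyMeasurable (fun t => k' (s, t)) ν := fun s =>
    (hk'm.comp measurable_prodMk_left).aestronglyMeasurable
  have hnorm : ∀ g : β → ℝ, Measurable g → Measurable fun s => eLpNorm (fun t => k' (s, t) - g t) 2 ν := by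
    intro g hg
    simp only [eLpNorm_eq_lintegral_rpow_enorm_toReal (two_ne_zero) (ENNReal.ofNat_ne_top (n := 2))]
    refine Measurable.pow_const ?_ _
    refine Measurable.lintegral_prod_right' (f := fun p : α × β =>
      ‖k' p - g p.2‖ₑ ^ (2 : ENNReal).toReal) ?_
    exact ((hk'm.sub (hg.comp measurable_snd)).enorm).pow_const _
  -- Only almost every fibre is square-integrable. The curried function is set to zero on the
  -- exceptional set, which is measurable because the fibre norms are.
  let A : Set α := {s | MemLp (fun t => k' (s, t)) 2 ν}
  have hA : MeasurableSet A := by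
    have : A = {s | eLpNorm (fun t => k' (s, t) - (0 : β → ℝ) t) 2 ν < ⊤} := by
      ext s
      simp only [A, mem_ofPred_eq, MemLp, hsm s, true_and, Pi.zero_apply, sub_zero]
    rw [this]
    exact measurableSet_lt (hnorm 0 measurable_zero) measurable_const
  let a : α → Lp ℝ 2 ν := fun s => if h : s ∈ A then MemLp.toLp _ h else 0
  have ha : ∀ s ∈ A, a s =ᵐ[ν] fun t => k' (s, t) := fun s hs => by
    simp only [a, hs, dif_pos]; exact MemLp.coeFn_toLp hs
  let := borel (Lp ℝ 2 ν)
  have : BorelSpace (Lp ℝ 2 ν) := ⟨rfl⟩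
  have ham : Measurable a := by
    refine measurable_of_measurable_edist fun f => ?_
    have hf' := (Lp.stronglyMeasurable f).measurable
    have : (fun s => edist (a s) f) = A.piecewise
        (fun s => eLpNorm (fun t => k' (s, t) - f t) 2 ν) (fun s => edist 0 f) := by
      ext s
      by_cases hs : s ∈ A
      · rw [piecewise_eq_of_mem _ _ _ hs, Lp.edist_def]
        refine eLpNorm_congr_ae ?_
        filter_upwards [ha s hs] with t ht
        simp [ht]
      · rw [piecewise_eq_of_notMem _ _ _ hs]; simp [a, hs]
    rw [this]
    exact Measurable.piecewise hA (hnorm _ hf') measurable_const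
  have hAae : ∀ᵐ s ∂μ, s ∈ A := memLp_two_fiber hk'
  refine ⟨a, ?_, ?_⟩
  · have hsma : AEStronglyMeasurable a μ := ham.stronglyMeasurable.aestronglyMeasurable
    rw [memLp_two_iff_integrable_sq_norm hsma]
    refine hk'.integrable_sq.integral_prod_left.congr ?_
    filter_upwards [hAae] with s hs
    have : ‖a s‖ ^ 2 = inner ℝ (a s) (a s) := (real_inner_self_eq_norm_sq _).symm
    rw [this, L2.inner_def]
    refine integral_congr_ae ?_
    filter_upwards [ha s hs] with t ht
    simp [ht, pow_two]
  · filter_upwards [hAae, Measure.ae_ae_of_ae_prod hkk] with s hs h2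
    filter_upwards [ha s hs, h2] with t h3 h4
    rw [h3, h4]

theorem memLp_two_inner {μ : Measure α} {ν : Measure β} [SFinite μ] [SFinite ν] {E : Type*}
    [NormedAddCommGroup E] [InnerProductSpace ℝ E] {a : α → E} {b : β → E} (ha : MemLp a 2 μ)
    (hb : MemLp b 2 ν) : MemLp (fun p : α × β => inner ℝ (a p.1) (b p.2)) 2 (μ.prod ν) := by
  refine (memLp_two_tensor ha.norm hb.norm).of_le_mul (c := 1) ?_ (ae_of_all _ fun p => ?_)
  · exact ha.1.comp_fst.inner hb.1.comp_snd
  · rw [one_mul]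
    refine (norm_inner_le_norm _ _).trans (le_of_eq ?_)
    simp

/-- The composed kernel is the inner product of a row of `k` and a column of `l`. Cauchy-Schwarz
bounds it by a tensor product of square-integrable norms, and `exists_curry` takes care of joint
measurability. -/
theorem memLp_two_comp [MeasurableSpace.CountablyGenerated β] {μ : Measure α} {ν : Measure β}
    {ξ : Measure γ} [SFinite μ] [SFinite ν] [SFinite ξ] {k : α × β → ℝ} {l : β × γ → ℝ}
    (hk : MemLp k 2 (μ.prod ν)) (hl : MemLp l 2 (ν.prod ξ)) :
    MemLp (fun p : α × γ => ∫ η, k (p.1, η) * l (η, p.2) ∂ν) 2 (μ.prod ξ) := by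
  obtain ⟨a, ha, hak⟩ := exists_curry hk
  obtain ⟨b, hb, hbl⟩ := exists_curry (memLp_two_swap hl)
  refine (memLp_two_inner ha hb).ae_eq ?_
  have h1 : ∀ᵐ p ∂μ.prod ξ, a p.1 =ᵐ[ν] fun t => k (p.1, t) :=
    Measure.quasiMeasurePreserving_fst.ae hak
  have h2 : ∀ᵐ p ∂μ.prod ξ, b p.2 =ᵐ[ν] fun t => l (t, p.2) :=
    Measure.quasiMeasurePreserving_snd.ae hbl
  filter_upwards [h1, h2] with p h1 h2
  rw [L2.inner_def]
  refine integral_congr_ae ?_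
  filter_upwards [h1, h2] with t h1 h2
  simp [h1, h2, mul_comm]

/-- Fubini applies because the triple product is the product of the two square-integrable functions
`k ⊗ u` and `l`. -/
theorem integral_comp_swap {ν : Measure β} {ξ : Measure γ} [SFinite ν] [SFinite ξ] {k : β → ℝ}
    {l : β × γ → ℝ} {u : γ → ℝ} (hk : MemLp k 2 ν) (hl : MemLp l 2 (ν.prod ξ))
    (hu : MemLp u 2 ξ) :
    Integrable (fun p : β × γ => k p.1 * l p * u p.2) (ν.prod ξ) ∧
    ∫ η, k η * ∫ q, l (η, q) * u q ∂ξ ∂ν = ∫ q, (∫ η, k η * l (η, q) ∂ν) * u q ∂ξ := by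
  have hint : Integrable (fun p : β × γ => k p.1 * l p * u p.2) (ν.prod ξ) := by
    refine (memLp_two_mul_integrable (memLp_two_tensor hk hu) hl).congr (ae_of_all _ fun p => ?_)
    simp only; ring
  refine ⟨hint, ?_⟩
  simp_rw [← integral_const_mul, ← integral_mul_const]
  rw [integral_integral_swap]
  · refine integral_congr_ae (ae_of_all _ fun q => integral_congr_ae (ae_of_all _ fun η => ?_))
    simp only; ring
  · refine hint.congr (ae_of_all _ fun p => ?_)
    simp only [Function.uncurry]; ring

end L2


/-! ## Matrix-valued functions -/

section Mat

variable {α β γ : Type*} [MeasurableSpace α] [MeasurableSpace β] [MeasurableSpace γ]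
  {ι κ τ : Type*} [Fintype κ]

/-- Entrywise integral of a matrix-valued function. -/
def matIntegral {ι κ : Type*} (μ : Measure α) (M : α → Matrix ι κ ℝ) : Matrix ι κ ℝ :=
  Matrix.of fun i j => ∫ t, M t i j ∂μ

theorem MatL2.congr {ι κ : Type*} {μ : Measure α} {M N : α → Matrix ι κ ℝ} (h : MatL2 μ M)
    (e : M =ᵐ[μ] N) : MatL2 μ N :=
  fun i j => (h i j).ae_eq (e.mono fun p hp => by simp [hp])

theorem MemL2.congr {κ : Type*} {μ : Measure α} {M N : α → κ → ℝ} (h : MemL2 μ M)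
    (e : M =ᵐ[μ] N) : MemL2 μ N :=
  fun i => (h i).ae_eq (e.mono fun p hp => by simp [hp])

theorem MatL2.add {ι κ : Type*} {μ : Measure α} {M N : α → Matrix ι κ ℝ} (hM : MatL2 μ M)
    (hN : MatL2 μ N) : MatL2 μ fun p => M p + N p :=
  fun i j => (hM i j).add (hN i j)

theorem MatL2.sub {ι κ : Type*} {μ : Measure α} {M N : α → Matrix ι κ ℝ} (hM : MatL2 μ M)
    (hN : MatL2 μ N) : MatL2 μ fun p => M p - N p :=
  fun i j => (hM i j).sub (hN i j)

theorem MatL2.neg {ι κ : Type*} {μ : Measure α} {M : α → Matrix ι κ ℝ} (hM : MatL2 μ M) :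
    MatL2 μ fun p => -M p :=
  fun i j => (hM i j).neg

theorem MemL2.add {κ : Type*} {μ : Measure α} {u v : α → κ → ℝ} (hu : MemL2 μ u)
    (hv : MemL2 μ v) : MemL2 μ fun p => u p + v p :=
  fun i => (hu i).add (hv i)

theorem MemL2.neg {κ : Type*} {μ : Measure α} {u : α → κ → ℝ} (hu : MemL2 μ u) :
    MemL2 μ fun p => -u p :=
  fun i => (hu i).neg

theorem MatLinf.matL2 {ι κ : Type*} {μ : Measure α} [IsFiniteMeasure μ] {M : α → Matrix ι κ ℝ}
    (h : MatLinf μ M) : MatL2 μ M :=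
  fun i j => (h i j).mono_exponent le_top

theorem matLinf_const {ι κ : Type*} (μ : Measure α) [IsFiniteMeasure μ] (C : Matrix ι κ ℝ) :
    MatLinf μ fun _ => C :=
  fun _ _ => memLp_const _

theorem matL2_const {ι κ : Type*} (μ : Measure α) [IsFiniteMeasure μ] (C : Matrix ι κ ℝ) :
    MatL2 μ fun _ => C :=
  fun _ _ => memLp_const _

theorem MatLinf.mul_matL2 {μ : Measure α} {M : α → Matrix ι κ ℝ} {N : α → Matrix κ τ ℝ}
    (hM : MatLinf μ M) (hN : MatL2 μ N) : MatL2 μ fun p => M p * N p := fun i j => by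
  simp only [Matrix.mul_apply]
  exact memLp_finsetSum _ fun k _ => (hN k j).mul (hM i k)

theorem MatL2.mul_matLinf {μ : Measure α} {M : α → Matrix ι κ ℝ} {N : α → Matrix κ τ ℝ}
    (hM : MatL2 μ M) (hN : MatLinf μ N) : MatL2 μ fun p => M p * N p := fun i j => by
  simp only [Matrix.mul_apply]
  exact memLp_finsetSum _ fun k _ => (hN k j).mul (hM i k)

theorem MatLinf.mul {μ : Measure α} {M : α → Matrix ι κ ℝ} {N : α → Matrix κ τ ℝ}
    (hM : MatLinf μ M) (hN : MatLinf μ N) : MatLinf μ fun p => M p * N p := fun i j => by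
  simp only [Matrix.mul_apply]
  exact memLp_finsetSum _ fun k _ => (hN k j).mul (hM i k)

theorem MatLinf.mulVec {μ : Measure α} {M : α → Matrix ι κ ℝ} {u : α → κ → ℝ}
    (hM : MatLinf μ M) (hu : MemL2 μ u) : MemL2 μ fun p => M p *ᵥ u p := fun i => by
  simp only [Matrix.mulVec, dotProduct]
  exact memLp_finsetSum _ fun k _ => (hu k).mul (hM i k)

theorem MatL2.mulVec_const {μ : Measure α} {M : α → Matrix ι κ ℝ} (hM : MatL2 μ M) (v : κ → ℝ) :
    MemL2 μ fun p => M p *ᵥ v := fun i => by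
  simp only [Matrix.mulVec, dotProduct]
  exact memLp_finsetSum _ fun k _ => by
    simpa only [mul_comm] using (hM i k).const_mul (v k)

theorem MatL2.const_mul {μ : Measure α} {N : α → Matrix κ τ ℝ}
    (hN : MatL2 μ N) (C : Matrix ι κ ℝ) : MatL2 μ fun p => C * N p := fun i j => by
  simp only [Matrix.mul_apply]
  exact memLp_finsetSum _ fun k _ => (hN k j).const_mul (C i k)

theorem MatL2.mul_const {μ : Measure α} {M : α → Matrix ι κ ℝ}
    (hM : MatL2 μ M) (C : Matrix κ τ ℝ) : MatL2 μ fun p => M p * C := fun i j => by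
  simp only [Matrix.mul_apply]
  exact memLp_finsetSum _ fun k _ => by simpa only [mul_comm] using (hM i k).const_mul (C k j)

theorem MatL2.transpose {ι κ : Type*} {μ : Measure α} {M : α → Matrix ι κ ℝ} (hM : MatL2 μ M) :
    MatL2 μ fun p => (M p)ᵀ :=
  fun i j => hM j i

theorem MatL2.fst {ι κ : Type*} {μ : Measure α} (ν : Measure β) [IsFiniteMeasure ν]
    {M : α → Matrix ι κ ℝ} (hM : MatL2 μ M) : MatL2 (μ.prod ν) fun p => M p.1 :=
  fun i j => (hM i j).comp_fst ν

theorem MatL2.snd {ι κ : Type*} {ν : Measure β} [SFinite ν] (μ : Measure α) [IsFiniteMeasure μ]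
    {M : β → Matrix ι κ ℝ} (hM : MatL2 ν M) : MatL2 (μ.prod ν) fun p => M p.2 :=
  fun i j => (hM i j).comp_snd μ

theorem MatLinf.fst {ι κ : Type*} {μ : Measure α} (ν : Measure β) [IsFiniteMeasure ν]
    {M : α → Matrix ι κ ℝ} (hM : MatLinf μ M) : MatLinf (μ.prod ν) fun p => M p.1 :=
  fun i j => (hM i j).comp_fst ν

theorem MatLinf.snd {ι κ : Type*} {ν : Measure β} [SFinite ν] (μ : Measure α) [IsFiniteMeasure μ]
    {M : β → Matrix ι κ ℝ} (hM : MatLinf ν M) : MatLinf (μ.prod ν) fun p => M p.2 :=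
  fun i j => (hM i j).comp_snd μ

theorem MatL2.swap {ι κ : Type*} {μ : Measure α} {ν : Measure β} [SFinite μ] [SFinite ν]
    {M : α × β → Matrix ι κ ℝ} (hM : MatL2 (μ.prod ν) M) :
    MatL2 (ν.prod μ) fun p => M (p.2, p.1) :=
  fun i j => memLp_two_swap (hM i j)

theorem MatL2.fiber [Finite ι] {μ : Measure α} {ν : Measure β} [SFinite μ] [SFinite ν]
    {M : α × β → Matrix ι κ ℝ} (hM : MatL2 (μ.prod ν) M) :
    ∀ᵐ s ∂μ, MatL2 ν fun t => M (s, t) := by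
  simp only [MatL2, ae_all_iff]
  exact fun i j => memLp_two_fiber (hM i j)

theorem MemL2.fiber {μ : Measure α} {ν : Measure β} [SFinite μ] [SFinite ν]
    {u : α × β → κ → ℝ} (hu : MemL2 (μ.prod ν) u) :
    ∀ᵐ s ∂μ, MemL2 ν fun t => u (s, t) := by
  simp only [MemL2, ae_all_iff]
  exact fun i => memLp_two_fiber (hu i)

theorem MemL2.swap {κ : Type*} {μ : Measure α} {ν : Measure β} [SFinite μ] [SFinite ν]
    {u : α × β → κ → ℝ} (hu : MemL2 (μ.prod ν) u) : MemL2 (ν.prod μ) fun p => u (p.2, p.1) :=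
  fun i => memLp_two_swap (hu i)

theorem MatL2.tensor {μ : Measure α} {ν : Measure β} [SFinite μ] [SFinite ν]
    {M : α → Matrix ι κ ℝ} {N : β → Matrix κ τ ℝ} (hM : MatL2 μ M) (hN : MatL2 ν N) :
    MatL2 (μ.prod ν) fun p => M p.1 * N p.2 := fun i j => by
  simp only [Matrix.mul_apply]
  exact memLp_finsetSum _ fun k _ => memLp_two_tensor (hM i k) (hN k j)

theorem MatL2.mul_entry_integrable {μ : Measure α} {M : α → Matrix ι κ ℝ} {N : α → Matrix κ τ ℝ}
    (hM : MatL2 μ M) (hN : MatL2 μ N) (i : ι) (j : τ) :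
    Integrable (fun p => (M p * N p) i j) μ := by
  simp only [Matrix.mul_apply]
  exact integrable_finsetSum _ fun k _ => memLp_two_mul_integrable (hM i k) (hN k j)

theorem MatL2.mulVec_entry_integrable {μ : Measure α} {M : α → Matrix ι κ ℝ} {u : α → κ → ℝ}
    (hM : MatL2 μ M) (hu : MemL2 μ u) (i : ι) : Integrable (fun p => (M p *ᵥ u p) i) μ := by
  simp only [Matrix.mulVec, dotProduct]
  exact integrable_finsetSum _ fun k _ => memLp_two_mul_integrable (hM i k) (hu k)

theorem MatL2.mulVec_integrable [Fintype ι] {μ : Measure α} {M : α → Matrix ι κ ℝ} {u : α → κ → ℝ}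
    (hM : MatL2 μ M) (hu : MemL2 μ u) : Integrable (fun p => M p *ᵥ u p) μ :=
  Integrable.of_eval fun i => hM.mulVec_entry_integrable hu i

theorem integral_mulVec_apply [Fintype ι] {μ : Measure α} {M : α → Matrix ι κ ℝ} {u : α → κ → ℝ}
    (hM : MatL2 μ M) (hu : MemL2 μ u) (i : ι) :
    (∫ p, M p *ᵥ u p ∂μ) i = ∑ k, ∫ p, M p i k * u p k ∂μ := by
  rw [eval_integral fun i => hM.mulVec_entry_integrable hu i]
  simp only [Matrix.mulVec, dotProduct]
  exact integral_finsetSum _ fun k _ => memLp_two_mul_integrable (hM i k) (hu k)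

theorem mulVec_integral [Fintype ι] {μ : Measure α} {u : α → κ → ℝ} (C : Matrix ι κ ℝ)
    (hu : Integrable u μ) : C *ᵥ (∫ p, u p ∂μ) = ∫ p, C *ᵥ u p ∂μ :=
  ((Matrix.mulVecLin C).toContinuousLinearMap.integral_comp_comm hu).symm

theorem MatL2.comp [Fintype ι] [Fintype τ] [MeasurableSpace.CountablyGenerated β] {μ : Measure α}
    {ν : Measure β} {ξ : Measure γ} [SFinite μ] [SFinite ν] [SFinite ξ] {k : α × β → Matrix ι κ ℝ}
    {l : β × γ → Matrix κ τ ℝ} (hk : MatL2 (μ.prod ν) k) (hl : MatL2 (ν.prod ξ) l) :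
    MatL2 (μ.prod ξ) fun p => matIntegral ν fun η => k (p.1, η) * l (η, p.2) := fun i j => by
  have h := memLp_finsetSum (μ := μ.prod ξ) (p := 2) (Finset.univ : Finset κ) fun m _ =>
    memLp_two_comp (hk i m) (hl m j)
  refine h.ae_eq ?_
  have h1 : ∀ᵐ p ∂μ.prod ξ, MatL2 ν fun t => k (p.1, t) :=
    Measure.quasiMeasurePreserving_fst.ae hk.fiber
  have h2 : ∀ᵐ p ∂μ.prod ξ, MatL2 ν fun t => l (t, p.2) :=
    Measure.quasiMeasurePreserving_snd.ae hl.swap.fiber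
  filter_upwards [h1, h2] with p h1 h2
  simp only [matIntegral, Matrix.of_apply, Matrix.mul_apply]
  rw [integral_finsetSum _ fun m _ => memLp_two_mul_integrable (h1 i m) (h2 m j)]

/-- The entrywise form of `integral_comp_swap`. Finite sums and integrals may be exchanged only for
those parameters whose fibres are square-integrable, hence the reductions `e1` and `e2` almost
everywhere. -/
theorem mulVec_integral_comp [Fintype ι] [Fintype τ] {ν : Measure β} {ξ : Measure γ}
    [SFinite ν] [SFinite ξ] {k : β → Matrix ι κ ℝ} {l : β × γ → Matrix κ τ ℝ} {u : γ → τ → ℝ}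
    (hk : MatL2 ν k) (hl : MatL2 (ν.prod ξ) l) (hu : MemL2 ξ u) :
    ∫ η, k η *ᵥ ∫ q, l (η, q) *ᵥ u q ∂ξ ∂ν =
      ∫ q, (matIntegral ν fun η => k η * l (η, q)) *ᵥ u q ∂ξ ∧
    Integrable (fun q => (matIntegral ν fun η => k η * l (η, q)) *ᵥ u q) ξ ∧
    Integrable (fun η => k η *ᵥ ∫ q, l (η, q) *ᵥ u q ∂ξ) ν := by
  have hl1 : ∀ᵐ η ∂ν, MatL2 ξ fun q => l (η, q) := hl.fiber
  have hl2 : ∀ᵐ q ∂ξ, MatL2 ν fun η => l (η, q) := hl.swap.fiber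
  have hS : ∀ i m j, Integrable (fun q => (∫ η, k η i m * l (η, q) m j ∂ν) * u q j) ξ := by
    intro i m j
    have := (integral_comp_swap (hk i m) (hl m j) (hu j)).1.integral_prod_right
    refine this.congr (ae_of_all _ fun q => ?_)
    simp only [integral_mul_const]
  have hS2 : ∀ i m j, Integrable (fun η => k η i m * ∫ q, l (η, q) m j * u q j ∂ξ) ν := by
    intro i m j
    have := (integral_comp_swap (hk i m) (hl m j) (hu j)).1.integral_prod_left
    refine this.congr (ae_of_all _ fun q => ?_)
    simp only [mul_assoc, integral_const_mul]
  have e1 : ∀ i, (fun q => ((matIntegral ν fun η => k η * l (η, q)) *ᵥ u q) i) =ᵐ[ξ]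
      fun q => ∑ j, ∑ m, (∫ η, k η i m * l (η, q) m j ∂ν) * u q j := by
    intro i
    filter_upwards [hl2] with q hq
    simp only [Matrix.mulVec, dotProduct, matIntegral, Matrix.of_apply, Matrix.mul_apply]
    refine Finset.sum_congr rfl fun j _ => ?_
    rw [integral_finsetSum _ fun m _ => memLp_two_mul_integrable (hk i m) (hq m j),
      Finset.sum_mul]
  have e2 : ∀ i, (fun η => (k η *ᵥ ∫ q, l (η, q) *ᵥ u q ∂ξ) i) =ᵐ[ν]
      fun η => ∑ m, ∑ j, k η i m * ∫ q, l (η, q) m j * u q j ∂ξ := by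
    intro i
    filter_upwards [hl1] with η hη
    rw [Matrix.mulVec, dotProduct]
    refine Finset.sum_congr rfl fun m _ => ?_
    rw [integral_mulVec_apply hη hu, Finset.mul_sum]
  have i1 : ∀ i, Integrable (fun q => ((matIntegral ν fun η => k η * l (η, q)) *ᵥ u q) i) ξ :=
    fun i => (integrable_finsetSum _ fun j _ => integrable_finsetSum _ fun m _ => hS i m j).congr
      (e1 i).symm
  have i2 : ∀ i, Integrable (fun η => (k η *ᵥ ∫ q, l (η, q) *ᵥ u q ∂ξ) i) ν :=
    fun i => (integrable_finsetSum _ fun m _ => integrable_finsetSum _ fun j _ => hS2 i m j).congr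
      (e2 i).symm
  refine ⟨?_, Integrable.of_eval i1, Integrable.of_eval i2⟩
  funext i
  rw [eval_integral i1, eval_integral i2, integral_congr_ae (e1 i), integral_congr_ae (e2 i),
    integral_finsetSum _ fun m _ => integrable_finsetSum _ fun j _ => hS2 i m j,
    integral_finsetSum _ fun j _ => integrable_finsetSum _ fun m _ => hS i m j]
  simp_rw [integral_finsetSum _ fun j _ => hS2 i _ j, integral_finsetSum _ fun m _ => hS i m _]
  rw [Finset.sum_comm]
  exact Finset.sum_congr rfl fun j _ => Finset.sum_congr rfl fun m _ =>
    (integral_comp_swap (hk i m) (hl m j) (hu j)).2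

theorem MatL2.integral_mulVec [Fintype ι] [MeasurableSpace.CountablyGenerated β] {μ : Measure α}
    {ν : Measure β} [SFinite μ] [SFinite ν] {k : α × β → Matrix ι κ ℝ} {u : β → κ → ℝ}
    (hk : MatL2 (μ.prod ν) k) (hu : MemL2 ν u) :
    MemL2 μ fun s => ∫ t, k (s, t) *ᵥ u t ∂ν := fun i => by
  have h : ∀ m, MemLp (fun s => ∫ t, k (s, t) i m * u t m ∂ν) 2 μ := fun m => by
    obtain ⟨a, ha, hak⟩ := exists_curry (hk i m)
    refine (ha.inner_const ((hu m).toLp _)).ae_eq ?_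
    filter_upwards [hak] with s hs
    rw [L2.inner_def]
    refine integral_congr_ae ?_
    filter_upwards [hs, (hu m).coeFn_toLp] with t h1 h2
    simp [h1, h2, mul_comm]
  refine (memLp_finsetSum Finset.univ fun m _ => h m).ae_eq ?_
  filter_upwards [hk.fiber] with s hs
  rw [integral_mulVec_apply hs hu]

end Mat

/-! ## Measures on intervals and rectangles -/

instance (s t : ℝ) : IsFiniteMeasure (muI s t) := by unfold muI; infer_instance

instance (R : Rect) : IsFiniteMeasure R.mux := by unfold Rect.mux; infer_instance

instance (R : Rect) : IsFiniteMeasure R.muy := by unfold Rect.muy; infer_instance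

instance (R : Rect) : IsFiniteMeasure R.mu := by unfold Rect.mu; infer_instance

/-- The rectangle with exchanged coordinates. -/
def Rect.swap (R : Rect) : Rect := ⟨R.c, R.d, R.a, R.b, R.hcd, R.hab⟩

theorem muI_eq_Ioc (s t : ℝ) : muI s t = volume.restrict (Ioc s t) :=
  (restrict_Ioc_eq_restrict_Icc (μ := volume)).symm

theorem intervalIntegral_eq_muI {E : Type*} [NormedAddCommGroup E] [NormedSpace ℝ E] {s t : ℝ}
    (h : s ≤ t) (f : ℝ → E) : ∫ x in s..t, f x = ∫ x, f x ∂muI s t := by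
  rw [intervalIntegral.integral_of_le h, muI_eq_Ioc]

theorem muI_ae_mem (s t : ℝ) : ∀ᵐ x ∂muI s t, x ∈ Icc s t :=
  ae_restrict_mem measurableSet_Icc

theorem muI_ae_mem_Ioo (s t : ℝ) : ∀ᵐ x ∂muI s t, x ∈ Ioo s t := by
  rw [muI, ← restrict_Ioo_eq_restrict_Icc]
  exact ae_restrict_mem measurableSet_Ioo

theorem Rect.mux_ae_mem (R : Rect) : ∀ᵐ x ∂ R.mux, x ∈ Icc R.a R.b := muI_ae_mem _ _

theorem Rect.muy_ae_mem (R : Rect) : ∀ᵐ x ∂ R.muy, x ∈ Icc R.c R.d := muI_ae_mem _ _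

theorem Rect.mu_ae_mem (R : Rect) : ∀ᵐ p ∂ R.mu, p ∈ Icc R.a R.b ×ˢ Icc R.c R.d := by
  filter_upwards [Measure.quasiMeasurePreserving_fst.ae R.mux_ae_mem,
    Measure.quasiMeasurePreserving_snd.ae R.muy_ae_mem] with p h1 h2 using ⟨h1, h2⟩

/-- The initial part of an interval integral as an integral with a cut-off kernel. -/
theorem intervalIntegral_eq_indicator {E : Type*} [NormedAddCommGroup E] [NormedSpace ℝ E]
    {s t x : ℝ} (hx : x ∈ Icc s t) (f : ℝ → E) :
    ∫ θ in s..x, f θ = ∫ θ, (if θ ≤ x then f θ else 0) ∂muI s t := by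
  have : (fun θ => if θ ≤ x then f θ else 0) = (Iic x).indicator f := by
    ext θ; simp [indicator]
  rw [this, integral_indicator measurableSet_Iic, muI_eq_Ioc,
    Measure.restrict_restrict measurableSet_Iic, intervalIntegral.integral_of_le hx.1]
  congr 2
  ext θ
  simp only [mem_Ioc, mem_inter_iff, mem_Iic]
  constructor
  · rintro ⟨h1, h2⟩; exact ⟨h2, h1, h2.trans hx.2⟩
  · rintro ⟨h1, h2, -⟩; exact ⟨h2, h1⟩

theorem measurableSet_le_prod : MeasurableSet {p : ℝ × ℝ | p.2 ≤ p.1} :=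
  measurableSet_le measurable_snd measurable_fst

theorem intervalIntegrable_of_memLp {s t x : ℝ} (hx : x ∈ Icc s t) {f : ℝ → ℝ}
    (hf : MemLp f 2 (muI s t)) : IntervalIntegrable f volume s x := by
  rw [intervalIntegrable_iff_integrableOn_Ioc_of_le hx.1]
  have h : Integrable f (muI s t) := hf.integrable one_le_two
  rw [muI_eq_Ioc] at h
  exact IntegrableOn.mono_set h (Ioc_subset_Ioc_right hx.2)

/-! ## Partial antiderivatives -/

/-- `∫_a^x f(s,y) ds`. -/
def Jx (R : Rect) (f : ℝ × ℝ → ℝ) : ℝ × ℝ → ℝ := fun p => ∫ s in R.a..p.1, f (s, p.2)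

/-- `∫_c^y f(x,t) dt`. -/
def Jy (R : Rect) (f : ℝ × ℝ → ℝ) : ℝ × ℝ → ℝ := fun p => ∫ t in R.c..p.2, f (p.1, t)

/-- The Volterra kernel: taking antiderivatives is a Hilbert-Schmidt operator, so the results on
square-integrable kernels apply to it. -/
theorem memLp_two_cut (s t : ℝ) :
    MemLp (fun p : ℝ × ℝ => if p.2 ≤ p.1 then (1 : ℝ) else 0) 2 ((muI s t).prod (muI s t)) := by
  refine MemLp.of_bound (C := 1) ?_ (ae_of_all _ fun p => ?_)
  · exact (Measurable.ite measurableSet_le_prod measurable_const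
      measurable_const).aestronglyMeasurable
  · split_ifs <;> simp

theorem Jx_ae {R : Rect} (f : ℝ × ℝ → ℝ) :
    Jx R f =ᵐ[R.mu] fun p => ∫ s, (if s ≤ p.1 then (1 : ℝ) else 0) * f (s, p.2) ∂ R.mux := by
  filter_upwards [R.mu_ae_mem] with p hp
  rw [Jx, intervalIntegral_eq_indicator hp.1]
  refine integral_congr_ae (ae_of_all _ fun s => ?_)
  simp only [ite_mul, one_mul, zero_mul]

theorem memLp_Jx {R : Rect} {f : ℝ × ℝ → ℝ} (hf : MemLp f 2 R.mu) : MemLp (Jx R f) 2 R.mu :=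
  (memLp_two_comp (memLp_two_cut R.a R.b) hf).ae_eq (Jx_ae f).symm

theorem memLp_antideriv {s t : ℝ} {f : ℝ → ℝ} (hf : MemLp f 2 (muI s t)) :
    MemLp (fun x => ∫ θ in s..x, f θ) 2 (muI s t) := by
  obtain ⟨a, ha, hak⟩ := exists_curry (memLp_two_cut s t)
  refine (ha.inner_const (hf.toLp _)).ae_eq ?_
  filter_upwards [hak, muI_ae_mem s t] with x hx hx2
  rw [L2.inner_def, intervalIntegral_eq_indicator hx2]
  refine integral_congr_ae ?_
  filter_upwards [hx, hf.coeFn_toLp] with θ h1 h2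
  simp [h1, h2]

theorem Jx_congr {R : Rect} {f g : ℝ × ℝ → ℝ} (h : f =ᵐ[R.mu] g) : Jx R f =ᵐ[R.mu] Jx R g := by
  have h1 : ∀ᵐ p ∂ R.mu, ∀ᵐ s ∂ R.mux, f (s, p.2) = g (s, p.2) := by
    have h3 : ∀ᵐ q ∂(R.muy.prod R.mux), f q.swap = g q.swap :=
      Measure.measurePreserving_swap.quasiMeasurePreserving.ae h
    exact Measure.quasiMeasurePreserving_snd.ae (Measure.ae_ae_of_ae_prod h3)
  filter_upwards [Jx_ae (R := R) f, Jx_ae (R := R) g, h1] with p hf hg h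
  rw [hf, hg]
  exact integral_congr_ae (h.mono fun s hs => by simp only [hs])

/-- With `integral_swap_mu` and `memLp_swap`, this transfers statements on the variable `x` of
`R.swap` to the variable `y` of `R`, so that many of them need only one proof. -/
theorem swap_ae {R : Rect} {p : ℝ × ℝ → Prop} (h : ∀ᵐ z ∂ R.mu, p z) :
    ∀ᵐ z ∂ R.swap.mu, p z.swap :=
  (Measure.measurePreserving_swap (μ := R.muy) (ν := R.mux)).quasiMeasurePreserving.ae h

theorem integral_swap_mu {R : Rect} {E : Type*} [NormedAddCommGroup E] [NormedSpace ℝ E]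
    (f : ℝ × ℝ → E) : ∫ z, f z.swap ∂ R.swap.mu = ∫ z, f z ∂ R.mu :=
  integral_prod_swap (μ := R.mux) (ν := R.muy) f

theorem memLp_swap {R : Rect} {f : ℝ × ℝ → ℝ} (h : MemLp f 2 R.mu) :
    MemLp (fun z => f z.swap) 2 R.swap.mu :=
  memLp_two_swap h

theorem ae_fst_of_ae {R : Rect} {p : ℝ → Prop} (h : ∀ᵐ x ∂ R.mux, p x) : ∀ᵐ z ∂ R.mu, p z.1 :=
  Measure.quasiMeasurePreserving_fst.ae h

theorem ae_snd_of_ae {R : Rect} {p : ℝ → Prop} (h : ∀ᵐ x ∂ R.muy, p x) : ∀ᵐ z ∂ R.mu, p z.2 :=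
  Measure.quasiMeasurePreserving_snd.ae h

theorem ae_ae_x {R : Rect} {p : ℝ × ℝ → Prop} (h : ∀ᵐ z ∂ R.mu, p z) :
    ∀ᵐ x ∂ R.mux, ∀ᵐ y ∂ R.muy, p (x, y) :=
  Measure.ae_ae_of_ae_prod h

theorem ae_ae_y {R : Rect} {p : ℝ × ℝ → Prop} (h : ∀ᵐ z ∂ R.mu, p z) :
    ∀ᵐ y ∂ R.muy, ∀ᵐ x ∂ R.mux, p (x, y) :=
  Measure.ae_ae_of_ae_prod (swap_ae h)

theorem Jy_congr {R : Rect} {f g : ℝ × ℝ → ℝ} (h : f =ᵐ[R.mu] g) : Jy R f =ᵐ[R.mu] Jy R g :=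
  swap_ae (R := R.swap) (Jx_congr (R := R.swap) (swap_ae h))

theorem memLp_Jy {R : Rect} {f : ℝ × ℝ → ℝ} (hf : MemLp f 2 R.mu) : MemLp (Jy R f) 2 R.mu :=
  memLp_swap (R := R.swap) (memLp_Jx (R := R.swap) (memLp_swap hf))

/-- Integration by parts against a continuously differentiable function. -/
theorem integral_antideriv_mul_deriv {s t : ℝ} {f χ : ℝ → ℝ}
    (hf : MemLp f 2 (muI s t)) (hχ : ContDiff ℝ 1 χ) :
    ∫ x, (∫ θ in s..x, f θ) * deriv χ x ∂muI s t = ∫ θ, f θ * (χ t - χ θ) ∂muI s t := by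
  have hχ' : Continuous (deriv χ) := hχ.continuous_deriv le_rfl
  have hb : MemLp (deriv χ) 2 (muI s t) := by
    obtain ⟨C, hC⟩ := isCompact_Icc.exists_bound_of_continuousOn (s := Icc s t) hχ'.continuousOn
    exact MemLp.of_bound hχ'.aestronglyMeasurable C ((muI_ae_mem s t).mono hC)
  -- The antiderivative of an `L2` function need not be differentiable everywhere. Fubini for the
  -- Volterra kernel moves the integration onto `deriv χ`, whose integral over `[θ, t]` is a
  -- difference of values of `χ`.
  have h := (integral_comp_swap (k := deriv χ) (u := f) hb (memLp_two_cut s t) hf).2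
  calc ∫ x, (∫ θ in s..x, f θ) * deriv χ x ∂muI s t
      = ∫ x, deriv χ x * ∫ θ, (if θ ≤ x then (1 : ℝ) else 0) * f θ ∂muI s t ∂muI s t := by
        refine integral_congr_ae ((muI_ae_mem s t).mono fun x hx => ?_)
        simp only
        rw [intervalIntegral_eq_indicator hx, mul_comm]
        simp only [ite_mul, one_mul, zero_mul]
    _ = _ := h
    _ = _ := by
        refine integral_congr_ae ((muI_ae_mem s t).mono fun θ hθ => ?_)
        simp only
        rw [mul_comm]
        congr 1
        have : ∀ η, deriv χ η * (if θ ≤ η then (1 : ℝ) else 0) =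
            (Ici θ).indicator (deriv χ) η := fun η => by simp [indicator]
        simp only [this]
        rw [integral_indicator measurableSet_Ici, muI, Measure.restrict_restrict measurableSet_Ici]
        have e : Ici θ ∩ Icc s t = Icc θ t := by
          ext η; simp only [mem_inter_iff, mem_Ici, mem_Icc]
          exact ⟨fun h => ⟨h.1, h.2.2⟩, fun h => ⟨h.1, hθ.1.trans h.1, h.2⟩⟩
        rw [e, integral_Icc_eq_integral_Ioc, ← intervalIntegral.integral_of_le hθ.2]
        exact intervalIntegral.integral_deriv_eq_sub'  _ rfl
          (fun x _ => (hχ.differentiable one_ne_zero) x) hχ'.continuousOn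

/-- An iterated antiderivative as a single integral. -/
theorem antideriv_antideriv {s x : ℝ} (hx : s ≤ x) {f : ℝ → ℝ} (hf : MemLp f 2 (muI s x)) :
    ∫ η in s..x, ∫ θ in s..η, f θ = ∫ θ in s..x, (x - θ) * f θ := by
  -- Taking `χ = id`, with derivative `1`, gives Cauchy's formula for repeated integration.
  have h := integral_antideriv_mul_deriv (χ := fun x => x) hf contDiff_id
  rw [intervalIntegral_eq_muI hx, intervalIntegral_eq_muI hx]
  simpa [mul_comm] using h

/-! ## Test functions -/

/-- In terms of `fderiv`, smoothness, compact support and the symmetry of second derivatives are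
inherited from the general theory. -/
theorem contDiff_pdx {φ : ℝ × ℝ → ℝ} (h : ContDiff ℝ ∞ φ) :
    pdx φ = fun p => fderiv ℝ φ p (1, 0) := by
  funext p
  have h1 : HasFDerivAt φ (fderiv ℝ φ p) (p.1, p.2) :=
    ((h.differentiable (by simp)) p).hasFDerivAt
  have h2 : HasDerivAt (fun s : ℝ => (s, p.2)) ((1 : ℝ), (0 : ℝ)) p.1 :=
    (hasDerivAt_id p.1).prodMk (hasDerivAt_const _ _)
  exact (h1.comp_hasDerivAt p.1 h2).deriv

theorem contDiff_pdy {φ : ℝ × ℝ → ℝ} (h : ContDiff ℝ ∞ φ) :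
    pdy φ = fun p => fderiv ℝ φ p (0, 1) := by
  funext p
  have h1 : HasFDerivAt φ (fderiv ℝ φ p) (p.1, p.2) :=
    ((h.differentiable (by simp)) p).hasFDerivAt
  have h2 : HasDerivAt (fun s : ℝ => (p.1, s)) ((0 : ℝ), (1 : ℝ)) p.2 :=
    (hasDerivAt_const _ _).prodMk (hasDerivAt_id p.2)
  exact (h1.comp_hasDerivAt p.2 h2).deriv

theorem contDiff_fderiv_apply {φ : ℝ × ℝ → ℝ} (h : ContDiff ℝ ∞ φ) (v : ℝ × ℝ) :
    ContDiff ℝ ∞ fun p => fderiv ℝ φ p v :=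
  (h.fderiv_right (m := ∞) le_rfl).clm_apply contDiff_const

theorem pdx_pdy_comm {φ : ℝ × ℝ → ℝ} (h : ContDiff ℝ ∞ φ) : pdx (pdy φ) = pdy (pdx φ) := by
  rw [contDiff_pdy h, contDiff_pdx h, contDiff_pdx (contDiff_fderiv_apply h _),
    contDiff_pdy (contDiff_fderiv_apply h _)]
  funext p
  have hd : DifferentiableAt ℝ (fderiv ℝ φ) p :=
    ((h.fderiv_right (m := ∞) le_rfl).differentiable (by simp)) p
  have e : ∀ v w : ℝ × ℝ, fderiv ℝ (fun q => fderiv ℝ φ q v) p w = fderiv ℝ (fderiv ℝ φ) p w v := by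
    intro v w
    rw [fderiv_clm_apply hd (differentiableAt_const v)]
    simp
  rw [e, e]
  exact (h.contDiffAt.isSymmSndFDerivAt
    (by rw [minSmoothness_of_isRCLikeNormedField]; exact (WithTop.coe_le_coe.2 le_top : ((2 : ℕ∞) : WithTop ℕ∞) ≤ _))) _ _

theorem IsTest.fderiv_apply {R : Rect} {φ : ℝ × ℝ → ℝ} (h : IsTest R φ) (v : ℝ × ℝ) :
    IsTest R fun p => fderiv ℝ φ p v := by
  refine ⟨contDiff_fderiv_apply h.1 v, ?_, ?_⟩
  · exact h.2.1.fderiv_apply ℝ v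
  · exact (tsupport_fderiv_apply_subset ℝ v).trans h.2.2

theorem IsTest.pdx {R : Rect} {φ : ℝ × ℝ → ℝ} (h : IsTest R φ) : IsTest R (pdx φ) := by
  rw [contDiff_pdx h.1]; exact h.fderiv_apply _

theorem IsTest.pdy {R : Rect} {φ : ℝ × ℝ → ℝ} (h : IsTest R φ) : IsTest R (pdy φ) := by
  rw [contDiff_pdy h.1]; exact h.fderiv_apply _

theorem IsTest.pdx_iterate {R : Rect} {φ : ℝ × ℝ → ℝ} (h : IsTest R φ) (i : ℕ) :
    IsTest R (PI2D.pdx^[i] φ) := by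
  induction i generalizing φ with
  | zero => exact h
  | succ k ih => exact ih h.pdx

theorem IsTest.pdy_iterate {R : Rect} {φ : ℝ × ℝ → ℝ} (h : IsTest R φ) (i : ℕ) :
    IsTest R (PI2D.pdy^[i] φ) := by
  induction i generalizing φ with
  | zero => exact h
  | succ k ih => exact ih h.pdy

theorem IsTest.pdx_pdy_iterate {R : Rect} {φ : ℝ × ℝ → ℝ} (h : IsTest R φ) (j : ℕ) :
    PI2D.pdx (PI2D.pdy^[j] φ) = PI2D.pdy^[j] (PI2D.pdx φ) := by
  induction j generalizing φ with
  | zero => rfl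
  | succ k ih => rw [Function.iterate_succ_apply, ih h.pdy, pdx_pdy_comm h.1,
      Function.iterate_succ_apply]

theorem IsTest.memLp {R : Rect} {φ : ℝ × ℝ → ℝ} (h : IsTest R φ) : MemLp φ 2 R.mu := by
  obtain ⟨C, hC⟩ := h.2.1.exists_bound_of_continuous h.1.continuous
  exact MemLp.of_bound h.1.continuous.aestronglyMeasurable C (ae_of_all _ hC)

theorem IsTest.swap {R : Rect} {φ : ℝ × ℝ → ℝ} (h : IsTest R φ) :
    IsTest R.swap fun z => φ z.swap := by
  have hs : tsupport (fun z : ℝ × ℝ => φ z.swap) ⊆ Prod.swap ⁻¹' tsupport φ :=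
    tsupport_comp_subset_preimage φ continuous_swap
  refine ⟨h.1.comp (contDiff_snd.prodMk contDiff_fst), ?_, fun z hz => ?_⟩
  · exact h.2.1.comp_homeomorph (Homeomorph.prodComm ℝ ℝ)
  · exact ⟨(h.2.2 (hs hz)).2, (h.2.2 (hs hz)).1⟩

/-! ## Weak derivatives -/

theorem HasWeakDeriv.congr {R : Rect} {i j : ℕ} {u u' v v' : ℝ × ℝ → ℝ}
    (h : HasWeakDeriv R i j u v) (hu : u =ᵐ[R.mu] u') (hv : v =ᵐ[R.mu] v') :
    HasWeakDeriv R i j u' v' := by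
  refine ⟨h.1.ae_eq hv, fun φ hφ => ?_⟩
  rw [← integral_congr_ae (hu.mono fun p hp => by simp only [hp] :
      (fun p => u p * (pdx^[i] (pdy^[j] φ)) p) =ᵐ[R.mu] fun p => u' p * (pdx^[i] (pdy^[j] φ)) p),
    ← integral_congr_ae (hv.mono fun p hp => by simp only [hp] :
      (fun p => v p * φ p) =ᵐ[R.mu] fun p => v' p * φ p)]
  exact h.2 φ hφ

theorem hasWeakDeriv_zero {R : Rect} {u : ℝ × ℝ → ℝ} (hu : MemLp u 2 R.mu) :
    HasWeakDeriv R 0 0 u u :=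
  ⟨hu, fun φ _ => by simp⟩

/-- Apply the first hypothesis to the test function `pdx φ`. Mixed partial derivatives commute, so
the additional `∂x` can be moved through `∂y^j` onto `φ`. -/
theorem HasWeakDeriv.comp_x {R : Rect} {i j : ℕ} {u v w : ℝ × ℝ → ℝ} (h : HasWeakDeriv R i j u v)
    (h' : HasWeakDeriv R 1 0 v w) : HasWeakDeriv R (i + 1) j u w := by
  refine ⟨h'.1, fun φ hφ => ?_⟩
  rw [Function.iterate_succ_apply, hφ.pdx_pdy_iterate, h.2 _ hφ.pdx]
  have := h'.2 φ hφ
  simp only [Function.iterate_one, Function.iterate_zero, id] at this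
  rw [this]; ring

theorem HasWeakDeriv.comp_y {R : Rect} {i j : ℕ} {u v w : ℝ × ℝ → ℝ} (h : HasWeakDeriv R i j u v)
    (h' : HasWeakDeriv R 0 1 v w) : HasWeakDeriv R i (j + 1) u w := by
  refine ⟨h'.1, fun φ hφ => ?_⟩
  rw [Function.iterate_succ_apply, h.2 _ hφ.pdy]
  have := h'.2 φ hφ
  simp only [Function.iterate_one, Function.iterate_zero, id] at this
  rw [this]; ring

/-- The computation of `comp_x` read backwards, after division by a sign. It turns the derivatives
listed in `MemH`, each defined by testing `u` itself, into a chain of first-order relations between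
them. -/
theorem HasWeakDeriv.decomp_x {R : Rect} {i j : ℕ} {u v w : ℝ × ℝ → ℝ}
    (h : HasWeakDeriv R i j u v) (h' : HasWeakDeriv R (i + 1) j u w) : HasWeakDeriv R 1 0 v w := by
  refine ⟨h'.1, fun φ hφ => ?_⟩
  have h1 := h.2 _ hφ.pdx
  have h2 := h'.2 φ hφ
  rw [Function.iterate_succ_apply, hφ.pdx_pdy_iterate, h1] at h2
  simp only [Function.iterate_one, Function.iterate_zero, id]
  have : ((-1 : ℝ) ^ (i + j)) ≠ 0 := by simp
  apply mul_left_cancel₀ this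
  rw [h2]; ring

theorem HasWeakDeriv.decomp_y {R : Rect} {i j : ℕ} {u v w : ℝ × ℝ → ℝ}
    (h : HasWeakDeriv R i j u v) (h' : HasWeakDeriv R i (j + 1) u w) : HasWeakDeriv R 0 1 v w := by
  refine ⟨h'.1, fun φ hφ => ?_⟩
  have h1 := h.2 _ hφ.pdy
  have h2 := h'.2 φ hφ
  rw [Function.iterate_succ_apply, h1] at h2
  simp only [Function.iterate_one, Function.iterate_zero, id]
  have : ((-1 : ℝ) ^ (i + j)) ≠ 0 := by simp
  apply mul_left_cancel₀ this
  rw [h2]; ring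

theorem HasWeakDeriv.swap_xy {R : Rect} {u v : ℝ × ℝ → ℝ} (h : HasWeakDeriv R 1 0 u v) :
    HasWeakDeriv R.swap 0 1 (fun z => u z.swap) fun z => v z.swap := by
  refine ⟨memLp_swap h.1, fun φ hφ => ?_⟩
  have := h.2 _ (IsTest.swap (R := R.swap) hφ)
  rw [← integral_swap_mu, ← integral_swap_mu (R := R)] at this
  simp only [Function.iterate_one, Function.iterate_zero, id, zero_add, add_zero] at this ⊢
  exact this

theorem HasWeakDeriv.swap_yx {R : Rect} {u v : ℝ × ℝ → ℝ} (h : HasWeakDeriv R 0 1 u v) :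
    HasWeakDeriv R.swap 1 0 (fun z => u z.swap) fun z => v z.swap := by
  refine ⟨memLp_swap h.1, fun φ hφ => ?_⟩
  have := h.2 _ (IsTest.swap (R := R.swap) hφ)
  rw [← integral_swap_mu, ← integral_swap_mu (R := R)] at this
  simp only [Function.iterate_one, Function.iterate_zero, id, zero_add, add_zero] at this ⊢
  exact this

/-! ## The fundamental lemma in one and two variables -/

/-- Smooth functions with compact support in the open interval `(s,t)`. -/
def IsTest1 (s t : ℝ) (χ : ℝ → ℝ) : Prop :=
  ContDiff ℝ ∞ χ ∧ HasCompactSupport χ ∧ tsupport χ ⊆ Ioo s t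

theorem IsTest1.memLp {s t : ℝ} {χ : ℝ → ℝ} (h : IsTest1 s t χ) : MemLp χ 2 (muI s t) := by
  obtain ⟨C, hC⟩ := h.2.1.exists_bound_of_continuous h.1.continuous
  exact MemLp.of_bound h.1.continuous.aestronglyMeasurable C (ae_of_all _ hC)

theorem IsTest1.tensor {R : Rect} {χ ψ : ℝ → ℝ} (hχ : IsTest1 R.a R.b χ)
    (hψ : IsTest1 R.c R.d ψ) : IsTest R fun p => χ p.1 * ψ p.2 := by
  have hs : tsupport (fun p : ℝ × ℝ => χ p.1 * ψ p.2) ⊆ tsupport χ ×ˢ tsupport ψ := by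
    refine closure_minimal (fun p hp => ?_) ((isClosed_tsupport _).prod (isClosed_tsupport _))
    have hp' : χ p.1 * ψ p.2 ≠ 0 := hp
    exact ⟨subset_tsupport _ (left_ne_zero_of_mul hp'), subset_tsupport _ (right_ne_zero_of_mul hp')⟩
  refine ⟨(hχ.1.comp contDiff_fst).mul (hψ.1.comp contDiff_snd), ?_, ?_⟩
  · exact (hχ.2.1.isCompact.prod hψ.2.1.isCompact).of_isClosed_subset (isClosed_tsupport _) hs
  · exact hs.trans (prod_mono hχ.2.2 hψ.2.2)

theorem ae_eq_zero_of_test1 {s t : ℝ} {h : ℝ → ℝ} (hh : Integrable h (muI s t))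
    (h0 : ∀ χ, IsTest1 s t χ → ∫ x, h x * χ x ∂muI s t = 0) : h =ᵐ[muI s t] 0 := by
  have := isOpen_Ioo.ae_eq_zero_of_integral_contDiff_smul_eq_zero (U := Ioo s t)
    (hh.locallyIntegrable.locallyIntegrableOn _) fun g h1 h2 h3 => by
      simpa [mul_comm] using h0 g ⟨h1, h2, h3⟩
  filter_upwards [this, muI_ae_mem_Ioo s t] with x h1 h2 using h1 h2

/-- Measurable rectangles form a π-system that generates the product σ-algebra, and the sets over
which the integral vanishes are closed under complements and countable disjoint unions. -/
theorem ae_eq_zero_of_setIntegral_prod {μ ν : Measure ℝ} [IsFiniteMeasure μ] [IsFiniteMeasure ν]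
    {h : ℝ × ℝ → ℝ} (hh : Integrable h (μ.prod ν))
    (h0 : ∀ A B, MeasurableSet A → MeasurableSet B → ∫ p in A ×ˢ B, h p ∂μ.prod ν = 0) :
    h =ᵐ[μ.prod ν] 0 := by
  have key : ∀ S, MeasurableSet S → ∫ p in S, h p ∂μ.prod ν = 0 := by
    intro S hS
    induction S, hS using MeasurableSpace.induction_on_inter generateFrom_prod.symm
      isPiSystem_prod with
    | empty => simp
    | basic S hS =>
      obtain ⟨A, hA, B, hB, rfl⟩ := hS
      exact h0 A B hA hB
    | compl S hS ih =>
      have h1 := integral_add_compl hS hh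
      have h2 := h0 univ univ MeasurableSet.univ MeasurableSet.univ
      rw [univ_prod_univ, setIntegral_univ] at h2
      linarith
    | iUnion f hd hf ih =>
      have := hasSum_integral_iUnion hf hd hh.integrableOn
      simp only [ih] at this
      exact this.unique hasSum_zero
  exact Integrable.ae_eq_zero_of_forall_setIntegral_eq_zero hh fun S hS _ => key S hS

/-- The one-dimensional fundamental lemma is used twice. For fixed `ψ` it shows that `∫
h(x,y)ψ(y)dy` vanishes for almost every `x`; integration over `x ∈ A` then allows its use in `y`.
Product test functions suffice, and these are compatible with antiderivatives in one variable. -/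
theorem ae_eq_zero_of_tensor_test {R : Rect} {h : ℝ × ℝ → ℝ} (hh : MemLp h 2 R.mu)
    (h0 : ∀ χ ψ, IsTest1 R.a R.b χ → IsTest1 R.c R.d ψ →
      ∫ p, h p * (χ p.1 * ψ p.2) ∂ R.mu = 0) : h =ᵐ[R.mu] 0 := by
  have hind : ∀ {α : Type} [MeasurableSpace α] {μ : Measure α} [IsFiniteMeasure μ] {A : Set α},
      MeasurableSet A → MemLp (A.indicator fun _ => (1 : ℝ)) 2 μ := fun hA =>
    (memLp_const (1 : ℝ)).indicator hA
  have h1 : ∀ ψ, IsTest1 R.c R.d ψ → (fun x => ∫ y, h (x, y) * ψ y ∂ R.muy) =ᵐ[R.mux] 0 := by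
    intro ψ hψ
    have hψ2 := memLp_two_mul_integrable hh (memLp_two_tensor
      (memLp_const (1 : ℝ) (μ := R.mux)) (hψ.memLp : MemLp ψ 2 R.muy))
    refine ae_eq_zero_of_test1 ?_ fun χ hχ => ?_
    · refine hψ2.integral_prod_left.congr (ae_of_all _ fun x => ?_)
      simp
    · have := h0 χ ψ hχ hψ
      rw [Rect.mu, integral_prod _ (memLp_two_mul_integrable hh
        (memLp_two_tensor (hχ.memLp : MemLp χ 2 R.mux) (hψ.memLp : MemLp ψ 2 R.muy)))] at this
      rw [← this]
      refine integral_congr_ae (ae_of_all _ fun x => ?_)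
      simp only
      rw [← integral_mul_const]
      refine integral_congr_ae (ae_of_all _ fun y => ?_)
      simp only; ring
  refine ae_eq_zero_of_setIntegral_prod (hh.integrable one_le_two) fun A B hA hB => ?_
  have h2 : (fun y => ∫ x in A, h (x, y) ∂ R.mux) =ᵐ[R.muy] 0 := by
    have hA2 := memLp_two_mul_integrable hh (memLp_two_tensor (hind hA (μ := R.mux))
      (memLp_const (1 : ℝ) (μ := R.muy)))
    refine ae_eq_zero_of_test1 ?_ fun ψ hψ => ?_
    · refine hA2.integral_prod_right.congr (ae_of_all _ fun y => ?_)
      simp only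
      rw [← integral_indicator hA]
      refine integral_congr_ae (ae_of_all _ fun x => ?_)
      by_cases hx : x ∈ A <;> simp [hx]
    · have e : ∀ y, (∫ x in A, h (x, y) ∂ R.mux) * ψ y =
          ∫ x, A.indicator (fun _ => (1 : ℝ)) x * (h (x, y) * ψ y) ∂ R.mux := by
        intro y
        rw [← integral_indicator hA, ← integral_mul_const]
        refine integral_congr_ae (ae_of_all _ fun x => ?_)
        by_cases hx : x ∈ A <;> simp [hx]
      change ∫ y, (∫ x in A, h (x, y) ∂ R.mux) * ψ y ∂ R.muy = 0
      simp only [e]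
      have hs := (integral_comp_swap (hind hA (μ := R.mux)) hh
        (hψ.memLp : MemLp ψ 2 R.muy)).2
      have hz : ∫ x, A.indicator (fun _ => (1 : ℝ)) x * ∫ y, h (x, y) * ψ y ∂ R.muy ∂ R.mux = 0 := by
        rw [integral_congr_ae ((h1 ψ hψ).mono fun x hx => by
          simp only at hx ⊢; rw [hx] :
          (fun x => A.indicator (fun _ => (1 : ℝ)) x * ∫ y, h (x, y) * ψ y ∂ R.muy) =ᵐ[R.mux]
            fun x => A.indicator (fun _ => (1 : ℝ)) x * (0 : ℝ → ℝ) x)]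
        simp
      rw [hz] at hs
      rw [hs]
      refine integral_congr_ae (ae_of_all _ fun y => ?_)
      simp only
      rw [← integral_mul_const]
      refine integral_congr_ae (ae_of_all _ fun x => ?_)
      simp only; ring
  have hpr : ∫ p in A ×ˢ B, h p ∂ R.mux.prod R.muy =
      ∫ y in B, ∫ x in A, h (x, y) ∂ R.mux ∂ R.muy := by
    rw [← Measure.prod_restrict, ← integral_prod_swap, integral_prod]
    · rfl
    · have : Integrable h ((R.mux.restrict A).prod (R.muy.restrict B)) := by
        rw [Measure.prod_restrict]; exact (hh.integrable one_le_two).integrableOn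
      exact this.swap
  rw [hpr]
  rw [integral_congr_ae (ae_restrict_of_ae h2)]
  simp

/-! ## Functions with a vanishing derivative -/

theorem exists_test1 {s t : ℝ} (h : s < t) : ∃ ρ, IsTest1 s t ρ ∧ ∫ x, ρ x ∂muI s t = 1 := by
  let f : ContDiffBump ((s + t) / 2) := ⟨(t - s) / 8, (t - s) / 4, by linarith, by linarith⟩
  have hsub : tsupport (f.normed volume) ⊆ Ioo s t := by
    rw [f.tsupport_normed_eq, Real.closedBall_eq_Icc]
    intro x hx
    change x ∈ Icc ((s + t) / 2 - (t - s) / 4) ((s + t) / 2 + (t - s) / 4) at hx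
    exact ⟨by linarith [hx.1], by linarith [hx.2]⟩
  refine ⟨f.normed volume, ⟨f.contDiff_normed, f.hasCompactSupport_normed, hsub⟩, ?_⟩
  rw [muI, setIntegral_eq_integral_of_forall_compl_eq_zero]
  · exact f.integral_normed
  · intro x hx
    by_contra hne
    exact hx (Ioo_subset_Icc_self (hsub (subset_tsupport _ hne)))

/-- The antiderivative from `s` vanishes to the left of the support of `η`, and to the right of it
because the total integral is zero. The support lies in some `[a', b']` inside the open interval,
hence so does that of the antiderivative. -/
theorem IsTest1.exists_antideriv {s t : ℝ} (hst : s < t) {η : ℝ → ℝ} (h : IsTest1 s t η)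
    (h0 : ∫ x, η x ∂muI s t = 0) : ∃ χ, IsTest1 s t χ ∧ deriv χ = η := by
  have hd : ∀ x, HasDerivAt (fun x => ∫ y in s..x, η y) (η x) x := fun x =>
    intervalIntegral.integral_hasDerivAt_right (h.1.continuous.intervalIntegrable _ _)
      (h.1.continuous.stronglyMeasurableAtFilter _ _) h.1.continuous.continuousAt
  have hderiv : deriv (fun x => ∫ y in s..x, η y) = η := funext fun x => (hd x).deriv
  obtain ⟨a', b', ha, hb, hK⟩ : ∃ a' b', s < a' ∧ b' < t ∧ tsupport η ⊆ Icc a' b' := by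
    rcases (tsupport η).eq_empty_or_nonempty with he | hne
    · exact ⟨(s + t) / 2, (s + t) / 2, by linarith, by linarith, by simp [he]⟩
    · have hc : IsCompact (tsupport η) := h.2.1
      exact ⟨sInf (tsupport η), sSup (tsupport η), (h.2.2 (hc.sInf_mem hne)).1,
        (h.2.2 (hc.sSup_mem hne)).2, fun x hx =>
          ⟨csInf_le hc.bddBelow hx, le_csSup hc.bddAbove hx⟩⟩
  have hz : ∀ x, x ∉ Icc a' b' → η x = 0 := fun x hx => by
    by_contra hne; exact hx (hK (subset_tsupport _ hne))
  have hsupp : Function.support (fun x => ∫ y in s..x, η y) ⊆ Icc a' b' := by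
    intro x hx
    by_contra hxn
    apply hx
    simp only [mem_Icc, not_and_or, not_le] at hxn
    rcases hxn with hxa | hxb
    · refine intervalIntegral.integral_zero_ae (ae_of_all _ fun y hy => hz y ?_)
      intro hy2
      have : y ≤ max s x := hy.2
      have : y < a' := lt_of_le_of_lt this (max_lt ha hxa)
      linarith [hy2.1]
    · have e1 : ∫ y in s..t, η y = 0 := by rw [intervalIntegral_eq_muI hst.le, h0]
      have e2 : ∫ y in x..t, η y = 0 := by
        refine intervalIntegral.integral_zero_ae (ae_of_all _ fun y hy => hz y ?_)
        intro hy2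
        have : min x t < y := hy.1
        have : b' < y := lt_trans (lt_min hxb hb) this
        linarith [hy2.2]
      have := intervalIntegral.integral_add_adjacent_intervals
        (h.1.continuous.intervalIntegrable (μ := volume) s x)
        (h.1.continuous.intervalIntegrable x t)
      simp only
      linarith
  have hts : tsupport (fun x => ∫ y in s..x, η y) ⊆ Icc a' b' :=
    closure_minimal hsupp isClosed_Icc
  refine ⟨_, ⟨?_, ?_, hts.trans fun x hx => ⟨ha.trans_le hx.1, hx.2.trans_lt hb⟩⟩, hderiv⟩
  · rw [contDiff_infty_iff_deriv]
    exact ⟨fun x => (hd x).differentiableAt, by rw [hderiv]; exact h.1⟩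
  · exact isCompact_Icc.of_isClosed_subset (isClosed_tsupport _) hts

/-! ## Weak derivatives and partial antiderivatives -/

/-- The value at `s` is the inner product of `u` with the curried kernel, and pairing an `L2`
function with values in `L2` with a fixed vector preserves square-integrability. -/
theorem memLp_integral_mul {α β : Type*} [MeasurableSpace α] [MeasurableSpace β]
    [MeasurableSpace.CountablyGenerated β] {μ : Measure α} {ν : Measure β} [SFinite μ] [SFinite ν]
    {k : α × β → ℝ} {u : β → ℝ} (hk : MemLp k 2 (μ.prod ν)) (hu : MemLp u 2 ν) :
    MemLp (fun s => ∫ t, k (s, t) * u t ∂ν) 2 μ := by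
  obtain ⟨a, ha, hak⟩ := exists_curry hk
  refine (ha.inner_const (hu.toLp _)).ae_eq ?_
  filter_upwards [hak] with s hs
  rw [L2.inner_def]
  refine integral_congr_ae ?_
  filter_upwards [hs, hu.coeFn_toLp] with t h1 h2
  simp [h1, h2, mul_comm]

/-- Integration by parts on almost every horizontal line. The test function vanishes at both ends,
so neither boundary terms nor the function `g` of `y` contribute. -/
theorem hasWeakDeriv_x {R : Rect} {v : ℝ × ℝ → ℝ} (hv : MemLp v 2 R.mu) {g : ℝ → ℝ}
    (hg : MemLp g 2 R.muy) : HasWeakDeriv R 1 0 (fun p => g p.2 + Jx R v p) v := by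
  refine ⟨hv, fun φ hφ => ?_⟩
  simp only [Function.iterate_one, Function.iterate_zero, id]
  have hg2 : MemLp (fun p : ℝ × ℝ => g p.2) 2 R.mu := hg.comp_snd R.mux
  have i1 : Integrable (fun p => (g p.2 + Jx R v p) * pdx φ p) R.mu :=
    memLp_two_mul_integrable (hg2.add (memLp_Jx hv)) hφ.pdx.memLp
  have i2 := memLp_two_mul_integrable hv hφ.memLp
  change ∫ p, (g p.2 + Jx R v p) * pdx φ p ∂ R.mux.prod R.muy = _ * ∫ p, v p * φ p ∂ R.mux.prod R.muy
  rw [integral_prod_symm _ i1, integral_prod_symm _ i2, ← integral_const_mul]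
  have hvy : ∀ᵐ y ∂ R.muy, MemLp (fun x => v (x, y)) 2 R.mux :=
    memLp_two_fiber (memLp_two_swap hv)
  refine integral_congr_ae (hvy.mono fun y hy => ?_)
  simp only
  have hχ : ContDiff ℝ 1 (fun x => φ (x, y)) :=
    (hφ.1.comp (contDiff_id.prodMk contDiff_const)).of_le (by simp)
  have hz : ∀ x, x ∉ Ioo R.a R.b → φ (x, y) = 0 := fun x hx => by
    by_contra hne
    exact hx (hφ.2.2 (subset_tsupport _ hne)).1
  have hb : φ (R.b, y) = 0 := hz _ (by simp)
  have ha : φ (R.a, y) = 0 := hz _ (by simp)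
  have hd : MemLp (fun x => pdx φ (x, y)) 2 R.mux := by
    have hc : Continuous fun x => pdx φ (x, y) :=
      hφ.pdx.1.continuous.comp (Continuous.prodMk_left y)
    obtain ⟨C, hC⟩ := hφ.pdx.2.1.exists_bound_of_continuous hφ.pdx.1.continuous
    exact MemLp.of_bound hc.aestronglyMeasurable C (ae_of_all _ fun x => hC _)
  have e1 := integral_antideriv_mul_deriv hy hχ
  have e2 : ∫ x, pdx φ (x, y) ∂ R.mux = 0 := by
    change ∫ x, pdx φ (x, y) ∂ muI R.a R.b = 0
    rw [← intervalIntegral_eq_muI R.hab.le]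
    have := intervalIntegral.integral_deriv_eq_sub' (f := fun x => φ (x, y)) (a := R.a) (b := R.b)
      rfl (fun x _ => (hχ.differentiable one_ne_zero) x) (hχ.continuous_deriv le_rfl).continuousOn
    rw [ha, hb, sub_zero] at this
    exact this
  have hJ : MemLp (fun x => Jx R v (x, y)) 2 R.mux := memLp_antideriv hy
  calc ∫ x, (g y + Jx R v (x, y)) * pdx φ (x, y) ∂ R.mux
      = g y * ∫ x, pdx φ (x, y) ∂ R.mux + ∫ x, Jx R v (x, y) * pdx φ (x, y) ∂ R.mux := by
        simp only [add_mul]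
        rw [integral_add ((hd.integrable one_le_two).const_mul _)
          (memLp_two_mul_integrable hJ hd), integral_const_mul]
    _ = ∫ θ, v (θ, y) * (φ (R.b, y) - φ (θ, y)) ∂ muI R.a R.b := by
        rw [e2, mul_zero, zero_add]; exact e1
    _ = _ := by
        rw [hb]
        change ∫ θ, v (θ, y) * (0 - φ (θ, y)) ∂ R.mux = _
        rw [← integral_const_mul]
        refine integral_congr_ae (ae_of_all _ fun x => ?_)
        simp only; ring

theorem hasWeakDeriv_y {R : Rect} {v : ℝ × ℝ → ℝ} (hv : MemLp v 2 R.mu) {g : ℝ → ℝ}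
    (hg : MemLp g 2 R.mux) : HasWeakDeriv R 0 1 (fun p => g p.1 + Jy R v p) v :=
  (hasWeakDeriv_x (R := R.swap) (memLp_swap hv) hg).swap_xy

/-- The du Bois-Reymond lemma with a parameter: the difference `w` of `u` and the antiderivative of
`v` has vanishing weak `x`-derivative, so it equals its average `g` in `x` against a bump `ρ` of
integral one. -/
theorem HasWeakDeriv.exists_x {R : Rect} {u v : ℝ × ℝ → ℝ} (hu : MemLp u 2 R.mu)
    (h : HasWeakDeriv R 1 0 u v) :
    ∃ g, MemLp g 2 R.muy ∧ u =ᵐ[R.mu] fun p => g p.2 + Jx R v p := by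
  have hJ := memLp_Jx h.1
  set w : ℝ × ℝ → ℝ := fun p => u p - Jx R v p with hw
  have hw2 : MemLp w 2 R.mu := hu.sub hJ
  have hw0 : ∀ φ, IsTest R φ → ∫ p, w p * pdx φ p ∂ R.mu = 0 := by
    intro φ hφ
    have h1 := h.2 φ hφ
    have h2 := (hasWeakDeriv_x h.1 (MemLp.zero (p := 2) (μ := R.muy) (ε := ℝ))).2 φ hφ
    simp only [Function.iterate_one, Function.iterate_zero, id, Pi.zero_apply, zero_add] at h1 h2
    simp only [hw, sub_mul]
    rw [integral_sub (memLp_two_mul_integrable hu hφ.pdx.memLp)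
      (memLp_two_mul_integrable hJ hφ.pdx.memLp), h1, h2, sub_self]
  obtain ⟨ρ, hρ, hρ1⟩ := exists_test1 R.hab
  have hρm : MemLp ρ 2 R.mux := hρ.memLp
  set g : ℝ → ℝ := fun y => ∫ x, w (x, y) * ρ x ∂ R.mux with hg
  have hg2 : MemLp g 2 R.muy := memLp_integral_mul (memLp_two_swap hw2) hρm
  have hg3 : MemLp (fun p : ℝ × ℝ => g p.2) 2 R.mu := hg2.comp_snd R.mux
  refine ⟨g, hg2, ?_⟩
  have hz : (fun p => w p - g p.2) =ᵐ[R.mu] 0 := by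
    refine ae_eq_zero_of_tensor_test (hw2.sub hg3) fun η ψ hη hψ => ?_
    have hηm : MemLp η 2 R.mux := hη.memLp
    have hψm : MemLp ψ 2 R.muy := hψ.memLp
    set m := ∫ x, η x ∂ R.mux with hm
    -- Subtracting `m ρ` makes the mean zero, so the difference is the derivative of a test function
    -- `χ`, and `w` annihilates `χ' ⊗ ψ`. Thus `η` may be replaced by `m ρ` when testing `w`.
    obtain ⟨χ, hχ, hχd⟩ := IsTest1.exists_antideriv R.hab (η := fun x => η x - m * ρ x)
      ⟨hη.1.sub (contDiff_const.mul hρ.1), hη.2.1.sub hρ.2.1.mul_left,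
        (tsupport_sub _ _).trans (union_subset hη.2.2
          ((tsupport_mul_subset_right).trans hρ.2.2))⟩ (by
        change ∫ x, η x - m * ρ x ∂ R.mux = 0
        rw [integral_sub (hηm.integrable one_le_two) ((hρm.integrable one_le_two).const_mul m),
          integral_const_mul]
        change _ - m * ∫ x, ρ x ∂muI R.a R.b = 0
        rw [hρ1]; simp [hm])
    have h1 := hw0 _ (hχ.tensor hψ)
    have hpd : ∀ p, pdx (fun p : ℝ × ℝ => χ p.1 * ψ p.2) p = (η p.1 - m * ρ p.1) * ψ p.2 := by
      intro p
      simp only [pdx]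
      rw [deriv_mul_const ((hχ.1.differentiable (by simp)) _), hχd]
    simp only [hpd] at h1
    have i1 := memLp_two_mul_integrable hw2 (memLp_two_tensor hηm hψm)
    have i2 := memLp_two_mul_integrable hw2 (memLp_two_tensor hρm hψm)
    have i3 := memLp_two_mul_integrable hg3 (memLp_two_tensor hηm hψm)
    have h2 : ∫ p, w p * (η p.1 * ψ p.2) ∂ R.mu = m * ∫ p, w p * (ρ p.1 * ψ p.2) ∂ R.mu := by
      have : ∫ p, w p * ((η p.1 - m * ρ p.1) * ψ p.2) ∂ R.mu =
          ∫ p, w p * (η p.1 * ψ p.2) - m * (w p * (ρ p.1 * ψ p.2)) ∂ R.mu :=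
        integral_congr_ae (ae_of_all _ fun p => by simp only; ring)
      rw [this, integral_sub i1 (i2.const_mul m), integral_const_mul] at h1
      linarith
    have h3 : ∫ p, g p.2 * (η p.1 * ψ p.2) ∂ R.mu = m * ∫ y, g y * ψ y ∂ R.muy := by
      change ∫ p, g p.2 * (η p.1 * ψ p.2) ∂ R.mux.prod R.muy = _
      rw [hm, ← integral_prod_mul (μ := R.mux) (ν := R.muy) η fun y => g y * ψ y]
      exact integral_congr_ae (ae_of_all _ fun p => by simp only; ring)
    have h4 : ∫ p, w p * (ρ p.1 * ψ p.2) ∂ R.mu = ∫ y, g y * ψ y ∂ R.muy := by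
      change ∫ p, w p * (ρ p.1 * ψ p.2) ∂ R.mux.prod R.muy = _
      rw [integral_prod_symm _ i2]
      refine integral_congr_ae (ae_of_all _ fun y => ?_)
      simp only [hg]
      rw [← integral_mul_const]
      exact integral_congr_ae (ae_of_all _ fun p => by simp only; ring)
    simp only [sub_mul]
    rw [integral_sub i1 i3, h2, h3, h4, sub_self]
  filter_upwards [hz] with p hp
  simp only [hw, Pi.zero_apply] at hp
  linarith

theorem HasWeakDeriv.exists_y {R : Rect} {u v : ℝ × ℝ → ℝ} (hu : MemLp u 2 R.mu)
    (h : HasWeakDeriv R 0 1 u v) :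
    ∃ g, MemLp g 2 R.mux ∧ u =ᵐ[R.mu] fun p => g p.1 + Jy R v p := by
  obtain ⟨g, hg, hug⟩ := HasWeakDeriv.exists_x (R := R.swap) (memLp_swap hu) h.swap_yx
  exact ⟨g, hg, swap_ae (R := R.swap) hug⟩

theorem HasWeakDeriv.ae_unique {R : Rect} {i j : ℕ} {u v w : ℝ × ℝ → ℝ}
    (h : HasWeakDeriv R i j u v) (h' : HasWeakDeriv R i j u w) : v =ᵐ[R.mu] w := by
  have hz : (fun p => v p - w p) =ᵐ[R.mu] 0 := by
    refine ae_eq_zero_of_tensor_test (h.1.sub h'.1) fun χ ψ hχ hψ => ?_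
    have ht := hχ.tensor hψ
    have e := (h.2 _ ht).symm.trans (h'.2 _ ht)
    have hne : ((-1 : ℝ) ^ (i + j)) ≠ 0 := by simp
    simp only [sub_mul]
    rw [integral_sub (memLp_two_mul_integrable h.1 ht.memLp)
      (memLp_two_mul_integrable h'.1 ht.memLp), mul_left_cancel₀ hne e, sub_self]
  filter_upwards [hz] with p hp
  exact sub_eq_zero.1 hp

/-! ## Functions with an integrable mixed derivative -/

/-- The closed rectangle. -/
def Rect.dom (R : Rect) : Set (ℝ × ℝ) := Icc R.a R.b ×ˢ Icc R.c R.d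

theorem Rect.mu_eq (R : Rect) : R.mu = volume.restrict R.dom := by
  rw [Rect.mu, Rect.mux, Rect.muy, muI, muI, Measure.prod_restrict]; rfl

theorem ae_of_dom {R : Rect} {p : ℝ × ℝ → Prop} (h : ∀ z ∈ R.dom, p z) : ∀ᵐ z ∂ R.mu, p z :=
  R.mu_ae_mem.mono h

theorem integrable_Ioc_prod {R : Rect} {f : ℝ × ℝ → ℝ} (hf : Integrable f R.mu) {x y : ℝ}
    (hx : x ∈ Icc R.a R.b) (hy : y ∈ Icc R.c R.d) :
    Integrable f ((volume.restrict (Ioc R.a x)).prod (volume.restrict (Ioc R.c y))) := by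
  rw [Measure.prod_restrict]
  rw [R.mu_eq] at hf
  exact IntegrableOn.mono_set hf (prod_mono (Ioc_subset_Icc_self.trans (Icc_subset_Icc_right hx.2))
    (Ioc_subset_Icc_self.trans (Icc_subset_Icc_right hy.2)))

/-- Integrability on the rectangle passes to each subrectangle `[a,x] × [c,y]`, so the identity
holds at every point of the closed rectangle. Values at corners and on edges, which are null sets,
depend on this. -/
theorem Jx_Jy_eq {R : Rect} {f : ℝ × ℝ → ℝ} (hf : Integrable f R.mu) {z : ℝ × ℝ}
    (hz : z ∈ R.dom) : Jx R (Jy R f) z =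
      ∫ p, f p ∂((volume.restrict (Ioc R.a z.1)).prod (volume.restrict (Ioc R.c z.2))) := by
  rw [integral_prod _ (integrable_Ioc_prod hf hz.1 hz.2)]
  simp only [Jx, Jy]
  rw [intervalIntegral.integral_of_le hz.1.1]
  simp only [intervalIntegral.integral_of_le hz.2.1]

theorem Jy_Jx_eq {R : Rect} {f : ℝ × ℝ → ℝ} (hf : Integrable f R.mu) {z : ℝ × ℝ}
    (hz : z ∈ R.dom) : Jy R (Jx R f) z = Jx R (Jy R f) z := by
  rw [Jx_Jy_eq hf hz, integral_prod_symm _ (integrable_Ioc_prod hf hz.1 hz.2)]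
  simp only [Jx, Jy]
  rw [intervalIntegral.integral_of_le hz.2.1]
  simp only [intervalIntegral.integral_of_le hz.1.1]

theorem Jx_Jy_congr {R : Rect} {f g : ℝ × ℝ → ℝ} (hf : Integrable f R.mu) (h : f =ᵐ[R.mu] g)
    {z : ℝ × ℝ} (hz : z ∈ R.dom) : Jx R (Jy R f) z = Jx R (Jy R g) z := by
  rw [Jx_Jy_eq hf hz, Jx_Jy_eq (hf.congr h) hz]
  refine integral_congr_ae ?_
  rw [Measure.prod_restrict]
  refine ae_mono (Measure.restrict_mono ?_ le_rfl) (R.mu_eq ▸ h)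
  exact prod_mono (Ioc_subset_Icc_self.trans (Icc_subset_Icc_right hz.1.2))
    (Ioc_subset_Icc_self.trans (Icc_subset_Icc_right hz.2.2))

theorem intervalIntegrable_Jy {R : Rect} {f : ℝ × ℝ → ℝ} (hf : Integrable f R.mu) {x y : ℝ}
    (hx : x ∈ Icc R.a R.b) (hy : y ∈ Icc R.c R.d) :
    IntervalIntegrable (fun s => Jy R f (s, y)) volume R.a x := by
  rw [intervalIntegrable_iff_integrableOn_Ioc_of_le hx.1]
  refine (integrable_Ioc_prod hf hx hy).integral_prod_left.congr (ae_of_all _ fun s => ?_)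
  simp only [Jy, intervalIntegral.integral_of_le hy.1]

theorem intervalIntegrable_Jx {R : Rect} {f : ℝ × ℝ → ℝ} (hf : Integrable f R.mu) {x y : ℝ}
    (hx : x ∈ Icc R.a R.b) (hy : y ∈ Icc R.c R.d) :
    IntervalIntegrable (fun t => Jx R f (x, t)) volume R.c y := by
  rw [intervalIntegrable_iff_integrableOn_Ioc_of_le hy.1]
  refine (integrable_Ioc_prod hf hx hy).integral_prod_right.congr (ae_of_all _ fun s => ?_)
  simp only [Jx, intervalIntegral.integral_of_le hx.1]

/-- The double integral is that of `f` over a quadrant with vertex `z`. As `z` moves, the indicators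
converge off two lines of measure zero, and `‖f‖` dominates. -/
theorem continuousOn_Jx_Jy {R : Rect} {f : ℝ × ℝ → ℝ} (hf : Integrable f R.mu) :
    ContinuousOn (Jx R (Jy R f)) R.dom := by
  have hc : Continuous fun z : ℝ × ℝ =>
      ∫ p, (Iic z.1 ×ˢ Iic z.2).indicator f p ∂ R.mu := by
    refine continuous_iff_continuousAt.2 fun z₀ => ?_
    refine continuousAt_of_dominated (bound := fun p => ‖f p‖) ?_ ?_ hf.norm ?_
    · exact Eventually.of_forall fun z =>
        hf.1.indicator (measurableSet_Iic.prod measurableSet_Iic)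
    · exact Eventually.of_forall fun z => ae_of_all _ fun p => norm_indicator_le_norm_self _ _
    · have h1 : ∀ᵐ p ∂ R.mu, p.1 ≠ z₀.1 := ae_fst_of_ae (R := R) (p := fun x => x ≠ z₀.1)
        (ae_restrict_of_ae (Measure.ae_ne volume z₀.1))
      have h2 : ∀ᵐ p ∂ R.mu, p.2 ≠ z₀.2 := ae_snd_of_ae (R := R) (p := fun x => x ≠ z₀.2)
        (ae_restrict_of_ae (Measure.ae_ne volume z₀.2))
      have key : ∀ {r s : ℝ}, r ≠ s → ∀ᶠ t in 𝓝 s, (r ≤ t ↔ r ≤ s) := by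
        intro r s hrs
        rcases lt_or_gt_of_ne hrs with h | h
        · filter_upwards [lt_mem_nhds h] with t ht using ⟨fun _ => h.le, fun _ => ht.le⟩
        · filter_upwards [gt_mem_nhds h] with t ht
          exact ⟨fun h' => absurd h' (not_le.2 ht), fun h' => absurd h' (not_le.2 h)⟩
      filter_upwards [h1, h2] with p h1 h2
      have e1 := (continuous_fst.tendsto z₀).eventually (key h1)
      have e2 := (continuous_snd.tendsto z₀).eventually (key h2)
      refine ContinuousAt.congr (continuousAt_const (y := (Iic z₀.1 ×ˢ Iic z₀.2).indicator f p)) ?_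
      filter_upwards [e1, e2] with z e1 e2
      classical
      simp only [indicator, mem_prod, mem_Iic, e1, e2]
  refine hc.continuousOn.congr fun z hz => ?_
  have e : ∀ {s t x : ℝ}, x ∈ Icc s t → Icc s t ∩ Iic x = Icc s x := fun hx => by
    ext r
    exact ⟨fun h => ⟨h.1.1, h.2⟩, fun h => ⟨⟨h.1, h.2.trans hx.2⟩, h.2⟩⟩
  simp only
  rw [Jx_Jy_eq hf hz, integral_indicator (measurableSet_Iic.prod measurableSet_Iic), R.mu_eq,
    Measure.restrict_restrict (measurableSet_Iic.prod measurableSet_Iic), Measure.prod_restrict,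
    Rect.dom, prod_inter_prod, inter_comm (Iic z.1), inter_comm (Iic z.2), e hz.1, e hz.2]
  exact setIntegral_congr_set (Measure.set_prod_ae_eq Ioc_ae_eq_Icc Ioc_ae_eq_Icc)

theorem continuousOn_antideriv {s t : ℝ} {f : ℝ → ℝ} (hf : Integrable f (muI s t)) :
    ContinuousOn (fun x => ∫ θ in s..x, f θ) (Icc s t) := by
  rcases le_or_gt s t with h | h
  · have := intervalIntegral.continuousOn_primitive_interval (a := s) (b := t) (f := f)
      (μ := volume) (by rw [uIcc_of_le h]; exact hf)
    rwa [uIcc_of_le h] at this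
  · simp [Icc_eq_empty (not_le.2 h)]

/-- The function with corner value `c`, edge derivatives `p`, `q` and mixed derivative `f`. -/
def rep1 (R : Rect) (c : ℝ) (p q : ℝ → ℝ) (f : ℝ × ℝ → ℝ) : ℝ × ℝ → ℝ := fun z =>
  c + (∫ s in R.a..z.1, p s) + (∫ t in R.c..z.2, q t) + Jx R (Jy R f) z

/-- The `x`-derivative of `rep1 R c p q f`. -/
def repx (R : Rect) (p : ℝ → ℝ) (f : ℝ × ℝ → ℝ) : ℝ × ℝ → ℝ := fun z => p z.1 + Jy R f z

/-- The `y`-derivative of `rep1 R c p q f`. -/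
def repy (R : Rect) (q : ℝ → ℝ) (f : ℝ × ℝ → ℝ) : ℝ × ℝ → ℝ := fun z => q z.2 + Jx R f z

section rep1

variable {R : Rect} {c : ℝ} {p q : ℝ → ℝ} {f : ℝ × ℝ → ℝ}

theorem memLp_repx (hp : MemLp p 2 R.mux) (hf : MemLp f 2 R.mu) : MemLp (repx R p f) 2 R.mu :=
  (hp.comp_fst R.muy).add (memLp_Jy hf)

theorem memLp_repy (hq : MemLp q 2 R.muy) (hf : MemLp f 2 R.mu) : MemLp (repy R q f) 2 R.mu :=
  (hq.comp_snd R.mux).add (memLp_Jx hf)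

theorem memLp_primitive_x (c : ℝ) (hp : MemLp p 2 R.mux) :
    MemLp (fun x => c + ∫ s in R.a..x, p s) 2 R.mux :=
  (memLp_const c).add (memLp_antideriv hp)

theorem memLp_primitive_y (c : ℝ) (hq : MemLp q 2 R.muy) :
    MemLp (fun x => c + ∫ s in R.c..x, q s) 2 R.muy :=
  (memLp_const c).add (memLp_antideriv hq)

theorem memLp_rep1 (hp : MemLp p 2 R.mux) (hq : MemLp q 2 R.muy) (hf : MemLp f 2 R.mu) :
    MemLp (rep1 R c p q f) 2 R.mu :=
  (((memLp_primitive_x c hp).comp_fst R.muy).add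
    ((memLp_antideriv (s := R.c) (t := R.d) hq).comp_snd R.mux)).add (memLp_Jx (memLp_Jy hf))

/-- Read as an antiderivative in `x` that starts from the edge `x = a`, the function falls under
`hasWeakDeriv_x`. The version in `y` needs Fubini in addition. -/
theorem rep1_eq_x (hp : MemLp p 2 R.mux) (hf : MemLp f 2 R.mu) {z : ℝ × ℝ} (hz : z ∈ R.dom) :
    rep1 R c p q f z = (c + ∫ t in R.c..z.2, q t) + Jx R (repx R p f) z := by
  have h1 := intervalIntegrable_of_memLp hz.1 hp
  have h2 := intervalIntegrable_Jy (hf.integrable one_le_two) hz.1 hz.2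
  have : Jx R (repx R p f) z = (∫ s in R.a..z.1, p s) + Jx R (Jy R f) z :=
    intervalIntegral.integral_add h1 h2
  rw [this, rep1]; ring

theorem rep1_eq_y (hq : MemLp q 2 R.muy) (hf : MemLp f 2 R.mu) {z : ℝ × ℝ} (hz : z ∈ R.dom) :
    rep1 R c p q f z = (c + ∫ t in R.a..z.1, p t) + Jy R (repy R q f) z := by
  have h1 := intervalIntegrable_of_memLp hz.2 hq
  have h2 := intervalIntegrable_Jx (hf.integrable one_le_two) hz.1 hz.2
  have : Jy R (repy R q f) z = (∫ s in R.c..z.2, q s) + Jy R (Jx R f) z :=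
    intervalIntegral.integral_add h1 h2
  rw [this, rep1, Jy_Jx_eq (hf.integrable one_le_two) hz]; ring

theorem hasWeakDeriv_rep1_x (hp : MemLp p 2 R.mux) (hq : MemLp q 2 R.muy) (hf : MemLp f 2 R.mu) :
    HasWeakDeriv R 1 0 (rep1 R c p q f) (repx R p f) :=
  (hasWeakDeriv_x (memLp_repx hp hf) (memLp_primitive_y c hq)).congr
    (ae_of_dom fun _ hz => (rep1_eq_x hp hf hz).symm) .rfl

theorem hasWeakDeriv_rep1_y (hp : MemLp p 2 R.mux) (hq : MemLp q 2 R.muy) (hf : MemLp f 2 R.mu) :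
    HasWeakDeriv R 0 1 (rep1 R c p q f) (repy R q f) :=
  (hasWeakDeriv_y (memLp_repy hq hf) (memLp_primitive_x c hp)).congr
    (ae_of_dom fun _ hz => (rep1_eq_y hq hf hz).symm) .rfl

theorem hasWeakDeriv_repx (hp : MemLp p 2 R.mux) (hf : MemLp f 2 R.mu) :
    HasWeakDeriv R 0 1 (repx R p f) f :=
  hasWeakDeriv_y hf hp

theorem hasWeakDeriv_repy (hq : MemLp q 2 R.muy) (hf : MemLp f 2 R.mu) :
    HasWeakDeriv R 1 0 (repy R q f) f :=
  hasWeakDeriv_x hf hq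

theorem continuousOn_rep1 (hp : MemLp p 2 R.mux) (hq : MemLp q 2 R.muy) (hf : MemLp f 2 R.mu) :
    ContinuousOn (rep1 R c p q f) R.dom := by
  have h1 := (continuousOn_antideriv (s := R.a) (t := R.b) (hp.integrable one_le_two)).comp
    continuousOn_fst (s := R.dom) fun z hz => hz.1
  have h2 := (continuousOn_antideriv (s := R.c) (t := R.d) (hq.integrable one_le_two)).comp
    continuousOn_snd (s := R.dom) fun z hz => hz.2
  exact ((continuousOn_const.add h1).add h2).add
    (continuousOn_Jx_Jy (hf.integrable one_le_two))

theorem continuousOn_repx (p : ℝ → ℝ) (hf : MemLp f 2 R.mu) :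
    ∀ᵐ x ∂ R.mux, ContinuousOn (fun y => repx R p f (x, y)) (Icc R.c R.d) := by
  filter_upwards [memLp_two_fiber hf] with x hx
  exact (continuousOn_const (c := p x)).add
    (continuousOn_antideriv (s := R.c) (t := R.d) (hx.integrable one_le_two))

theorem continuousOn_repy (q : ℝ → ℝ) (hf : MemLp f 2 R.mu) :
    ∀ᵐ y ∂ R.muy, ContinuousOn (fun x => repy R q f (x, y)) (Icc R.a R.b) := by
  filter_upwards [memLp_two_fiber (memLp_two_swap hf)] with y hy
  exact (continuousOn_const (c := q y)).add
    (continuousOn_antideriv (s := R.a) (t := R.b) (hy.integrable one_le_two))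

theorem intervalIntegral_congr_muI {s t x : ℝ} {f g : ℝ → ℝ} (h : f =ᵐ[muI s t] g)
    (hx : x ∈ Icc s t) : ∫ θ in s..x, f θ = ∫ θ in s..x, g θ := by
  rw [intervalIntegral_eq_indicator hx, intervalIntegral_eq_indicator hx]
  exact integral_congr_ae (h.mono fun θ hθ => by simp only [hθ])

theorem rep1_congr {p' q' : ℝ → ℝ} {f' : ℝ × ℝ → ℝ} (hf : MemLp f 2 R.mu) (ep : p =ᵐ[R.mux] p')
    (eq : q =ᵐ[R.muy] q') (ef : f =ᵐ[R.mu] f') {z : ℝ × ℝ} (hz : z ∈ R.dom) :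
    rep1 R c p q f z = rep1 R c p' q' f' z := by
  simp only [rep1]
  rw [intervalIntegral_congr_muI ep hz.1, intervalIntegral_congr_muI eq hz.2,
    Jx_Jy_congr (hf.integrable one_le_two) ef hz]

end rep1

instance Rect.neBot_mux (R : Rect) : (ae R.mux).NeBot := by
  rw [ae_neBot, Rect.mux, muI, Ne, Measure.restrict_eq_zero]
  simp [R.hab]

instance Rect.neBot_muy (R : Rect) : (ae R.muy).NeBot := R.swap.neBot_mux

theorem HasWeakDeriv.sub {R : Rect} {i j : ℕ} {u u' v v' : ℝ × ℝ → ℝ} (hu : MemLp u 2 R.mu)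
    (hu' : MemLp u' 2 R.mu) (h : HasWeakDeriv R i j u v) (h' : HasWeakDeriv R i j u' v') :
    HasWeakDeriv R i j (fun p => u p - u' p) fun p => v p - v' p := by
  refine ⟨h.1.sub h'.1, fun φ hφ => ?_⟩
  have ht := (hφ.pdy_iterate j).pdx_iterate i
  simp only [sub_mul]
  rw [integral_sub (memLp_two_mul_integrable hu ht.memLp) (memLp_two_mul_integrable hu' ht.memLp),
    integral_sub (memLp_two_mul_integrable h.1 hφ.memLp)
      (memLp_two_mul_integrable h'.1 hφ.memLp), h.2 φ hφ, h'.2 φ hφ, mul_sub]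

/-- Functions with square-integrable first and mixed weak derivatives. -/
theorem exists_rep1 {R : Rect} {u ux uy f : ℝ × ℝ → ℝ} (hu : MemLp u 2 R.mu)
    (hx : HasWeakDeriv R 1 0 u ux) (hy : HasWeakDeriv R 0 1 u uy) (hxy : HasWeakDeriv R 0 1 ux f)
    (hyx : HasWeakDeriv R 1 0 uy f) :
    ∃ c p q, MemLp p 2 R.mux ∧ MemLp q 2 R.muy ∧ u =ᵐ[R.mu] rep1 R c p q f ∧
      ux =ᵐ[R.mu] repx R p f ∧ uy =ᵐ[R.mu] repy R q f := by
  obtain ⟨p, hp, hpe⟩ := hxy.exists_y hx.1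
  obtain ⟨q, hq, hqe⟩ := hyx.exists_x hy.1
  obtain ⟨g, hg, hge⟩ := hx.exists_x hu
  have hf := hxy.1
  have hp0 : HasWeakDeriv R 0 1 (rep1 R 0 p 0 f) (repy R 0 f) :=
    hasWeakDeriv_rep1_y hp MemLp.zero hf
  have hge' : u =ᵐ[R.mu] fun z => g z.2 + rep1 R 0 p 0 f z := by
    filter_upwards [hge, Jx_congr hpe, R.mu_ae_mem] with z h1 h2 h3
    rw [h1, h2, rep1_eq_x hp hf h3]
    simp; rfl
  -- The unknown function `g` of `y` is what `u` has in excess of the part with zero corner value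
  -- and zero data on `x = a`. Comparing weak `y`-derivatives shows that its derivative is `q`.
  have hgy : HasWeakDeriv R 0 1 (fun z => g z.2) fun z => q z.2 := by
    refine (hy.sub hu (memLp_rep1 hp MemLp.zero hf) hp0).congr ?_ ?_
    · filter_upwards [hge'] with z hz
      rw [hz]; ring
    · filter_upwards [hqe] with z hz
      rw [hz, repy]; simp
  obtain ⟨k, -, hke⟩ := hgy.exists_y (hg.comp_snd R.mux)
  -- The constant of integration `k` may depend on `x`, but `g` does not; fixing `x` at a point
  -- where the identity holds for almost every `y` gives the corner value `k x₀`.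
  obtain ⟨x₀, hx₀⟩ := (ae_ae_x hke).exists
  refine ⟨k x₀, p, q, hp, hq, ?_, hpe, hqe⟩
  filter_upwards [hge', ae_snd_of_ae hx₀] with z h1 h2
  rw [h1, h2]
  simp only [rep1, Jy, Pi.zero_apply, intervalIntegral.integral_zero]
  ring

/-! ## Functions with square-integrable derivatives up to second order in each variable -/

theorem Jx_congr_dom {R : Rect} {f g : ℝ × ℝ → ℝ} (h : ∀ z ∈ R.dom, f z = g z) {z : ℝ × ℝ}
    (hz : z ∈ R.dom) : Jx R f z = Jx R g z := by
  refine intervalIntegral.integral_congr fun s hs => ?_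
  rw [uIcc_of_le hz.1.1] at hs
  exact h _ ⟨⟨hs.1, hs.2.trans hz.1.2⟩, hz.2⟩

theorem Jy_congr_dom {R : Rect} {f g : ℝ × ℝ → ℝ} (h : ∀ z ∈ R.dom, f z = g z) {z : ℝ × ℝ}
    (hz : z ∈ R.dom) : Jy R f z = Jy R g z := by
  refine intervalIntegral.integral_congr fun s hs => ?_
  rw [uIcc_of_le hz.2.1] at hs
  exact h _ ⟨hz.1, ⟨hs.1, hs.2.trans hz.2.2⟩⟩

/-- Different derivatives of `u` are represented independently, each with edge data of its own.
Where the same derivative appears in two forms, the integrals over `x` agree, and hence so do the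
parts that depend on `y` alone. -/
theorem repy_edge_unique {R : Rect} {c : ℝ} {p q q' : ℝ → ℝ} {f g w : ℝ × ℝ → ℝ}
    (hp : MemLp p 2 R.mux) (hf : MemLp f 2 R.mu) (h : w =ᵐ[R.mu] rep1 R c p q f)
    (h' : w =ᵐ[R.mu] repy R q' g) (hg : g =ᵐ[R.mu] repx R p f) :
    q' =ᵐ[R.muy] fun y => c + ∫ t in R.c..y, q t := by
  have : ∀ᵐ z ∂ R.mu, q' z.2 = c + ∫ t in R.c..z.2, q t := by
    filter_upwards [h, h', Jx_congr hg, R.mu_ae_mem] with z h1 h2 h3 h4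
    rw [h1, rep1_eq_x hp hf h4, repy, h3] at h2
    linarith
  filter_upwards [ae_ae_y this] with y hy
  exact hy.exists.choose_spec

theorem repx_edge_unique {R : Rect} {c : ℝ} {p p' q : ℝ → ℝ} {f g w : ℝ × ℝ → ℝ}
    (hq : MemLp q 2 R.muy) (hf : MemLp f 2 R.mu) (h : w =ᵐ[R.mu] rep1 R c p q f)
    (h' : w =ᵐ[R.mu] repx R p' g) (hg : g =ᵐ[R.mu] repy R q f) :
    p' =ᵐ[R.mux] fun x => c + ∫ s in R.a..x, p s := by
  have : ∀ᵐ z ∂ R.mu, p' z.1 = c + ∫ s in R.a..z.1, p s := by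
    filter_upwards [h, h', Jy_congr hg, R.mu_ae_mem] with z h1 h2 h3 h4
    rw [h1, rep1_eq_y hq hf h4, repx, h3] at h2
    linarith
  filter_upwards [ae_ae_x this] with y hy
  exact hy.exists.choose_spec

/-- The derivatives `∂x^i ∂y^j`, `i, j ≤ 2`, of the function with corner values `c` of
`1, ∂x, ∂y, ∂x∂y`, edge values `p` of `∂x², ∂x²∂y`, edge values `q` of `∂y², ∂x∂y²`, and with
`∂x²∂y²` equal to `f`. -/
def rep2 (R : Rect) (c : Fin 4 → ℝ) (p q : Fin 2 → ℝ → ℝ) (f : ℝ × ℝ → ℝ) :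
    ℕ → ℕ → ℝ × ℝ → ℝ
  | 0, 0 => rep1 R (c 0) (fun x => c 1 + ∫ s in R.a..x, p 0 s)
      (fun y => c 2 + ∫ t in R.c..y, q 0 t) (rep1 R (c 3) (p 1) (q 1) f)
  | 1, 0 => rep1 R (c 1) (p 0) (fun y => c 3 + ∫ t in R.c..y, q 1 t) (repx R (p 1) f)
  | 0, 1 => rep1 R (c 2) (fun x => c 3 + ∫ s in R.a..x, p 1 s) (q 0) (repy R (q 1) f)
  | 1, 1 => rep1 R (c 3) (p 1) (q 1) f
  | 2, 0 => repx R (p 0) (repx R (p 1) f)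
  | 2, 1 => repx R (p 1) f
  | 0, 2 => repy R (q 0) (repy R (q 1) f)
  | 1, 2 => repy R (q 1) f
  | _, _ => f

section rep2

variable {R : Rect} {c : Fin 4 → ℝ} {p q : Fin 2 → ℝ → ℝ} {f : ℝ × ℝ → ℝ}

theorem rep2_dom_y (hp : ∀ m, MemLp (p m) 2 R.mux) (hf : MemLp f 2 R.mu) {z : ℝ × ℝ}
    (hz : z ∈ R.dom) :
    repy R (fun y => c 3 + ∫ t in R.c..y, q 1 t) (repx R (p 1) f) z =
      rep1 R (c 3) (p 1) (q 1) f z :=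
  (rep1_eq_x (hp 1) hf hz).symm

theorem rep2_dom_x (hq : ∀ m, MemLp (q m) 2 R.muy) (hf : MemLp f 2 R.mu) {z : ℝ × ℝ}
    (hz : z ∈ R.dom) :
    repx R (fun x => c 3 + ∫ t in R.a..x, p 1 t) (repy R (q 1) f) z =
      rep1 R (c 3) (p 1) (q 1) f z :=
  (rep1_eq_y (hq 1) hf hz).symm

/-- In `rep2` the derivative of order `(1,0)` is written as a `rep1` with its own corner and edge
data, from which its further derivatives can be read off. This identifies it with the `x`-derivative
that the formula of order `(0,0)` produces. -/
theorem rep2_dom_10 (hp : ∀ m, MemLp (p m) 2 R.mux) (hq : ∀ m, MemLp (q m) 2 R.muy)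
    (hf : MemLp f 2 R.mu) {z : ℝ × ℝ} (hz : z ∈ R.dom) :
    repx R (fun x => c 1 + ∫ s in R.a..x, p 0 s) (rep1 R (c 3) (p 1) (q 1) f) z =
      rep2 R c p q f 1 0 z := by
  change _ = rep1 R (c 1) (p 0) (fun y => c 3 + ∫ t in R.c..y, q 1 t) (repx R (p 1) f) z
  rw [rep1_eq_y (memLp_primitive_y _ (hq 1)) (memLp_repx (hp 1) hf) hz, repx]
  congr 1
  exact Jy_congr_dom (fun z hz => (rep2_dom_y hp hf hz).symm) hz

theorem rep2_dom_01 (hp : ∀ m, MemLp (p m) 2 R.mux) (hq : ∀ m, MemLp (q m) 2 R.muy)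
    (hf : MemLp f 2 R.mu) {z : ℝ × ℝ} (hz : z ∈ R.dom) :
    repy R (fun y => c 2 + ∫ t in R.c..y, q 0 t) (rep1 R (c 3) (p 1) (q 1) f) z =
      rep2 R c p q f 0 1 z := by
  change _ = rep1 R (c 2) (fun x => c 3 + ∫ s in R.a..x, p 1 s) (q 0) (repy R (q 1) f) z
  rw [rep1_eq_x (memLp_primitive_x _ (hp 1)) (memLp_repy (hq 1) hf) hz, repy]
  congr 1
  exact Jx_congr_dom (fun z hz => (rep2_dom_x hq hf hz).symm) hz

theorem memLp_rep2 (hp : ∀ m, MemLp (p m) 2 R.mux) (hq : ∀ m, MemLp (q m) 2 R.muy)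
    (hf : MemLp f 2 R.mu) : MemLp (rep2 R c p q f 0 0) 2 R.mu :=
  memLp_rep1 (memLp_primitive_x _ (hp 0)) (memLp_primitive_y _ (hq 0))
    (memLp_rep1 (hp 1) (hq 1) hf)

theorem hasWeakDeriv_rep2 (hp : ∀ m, MemLp (p m) 2 R.mux) (hq : ∀ m, MemLp (q m) 2 R.muy)
    (hf : MemLp f 2 R.mu) {i j : ℕ} (hi : i ≤ 2) (hj : j ≤ 2) :
    HasWeakDeriv R i j (rep2 R c p q f 0 0) (rep2 R c p q f i j) := by
  have m11 : MemLp (rep1 R (c 3) (p 1) (q 1) f) 2 R.mu := memLp_rep1 (hp 1) (hq 1) hf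
  have h00 : HasWeakDeriv R 0 0 (rep2 R c p q f 0 0) (rep2 R c p q f 0 0) :=
    hasWeakDeriv_zero (memLp_rep2 hp hq hf)
  have h10 : HasWeakDeriv R 1 0 (rep2 R c p q f 0 0) (rep2 R c p q f 1 0) :=
    (hasWeakDeriv_rep1_x (memLp_primitive_x _ (hp 0)) (memLp_primitive_y _ (hq 0)) m11).congr
      .rfl (ae_of_dom fun z hz => rep2_dom_10 hp hq hf hz)
  have h01 : HasWeakDeriv R 0 1 (rep2 R c p q f 0 0) (rep2 R c p q f 0 1) :=
    (hasWeakDeriv_rep1_y (memLp_primitive_x _ (hp 0)) (memLp_primitive_y _ (hq 0)) m11).congr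
      .rfl (ae_of_dom fun z hz => rep2_dom_01 hp hq hf hz)
  have h20 : HasWeakDeriv R 2 0 (rep2 R c p q f 0 0) (rep2 R c p q f 2 0) :=
    h10.comp_x (hasWeakDeriv_rep1_x (hp 0) (memLp_primitive_y _ (hq 1)) (memLp_repx (hp 1) hf))
  have h02 : HasWeakDeriv R 0 2 (rep2 R c p q f 0 0) (rep2 R c p q f 0 2) :=
    h01.comp_y (hasWeakDeriv_rep1_y (memLp_primitive_x _ (hp 1)) (hq 0) (memLp_repy (hq 1) hf))
  have h21 : HasWeakDeriv R 2 1 (rep2 R c p q f 0 0) (rep2 R c p q f 2 1) :=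
    h20.comp_y (hasWeakDeriv_repx (hp 0) (memLp_repx (hp 1) hf))
  have h12 : HasWeakDeriv R 1 2 (rep2 R c p q f 0 0) (rep2 R c p q f 1 2) :=
    h02.comp_x (hasWeakDeriv_repy (hq 0) (memLp_repy (hq 1) hf))
  have h22 : HasWeakDeriv R 2 2 (rep2 R c p q f 0 0) (rep2 R c p q f 2 2) :=
    h21.comp_y (hasWeakDeriv_repx (hp 1) hf)
  have h11 : HasWeakDeriv R 1 1 (rep2 R c p q f 0 0) (rep2 R c p q f 1 1) :=
    h10.comp_y ((hasWeakDeriv_rep1_y (hp 0) (memLp_primitive_y _ (hq 1))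
      (memLp_repx (hp 1) hf)).congr .rfl (ae_of_dom fun z hz => rep2_dom_y hp hf hz))
  interval_cases i <;> interval_cases j <;> assumption

/-- `exists_rep1` is applied to the derivatives of orders `(1,1)`, `(1,0)`, `(0,1)` and `(0,0)`.
This gives too many edge functions; the uniqueness lemmas express the redundant ones as primitives
of the others, and what remains are four corner values and two functions on each of two edges. -/
theorem exists_rep2 {u : ℝ × ℝ → ℝ} {v : ℕ → ℕ → ℝ × ℝ → ℝ} (hu : MemLp u 2 R.mu)
    (hv : ∀ i j, i ≤ 2 → j ≤ 2 → HasWeakDeriv R i j u (v i j)) :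
    ∃ c p q, (∀ m, MemLp (p m) 2 R.mux) ∧ (∀ m, MemLp (q m) 2 R.muy) ∧
      u =ᵐ[R.mu] rep2 R c p q (v 2 2) 0 0 := by
  have hx : ∀ i j, i ≤ 1 → j ≤ 2 → HasWeakDeriv R 1 0 (v i j) (v (i + 1) j) := fun i j hi hj =>
    (hv i j (by omega) hj).decomp_x (hv (i + 1) j (by omega) hj)
  have hy : ∀ i j, i ≤ 2 → j ≤ 1 → HasWeakDeriv R 0 1 (v i j) (v i (j + 1)) := fun i j hi hj =>
    (hv i j hi (by omega)).decomp_y (hv i (j + 1) hi (by omega))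
  have hm : ∀ i j, i ≤ 2 → j ≤ 2 → MemLp (v i j) 2 R.mu := fun i j hi hj => (hv i j hi hj).1
  obtain ⟨c3, p1, q1, hp1, hq1, e11, e21, e12⟩ := exists_rep1 (hm 1 1 (by simp) (by simp))
    (hx 1 1 le_rfl (by simp)) (hy 1 1 (by simp) le_rfl) (hy 2 1 le_rfl le_rfl) (hx 1 2 le_rfl le_rfl)
  obtain ⟨c1, p0, q', hp0, hq', e10, e20, e11y⟩ := exists_rep1 (hm 1 0 (by simp) (by simp))
    (hx 1 0 le_rfl (by simp)) (hy 1 0 (by simp) (by simp)) (hy 2 0 le_rfl (by simp))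
    (hx 1 1 le_rfl (by simp))
  obtain ⟨c2, p', q0, hp', hq0, e01, e11x, e02⟩ := exists_rep1 (hm 0 1 (by simp) (by simp))
    (hx 0 1 (by simp) (by simp)) (hy 0 1 (by simp) le_rfl) (hy 1 1 (by simp) le_rfl)
    (hx 0 2 (by simp) le_rfl)
  obtain ⟨c0, p'', q'', hp'', hq'', e00, e10x, e01y⟩ := exists_rep1 hu
    (hv 1 0 (by simp) (by simp)) (hv 0 1 (by simp) (by simp)) (hy 1 0 (by simp) (by simp))
    (hx 0 1 (by simp) (by simp))
  have hf : MemLp (v 2 2) 2 R.mu := hm 2 2 le_rfl le_rfl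
  have hP : ∀ m, MemLp ((![p0, p1] : Fin 2 → ℝ → ℝ) m) 2 R.mux := by
    intro m; fin_cases m <;> assumption
  have hQ : ∀ m, MemLp ((![q0, q1] : Fin 2 → ℝ → ℝ) m) 2 R.muy := by
    intro m; fin_cases m <;> assumption
  refine ⟨![c0, c1, c2, c3], ![p0, p1], ![q0, q1], hP, hQ, ?_⟩
  have f1 := repy_edge_unique hp1 hf e11 e11y e21
  have f2 := repx_edge_unique hq1 hf e11 e11x e12
  have e10' : v 1 0 =ᵐ[R.mu] rep1 R c1 p0 (fun y => c3 + ∫ t in R.c..y, q1 t)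
      (repx R p1 (v 2 2)) :=
    e10.trans (ae_of_dom fun z hz => rep1_congr (hm 2 1 le_rfl (by simp)) .rfl f1 e21 hz)
  have e01' : v 0 1 =ᵐ[R.mu] rep1 R c2 (fun x => c3 + ∫ t in R.a..x, p1 t) q0
      (repy R q1 (v 2 2)) :=
    e01.trans (ae_of_dom fun z hz => rep1_congr (hm 1 2 (by simp) le_rfl) f2 .rfl e12 hz)
  have f3 := repx_edge_unique (memLp_primitive_y c3 hq1) (memLp_repx hp1 hf) e10' e10x
    (e11.trans (ae_of_dom fun z hz => rep1_eq_x hp1 hf hz))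
  have f4 := repy_edge_unique (memLp_primitive_x c3 hp1) (memLp_repy hq1 hf) e01' e01y
    (e11.trans (ae_of_dom fun z hz => rep1_eq_y hq1 hf hz))
  exact e00.trans (ae_of_dom fun z hz => rep1_congr (hm 1 1 (by simp) (by simp)) f3 f4 e11 hz)

/-! ### Explicit formulas -/

theorem integral_primitive {s t x k : ℝ} (hx : x ∈ Icc s t) {g : ℝ → ℝ}
    (hg : MemLp g 2 (muI s t)) :
    ∫ η in s..x, (k + ∫ θ in s..η, g θ) = (x - s) * k + ∫ θ in s..x, (x - θ) * g θ := by
  have hg' : MemLp g 2 (muI s x) :=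
    hg.mono_measure (Measure.restrict_mono (Icc_subset_Icc_right hx.2) le_rfl)
  rw [← antideriv_antideriv hx.1 hg', intervalIntegral.integral_add]
  · simp
  · exact intervalIntegrable_const
  · exact intervalIntegrable_of_memLp ⟨hx.1, le_rfl⟩ (memLp_antideriv hg')

theorem memLp_weighted_y {f : ℝ × ℝ → ℝ} (hf : MemLp f 2 R.mu) {g : ℝ → ℝ} (hg : Continuous g)
    {y : ℝ} (hy : y ∈ Icc R.c R.d) :
    MemLp (fun s => ∫ ν in R.c..y, g ν * f (s, ν)) 2 R.mux := by
  have hb : MemLp (fun ν => if ν ≤ y then g ν else 0) 2 R.muy := by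
    obtain ⟨C, hC⟩ := isCompact_Icc.exists_bound_of_continuousOn (s := Icc R.c R.d) hg.continuousOn
    refine MemLp.of_bound (C := C) ?_ ?_
    · exact (Measurable.ite measurableSet_Iic hg.measurable measurable_const).aestronglyMeasurable
    · filter_upwards [R.muy_ae_mem] with ν hν
      split_ifs
      · exact hC ν hν
      · simpa using (norm_nonneg _).trans (hC ν hν)
  refine (memLp_integral_mul (β := ℝ) hf hb).ae_eq (ae_of_all _ fun s => ?_)
  simp only
  rw [intervalIntegral_eq_indicator hy]
  refine integral_congr_ae (ae_of_all _ fun ν => ?_)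
  simp only [ite_mul, zero_mul, mul_comm (f _)]

/-- Only `x` is subject to an exceptional set, and `y` is arbitrary. An identity almost everywhere
on the rectangle would say nothing about the edges `y = c` and `y = d`. -/
theorem rep2_20_eq (hf : MemLp f 2 R.mu) {y : ℝ} (hy : y ∈ Icc R.c R.d) : ∀ᵐ x ∂ R.mux,
    rep2 R c p q f 2 0 (x, y) =
      p 0 x + (y - R.c) * p 1 x + ∫ ν in R.c..y, (y - ν) * f (x, ν) := by
  filter_upwards [memLp_two_fiber hf] with x hx
  have := integral_primitive (k := p 1 x) hy (g := fun ν => f (x, ν)) hx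
  change p 0 x + ∫ t in R.c..y, (p 1 x + ∫ ν in R.c..t, f (x, ν)) = _
  rw [this]; ring

theorem rep2_02_eq (hf : MemLp f 2 R.mu) {x : ℝ} (hx : x ∈ Icc R.a R.b) : ∀ᵐ y ∂ R.muy,
    rep2 R c p q f 0 2 (x, y) =
      q 0 y + (x - R.a) * q 1 y + ∫ θ in R.a..x, (x - θ) * f (θ, y) := by
  filter_upwards [memLp_two_fiber (memLp_two_swap hf)] with y hy
  have := integral_primitive (k := q 1 y) hx (g := fun θ => f (θ, y)) hy
  change q 0 y + ∫ t in R.a..x, (q 1 y + ∫ ν in R.a..t, f (ν, y)) = _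
  rw [this]; ring

theorem rep2_10_primitive (hp : ∀ m, MemLp (p m) 2 R.mux) (hq : ∀ m, MemLp (q m) 2 R.muy)
    (hf : MemLp f 2 R.mu) {x y : ℝ} (hx : x ∈ Icc R.a R.b) (hy : y ∈ Icc R.c R.d) :
    rep2 R c p q f 1 0 (x, y) =
      (c 1 + (y - R.c) * c 3 + ∫ ν in R.c..y, (y - ν) * q 1 ν) +
        ∫ θ in R.a..x, (p 0 θ + (y - R.c) * p 1 θ + ∫ ν in R.c..y, (y - ν) * f (θ, ν)) := by
  change rep1 R (c 1) (p 0) (fun y => c 3 + ∫ t in R.c..y, q 1 t) (repx R (p 1) f) (x, y) = _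
  have h := intervalIntegral_congr_muI (rep2_20_eq (c := c) (p := p) (q := q) hf hy) hx
  rw [rep1_eq_x (hp 0) (memLp_repx (hp 1) hf) ⟨hx, hy⟩, integral_primitive hy (hq 1), ← h]
  simp only [Jx, rep2]
  ring

theorem rep2_10_eq (hp : ∀ m, MemLp (p m) 2 R.mux) (hq : ∀ m, MemLp (q m) 2 R.muy)
    (hf : MemLp f 2 R.mu) {x y : ℝ} (hx : x ∈ Icc R.a R.b) (hy : y ∈ Icc R.c R.d) :
    rep2 R c p q f 1 0 (x, y) = c 1 + (y - R.c) * c 3 +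
      (∫ θ in R.a..x, (p 0 θ + (y - R.c) * p 1 θ)) + (∫ ν in R.c..y, (y - ν) * q 1 ν) +
        ∫ θ in R.a..x, ∫ ν in R.c..y, (y - ν) * f (θ, ν) := by
  rw [rep2_10_primitive hp hq hf hx hy, intervalIntegral.integral_add]
  · ring
  · exact (intervalIntegrable_of_memLp hx (hp 0)).add
      ((intervalIntegrable_of_memLp hx (hp 1)).const_mul _)
  · exact intervalIntegrable_of_memLp hx (memLp_weighted_y hf (by fun_prop) hy)

theorem intervalIntegrable_weight {s t x : ℝ} (hx : x ∈ Icc s t) {g : ℝ → ℝ}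
    (hg : MemLp g 2 (muI s t)) {w : ℝ → ℝ} (hw : Continuous w) :
    IntervalIntegrable (fun θ => w θ * g θ) volume s x :=
  (intervalIntegrable_of_memLp hx hg).continuousOn_mul hw.continuousOn

theorem rep2_01_eq (hp : ∀ m, MemLp (p m) 2 R.mux) (hq : ∀ m, MemLp (q m) 2 R.muy)
    (hf : MemLp f 2 R.mu) {x y : ℝ} (hx : x ∈ Icc R.a R.b) (hy : y ∈ Icc R.c R.d) :
    rep2 R c p q f 0 1 (x, y) = c 2 + (x - R.a) * c 3 +
      (∫ θ in R.a..x, (x - θ) * p 1 θ) + (∫ ν in R.c..y, (q 0 ν + (x - R.a) * q 1 ν)) +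
        ∫ θ in R.a..x, ∫ ν in R.c..y, (x - θ) * f (θ, ν) := by
  have hW : MemLp (fun θ => ∫ ν in R.c..y, f (θ, ν)) 2 R.mux := by
    simpa using memLp_weighted_y hf (g := fun _ => 1) continuous_const hy
  have hS : MemLp (fun θ => p 1 θ + ∫ ν in R.c..y, f (θ, ν)) 2 R.mux := (hp 1).add hW
  have e : ∀ s ∈ uIcc R.a x, repx R (fun x => c 3 + ∫ t in R.a..x, p 1 t) (repy R (q 1) f) (s, y) =
      (c 3 + ∫ t in R.c..y, q 1 t) + ∫ θ in R.a..s, (p 1 θ + ∫ ν in R.c..y, f (θ, ν)) := by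
    intro s hs
    rw [uIcc_of_le hx.1] at hs
    have hs' : (s, y) ∈ R.dom := ⟨⟨hs.1, hs.2.trans hx.2⟩, hy⟩
    rw [rep2_dom_x hq hf hs', rep1_eq_x (hp 1) hf hs']
    rfl
  change rep1 R (c 2) (fun x => c 3 + ∫ s in R.a..x, p 1 s) (q 0) (repy R (q 1) f) (x, y) = _
  rw [rep1_eq_x (memLp_primitive_x _ (hp 1)) (memLp_repy (hq 1) hf) ⟨hx, hy⟩, Jx,
    intervalIntegral.integral_congr e, integral_primitive hx hS,
    intervalIntegral.integral_add (intervalIntegrable_of_memLp hy (hq 0))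
      ((intervalIntegrable_of_memLp hy (hq 1)).const_mul _), intervalIntegral.integral_const_mul]
  simp only [mul_add, intervalIntegral.integral_const_mul]
  rw [intervalIntegral.integral_add (intervalIntegrable_weight hx (hp 1) (by fun_prop))
    (intervalIntegrable_weight hx hW (by fun_prop))]
  ring

/-- Taylor's formula of second order in each variable, obtained by integrating the formula for the
`x`-derivative once more. Its coefficients are the last rows of `K30`, `K31`, `K32` and `K33`. -/
theorem rep2_00_eq (hp : ∀ m, MemLp (p m) 2 R.mux) (hq : ∀ m, MemLp (q m) 2 R.muy)
    (hf : MemLp f 2 R.mu) {x y : ℝ} (hx : x ∈ Icc R.a R.b) (hy : y ∈ Icc R.c R.d) :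
    rep2 R c p q f 0 0 (x, y) =
      c 0 + (x - R.a) * c 1 + (y - R.c) * c 2 + (y - R.c) * (x - R.a) * c 3 +
      (∫ θ in R.a..x, ((x - θ) * p 0 θ + (y - R.c) * (x - θ) * p 1 θ)) +
      (∫ ν in R.c..y, ((y - ν) * q 0 ν + (x - R.a) * (y - ν) * q 1 ν)) +
        ∫ θ in R.a..x, ∫ ν in R.c..y, (x - θ) * (y - ν) * f (θ, ν) := by
  have hW : MemLp (fun θ => ∫ ν in R.c..y, (y - ν) * f (θ, ν)) 2 R.mux :=
    memLp_weighted_y hf (by fun_prop) hy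
  have hP : MemLp (fun θ => p 0 θ + (y - R.c) * p 1 θ) 2 R.mux := (hp 0).add ((hp 1).const_mul _)
  have hS : MemLp (fun θ => p 0 θ + (y - R.c) * p 1 θ + ∫ ν in R.c..y, (y - ν) * f (θ, ν)) 2
      R.mux := hP.add hW
  have e : ∀ s ∈ uIcc R.a x,
      repx R (fun x => c 1 + ∫ s in R.a..x, p 0 s) (rep1 R (c 3) (p 1) (q 1) f) (s, y) =
      (c 1 + (y - R.c) * c 3 + ∫ ν in R.c..y, (y - ν) * q 1 ν) +
        ∫ θ in R.a..s, (p 0 θ + (y - R.c) * p 1 θ + ∫ ν in R.c..y, (y - ν) * f (θ, ν)) := by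
    intro s hs
    rw [uIcc_of_le hx.1] at hs
    have hs' : s ∈ Icc R.a R.b := ⟨hs.1, hs.2.trans hx.2⟩
    rw [rep2_dom_10 hp hq hf ⟨hs', hy⟩, rep2_10_primitive hp hq hf hs' hy]
  change rep1 R (c 0) (fun x => c 1 + ∫ s in R.a..x, p 0 s)
    (fun y => c 2 + ∫ t in R.c..y, q 0 t) (rep1 R (c 3) (p 1) (q 1) f) (x, y) = _
  rw [rep1_eq_x (memLp_primitive_x _ (hp 0)) (memLp_rep1 (hp 1) (hq 1) hf) ⟨hx, hy⟩, Jx,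
    intervalIntegral.integral_congr e, integral_primitive hx hS,
    integral_primitive hy (hq 0)]
  have e1 : ∫ θ in R.a..x, (x - θ) * (p 0 θ + (y - R.c) * p 1 θ + ∫ ν in R.c..y, (y - ν) * f (θ, ν))
      = (∫ θ in R.a..x, (x - θ) * (p 0 θ + (y - R.c) * p 1 θ)) +
        ∫ θ in R.a..x, (x - θ) * ∫ ν in R.c..y, (y - ν) * f (θ, ν) := by
    rw [← intervalIntegral.integral_add (intervalIntegrable_weight hx hP (by fun_prop))
      (intervalIntegrable_weight hx hW (by fun_prop))]
    exact intervalIntegral.integral_congr fun θ _ => mul_add _ _ _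
  have e2 : ∫ ν in R.c..y, ((y - ν) * q 0 ν + (x - R.a) * (y - ν) * q 1 ν) =
      (∫ ν in R.c..y, (y - ν) * q 0 ν) + (x - R.a) * ∫ ν in R.c..y, (y - ν) * q 1 ν := by
    rw [← intervalIntegral.integral_const_mul,
      ← intervalIntegral.integral_add (intervalIntegrable_weight hy (hq 0) (by fun_prop))
      ((intervalIntegrable_weight hy (hq 1) (by fun_prop)).const_mul _)]
    exact intervalIntegral.integral_congr fun θ _ => by ring
  have e3 : ∫ θ in R.a..x, ((x - θ) * p 0 θ + (y - R.c) * (x - θ) * p 1 θ) =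
      ∫ θ in R.a..x, (x - θ) * (p 0 θ + (y - R.c) * p 1 θ) :=
    intervalIntegral.integral_congr fun θ _ => by ring
  have e4 : ∫ θ in R.a..x, ∫ ν in R.c..y, (x - θ) * (y - ν) * f (θ, ν) =
      ∫ θ in R.a..x, (x - θ) * ∫ ν in R.c..y, (y - ν) * f (θ, ν) :=
    intervalIntegral.integral_congr fun θ _ => by
      simp only [mul_assoc, intervalIntegral.integral_const_mul]
  rw [e1, e2, e3, e4]
  ring

end rep2

/-! ## Products with the block matrices -/

section blocks

variable {k r s n0 n1 n2 : ℕ}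

@[simp]
theorem stateCore_mulVec_inl (p : ℝ) (q : Fin r → ℝ) (v : Core r n1 n2 → ℝ) (i : Fin n0) :
    ((stateCore p q : Matrix (State n0 n1 n2) _ ℝ) *ᵥ v) (Sum.inl i) = 0 := by
  simp [Matrix.mulVec, dotProduct, stateCore]

@[simp]
theorem stateCore_mulVec_one (p : ℝ) (q : Fin r → ℝ) (v : Core r n1 n2 → ℝ) (i : Fin n1) :
    ((stateCore p q : Matrix (State n0 n1 n2) _ ℝ) *ᵥ v) (Sum.inr (Sum.inl i)) =
      p * v (Sum.inl i) := by
  simp [Matrix.mulVec, dotProduct, stateCore]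

@[simp]
theorem stateCore_mulVec_two (p : ℝ) (q : Fin r → ℝ) (v : Core r n1 n2 → ℝ) (i : Fin n2) :
    ((stateCore p q : Matrix (State n0 n1 n2) _ ℝ) *ᵥ v) (Sum.inr (Sum.inr i)) =
      ∑ m, q m * v (Sum.inr (m, i)) := by
  simp [Matrix.mulVec, dotProduct, stateCore, Fintype.sum_prod_type]

@[simp]
theorem fullCore_mulVec_inl (p : Fin k → ℝ) (q : Matrix (Fin r) (Fin s) ℝ) (v : Core s n1 n2 → ℝ)
    (l : Fin k) (i : Fin n1) : (fullCore p q *ᵥ v) (Sum.inl (l, i)) = p l * v (Sum.inl i) := by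
  simp [Matrix.mulVec, dotProduct, fullCore]

@[simp]
theorem fullCore_mulVec_inr (p : Fin k → ℝ) (q : Matrix (Fin r) (Fin s) ℝ) (v : Core s n1 n2 → ℝ)
    (l : Fin r) (i : Fin n2) :
    (fullCore p q *ᵥ v) (Sum.inr (l, i)) = ∑ m, q l m * v (Sum.inr (m, i)) := by
  simp [Matrix.mulVec, dotProduct, fullCore, Fintype.sum_prod_type]

@[simp]
theorem fullState_mulVec_inl (p : Fin k → ℝ) (q : Fin r → ℝ) (v : State n0 n1 n2 → ℝ)
    (l : Fin k) (i : Fin n1) :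
    (fullState p q *ᵥ v) (Sum.inl (l, i)) = p l * v (Sum.inr (Sum.inl i)) := by
  simp [Matrix.mulVec, dotProduct, fullState]

@[simp]
theorem fullState_mulVec_inr (p : Fin k → ℝ) (q : Fin r → ℝ) (v : State n0 n1 n2 → ℝ)
    (l : Fin r) (i : Fin n2) :
    (fullState p q *ᵥ v) (Sum.inr (l, i)) = q l * v (Sum.inr (Sum.inr i)) := by
  simp [Matrix.mulVec, dotProduct, fullState]

theorem continuous_fullCore {α : Type*} [TopologicalSpace α] {p : α → Fin k → ℝ}
    {q : α → Matrix (Fin r) (Fin s) ℝ} (hp : ∀ l, Continuous fun x => p x l)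
    (hq : ∀ l m, Continuous fun x => q x l m) (i : Full k r n1 n2) (j : Core s n1 n2) :
    Continuous fun x => fullCore (p x) (q x) i j := by
  rcases i with ⟨l, i⟩ | ⟨l, i⟩ <;> rcases j with j | ⟨m, j⟩ <;>
    simp only [fullCore, Matrix.of_apply] <;> (try split_ifs) <;>
    first | exact continuous_const | exact hp _ | exact hq _ _

theorem continuous_fullState {α : Type*} [TopologicalSpace α] {p : α → Fin k → ℝ}
    {q : α → Fin r → ℝ} (hp : ∀ l, Continuous fun x => p x l)
    (hq : ∀ l, Continuous fun x => q x l) (i : Full k r n1 n2) (j : State n0 n1 n2) :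
    Continuous fun x => fullState (p x) (q x) i j := by
  rcases i with ⟨l, i⟩ | ⟨l, i⟩ <;> rcases j with j | j | j <;>
    simp only [fullState, Matrix.of_apply] <;> (try split_ifs) <;>
    first | exact continuous_const | exact hp _ | exact hq _

theorem continuous_stateCore {α : Type*} [TopologicalSpace α] {p : α → ℝ}
    {q : α → Fin r → ℝ} (hp : Continuous p)
    (hq : ∀ l, Continuous fun x => q x l) (i : State n0 n1 n2) (j : Core r n1 n2) :
    Continuous fun x => stateCore (p x) (q x) i j := by
  rcases i with i | i | i <;> rcases j with j | ⟨m, j⟩ <;>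
    simp only [stateCore, Matrix.of_apply] <;> (try split_ifs) <;>
    first | exact continuous_const | exact hp | exact hq _

end blocks

theorem matLinf_muI {ι κ : Type*} {s t : ℝ} {M : ℝ → Matrix ι κ ℝ}
    (h : ∀ i j, Continuous fun x => M x i j) : MatLinf (muI s t) M := fun i j => by
  obtain ⟨C, hC⟩ := isCompact_Icc.exists_bound_of_continuousOn (s := Icc s t) (h i j).continuousOn
  exact memLp_top_of_bound (h i j).aestronglyMeasurable C ((muI_ae_mem s t).mono hC)

theorem matLinf_of_continuous {α ι κ : Type*} [TopologicalSpace α] [MeasurableSpace α]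
    [OpensMeasurableSpace α] [SecondCountableTopology α] {μ : Measure α} {S : Set α}
    (hS : IsCompact S) (hμ : ∀ᵐ x ∂μ, x ∈ S) {M : α → Matrix ι κ ℝ}
    (h : ∀ i j, Continuous fun x => M x i j) : MatLinf μ M := fun i j => by
  obtain ⟨C, hC⟩ := hS.exists_bound_of_continuousOn (h i j).continuousOn
  exact memLp_top_of_bound (h i j).aestronglyMeasurable C (hμ.mono hC)

theorem Rect.isCompact_dom (R : Rect) : IsCompact R.dom := isCompact_Icc.prod isCompact_Icc

section Hcont

variable (R : Rect) {n0 n1 n2 : ℕ}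

theorem matLinf_H01 : MatLinf R.mux (H01 R : ℝ → Matrix (Full 4 16 n1 n2) _ ℝ) := by
  refine matLinf_muI (continuous_fullCore (fun l => continuous_const) fun l m => ?_)
  fin_cases l <;> fin_cases m <;> simp <;> fun_prop

theorem matLinf_H02 : MatLinf R.muy (H02 R : ℝ → Matrix (Full 4 16 n1 n2) _ ℝ) := by
  refine matLinf_muI (continuous_fullCore (fun l => continuous_const) fun l m => ?_)
  fin_cases l <;> fin_cases m <;> simp <;> fun_prop

theorem matLinf_H13 : MatLinf R.muy (H13 R : ℝ → Matrix (Full 2 4 n1 n2) (State n0 n1 n2) ℝ) := by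
  refine matLinf_muI (continuous_fullState (fun l => continuous_const) fun l => ?_)
  fin_cases l <;> simp <;> fun_prop

theorem matLinf_H23 : MatLinf R.mux (H23 R : ℝ → Matrix (Full 2 4 n1 n2) (State n0 n1 n2) ℝ) := by
  refine matLinf_muI (continuous_fullState (fun l => continuous_const) fun l => ?_)
  fin_cases l <;> simp <;> fun_prop

theorem matLinf_H03 : MatLinf R.mu fun p =>
    (H03 R p.1 p.2 : Matrix (Full 4 16 n1 n2) (State n0 n1 n2) ℝ) := by
  refine matLinf_of_continuous R.isCompact_dom R.mu_ae_mem
    (continuous_fullState (fun l => continuous_const) fun l => ?_)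
  fin_cases l <;> simp <;> fun_prop

end Hcont

/-! ## Uniqueness of boundary values -/

/-- Two continuous representatives agree almost everywhere, hence everywhere, because the closed
rectangle is the closure of its interior. -/
theorem PointVal.unique {R : Rect} {i j : ℕ} {u : ℝ × ℝ → ℝ} {z : ℝ × ℝ} {s t : ℝ}
    (hz : z ∈ R.dom) (h : PointVal R i j u z s) (h' : PointVal R i j u z t) : s = t := by
  obtain ⟨w, hw, hc, rfl⟩ := h
  obtain ⟨w', hw', hc', rfl⟩ := h'
  have e := hw.ae_unique hw'
  rw [R.mu_eq] at e
  refine Measure.eqOn_of_ae_eq e hc hc' ?_ hz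
  rw [Rect.dom, interior_prod_eq, closure_prod_eq, interior_Icc, interior_Icc,
    closure_Ioo R.hab.ne, closure_Ioo R.hcd.ne]

/-- Two representatives agree at almost every point of almost every vertical segment. Continuity
along the segment extends this to its end points. -/
theorem EdgeValX.unique {R : Rect} {i j : ℕ} {u : ℝ × ℝ → ℝ} {y : ℝ} {g g' : ℝ → ℝ}
    (hy : y ∈ Icc R.c R.d) (h : EdgeValX R i j u y g) (h' : EdgeValX R i j u y g') :
    g =ᵐ[R.mux] g' := by
  obtain ⟨w, hw, hc⟩ := h
  obtain ⟨w', hw', hc'⟩ := h'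
  filter_upwards [ae_ae_x (hw.ae_unique hw'), hc, hc'] with x h1 h2 h3
  rw [← h2.2, ← h3.2]
  exact Measure.eqOn_Icc_of_ae_eq volume R.hcd.ne h1 h2.1 h3.1 hy

theorem EdgeValY.unique {R : Rect} {i j : ℕ} {u : ℝ × ℝ → ℝ} {x : ℝ} {g g' : ℝ → ℝ}
    (hx : x ∈ Icc R.a R.b) (h : EdgeValY R i j u x g) (h' : EdgeValY R i j u x g') :
    g =ᵐ[R.muy] g' := by
  obtain ⟨w, hw, hc⟩ := h
  obtain ⟨w', hw', hc'⟩ := h'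
  filter_upwards [ae_ae_y (hw.ae_unique hw'), hc, hc'] with x h1 h2 h3
  rw [← h2.2, ← h3.2]
  exact Measure.eqOn_Icc_of_ae_eq volume R.hab.ne h1 h2.1 h3.1 hx

theorem Rect.corner_mem (R : Rect) (l : Fin 4) : R.corner l ∈ R.dom := by
  have h1 := R.hab.le
  have h2 := R.hcd.le
  fin_cases l <;> simp [Rect.corner, Rect.dom, h1, h2]

theorem Rect.edge_mem_y (R : Rect) (l : Fin 2) : (![R.c, R.d] l) ∈ Icc R.c R.d := by
  have h2 := R.hcd.le
  fin_cases l <;> simp [h2]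

theorem Rect.edge_mem_x (R : Rect) (l : Fin 2) : (![R.a, R.b] l) ∈ Icc R.a R.b := by
  have h2 := R.hab.le
  fin_cases l <;> simp [h2]

theorem ae_eq_pi {κ : Type*} [Finite κ] {μ : Measure ℝ} {f g : ℝ → κ → ℝ}
    (h : ∀ i, (fun x => f x i) =ᵐ[μ] fun x => g x i) : f =ᵐ[μ] g := by
  filter_upwards [ae_all_iff.2 h] with x hx using funext hx

/-- The boundary values `β` in `MemX` are only asserted to exist; by uniqueness they can be replaced
by those computed from the core data. -/
theorem IsBoundary.unique {R : Rect} {n0 n1 n2 : ℕ} {u : ℝ × ℝ → State n0 n1 n2 → ℝ}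
    {β β' : RL (Full 4 16 n1 n2) (Full 2 4 n1 n2)} (h : IsBoundary R u β)
    (h' : IsBoundary R u β') : EqRL R β β' := by
  refine ⟨funext fun j => ?_, ae_eq_pi fun j => ?_, ae_eq_pi fun j => ?_⟩
  · rcases j with ⟨l, i⟩ | ⟨k, i⟩
    · exact (h.corner1 l i).unique (R.corner_mem l) (h'.corner1 l i)
    · obtain ⟨⟨m, l⟩, rfl⟩ := (finProdFinEquiv (m := 4) (n := 4)).surjective k
      exact (h.corner2 m l i).unique (R.corner_mem l) (h'.corner2 m l i)
  · rcases j with ⟨l, i⟩ | ⟨k, i⟩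
    · exact (h.xEdge1 l i).unique (R.edge_mem_y l) (h'.xEdge1 l i)
    · obtain ⟨⟨m, l⟩, rfl⟩ := (finProdFinEquiv (m := 2) (n := 2)).surjective k
      exact (h.xEdge2 m l i).unique (R.edge_mem_y l) (h'.xEdge2 m l i)
  · rcases j with ⟨l, i⟩ | ⟨k, i⟩
    · exact (h.yEdge1 l i).unique (R.edge_mem_x l) (h'.yEdge1 l i)
    · obtain ⟨⟨m, l⟩, rfl⟩ := (finProdFinEquiv (m := 2) (n := 2)).surjective k
      exact (h.yEdge2 m l i).unique (R.edge_mem_x l) (h'.yEdge2 m l i)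

theorem PointVal.congr {R : Rect} {i j : ℕ} {u u' : ℝ × ℝ → ℝ} {z : ℝ × ℝ} {s : ℝ}
    (h : PointVal R i j u z s) (e : u =ᵐ[R.mu] u') : PointVal R i j u' z s :=
  h.imp fun _ hw => ⟨hw.1.congr e .rfl, hw.2⟩

theorem EdgeValX.congr {R : Rect} {i j : ℕ} {u u' : ℝ × ℝ → ℝ} {y : ℝ} {g : ℝ → ℝ}
    (h : EdgeValX R i j u y g) (e : u =ᵐ[R.mu] u') : EdgeValX R i j u' y g :=
  h.imp fun _ hw => ⟨hw.1.congr e .rfl, hw.2⟩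

theorem EdgeValY.congr {R : Rect} {i j : ℕ} {u u' : ℝ × ℝ → ℝ} {y : ℝ} {g : ℝ → ℝ}
    (h : EdgeValY R i j u y g) (e : u =ᵐ[R.mu] u') : EdgeValY R i j u' y g :=
  h.imp fun _ hw => ⟨hw.1.congr e .rfl, hw.2⟩

theorem comp1_ae {R : Rect} {n0 n1 n2 : ℕ} {u u' : ℝ × ℝ → State n0 n1 n2 → ℝ}
    (e : u =ᵐ[R.mu] u') (i : Fin n1) : comp1 u i =ᵐ[R.mu] comp1 u' i :=
  e.mono fun p hp => by simp only [comp1, hp]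

theorem comp2_ae {R : Rect} {n0 n1 n2 : ℕ} {u u' : ℝ × ℝ → State n0 n1 n2 → ℝ}
    (e : u =ᵐ[R.mu] u') (i : Fin n2) : comp2 u i =ᵐ[R.mu] comp2 u' i :=
  e.mono fun p hp => by simp only [comp2, hp]

theorem IsBoundary.congr {R : Rect} {n0 n1 n2 : ℕ} {u u' : ℝ × ℝ → State n0 n1 n2 → ℝ}
    {β : RL (Full 4 16 n1 n2) (Full 2 4 n1 n2)} (h : IsBoundary R u β) (e : u =ᵐ[R.mu] u') :
    IsBoundary R u' β where
  mem := h.mem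
  corner1 l i := (h.corner1 l i).congr (comp1_ae e i)
  corner2 m l i := (h.corner2 m l i).congr (comp2_ae e i)
  xEdge1 l i := (h.xEdge1 l i).congr (comp1_ae e i)
  xEdge2 m l i := (h.xEdge2 m l i).congr (comp2_ae e i)
  yEdge1 l i := (h.yEdge1 l i).congr (comp1_ae e i)
  yEdge2 m l i := (h.yEdge2 m l i).congr (comp2_ae e i)

/-! ## The state with prescribed core boundary values and fundamental state -/

/-- The state with core boundary values `v` and fundamental state `uh`. -/
def stateRep (R : Rect) {n0 n1 n2 : ℕ} (v : RL (Core 4 n1 n2) (Core 2 n1 n2))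
    (uh : ℝ × ℝ → State n0 n1 n2 → ℝ) : ℝ × ℝ → State n0 n1 n2 → ℝ := fun z => fun
  | .inl i => uh z (Sum.inl i)
  | .inr (.inl i) => rep1 R (v.1 (Sum.inl i)) (fun x => v.2.1 x (Sum.inl i))
      (fun y => v.2.2 y (Sum.inl i)) (comp1 uh i) z
  | .inr (.inr i) => rep2 R (fun m => v.1 (Sum.inr (m, i))) (fun m x => v.2.1 x (Sum.inr (m, i)))
      (fun m y => v.2.2 y (Sum.inr (m, i))) (comp2 uh i) 0 0 z

section stateRep

variable {R : Rect} {n0 n1 n2 : ℕ} {v : RL (Core 4 n1 n2) (Core 2 n1 n2)}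
  {uh : ℝ × ℝ → State n0 n1 n2 → ℝ}

theorem memLp_comp1 (hu : MemL2 R.mu uh) (i : Fin n1) : MemLp (comp1 uh i) 2 R.mu := hu _

theorem memLp_comp2 (hu : MemL2 R.mu uh) (i : Fin n2) : MemLp (comp2 uh i) 2 R.mu := hu _

theorem comp2_stateRep (v : RL (Core 4 n1 n2) (Core 2 n1 n2)) (uh : ℝ × ℝ → State n0 n1 n2 → ℝ)
    (i : Fin n2) : comp2 (stateRep R v uh) i = rep2 R (fun m => v.1 (Sum.inr (m, i)))
      (fun m x => v.2.1 x (Sum.inr (m, i))) (fun m y => v.2.2 y (Sum.inr (m, i)))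
      (comp2 uh i) 0 0 :=
  rfl

theorem isD_stateRep (hv : MemRL R v) (hu : MemL2 R.mu uh) : IsD R (stateRep R v uh) uh :=
  ⟨hu, fun _ => .rfl,
    fun i => (hasWeakDeriv_rep1_x (hv.1 _) (hv.2 _) (memLp_comp1 hu i)).comp_y
      (hasWeakDeriv_repx (hv.1 _) (memLp_comp1 hu i)),
    fun i => hasWeakDeriv_rep2 (c := fun m => v.1 (Sum.inr (m, i)))
      (fun m => hv.1 (Sum.inr (m, i))) (fun m => hv.2 (Sum.inr (m, i))) (memLp_comp2 hu i) le_rfl le_rfl⟩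

theorem memH_rep1 (hv : MemRL R v) (hu : MemL2 R.mu uh) (i : Fin n1) :
    MemH R 1 (comp1 (stateRep R v uh) i) := by
  have hf := memLp_comp1 hu i
  have h1 := memLp_rep1 (c := v.1 (Sum.inl i)) (hv.1 (Sum.inl i)) (hv.2 (Sum.inl i)) hf
  have hx := hasWeakDeriv_rep1_x (c := v.1 (Sum.inl i)) (hv.1 (Sum.inl i)) (hv.2 (Sum.inl i)) hf
  refine ⟨h1, fun k l hk hl => ?_⟩
  interval_cases k <;> interval_cases l
  · exact ⟨_, hasWeakDeriv_zero h1⟩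
  · exact ⟨_, hasWeakDeriv_rep1_y (hv.1 (Sum.inl i)) (hv.2 (Sum.inl i)) hf⟩
  · exact ⟨_, hx⟩
  · exact ⟨_, hx.comp_y (hasWeakDeriv_repx (hv.1 (Sum.inl i)) hf)⟩

theorem memH_rep2 (hv : MemRL R v) (hu : MemL2 R.mu uh) (i : Fin n2) :
    MemH R 2 (comp2 (stateRep R v uh) i) := by
  rw [comp2_stateRep]
  have h0 := fun m => hv.1 (Sum.inr (m, i))
  have h1 := fun m => hv.2 (Sum.inr (m, i))
  have h2 := memLp_comp2 hu i
  generalize comp2 uh i = f at *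
  exact ⟨memLp_rep2 h0 h1 h2, fun _ _ hk hl => ⟨_, hasWeakDeriv_rep2 h0 h1 h2 hk hl⟩⟩

theorem MemH.exists_rep1 {u f : ℝ × ℝ → ℝ} (h : MemH R 1 u) (hD : HasWeakDeriv R 1 1 u f) :
    ∃ c p q, MemLp p 2 R.mux ∧ MemLp q 2 R.muy ∧ u =ᵐ[R.mu] rep1 R c p q f := by
  obtain ⟨ux, hx⟩ := h.2 1 0 le_rfl (by simp)
  obtain ⟨uy, hy⟩ := h.2 0 1 (by simp) le_rfl
  obtain ⟨c, p, q, hp, hq, e, -⟩ := PI2D.exists_rep1 h.1 hx hy (hx.decomp_y hD) (hy.decomp_x hD)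
  exact ⟨c, p, q, hp, hq, e⟩

theorem MemH.exists_rep2 {u f : ℝ × ℝ → ℝ} (h : MemH R 2 u) (hD : HasWeakDeriv R 2 2 u f) :
    ∃ c p q, (∀ m, MemLp (p m) 2 R.mux) ∧ (∀ m, MemLp (q m) 2 R.muy) ∧
      u =ᵐ[R.mu] rep2 R c p q f 0 0 := by
  -- The value `0` outside the range makes the choice of derivatives a total function of the order.
  -- The choice at `(2,2)` is afterwards replaced by the prescribed `f`.
  have : ∀ k l, ∃ w, k ≤ 2 → l ≤ 2 → HasWeakDeriv R k l u w := by
    intro k l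
    by_cases hk : k ≤ 2 <;> by_cases hl : l ≤ 2
    · obtain ⟨w, hw⟩ := h.2 k l hk hl
      exact ⟨w, fun _ _ => hw⟩
    all_goals exact ⟨0, fun _ _ => by contradiction⟩
  choose w hw using this
  obtain ⟨c, p, q, hp, hq, e⟩ := PI2D.exists_rep2 (v := fun k l => if k = 2 ∧ l = 2 then f
    else w k l) h.1 fun k l hk hl => by
      split_ifs with h
      · rw [h.1, h.2]; exact hD
      · exact hw k l hk hl
  exact ⟨c, p, q, hp, hq, by simpa using e⟩

/-- Every state in the Sobolev spaces is determined by core boundary values and its fundamental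
state. -/
theorem exists_stateRep {u : ℝ × ℝ → State n0 n1 n2 → ℝ} (h1 : ∀ i, MemH R 1 (comp1 u i))
    (h2 : ∀ i, MemH R 2 (comp2 u i)) (hD : IsD R u uh) :
    ∃ v, MemRL R v ∧ u =ᵐ[R.mu] stateRep R v uh := by
  choose c1 p1 q1 hp1 hq1 e1 using fun i => (h1 i).exists_rep1 (hD.2.2.1 i)
  choose c2 p2 q2 hp2 hq2 e2 using fun i => (h2 i).exists_rep2 (hD.2.2.2 i)
  let v1 : Core 4 n1 n2 → ℝ
    | .inl i => c1 i
    | .inr (m, i) => c2 i m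
  let v2 : ℝ → Core 2 n1 n2 → ℝ := fun x j => match j with
    | .inl i => p1 i x
    | .inr (m, i) => p2 i m x
  let v3 : ℝ → Core 2 n1 n2 → ℝ := fun x j => match j with
    | .inl i => q1 i x
    | .inr (m, i) => q2 i m x
  refine ⟨(v1, v2, v3), ⟨?_, ?_⟩, ?_⟩
  · rintro (i | ⟨m, i⟩)
    · exact hp1 i
    · exact hp2 i m
  · rintro (i | ⟨m, i⟩)
    · exact hq1 i
    · exact hq2 i m
  · filter_upwards [ae_all_iff.2 hD.2.1, ae_all_iff.2 e1, ae_all_iff.2 e2] with z h0 h1 h2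
    funext j
    rcases j with i | i | i
    · exact (h0 i).symm
    · exact h1 i
    · exact h2 i

end stateRep

/-! ## 011-PI operators with separable diagonal parts -/

section EqRL

variable {R : Rect} {κ₀ κ₁ : Type*} {f g h f' g' : RL κ₀ κ₁}

theorem EqRL.refl (f : RL κ₀ κ₁) : EqRL R f f := ⟨rfl, .rfl, .rfl⟩

theorem EqRL.symm (h : EqRL R f g) : EqRL R g f := ⟨h.1.symm, h.2.1.symm, h.2.2.symm⟩

theorem EqRL.trans (h1 : EqRL R f g) (h2 : EqRL R g h) : EqRL R f h :=
  ⟨h1.1.trans h2.1, h1.2.1.trans h2.2.1, h1.2.2.trans h2.2.2⟩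

theorem EqRL.add (h1 : EqRL R f f') (h2 : EqRL R g g') : EqRL R (f + g) (f' + g') :=
  ⟨by change f.1 + g.1 = f'.1 + g'.1; rw [h1.1, h2.1], h1.2.1.add h2.2.1, h1.2.2.add h2.2.2⟩

theorem EqRL.neg (h1 : EqRL R f f') : EqRL R (-f) (-f') :=
  ⟨by change -f.1 = -f'.1; rw [h1.1], h1.2.1.neg, h1.2.2.neg⟩

theorem MemRL.congr (h : MemRL R f) (e : EqRL R f g) : MemRL R g :=
  ⟨h.1.congr e.2.1, h.2.congr e.2.2⟩

theorem MemRL.add (h : MemRL R f) (h' : MemRL R g) : MemRL R (f + g) :=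
  ⟨MemL2.add h.1 h'.1, MemL2.add h.2 h'.2⟩

theorem MemRL.neg (h : MemRL R f) : MemRL R (-f) := ⟨MemL2.neg h.1, MemL2.neg h.2⟩

end EqRL

section P011

variable {R : Rect} {ι₀ ι₁ κ₀ κ₁ : Type*} [Fintype ι₀] [Fintype ι₁] [Fintype κ₀] [Fintype κ₁]
  {N : N011 ι₀ ι₁ κ₀ κ₁} {g h : RL κ₀ κ₁}

/-- The operator `P011 R N` for `N` with separable diagonal parts. -/
def S011 (R : Rect) (N : N011 ι₀ ι₁ κ₀ κ₁) (g : RL κ₀ κ₁) : RL ι₀ ι₁ :=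
  (N.z00 *ᵥ g.1 + ∫ x, N.z0x x *ᵥ g.2.1 x ∂ R.mux + ∫ y, N.z0y y *ᵥ g.2.2 y ∂ R.muy,
   fun x => N.x0 x *ᵥ g.1 + N.xx.r0 x *ᵥ g.2.1 x + ∫ θ, N.xx.r1 x θ *ᵥ g.2.1 θ ∂ R.mux +
    ∫ y, N.xy x y *ᵥ g.2.2 y ∂ R.muy,
   fun y => N.y0 y *ᵥ g.1 + N.yy.r0 y *ᵥ g.2.2 y + ∫ x, N.yx x y *ᵥ g.2.1 x ∂ R.mux +
    ∫ ν, N.yy.r1 y ν *ᵥ g.2.2 ν ∂ R.muy)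

/-- Equal kernels on both sides of the diagonal merge the two Volterra integrals into one Fredholm
integral. Separability gives equality for almost every pair only, hence for almost every `x` on
almost all of the fibre. -/
theorem P1D_ae {s t : ℝ} {N : N1D ι₁ κ₁} (hN : IsN1D s t N) (hs : N.Separable s t)
    {v : ℝ → κ₁ → ℝ} (hv : MemL2 (muI s t) v) :
    P1D s t N v =ᵐ[muI s t] fun x => N.r0 x *ᵥ v x + ∫ θ, N.r1 x θ *ᵥ v θ ∂muI s t := by
  filter_upwards [muI_ae_mem s t, hN.2.1.fiber, Measure.ae_ae_of_ae_prod hs] with x hx h1 h2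
  have hst : s ≤ t := hx.1.trans hx.2
  have hi : Integrable (fun θ => N.r1 x θ *ᵥ v θ) (muI s t) := h1.mulVec_integrable hv
  have hi' : IntervalIntegrable (fun θ => N.r1 x θ *ᵥ v θ) volume s t := by
    rw [intervalIntegrable_iff_integrableOn_Ioc_of_le hst]
    rwa [muI_eq_Ioc] at hi
  have e : ∫ θ in x..t, N.r2 x θ *ᵥ v θ = ∫ θ in x..t, N.r1 x θ *ᵥ v θ := by
    rw [intervalIntegral.integral_of_le hx.2, intervalIntegral.integral_of_le hx.2]
    refine integral_congr_ae ?_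
    have h3 : ∀ᵐ θ ∂volume.restrict (Ioc x t), N.r1 x θ = N.r2 x θ :=
      ae_mono (Measure.restrict_mono (Ioc_subset_Icc_self.trans (Icc_subset_Icc_left hx.1))
        le_rfl) h2
    filter_upwards [h3] with θ hθ
    rw [hθ]
  rw [P1D, e, add_assoc, intervalIntegral.integral_add_adjacent_intervals,
    intervalIntegral_eq_muI hst]
  · exact hi'.mono_set (by rw [uIcc_of_le hst, uIcc_of_le hx.1]; exact Icc_subset_Icc_right hx.2)
  · exact hi'.mono_set (by rw [uIcc_of_le hst, uIcc_of_le hx.2]; exact Icc_subset_Icc_left hx.1)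

theorem P011_eq (hN : IsN011 R N) (hs : N.Separable R) (hg : MemRL R g) :
    EqRL R (P011 R N g) (S011 R N g) := by
  refine ⟨?_, ?_, ?_⟩
  · simp only [P011, S011, intervalIntegral_eq_muI R.hab.le, intervalIntegral_eq_muI R.hcd.le]; rfl
  · filter_upwards [P1D_ae hN.xx hs.1 hg.1] with x hx
    simp only [P011, S011, intervalIntegral_eq_muI R.hcd.le, hx, ← add_assoc]; rfl
  · filter_upwards [P1D_ae hN.yy hs.2 hg.2] with x hx
    simp only [P011, S011, intervalIntegral_eq_muI R.hab.le, hx]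
    rw [add_assoc, add_assoc, add_assoc, add_left_comm (∫ _, _ ∂_)]; rfl

theorem S011_congr (N : N011 ι₀ ι₁ κ₀ κ₁) (e : EqRL R g h) :
    EqRL R (S011 R N g) (S011 R N h) := by
  have e1 : ∀ (M : ℝ → Matrix ι₁ κ₁ ℝ),
      ∫ x, M x *ᵥ g.2.1 x ∂ R.mux = ∫ x, M x *ᵥ h.2.1 x ∂ R.mux := fun M =>
    integral_congr_ae (e.2.1.mono fun x hx => by simp only [hx])
  have e2 : ∀ (M : ℝ → Matrix ι₁ κ₁ ℝ),
      ∫ x, M x *ᵥ g.2.2 x ∂ R.muy = ∫ x, M x *ᵥ h.2.2 x ∂ R.muy := fun M =>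
    integral_congr_ae (e.2.2.mono fun x hx => by simp only [hx])
  have e3 : ∀ (M : ℝ → Matrix ι₀ κ₁ ℝ),
      ∫ x, M x *ᵥ g.2.1 x ∂ R.mux = ∫ x, M x *ᵥ h.2.1 x ∂ R.mux := fun M =>
    integral_congr_ae (e.2.1.mono fun x hx => by simp only [hx])
  have e4 : ∀ (M : ℝ → Matrix ι₀ κ₁ ℝ),
      ∫ x, M x *ᵥ g.2.2 x ∂ R.muy = ∫ x, M x *ᵥ h.2.2 x ∂ R.muy := fun M =>
    integral_congr_ae (e.2.2.mono fun x hx => by simp only [hx])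
  refine ⟨?_, ?_, ?_⟩
  · simp only [S011, e.1, e3, e4]
  · filter_upwards [e.2.1] with x hx
    simp only [S011, e.1, e1, e2, hx]
  · filter_upwards [e.2.2] with x hx
    simp only [S011, e.1, e1, e2, hx]

theorem memRL_S011 (hN : IsN011 R N) (hg : MemRL R g) : MemRL R (S011 R N g) :=
  ⟨(((hN.x0.mulVec_const g.1).add (hN.xx.1.mulVec hg.1)).add
      (hN.xx.2.1.integral_mulVec hg.1)).add (MatL2.integral_mulVec hN.xy hg.2),
    (((hN.y0.mulVec_const g.1).add (hN.yy.1.mulVec hg.2)).add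
      (MatL2.integral_mulVec (MatL2.swap hN.yx) hg.1)).add (hN.yy.2.1.integral_mulVec hg.2)⟩

theorem memRL_P011 (hN : IsN011 R N) (hs : N.Separable R) (hg : MemRL R g) :
    MemRL R (P011 R N g) :=
  (memRL_S011 hN hg).congr (P011_eq hN hs hg).symm

theorem P011_congr (hN : IsN011 R N) (hs : N.Separable R) (hg : MemRL R g) (e : EqRL R g h) :
    EqRL R (P011 R N g) (P011 R N h) :=
  ((P011_eq hN hs hg).trans (S011_congr N e)).trans (P011_eq hN hs (hg.congr e)).symm

theorem S011_add (hN : IsN011 R N) (hg : MemRL R g) (hh : MemRL R h) :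
    EqRL R (S011 R N (g + h)) (S011 R N g + S011 R N h) := by
  refine ⟨?_, ?_, ?_⟩
  · simp only [S011, Prod.fst_add, Prod.snd_add, Pi.add_apply, Matrix.mulVec_add,
      integral_add (hN.z0x.mulVec_integrable hg.1) (hN.z0x.mulVec_integrable hh.1),
      integral_add (hN.z0y.mulVec_integrable hg.2) (hN.z0y.mulVec_integrable hh.2)]
    abel
  · filter_upwards [hN.xx.2.1.fiber, MatL2.fiber hN.xy] with x h1 h2
    have h1 : MatL2 R.mux fun t => N.xx.r1 x t := h1
    simp only [S011, Prod.fst_add, Prod.snd_add, Pi.add_apply, Matrix.mulVec_add,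
      integral_add (h1.mulVec_integrable hg.1) (h1.mulVec_integrable hh.1),
      integral_add (h2.mulVec_integrable hg.2) (h2.mulVec_integrable hh.2)]
    abel
  · filter_upwards [hN.yy.2.1.fiber, (MatL2.swap hN.yx).fiber] with x h1 h2
    have h1 : MatL2 R.muy fun t => N.yy.r1 x t := h1
    simp only [S011, Prod.fst_add, Prod.snd_add, Pi.add_apply, Matrix.mulVec_add,
      integral_add (h2.mulVec_integrable hg.1) (h2.mulVec_integrable hh.1),
      integral_add (h1.mulVec_integrable hg.2) (h1.mulVec_integrable hh.2)]
    abel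

theorem S011_smul (N : N011 ι₀ ι₁ κ₀ κ₁) (c : ℝ) : S011 R N (c • g) = c • S011 R N g := by
  simp only [S011, Prod.smul_fst, Prod.smul_snd, Pi.smul_apply, Matrix.mulVec_smul, integral_smul]
  ext <;> simp [mul_add]

theorem S011_neg (N : N011 ι₀ ι₁ κ₀ κ₁) : S011 R N (-g) = -S011 R N g := by
  rw [← neg_one_smul ℝ g, S011_smul, neg_one_smul]

end P011

/-! ## The boundary values of a state -/

section boundary

variable {R : Rect} {n0 n1 n2 : ℕ} {v : RL (Core 4 n1 n2) (Core 2 n1 n2)}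
  {uh : ℝ × ℝ → State n0 n1 n2 → ℝ}

theorem isN011_H1 : IsN011 R (H1 R : N011 (Full 4 16 n1 n2) (Full 2 4 n1 n2) _ _) where
  z0x := (matLinf_H01 R).matL2
  z0y := (matLinf_H02 R).matL2
  x0 := matL2_const _ 0
  xx := ⟨matLinf_const _ _, matL2_const _ 0, matL2_const _ 0⟩
  xy := matL2_const _ 0
  y0 := matL2_const _ 0
  yx := matL2_const _ 0
  yy := ⟨matLinf_const _ _, matL2_const _ 0, matL2_const _ 0⟩

theorem separable_H1 : (H1 R : N011 (Full 4 16 n1 n2) (Full 2 4 n1 n2) _ _).Separable R :=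
  ⟨.rfl, .rfl⟩

/-- The contribution of the fundamental state to the boundary values. -/
def boundaryD (R : Rect) (uh : ℝ × ℝ → State n0 n1 n2 → ℝ) :
    RL (Full 4 16 n1 n2) (Full 2 4 n1 n2) :=
  (∫ p, H03 R p.1 p.2 *ᵥ uh p ∂ R.mu, fun x => ∫ y, H13 R y *ᵥ uh (x, y) ∂ R.muy,
    fun y => ∫ x, H23 R x *ᵥ uh (x, y) ∂ R.mux)

theorem MemL2.integral_mulVec {α β ι κ : Type*} [MeasurableSpace α] [MeasurableSpace β]
    [MeasurableSpace.CountablyGenerated β] [Fintype ι] [Fintype κ] {μ : Measure α} {ν : Measure β}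
    [SFinite μ] [SFinite ν] {u : α × β → κ → ℝ} {M : β → Matrix ι κ ℝ} (hu : MemL2 (μ.prod ν) u)
    (hM : MatL2 ν M) : MemL2 μ fun s => ∫ t, M t *ᵥ u (s, t) ∂ν := fun i => by
  refine (memLp_finsetSum Finset.univ fun m _ => memLp_integral_mul (hu m) (hM i m)).ae_eq ?_
  filter_upwards [hu.fiber] with s hs
  rw [integral_mulVec_apply hM hs]
  refine Finset.sum_congr rfl fun k _ => integral_congr_ae (ae_of_all _ fun t => ?_)
  exact mul_comm _ _

theorem memRL_boundaryD (hu : MemL2 R.mu uh) : MemRL R (boundaryD R uh) :=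
  ⟨MemL2.integral_mulVec hu (matLinf_H13 R).matL2,
    MemL2.integral_mulVec (MemL2.swap hu) (matLinf_H23 R).matL2⟩

theorem S011_H1_fst (hv : MemRL R v) (j : Full 4 16 n1 n2) :
    (S011 R (H1 R) v).1 j = (H00 R *ᵥ v.1) j + (∫ x in R.a..R.b, (H01 R x *ᵥ v.2.1 x) j) +
      ∫ y in R.c..R.d, (H02 R y *ᵥ v.2.2 y) j := by
  simp only [S011, H1, Pi.add_apply]
  rw [eval_integral fun j => (matLinf_H01 R).matL2.mulVec_entry_integrable hv.1 j,
    eval_integral fun j => (matLinf_H02 R).matL2.mulVec_entry_integrable hv.2 j,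
    intervalIntegral_eq_muI R.hab.le, intervalIntegral_eq_muI R.hcd.le]
  rfl

theorem S011_H1_x (x : ℝ) : (S011 R (H1 R) v).2.1 x = H11 R *ᵥ v.2.1 x := by
  simp [S011, H1]

theorem S011_H1_y (y : ℝ) : (S011 R (H1 R) v).2.2 y = H22 R *ᵥ v.2.2 y := by
  simp [S011, H1]

theorem boundaryD_fst (hu : MemL2 R.mu uh) (j : Full 4 16 n1 n2) :
    (boundaryD R uh).1 j = ∫ θ in R.a..R.b, ∫ ν in R.c..R.d, (H03 R θ ν *ᵥ uh (θ, ν)) j := by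
  have hi := fun j => (matLinf_H03 R).matL2.mulVec_entry_integrable hu j
  simp only [boundaryD]
  rw [eval_integral hi, intervalIntegral_eq_muI R.hab.le]
  simp only [intervalIntegral_eq_muI R.hcd.le]
  exact integral_prod _ (hi j)

theorem boundaryD_x (hu : MemL2 R.mu uh) : ∀ᵐ x ∂ R.mux, ∀ j,
    (boundaryD R uh).2.1 x j = ∫ ν in R.c..R.d, (H13 R ν *ᵥ uh (x, ν)) j := by
  filter_upwards [hu.fiber] with x hx j
  simp only [boundaryD]
  rw [eval_integral fun j => (matLinf_H13 R).matL2.mulVec_entry_integrable hx j,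
    intervalIntegral_eq_muI R.hcd.le]
  rfl

theorem boundaryD_y (hu : MemL2 R.mu uh) : ∀ᵐ y ∂ R.muy, ∀ j,
    (boundaryD R uh).2.2 y j = ∫ θ in R.a..R.b, (H23 R θ *ᵥ uh (θ, y)) j := by
  filter_upwards [hu.swap.fiber] with x hx j
  simp only [boundaryD]
  rw [eval_integral fun j => (matLinf_H23 R).matL2.mulVec_entry_integrable hx j,
    intervalIntegral_eq_muI R.hab.le]
  rfl

end boundary

section

variable {R : Rect} {c : Fin 4 → ℝ} {p q : Fin 2 → ℝ → ℝ} {f : ℝ × ℝ → ℝ}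

theorem continuousOn_rep2 (hp : ∀ m, MemLp (p m) 2 R.mux) (hq : ∀ m, MemLp (q m) 2 R.muy)
    (hf : MemLp f 2 R.mu) {i j : ℕ} (hi : i ≤ 1) (hj : j ≤ 1) :
    ContinuousOn (rep2 R c p q f i j) R.dom := by
  interval_cases i <;> interval_cases j
  · exact continuousOn_rep1 (memLp_primitive_x _ (hp 0)) (memLp_primitive_y _ (hq 0))
      (memLp_rep1 (hp 1) (hq 1) hf)
  · exact continuousOn_rep1 (memLp_primitive_x _ (hp 1)) (hq 0) (memLp_repy (hq 1) hf)
  · exact continuousOn_rep1 (hp 0) (memLp_primitive_y _ (hq 1)) (memLp_repx (hp 1) hf)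
  · exact continuousOn_rep1 (hp 1) (hq 1) hf

theorem rep1_apply (c : ℝ) (p q : ℝ → ℝ) (f : ℝ × ℝ → ℝ) (x y : ℝ) :
    rep1 R c p q f (x, y) = c + (∫ s in R.a..x, p s) + (∫ t in R.c..y, q t) +
      ∫ s in R.a..x, ∫ t in R.c..y, f (s, t) :=
  rfl

theorem rep2_11_eq (x y : ℝ) : rep2 R c p q f 1 1 (x, y) =
    c 3 + (∫ s in R.a..x, p 1 s) + (∫ t in R.c..y, q 1 t) +
      ∫ s in R.a..x, ∫ t in R.c..y, f (s, t) :=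
  rfl

end

section

variable {R : Rect} {n0 n1 n2 : ℕ} {v : RL (Core 4 n1 n2) (Core 2 n1 n2)}
  {uh : ℝ × ℝ → State n0 n1 n2 → ℝ}

theorem comp1_stateRep (v : RL (Core 4 n1 n2) (Core 2 n1 n2)) (uh : ℝ × ℝ → State n0 n1 n2 → ℝ)
    (i : Fin n1) : comp1 (stateRep R v uh) i = rep1 R (v.1 (Sum.inl i))
      (fun x => v.2.1 x (Sum.inl i)) (fun y => v.2.2 y (Sum.inl i)) (comp1 uh i) :=
  rfl

theorem pointVal_stateRep_one (hv : MemRL R v) (hu : MemL2 R.mu uh) (l : Fin 4) (i : Fin n1) :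
    PointVal R 0 0 (comp1 (stateRep R v uh) i) (R.corner l)
      ((S011 R (H1 R) v + boundaryD R uh).1 (Sum.inl (l, i))) := by
  have hf := memLp_comp1 hu i
  rw [comp1_stateRep]
  refine ⟨_, hasWeakDeriv_zero (memLp_rep1 (hv.1 _) (hv.2 _) hf),
    continuousOn_rep1 (hv.1 _) (hv.2 _) hf, ?_⟩
  rw [Prod.fst_add, Pi.add_apply, S011_H1_fst hv, boundaryD_fst hu]
  simp only [H00, H01, H02, H03, fullCore_mulVec_inl, fullState_mulVec_inl]
  fin_cases l <;> simp [Rect.corner, rep1_apply, comp1]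

theorem pointVal_stateRep_two (hv : MemRL R v) (hu : MemL2 R.mu uh) (m l : Fin 4) (i : Fin n2) :
    PointVal R (cornerOrder m).1 (cornerOrder m).2 (comp2 (stateRep R v uh) i) (R.corner l)
      ((S011 R (H1 R) v + boundaryD R uh).1 (Sum.inr (finProdFinEquiv (m, l), i))) := by
  have hf := memLp_comp2 hu i
  have h1 := fun m => hv.1 (Sum.inr (m, i))
  have h2 := fun m => hv.2 (Sum.inr (m, i))
  have hm : (cornerOrder m).1 ≤ 1 ∧ (cornerOrder m).2 ≤ 1 := by
    fin_cases m <;> simp [cornerOrder]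
  refine ⟨_, hasWeakDeriv_rep2 (c := fun m => v.1 (Sum.inr (m, i))) h1 h2 hf (hm.1.trans one_le_two)
    (hm.2.trans one_le_two), continuousOn_rep2 h1 h2 hf hm.1 hm.2, ?_⟩
  rw [Prod.fst_add, Pi.add_apply, S011_H1_fst hv, boundaryD_fst hu]
  simp only [H00, H01, H02, H03, fullCore_mulVec_inr, fullState_mulVec_inr, Fin.sum_univ_two,
    Fin.sum_univ_four]
  have ha : R.a ∈ Icc R.a R.b := ⟨le_rfl, R.hab.le⟩
  have hb : R.b ∈ Icc R.a R.b := ⟨R.hab.le, le_rfl⟩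
  have hc : R.c ∈ Icc R.c R.d := ⟨le_rfl, R.hcd.le⟩
  have hd : R.d ∈ Icc R.c R.d := ⟨R.hcd.le, le_rfl⟩
  have e00 := fun x y => rep2_00_eq (c := fun m => v.1 (Sum.inr (m, i))) h1 h2 hf (x := x) (y := y)
  have e10 := fun x y => rep2_10_eq (c := fun m => v.1 (Sum.inr (m, i))) h1 h2 hf (x := x) (y := y)
  have e01 := fun x y => rep2_01_eq (c := fun m => v.1 (Sum.inr (m, i))) h1 h2 hf (x := x) (y := y)
  fin_cases m <;> fin_cases l <;>
    simp [Rect.corner, cornerOrder, e00, e10, e01, rep2_11_eq, ha, hb, hc, hd, comp2,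
      finProdFinEquiv]
  all_goals try ring_nf
  -- One equality of iterated integrals is left; the integrands differ by rearrangement of factors.
  refine intervalIntegral.integral_congr fun θ _ => intervalIntegral.integral_congr fun ν _ => ?_
  ring

theorem edgeValX_stateRep_one (hv : MemRL R v) (hu : MemL2 R.mu uh) (l : Fin 2) (i : Fin n1) :
    EdgeValX R 1 0 (comp1 (stateRep R v uh) i) (![R.c, R.d] l)
      fun x => (S011 R (H1 R) v + boundaryD R uh).2.1 x (Sum.inl (l, i)) := by
  have hf := memLp_comp1 hu i
  rw [comp1_stateRep]
  refine ⟨_, hasWeakDeriv_rep1_x (hv.1 _) (hv.2 _) hf, ?_⟩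
  filter_upwards [continuousOn_repx (fun x => v.2.1 x (Sum.inl i)) hf, boundaryD_x hu] with x h1 h2
  refine ⟨h1, ?_⟩
  rw [Prod.snd_add, Prod.fst_add, Pi.add_apply, Pi.add_apply, h2, S011_H1_x]
  simp only [H11, H13, fullCore_mulVec_inl, fullState_mulVec_inl]
  fin_cases l <;> simp [repx, Jy, comp1]

theorem edgeValY_stateRep_one (hv : MemRL R v) (hu : MemL2 R.mu uh) (l : Fin 2) (i : Fin n1) :
    EdgeValY R 0 1 (comp1 (stateRep R v uh) i) (![R.a, R.b] l)
      fun x => (S011 R (H1 R) v + boundaryD R uh).2.2 x (Sum.inl (l, i)) := by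
  have hf := memLp_comp1 hu i
  rw [comp1_stateRep]
  refine ⟨_, hasWeakDeriv_rep1_y (hv.1 _) (hv.2 _) hf, ?_⟩
  filter_upwards [continuousOn_repy (fun x => v.2.2 x (Sum.inl i)) hf, boundaryD_y hu] with x h1 h2
  refine ⟨h1, ?_⟩
  rw [Prod.snd_add, Prod.snd_add, Pi.add_apply, Pi.add_apply, h2, S011_H1_y]
  simp only [H22, H23, fullCore_mulVec_inl, fullState_mulVec_inl]
  fin_cases l <;> simp [repy, Jx, comp1]

theorem edgeValX_stateRep_two (hv : MemRL R v) (hu : MemL2 R.mu uh) (m l : Fin 2) (i : Fin n2) :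
    EdgeValX R (xEdgeOrder m).1 (xEdgeOrder m).2 (comp2 (stateRep R v uh) i) (![R.c, R.d] l)
      fun x => (S011 R (H1 R) v + boundaryD R uh).2.1 x (Sum.inr (finProdFinEquiv (m, l), i)) := by
  have hf := memLp_comp2 hu i
  have h1 := fun m => hv.1 (Sum.inr (m, i))
  have h2 := fun m => hv.2 (Sum.inr (m, i))
  rw [comp2_stateRep]
  have hm : (xEdgeOrder m).1 ≤ 2 ∧ (xEdgeOrder m).2 ≤ 2 := by fin_cases m <;> simp [xEdgeOrder]
  refine ⟨_, hasWeakDeriv_rep2 h1 h2 hf hm.1 hm.2, ?_⟩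
  filter_upwards [continuousOn_repx (fun x => v.2.1 x (Sum.inr (0, i)))
      (memLp_repx (h1 1) hf), continuousOn_repx (fun x => v.2.1 x (Sum.inr (1, i))) hf,
    rep2_20_eq (c := fun m => v.1 (Sum.inr (m, i))) (p := fun m x => v.2.1 x (Sum.inr (m, i)))
      (q := fun m y => v.2.2 y (Sum.inr (m, i))) hf (R.edge_mem_y l), boundaryD_x hu]
    with x c0 c1 e0 e1
  rw [Prod.snd_add, Prod.fst_add, Pi.add_apply, Pi.add_apply, e1, S011_H1_x]
  simp only [H11, H13, fullCore_mulVec_inr, fullState_mulVec_inr, Fin.sum_univ_two]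
  fin_cases m
  · refine ⟨c0, ?_⟩
    change rep2 _ _ _ _ _ 2 0 _ = _
    rw [e0]
    fin_cases l <;> simp [finProdFinEquiv, comp2]
  · refine ⟨c1, ?_⟩
    change rep2 _ _ _ _ _ 2 1 _ = _
    fin_cases l <;> simp [rep2, repx, Jy, finProdFinEquiv, comp2]

theorem edgeValY_stateRep_two (hv : MemRL R v) (hu : MemL2 R.mu uh) (m l : Fin 2) (i : Fin n2) :
    EdgeValY R (yEdgeOrder m).1 (yEdgeOrder m).2 (comp2 (stateRep R v uh) i) (![R.a, R.b] l)
      fun x => (S011 R (H1 R) v + boundaryD R uh).2.2 x (Sum.inr (finProdFinEquiv (m, l), i)) := by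
  have hf := memLp_comp2 hu i
  have h1 := fun m => hv.1 (Sum.inr (m, i))
  have h2 := fun m => hv.2 (Sum.inr (m, i))
  rw [comp2_stateRep]
  have hm : (yEdgeOrder m).1 ≤ 2 ∧ (yEdgeOrder m).2 ≤ 2 := by fin_cases m <;> simp [yEdgeOrder]
  refine ⟨_, hasWeakDeriv_rep2 h1 h2 hf hm.1 hm.2, ?_⟩
  filter_upwards [continuousOn_repy (fun x => v.2.2 x (Sum.inr (0, i)))
      (memLp_repy (h2 1) hf), continuousOn_repy (fun x => v.2.2 x (Sum.inr (1, i))) hf,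
    rep2_02_eq (c := fun m => v.1 (Sum.inr (m, i))) (p := fun m x => v.2.1 x (Sum.inr (m, i)))
      (q := fun m y => v.2.2 y (Sum.inr (m, i))) hf (R.edge_mem_x l), boundaryD_y hu]
    with x c0 c1 e0 e1
  rw [Prod.snd_add, Prod.snd_add, Pi.add_apply, Pi.add_apply, e1, S011_H1_y]
  simp only [H22, H23, fullCore_mulVec_inr, fullState_mulVec_inr, Fin.sum_univ_two]
  fin_cases m
  · refine ⟨c0, ?_⟩
    change rep2 _ _ _ _ _ 0 2 _ = _
    rw [e0]
    fin_cases l <;> simp [finProdFinEquiv, comp2]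
  · refine ⟨c1, ?_⟩
    change rep2 _ _ _ _ _ 1 2 _ = _
    fin_cases l <;> simp [rep2, repy, Jx, finProdFinEquiv, comp2]

/-- The boundary values of the state with core boundary values `v` and fundamental state `uh`. -/
theorem isBoundary_stateRep (hv : MemRL R v) (hu : MemL2 R.mu uh) :
    IsBoundary R (stateRep R v uh) (S011 R (H1 R) v + boundaryD R uh) where
  mem := (memRL_S011 isN011_H1 hv).add (memRL_boundaryD hu)
  corner1 := pointVal_stateRep_one hv hu
  corner2 := pointVal_stateRep_two hv hu
  xEdge1 := edgeValX_stateRep_one hv hu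
  xEdge2 := edgeValX_stateRep_two hv hu
  yEdge1 := edgeValY_stateRep_one hv hu
  yEdge2 := edgeValY_stateRep_two hv hu

end

/-! ## Operators from the fundamental state to boundary values -/

/-- Parameters of an operator from functions on the rectangle to `ℝ^{ι₀} × L2^{ι₁}[x] × L2^{ι₁}[y]`;
`k11` depends on `(x, y, θ)` and `k21` on `(x, y, ν)`. -/
structure DParam (ι₀ ι₁ τ : Type*) where
  k0 : ℝ → ℝ → Matrix ι₀ τ ℝ
  k10 : ℝ → ℝ → Matrix ι₁ τ ℝ
  k11 : ℝ → ℝ → ℝ → Matrix ι₁ τ ℝ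
  k20 : ℝ → ℝ → Matrix ι₁ τ ℝ
  k21 : ℝ → ℝ → ℝ → Matrix ι₁ τ ℝ

/-- The parameter class for the operators `PD`. -/
structure IsDParam (R : Rect) {ι₀ ι₁ τ : Type*} (k : DParam ι₀ ι₁ τ) : Prop where
  k0 : MatL2 R.mu fun p => k.k0 p.1 p.2
  k10 : MatLinf R.mu fun p => k.k10 p.1 p.2
  k11 : MatL2 (R.mux.prod R.mu) fun p => k.k11 p.1 p.2.2 p.2.1
  k20 : MatLinf R.mu fun p => k.k20 p.1 p.2
  k21 : MatL2 (R.muy.prod R.mu) fun p => k.k21 p.2.1 p.1 p.2.2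

/-- The operator with parameters `k`. -/
def PD (R : Rect) {ι₀ ι₁ τ : Type*} [Fintype ι₀] [Fintype ι₁] [Fintype τ] (k : DParam ι₀ ι₁ τ)
    (u : ℝ × ℝ → τ → ℝ) : RL ι₀ ι₁ :=
  (∫ p, k.k0 p.1 p.2 *ᵥ u p ∂ R.mu,
   fun x => ∫ y, k.k10 x y *ᵥ u (x, y) ∂ R.muy + ∫ p, k.k11 x p.2 p.1 *ᵥ u p ∂ R.mu,
   fun y => ∫ x, k.k20 x y *ᵥ u (x, y) ∂ R.mux + ∫ p, k.k21 p.1 y p.2 *ᵥ u p ∂ R.mu)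

/-- The kernel of `u ↦ N q₀ + ∫ A q₁ + ∫ B q₂` with `(q₀, q₁, q₂) = PD R k u`. -/
def rowKer (R : Rect) {ρ ι₀ ι₁ τ : Type*} [Fintype ι₀] [Fintype ι₁] (N : Matrix ρ ι₀ ℝ)
    (A B : ℝ → Matrix ρ ι₁ ℝ) (k : DParam ι₀ ι₁ τ) (x y : ℝ) : Matrix ρ τ ℝ :=
  N * k.k0 x y + A x * k.k10 x y + matIntegral R.mux (fun η => A η * k.k11 η y x) +
    B y * k.k20 x y + matIntegral R.muy fun η => B η * k.k21 x η y

section compose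

variable {R : Rect} {ρ ι₀ ι₁ τ : Type*} [Fintype ρ] [Fintype ι₀] [Fintype ι₁] [Fintype τ]
  {k : DParam ι₀ ι₁ τ} {u : ℝ × ℝ → τ → ℝ}

theorem MatL2.mul_matLinf_mulVec_integrable {α : Type*} [MeasurableSpace α] {μ : Measure α}
    {A : α → Matrix ρ ι₁ ℝ} {k : α → Matrix ι₁ τ ℝ} {u : α → τ → ℝ}
    (hA : MatL2 μ A) (hk : MatLinf μ k) (hu : MemL2 μ u) :
    Integrable (fun p => (A p * k p) *ᵥ u p) μ :=
  (hA.mul_matLinf hk).mulVec_integrable hu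

theorem mulVec_integral_fiber {α β : Type*} [MeasurableSpace α] [MeasurableSpace β]
    {μ : Measure α} {ν : Measure β} [IsFiniteMeasure μ] [IsFiniteMeasure ν]
    {A : α → Matrix ρ ι₁ ℝ} {k : α × β → Matrix ι₁ τ ℝ} {u : α × β → τ → ℝ}
    (hA : MatL2 μ A) (hk : MatLinf (μ.prod ν) k) (hu : MemL2 (μ.prod ν) u) :
    ∫ x, A x *ᵥ ∫ y, k (x, y) *ᵥ u (x, y) ∂ν ∂μ = ∫ p, (A p.1 * k p) *ᵥ u p ∂μ.prod ν ∧
      Integrable (fun x => A x *ᵥ ∫ y, k (x, y) *ᵥ u (x, y) ∂ν) μ := by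
  have hi := (hA.fst ν).mul_matLinf_mulVec_integrable hk hu
  have e : (fun x => ∫ y, (A x * k (x, y)) *ᵥ u (x, y) ∂ν) =ᵐ[μ]
      fun x => A x *ᵥ ∫ y, k (x, y) *ᵥ u (x, y) ∂ν := by
    filter_upwards [(hk.mulVec hu).fiber] with x hx
    rw [mulVec_integral _ (Integrable.of_eval fun i => (hx i).integrable one_le_two)]
    simp only [Matrix.mulVec_mulVec]
  exact ⟨by rw [integral_prod _ hi, integral_congr_ae e], hi.integral_prod_left.congr e⟩

/-- A row of an 011-PI operator composed with an operator `PD`. -/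
theorem row_PD (hk : IsDParam R k) (hu : MemL2 R.mu u) (N : Matrix ρ ι₀ ℝ)
    {A B : ℝ → Matrix ρ ι₁ ℝ} (hA : MatL2 R.mux A) (hB : MatL2 R.muy B) :
    N *ᵥ (PD R k u).1 + ∫ x, A x *ᵥ (PD R k u).2.1 x ∂ R.mux +
      ∫ y, B y *ᵥ (PD R k u).2.2 y ∂ R.muy =
    ∫ p, rowKer R N A B k p.1 p.2 *ᵥ u p ∂ R.mu := by
  -- The multiplier parts `k10`, `k20` turn into kernels on the rectangle by Fubini (`a1`, `b1`, the
  -- latter after exchanging the variables). The integral parts `k11`, `k21` are compositions of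
  -- kernels (`a2`, `b2`).
  have a1 := mulVec_integral_fiber hA hk.k10 hu
  have a2 := mulVec_integral_comp hA hk.k11 hu
  have b1 := mulVec_integral_fiber (k := fun p => k.k20 p.2 p.1) (u := fun p => u (p.2, p.1)) hB
    (fun i j => (hk.k20 i j).comp_measurePreserving
      (Measure.measurePreserving_swap (μ := R.muy) (ν := R.mux))) (MemL2.swap hu)
  have b2 := mulVec_integral_comp hB hk.k21 hu
  have b3 : ∫ p, (B p.1 * k.k20 p.2 p.1) *ᵥ u (p.2, p.1) ∂(R.muy.prod R.mux) =
      ∫ p, (B p.2 * k.k20 p.1 p.2) *ᵥ u p ∂ R.mu :=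
    integral_prod_swap (μ := R.mux) (ν := R.muy) fun p => (B p.2 * k.k20 p.1 p.2) *ᵥ u p
  have i0 : Integrable (fun p => (N * k.k0 p.1 p.2) *ᵥ u p) R.mu :=
    (hk.k0.const_mul N).mulVec_integrable hu
  have i1 : Integrable (fun p => (A p.1 * k.k10 p.1 p.2) *ᵥ u p) R.mu :=
    (hA.fst R.muy).mul_matLinf_mulVec_integrable hk.k10 hu
  have i2 : Integrable (fun p => (B p.2 * k.k20 p.1 p.2) *ᵥ u p) R.mu :=
    (hB.snd R.mux).mul_matLinf_mulVec_integrable hk.k20 hu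
  simp only [PD, rowKer, Matrix.mulVec_add, Matrix.add_mulVec]
  rw [integral_add a1.2 a2.2.2, integral_add b1.2 b2.2.2, a1.1, a2.1, b1.1, b2.1, b3,
    mulVec_integral _ (hk.k0.mulVec_integrable hu), integral_add _ b2.2.1, integral_add _ i2,
    integral_add _ a2.2.1, integral_add i0 i1]
  · simp only [Matrix.mulVec_mulVec, Rect.mu]
    abel
  · exact i0.add i1
  · exact (i0.add i1).add a2.2.1
  · exact ((i0.add i1).add a2.2.1).add i2

variable {α : Type*} [MeasurableSpace α] {ζ : Measure α}

theorem MatL2.pair_fst [SFinite ζ] {ι κ : Type*} {A : α × ℝ → Matrix ι κ ℝ} (hA : MatL2 (ζ.prod R.mux) A) :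
    MatL2 (ζ.prod R.mu) fun p => A (p.1, p.2.1) := fun i j =>
  ((hA i j).comp_fst R.muy).comp_measurePreserving
    (measurePreserving_prodAssoc ζ R.mux R.muy).symm

theorem MatL2.pair_snd [SFinite ζ] {ι κ : Type*} {A : α × ℝ → Matrix ι κ ℝ} (hA : MatL2 (ζ.prod R.muy) A) :
    MatL2 (ζ.prod R.mu) fun p => A (p.1, p.2.2) := fun i j => by
  have h := hA.pair_fst (R := R.swap) i j
  exact h.comp_measurePreserving ((MeasurePreserving.id ζ).prod
    (Measure.measurePreserving_swap (μ := R.mux) (ν := R.muy)))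

/-- The row may depend on a parameter in any finite measure space: a single point for vectors, an
edge variable for the components in `x` and `y`, or a point of the rectangle for the kernels `K`. -/
theorem matL2_rowKer [IsFiniteMeasure ζ] (hk : IsDParam R k) {N : α → Matrix ρ ι₀ ℝ} {A B : α → ℝ → Matrix ρ ι₁ ℝ}
    (hN : MatL2 ζ N) (hA : MatL2 (ζ.prod R.mux) fun p => A p.1 p.2)
    (hB : MatL2 (ζ.prod R.muy) fun p => B p.1 p.2) :
    MatL2 (ζ.prod R.mu) fun p => rowKer R (N p.1) (A p.1) (B p.1) k p.2.1 p.2.2 :=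
  ((((hN.tensor hk.k0).add (hA.pair_fst.mul_matLinf (hk.k10.snd ζ))).add (hA.comp hk.k11)).add
    (hB.pair_snd.mul_matLinf (hk.k20.snd ζ))).add (hB.comp hk.k21)

end compose

theorem matInt_eq {ι κ : Type*} {s t : ℝ} (h : s ≤ t) (M : ℝ → Matrix ι κ ℝ) :
    matInt s t M = matIntegral (muI s t) M := by
  ext i j
  simp only [matInt, matIntegral, Matrix.of_apply, intervalIntegral_eq_muI h]

theorem IsN011.yx_swap {R : Rect} {ι₀ ι₁ κ₀ κ₁ : Type*} {N : N011 ι₀ ι₁ κ₀ κ₁}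
    (hN : IsN011 R N) :
    MatL2 (R.muy.prod R.mux) fun p => N.yx p.2 p.1 :=
  MatL2.swap hN.yx

/-- Parameters of the composition of a 011-PI operator with an operator `PD`. -/
def N011.compD (R : Rect) {ι₀ ι₁ κ₀ κ₁ τ : Type*} [Fintype κ₀] [Fintype κ₁]
    (N : N011 ι₀ ι₁ κ₀ κ₁) (k : DParam κ₀ κ₁ τ) : DParam ι₀ ι₁ τ where
  k0 := rowKer R N.z00 N.z0x N.z0y k
  k10 x y := N.xx.r0 x * k.k10 x y
  k11 x y θ := N.xx.r0 x * k.k11 x y θ + rowKer R (N.x0 x) (N.xx.r1 x) (N.xy x) k θ y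
  k20 x y := N.yy.r0 y * k.k20 x y
  k21 x y ν := N.yy.r0 y * k.k21 x y ν +
    rowKer R (N.y0 y) (fun θ => N.yx θ y) (N.yy.r1 y) k x ν

section compose

variable {R : Rect} {ι₀ ι₁ κ₀ κ₁ τ : Type*} [Fintype ι₁] [Fintype κ₀] [Fintype κ₁]
  [Fintype τ] {N : N011 ι₀ ι₁ κ₀ κ₁} {k : DParam κ₀ κ₁ τ} {u : ℝ × ℝ → τ → ℝ}

theorem matL2_rowKer_x (hN : IsN011 R N) (hk : IsDParam R k) : MatL2 (R.mux.prod R.mu) fun p =>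
    rowKer R (N.x0 p.1) (N.xx.r1 p.1) (N.xy p.1) k p.2.1 p.2.2 :=
  matL2_rowKer hk hN.x0 hN.xx.2.1 hN.xy

theorem matL2_rowKer_y (hN : IsN011 R N) (hk : IsDParam R k) : MatL2 (R.muy.prod R.mu) fun p =>
    rowKer R (N.y0 p.1) (fun x => N.yx x p.1) (N.yy.r1 p.1) k p.2.1 p.2.2 :=
  matL2_rowKer (A := fun y x => N.yx x y) hk hN.y0 hN.yx_swap hN.yy.2.1

variable [Fintype ι₀]

theorem isDParam_compD (hN : IsN011 R N) (hk : IsDParam R k) : IsDParam R (N.compD R k) where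
  k0 := by
    -- The vector row carries no parameter; it is treated as a family over a one-point space.
    have hA : MatL2 ((Measure.dirac ()).prod R.mux) fun p => N.z0x p.2 := hN.z0x.snd _
    have hB : MatL2 ((Measure.dirac ()).prod R.muy) fun p => N.z0y p.2 := hN.z0y.snd _
    have h := (matL2_rowKer (A := fun _ => N.z0x) (B := fun _ => N.z0y) hk
      (matL2_const _ N.z00) hA hB).fiber
    rw [ae_dirac_eq] at h
    exact h
  k10 := (hN.xx.1.fst R.muy).mul hk.k10
  k11 := by
    have h : MatLinf (R.mux.prod R.mu) fun p => N.xx.r0 p.1 := MatLinf.fst R.mu hN.xx.1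
    exact (h.mul_matL2 hk.k11).add (matL2_rowKer_x hN hk)
  k20 := (hN.yy.1.snd R.mux).mul hk.k20
  k21 := by
    have h : MatLinf (R.muy.prod R.mu) fun p => N.yy.r0 p.1 := MatLinf.fst R.mu hN.yy.1
    exact (h.mul_matL2 hk.k21).add (matL2_rowKer_y hN hk)

theorem S011_PD (hN : IsN011 R N) (hk : IsDParam R k) (hu : MemL2 R.mu u) :
    EqRL R (S011 R N (PD R k u)) (PD R (N.compD R k) u) := by
  refine ⟨row_PD hk hu _ hN.z0x hN.z0y, ?_, ?_⟩
  · filter_upwards [hN.xx.2.1.fiber, MatL2.fiber hN.xy, MatL2.fiber hk.k11,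
      (hk.k10.mulVec hu).fiber,
      (matL2_rowKer_x hN hk).fiber] with x h1 h2 h3 h4 h5
    have h := row_PD hk hu (N.x0 x) (A := N.xx.r1 x) h1 h2
    have e : N.xx.r0 x *ᵥ (PD R k u).2.1 x = ∫ y, (N.xx.r0 x * k.k10 x y) *ᵥ u (x, y) ∂ R.muy +
        ∫ p, (N.xx.r0 x * k.k11 x p.2 p.1) *ᵥ u p ∂ R.mu := by
      simp only [PD, Matrix.mulVec_add, ← Matrix.mulVec_mulVec]
      rw [mulVec_integral _ (Integrable.of_eval fun i => (h4 i).integrable one_le_two),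
        mulVec_integral _ (h3.mulVec_integrable hu)]
    have i1 : Integrable (fun p : ℝ × ℝ => (N.xx.r0 x * k.k11 x p.2 p.1) *ᵥ u p) R.mu :=
      (h3.const_mul _).mulVec_integrable hu
    have e2 : (PD R (N.compD R k) u).2.1 x = N.xx.r0 x *ᵥ (PD R k u).2.1 x + (N.x0 x *ᵥ (PD R k u).1 +
        ∫ θ, N.xx.r1 x θ *ᵥ (PD R k u).2.1 θ ∂ R.mux + ∫ y, N.xy x y *ᵥ (PD R k u).2.2 y ∂ R.muy) := by
      change ∫ y, (N.xx.r0 x * k.k10 x y) *ᵥ u (x, y) ∂ R.muy + ∫ p, (N.xx.r0 x * k.k11 x p.2 p.1 +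
        rowKer R (N.x0 x) (N.xx.r1 x) (N.xy x) k p.1 p.2) *ᵥ u p ∂ R.mu = _
      simp only [Matrix.add_mulVec]
      rw [integral_add i1 (h5.mulVec_integrable hu), h, e, add_assoc]
    rw [e2]
    simp only [S011]
    abel
  · filter_upwards [hN.yy.2.1.fiber, hN.yx_swap.fiber, MatL2.fiber hk.k21,
      (MemL2.swap (hk.k20.mulVec hu)).fiber,
      (matL2_rowKer_y hN hk).fiber] with y h1 h2 h3 h4 h5
    have h := row_PD hk hu (N.y0 y) (A := fun x => N.yx x y) (B := N.yy.r1 y) h2 h1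
    have e : N.yy.r0 y *ᵥ (PD R k u).2.2 y = ∫ x, (N.yy.r0 y * k.k20 x y) *ᵥ u (x, y) ∂ R.mux +
        ∫ p, (N.yy.r0 y * k.k21 p.1 y p.2) *ᵥ u p ∂ R.mu := by
      simp only [PD, Matrix.mulVec_add, ← Matrix.mulVec_mulVec]
      rw [mulVec_integral _ (Integrable.of_eval fun i => (h4 i).integrable one_le_two),
        mulVec_integral _ (h3.mulVec_integrable hu)]
    have i1 : Integrable (fun p : ℝ × ℝ => (N.yy.r0 y * k.k21 p.1 y p.2) *ᵥ u p) R.mu :=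
      (h3.const_mul _).mulVec_integrable hu
    have e2 : (PD R (N.compD R k) u).2.2 y = N.yy.r0 y *ᵥ (PD R k u).2.2 y + (N.y0 y *ᵥ (PD R k u).1 +
        ∫ x, N.yx x y *ᵥ (PD R k u).2.1 x ∂ R.mux + ∫ ν, N.yy.r1 y ν *ᵥ (PD R k u).2.2 ν ∂ R.muy) := by
      change ∫ x, (N.yy.r0 y * k.k20 x y) *ᵥ u (x, y) ∂ R.mux + ∫ p, (N.yy.r0 y * k.k21 p.1 y p.2 +
        rowKer R (N.y0 y) (fun x => N.yx x y) (N.yy.r1 y) k p.1 p.2) *ᵥ u p ∂ R.mu = _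
      simp only [Matrix.add_mulVec]
      rw [integral_add i1 (h5.mulVec_integrable hu), h, e, add_assoc]
    rw [e2]
    simp only [S011]
    abel

end compose

/-! ## The parameters `F` and `G` -/

section params

variable (R : Rect) {n0 n1 n2 : ℕ} (B : BCParam n1 n2) (Eh : CoreParam n1 n2)

/-- Parameters of `boundaryD`. -/
def HParam : DParam (Full 4 16 n1 n2) (Full 2 4 n1 n2) (State n0 n1 n2) where
  k0 := H03 R
  k10 _ y := H13 R y
  k11 := 0
  k20 x _ := H23 R x
  k21 := 0

/-- The parameters `F`. -/
def FParam : DParam (Core 4 n1 n2) (Core 2 n1 n2) (State n0 n1 n2) :=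
  ⟨F0 R B, F10 R B, F11 R B, F20 R B, F21 R B⟩

/-- The parameters `G`. -/
def GParam : DParam (Core 4 n1 n2) (Core 2 n1 n2) (State n0 n1 n2) :=
  ⟨G0 R B Eh, G10 R B Eh, G11 R B Eh, G20 R B Eh, G21 R B Eh⟩

theorem isDParam_HParam :
    IsDParam R (HParam R : DParam (Full 4 16 n1 n2) (Full 2 4 n1 n2) (State n0 n1 n2)) where
  k0 := (matLinf_H03 R).matL2
  k10 := (matLinf_H13 R).snd R.mux
  k11 := matL2_const _ 0
  k20 := (matLinf_H23 R).fst R.muy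
  k21 := matL2_const _ 0

theorem PD_HParam (uh : ℝ × ℝ → State n0 n1 n2 → ℝ) : PD R (HParam R) uh = boundaryD R uh := by
  simp [PD, HParam, boundaryD]

theorem matIntegral_zero {α ι κ : Type*} [MeasurableSpace α] (μ : Measure α) :
    matIntegral μ (fun _ => (0 : Matrix ι κ ℝ)) = 0 := by
  ext; simp [matIntegral]

/-- The formulas for `F` are the composition rule for `B` after the blocks `H03`, `H13`, `H23`, and
likewise those for `G` are the rule for `Eh` after `F` (`GParam_eq`). Membership in `L2` and the
action on functions thus follow from `isDParam_compD` and `S011_PD`. -/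
theorem FParam_eq :
    (FParam R B : DParam _ _ (State n0 n1 n2)) = B.compD R (HParam R) := by
  simp only [FParam, N011.compD, HParam, rowKer, Pi.zero_apply, Matrix.mul_zero, matIntegral_zero,
    add_zero, zero_add, DParam.mk.injEq]
  refine ⟨?_, rfl, rfl, rfl, ?_⟩
  · funext x y
    simp only [F0, rowKer, Pi.zero_apply, Matrix.mul_zero, matIntegral_zero, add_zero]
    rfl
  · funext x y ν
    simp only [F21]
    exact add_right_comm _ _ _

theorem GParam_eq :
    (GParam R B Eh : DParam _ _ (State n0 n1 n2)) = Eh.compD R (FParam R B) := by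
  have hx : ∀ {ι κ : Type} (M : ℝ → Matrix ι κ ℝ), matIntegral R.mux M = matInt R.a R.b M :=
    fun M => (matInt_eq R.hab.le M).symm
  have hy : ∀ {ι κ : Type} (M : ℝ → Matrix ι κ ℝ), matIntegral R.muy M = matInt R.c R.d M :=
    fun M => (matInt_eq R.hcd.le M).symm
  simp only [GParam, N011.compD, FParam, rowKer, hx, hy, DParam.mk.injEq]
  refine ⟨?_, rfl, ?_, rfl, ?_⟩
  · funext x y
    simp only [G0, rowKer, hx, hy]
  · funext x y θ
    simp only [G11]
    abel
  · funext x y ν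
    simp only [G21]
    abel

end params

/-! ## The state as an integral operator applied to the fundamental state -/

section stateDiag

variable {n0 n1 n2 : ℕ} (p q r : ℝ) (v : State n0 n1 n2 → ℝ)

@[simp]
theorem stateDiag_mulVec_zero (i : Fin n0) :
    (stateDiag p q r *ᵥ v) (Sum.inl i) = p * v (Sum.inl i) := by
  simp [stateDiag, Matrix.mulVec_diagonal]

@[simp]
theorem stateDiag_mulVec_one (i : Fin n1) :
    (stateDiag p q r *ᵥ v) (Sum.inr (Sum.inl i)) = q * v (Sum.inr (Sum.inl i)) := by
  simp [stateDiag, Matrix.mulVec_diagonal]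

@[simp]
theorem stateDiag_mulVec_two (i : Fin n2) :
    (stateDiag p q r *ᵥ v) (Sum.inr (Sum.inr i)) = r * v (Sum.inr (Sum.inr i)) := by
  simp [stateDiag, Matrix.mulVec_diagonal]

theorem continuous_stateDiag {α : Type*} [TopologicalSpace α] {p q r : α → ℝ}
    (hp : Continuous p) (hq : Continuous q) (hr : Continuous r) (i j : State n0 n1 n2) :
    Continuous fun x => stateDiag (p x) (q x) (r x) i j := by
  simp only [stateDiag, Matrix.diagonal_apply]
  split_ifs
  · rcases i with i | i | i <;> assumption
  · exact continuous_const

end stateDiag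

theorem ite_mulVec_apply {ι κ : Type*} [Fintype κ] (c : Prop) [Decidable c] (M : Matrix ι κ ℝ)
    (v : κ → ℝ) (i : ι) : ((if c then M else 0) *ᵥ v) i = if c then (M *ᵥ v) i else 0 := by
  split_ifs <;> simp

theorem intervalIntegral_eq_indicator_compl {E : Type*} [NormedAddCommGroup E] [NormedSpace ℝ E]
    {s t x : ℝ} (hx : x ∈ Icc s t) (f : ℝ → E) :
    ∫ θ in x..t, f θ = ∫ θ, (if ¬ θ ≤ x then f θ else 0) ∂muI s t := by
  have : (fun θ => if ¬ θ ≤ x then f θ else 0) = (Ioi x).indicator f := by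
    ext θ; simp [indicator]
  rw [this, integral_indicator measurableSet_Ioi, muI_eq_Ioc,
    Measure.restrict_restrict measurableSet_Ioi, intervalIntegral.integral_of_le hx.2]
  congr 2
  ext θ
  simp only [mem_Ioc, mem_inter_iff, mem_Ioi]
  exact ⟨fun h => ⟨h.1, hx.1.trans_lt h.1, h.2⟩, fun h => ⟨h.1, h.2.2⟩⟩

section quadrant

variable {R : Rect} {E : Type*} [NormedAddCommGroup E] {f : ℝ × ℝ → E}

theorem integrable_ite_prod (hf : Integrable f R.mu) {P Q : ℝ → Prop} [DecidablePred P]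
    [DecidablePred Q] (hP : MeasurableSet {x | P x}) (hQ : MeasurableSet {x | Q x}) :
    Integrable (fun p => if P p.1 ∧ Q p.2 then f p else 0) R.mu := by
  refine (hf.indicator (hP.prod hQ)).congr (ae_of_all _ fun p => ?_)
  simp [indicator]

variable [NormedSpace ℝ E]

theorem integral_ite_prod (hf : Integrable f R.mu) {P Q : ℝ → Prop} [DecidablePred P]
    [DecidablePred Q] (hP : MeasurableSet {x | P x}) (hQ : MeasurableSet {x | Q x}) :
    ∫ θ, (if P θ then ∫ ν, (if Q ν then f (θ, ν) else 0) ∂ R.muy else 0) ∂ R.mux =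
      ∫ p, (if P p.1 ∧ Q p.2 then f p else 0) ∂ R.mu := by
  rw [Rect.mu, integral_prod _ (integrable_ite_prod hf hP hQ)]
  refine integral_congr_ae (ae_of_all _ fun θ => ?_)
  by_cases h : P θ <;> simp [h]

theorem measurableSet_not_le (x : ℝ) : MeasurableSet {θ | ¬ θ ≤ x} := by
  simp only [not_le]
  exact measurableSet_Ioi

theorem ite_quadrants {M : Type*} [AddMonoid M] (P Q : Prop) [Decidable P] [Decidable Q]
    (a b c d : M) : (if P ∧ Q then a else 0) + (if ¬P ∧ Q then c else 0) +
      (if P ∧ ¬Q then b else 0) + (if ¬P ∧ ¬Q then d else 0) =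
    if P then if Q then a else b else if Q then c else d := by
  by_cases hP : P <;> by_cases hQ : Q <;> simp [hP, hQ]

/-- A sum of integrals over the four quadrants at `z` as an integral over the rectangle. -/
theorem integral_quadrants {z : ℝ × ℝ} (hz : z ∈ R.dom) {f11 f12 f21 f22 : ℝ × ℝ → E}
    (h11 : Integrable f11 R.mu) (h12 : Integrable f12 R.mu) (h21 : Integrable f21 R.mu)
    (h22 : Integrable f22 R.mu) :
    (∫ θ in R.a..z.1, ∫ ν in R.c..z.2, f11 (θ, ν)) + (∫ θ in z.1..R.b, ∫ ν in R.c..z.2, f21 (θ, ν)) +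
      (∫ θ in R.a..z.1, ∫ ν in z.2..R.d, f12 (θ, ν)) +
      (∫ θ in z.1..R.b, ∫ ν in z.2..R.d, f22 (θ, ν)) =
    ∫ p, (if p.1 ≤ z.1 then if p.2 ≤ z.2 then f11 p else f12 p
      else if p.2 ≤ z.2 then f21 p else f22 p) ∂ R.mu := by
  simp only [intervalIntegral_eq_indicator hz.1, intervalIntegral_eq_indicator hz.2,
    intervalIntegral_eq_indicator_compl hz.1, intervalIntegral_eq_indicator_compl hz.2]
  have m1 : MeasurableSet {x | x ≤ z.1} := measurableSet_Iic
  have m2 : MeasurableSet {x | x ≤ z.2} := measurableSet_Iic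
  have m3 := measurableSet_not_le z.1
  have m4 := measurableSet_not_le z.2
  have e11 := integral_ite_prod h11 m1 m2
  have e12 := integral_ite_prod h12 m1 m4
  have e21 := integral_ite_prod h21 m3 m2
  have e22 := integral_ite_prod h22 m3 m4
  have i11 := integrable_ite_prod h11 m1 m2
  have i12 := integrable_ite_prod h12 m1 m4
  have i21 := integrable_ite_prod h21 m3 m2
  have i22 := integrable_ite_prod h22 m3 m4
  simp only [Rect.mux, Rect.muy] at e11 e12 e21 e22
  rw [e11, e12, e21, e22, ← integral_add' i11 i21, ← integral_add' (i11.add i21) i12,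
    ← integral_add' ((i11.add i21).add i12) i22]
  exact integral_congr_ae (ae_of_all _ fun p => ite_quadrants _ _ _ _ _ _)

end quadrant

/-! ### The reconstruction kernels `K`, extended by zero -/

section cut

variable (R : Rect) {n0 n1 n2 : ℕ}

/-- `K31` cut off at `θ ≤ x`. -/
def K31cut (z : ℝ × ℝ) (θ : ℝ) : Matrix (State n0 n1 n2) (Core 2 n1 n2) ℝ :=
  if θ ≤ z.1 then K31 R z.1 z.2 θ else 0

/-- `K32` cut off at `ν ≤ y`. -/
def K32cut (z : ℝ × ℝ) (ν : ℝ) : Matrix (State n0 n1 n2) (Core 2 n1 n2) ℝ :=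
  if ν ≤ z.2 then K32 R z.1 z.2 ν else 0

/-- `K33` cut off at `θ ≤ x`, `ν ≤ y`. -/
def K33cut (z p : ℝ × ℝ) : Matrix (State n0 n1 n2) (State n0 n1 n2) ℝ :=
  if p.1 ≤ z.1 ∧ p.2 ≤ z.2 then K33 z.1 z.2 p.1 p.2 else 0

theorem matLinf_ite {α ι κ : Type*} [MeasurableSpace α] {μ : Measure α} {M : α → Matrix ι κ ℝ}
    (hM : MatLinf μ M) {P : α → Prop} [DecidablePred P] (hP : MeasurableSet {x | P x}) :
    MatLinf μ fun x => if P x then M x else 0 := fun i j => by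
  refine (MemLp.indicator hP (hM i j)).ae_eq (ae_of_all _ fun p => ?_)
  by_cases h : P p <;> simp [indicator, h]

theorem matLinf_K30 :
    MatLinf R.mu fun p => (K30 R p.1 p.2 : Matrix (State n0 n1 n2) (Core 4 n1 n2) ℝ) := by
  refine matLinf_of_continuous R.isCompact_dom R.mu_ae_mem
    (continuous_stateCore continuous_const fun l => ?_)
  fin_cases l <;> simp <;> fun_prop

theorem prod_ae_mem {α β : Type*} [MeasurableSpace α] [MeasurableSpace β] {μ : Measure α}
    {ν : Measure β} [SFinite ν] {S : Set α} {T : Set β} (hS : ∀ᵐ x ∂μ, x ∈ S)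
    (hT : ∀ᵐ x ∂ν, x ∈ T) : ∀ᵐ x ∂μ.prod ν, x ∈ S ×ˢ T := by
  filter_upwards [Measure.quasiMeasurePreserving_fst.ae hS,
    Measure.quasiMeasurePreserving_snd.ae hT] with p h1 h2 using ⟨h1, h2⟩

theorem matLinf_K31 : MatLinf (R.mu.prod R.mux) fun p =>
    (K31 R p.1.1 p.1.2 p.2 : Matrix (State n0 n1 n2) (Core 2 n1 n2) ℝ) := by
  refine matLinf_of_continuous (R.isCompact_dom.prod isCompact_Icc)
    (prod_ae_mem R.mu_ae_mem R.mux_ae_mem)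
    (continuous_stateCore continuous_const fun l => ?_)
  fin_cases l <;> simp <;> fun_prop

theorem matLinf_K32 : MatLinf (R.mu.prod R.muy) fun p =>
    (K32 R p.1.1 p.1.2 p.2 : Matrix (State n0 n1 n2) (Core 2 n1 n2) ℝ) := by
  refine matLinf_of_continuous (R.isCompact_dom.prod isCompact_Icc)
    (prod_ae_mem R.mu_ae_mem R.muy_ae_mem)
    (continuous_stateCore continuous_const fun l => ?_)
  fin_cases l <;> simp <;> fun_prop

theorem matLinf_K31' : MatLinf (R.mu.prod R.mu) fun p =>
    (K31 R p.1.1 p.1.2 p.2.1 : Matrix (State n0 n1 n2) (Core 2 n1 n2) ℝ) := by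
  refine matLinf_of_continuous (R.isCompact_dom.prod R.isCompact_dom)
    (prod_ae_mem R.mu_ae_mem R.mu_ae_mem)
    (continuous_stateCore continuous_const fun l => ?_)
  fin_cases l <;> simp <;> fun_prop

theorem matLinf_K32' : MatLinf (R.mu.prod R.mu) fun p =>
    (K32 R p.1.1 p.1.2 p.2.2 : Matrix (State n0 n1 n2) (Core 2 n1 n2) ℝ) := by
  refine matLinf_of_continuous (R.isCompact_dom.prod R.isCompact_dom)
    (prod_ae_mem R.mu_ae_mem R.mu_ae_mem)
    (continuous_stateCore continuous_const fun l => ?_)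
  fin_cases l <;> simp <;> fun_prop

theorem matLinf_K33 : MatLinf (R.mu.prod R.mu) fun p =>
    (K33 p.1.1 p.1.2 p.2.1 p.2.2 : Matrix (State n0 n1 n2) (State n0 n1 n2) ℝ) := by
  refine matLinf_of_continuous (R.isCompact_dom.prod R.isCompact_dom)
    (prod_ae_mem R.mu_ae_mem R.mu_ae_mem)
    (continuous_stateDiag continuous_const continuous_const ?_)
  fun_prop

theorem matLinf_K31cut : MatLinf (R.mu.prod R.mux) fun p =>
    (K31cut R p.1 p.2 : Matrix (State n0 n1 n2) (Core 2 n1 n2) ℝ) :=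
  matLinf_ite (matLinf_K31 R) (measurableSet_le measurable_snd measurable_fst.fst)

theorem matLinf_K32cut : MatLinf (R.mu.prod R.muy) fun p =>
    (K32cut R p.1 p.2 : Matrix (State n0 n1 n2) (Core 2 n1 n2) ℝ) :=
  matLinf_ite (matLinf_K32 R) (measurableSet_le measurable_snd measurable_fst.snd)

theorem matLinf_K33cut : MatLinf (R.mu.prod R.mu) fun p =>
    (K33cut p.1 p.2 : Matrix (State n0 n1 n2) (State n0 n1 n2) ℝ) :=
  matLinf_ite (matLinf_K33 R) ((measurableSet_le measurable_snd.fst measurable_fst.fst).inter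
    (measurableSet_le measurable_snd.snd measurable_fst.snd))

variable {R} {v : RL (Core 4 n1 n2) (Core 2 n1 n2)} {uh : ℝ × ℝ → State n0 n1 n2 → ℝ}

theorem integral_K31cut_apply {z : ℝ × ℝ} (hz : z ∈ R.dom)
    (hK : MatL2 R.mux fun θ => (K31cut R z θ : Matrix (State n0 n1 n2) (Core 2 n1 n2) ℝ))
    (hv : MemRL R v) (j : State n0 n1 n2) :
    (∫ θ, K31cut R z θ *ᵥ v.2.1 θ ∂ R.mux) j =
      ∫ θ in R.a..z.1, (K31 R z.1 z.2 θ *ᵥ v.2.1 θ) j := by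
  rw [eval_integral (hK.mulVec_entry_integrable hv.1), intervalIntegral_eq_indicator hz.1]
  simp only [K31cut, ite_mulVec_apply, Rect.mux]

theorem integral_K32cut_apply {z : ℝ × ℝ} (hz : z ∈ R.dom)
    (hK : MatL2 R.muy fun θ => (K32cut R z θ : Matrix (State n0 n1 n2) (Core 2 n1 n2) ℝ))
    (hv : MemRL R v) (j : State n0 n1 n2) :
    (∫ θ, K32cut R z θ *ᵥ v.2.2 θ ∂ R.muy) j =
      ∫ θ in R.c..z.2, (K32 R z.1 z.2 θ *ᵥ v.2.2 θ) j := by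
  rw [eval_integral (hK.mulVec_entry_integrable hv.2), intervalIntegral_eq_indicator hz.2]
  simp only [K32cut, ite_mulVec_apply, Rect.muy]

theorem integral_K33cut_apply {z : ℝ × ℝ} (hz : z ∈ R.dom)
    (hK : MatL2 R.mu fun p => (K33cut z p : Matrix (State n0 n1 n2) (State n0 n1 n2) ℝ))
    (hK' : MatL2 R.mu fun p => (K33 z.1 z.2 p.1 p.2 : Matrix (State n0 n1 n2) (State n0 n1 n2) ℝ))
    (hu : MemL2 R.mu uh) (j : State n0 n1 n2) :
    (∫ p, K33cut z p *ᵥ uh p ∂ R.mu) j =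
      ∫ θ in R.a..z.1, ∫ ν in R.c..z.2, (K33 z.1 z.2 θ ν *ᵥ uh (θ, ν)) j := by
  have h := integral_ite_prod (hK'.mulVec_entry_integrable hu j) (P := fun x => x ≤ z.1)
    (Q := fun x => x ≤ z.2) measurableSet_Iic measurableSet_Iic
  simp only [Rect.mux, Rect.muy] at h
  rw [eval_integral (hK.mulVec_entry_integrable hu)]
  simp only [intervalIntegral_eq_indicator hz.1, intervalIntegral_eq_indicator hz.2, K33cut,
    ite_mulVec_apply, h]

/-- The state as the sum of the operators `K` applied to the core boundary values and to the
fundamental state. -/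
theorem stateRep_ae (hv : MemRL R v) (hu : MemL2 R.mu uh) : ∀ᵐ z ∂ R.mu,
    stateRep R v uh z = stateDiag 1 0 0 *ᵥ uh z +
      (K30 R z.1 z.2 *ᵥ v.1 + ∫ θ, K31cut R z θ *ᵥ v.2.1 θ ∂ R.mux +
        ∫ ν, K32cut R z ν *ᵥ v.2.2 ν ∂ R.muy) + ∫ p, K33cut z p *ᵥ uh p ∂ R.mu := by
  filter_upwards [R.mu_ae_mem, (matLinf_K31cut R (n0 := n0) (n1 := n1) (n2 := n2)).matL2.fiber,
    (matLinf_K32cut R (n0 := n0) (n1 := n1) (n2 := n2)).matL2.fiber,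
    (matLinf_K33cut R (n0 := n0) (n1 := n1) (n2 := n2)).matL2.fiber,
    (matLinf_K33 R (n0 := n0) (n1 := n1) (n2 := n2)).matL2.fiber] with z hz h1 h2 h3 h4
  funext j
  simp only [Pi.add_apply]
  rw [integral_K31cut_apply hz h1 hv, integral_K32cut_apply hz h2 hv,
    integral_K33cut_apply hz h3 h4 hu]
  rcases j with i | i | i
  · simp [K30, K31, K32, K33, stateRep]
  · simp [K30, K31, K32, K33, stateRep, rep1, Jx, Jy, comp1]
  · have e := rep2_00_eq (c := fun m => v.1 (Sum.inr (m, i))) (fun m => hv.1 (Sum.inr (m, i)))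
      (fun m => hv.2 (Sum.inr (m, i))) (memLp_comp2 hu i) hz.1 hz.2
    refine (congrFun (comp2_stateRep v uh i) z).trans (e.trans ?_)
    simp [K30, K31, K32, K33, Fin.sum_univ_four, comp2]

end cut

/-! ## The parameters `T` -/

section TMat

variable {R : Rect} {n0 n1 n2 : ℕ} {B : BCParam n1 n2} {Eh : CoreParam n1 n2}
  {uh : ℝ × ℝ → State n0 n1 n2 → ℝ}

theorem isDParam_GParam (hB : IsN011 R B) (hE : IsN011 R Eh) :
    IsDParam R (GParam R B Eh : DParam _ _ (State n0 n1 n2)) := by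
  rw [GParam_eq, FParam_eq]
  exact isDParam_compD hE (isDParam_compD hB (isDParam_HParam R))

theorem matInt_eq_cut {ι κ : Type*} {s t x : ℝ} (hx : x ∈ Icc s t) (M : ℝ → Matrix ι κ ℝ) :
    matInt s x M = matIntegral (muI s t) fun η => if η ≤ x then M η else 0 := by
  ext i j
  simp only [matInt, matIntegral, Matrix.of_apply, intervalIntegral_eq_indicator hx]
  refine integral_congr_ae (ae_of_all _ fun η => ?_)
  by_cases h : η ≤ x <;> simp [h]

theorem ite_mul_zero {ι κ τ : Type*} [Fintype κ] (c : Prop) [Decidable c] (M : Matrix ι κ ℝ)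
    (N : Matrix κ τ ℝ) : (if c then M else 0) * N = if c then M * N else 0 := by
  split_ifs <;> simp

/-- With `A`, `B` the cut-off kernels `K31cut`, `K32cut`, only the multiplier terms jump at `θ = x`
and `ν = y`. They account for the differences between `T22` and `T12`, `T21`; the remaining terms
are common to all four quadrants. -/
theorem rowKer_eq_add {ρ ι₀ ι₁ τ : Type*} [Fintype ι₀] [Fintype ι₁] (N : Matrix ρ ι₀ ℝ)
    (A B : ℝ → Matrix ρ ι₁ ℝ) (k : DParam ι₀ ι₁ τ) (x y : ℝ) :
    rowKer R N A B k x y = rowKer R N A B { k with k10 := 0, k20 := 0 } x y +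
      (A x * k.k10 x y + B y * k.k20 x y) := by
  simp only [rowKer, Pi.zero_apply, Matrix.mul_zero, add_zero]
  abel

/-- The parameters `G` without the multipliers. -/
def GParam' (R : Rect) (B : BCParam n1 n2) (Eh : CoreParam n1 n2) :
    DParam (Core 4 n1 n2) (Core 2 n1 n2) (State n0 n1 n2) :=
  { GParam R B Eh with k10 := 0, k20 := 0 }

theorem T22_eq {z : ℝ × ℝ} (hz : z ∈ R.dom) (θ ν : ℝ) :
    (T22 R B Eh z.1 z.2 θ ν : Matrix (State n0 n1 n2) (State n0 n1 n2) ℝ) =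
      -rowKer R (K30 R z.1 z.2) (K31cut R z) (K32cut R z) (GParam' R B Eh) θ ν := by
  simp only [T22, rowKer, matInt_eq_cut hz.1, matInt_eq_cut hz.2, K31cut, K32cut, ite_mul_zero,
    GParam', GParam, Pi.zero_apply, Matrix.mul_zero, add_zero, Rect.mux, Rect.muy]
  abel

theorem matL2_rowKer_K {τ : Type*} [Fintype τ] {k : DParam (Core 4 n1 n2) (Core 2 n1 n2) τ}
    (hk : IsDParam R k) : MatL2 (R.mu.prod R.mu) fun p =>
      (rowKer R (K30 R p.1.1 p.1.2) (K31cut R p.1) (K32cut R p.1) k p.2.1 p.2.2 :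
        Matrix (State n0 n1 n2) τ ℝ) := by
  have h1 := (matLinf_K30 (n0 := n0) (n1 := n1) (n2 := n2) R).matL2
  have h2 := (matLinf_K31cut (n0 := n0) (n1 := n1) (n2 := n2) R).matL2
  have h3 := (matLinf_K32cut (n0 := n0) (n1 := n1) (n2 := n2) R).matL2
  have h := matL2_rowKer hk h1 h2 h3
  exact h

theorem matL2_T22 (hB : IsN011 R B) (hE : IsN011 R Eh) : MatL2 (R.mu.prod R.mu) fun p =>
    (T22 R B Eh p.1.1 p.1.2 p.2.1 p.2.2 : Matrix (State n0 n1 n2) (State n0 n1 n2) ℝ) := by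
  have hG := isDParam_GParam (n0 := n0) hB hE
  have hG' : IsDParam R (GParam' R B Eh : DParam _ _ (State n0 n1 n2)) :=
    ⟨hG.k0, matLinf_const _ 0, hG.k11, matLinf_const _ 0, hG.k21⟩
  refine (matL2_rowKer_K hG').neg.congr ?_
  filter_upwards [Measure.quasiMeasurePreserving_fst.ae R.mu_ae_mem] with p hp
  exact (T22_eq hp _ _).symm

theorem isN2D_TMat (hB : IsN011 R B) (hE : IsN011 R Eh) :
    IsN2D R (TMat R B Eh : N2D (State n0 n1 n2) (State n0 n1 n2)) := by
  have hG := isDParam_GParam (n0 := n0) hB hE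
  have h22 := matL2_T22 (n0 := n0) hB hE
  have h12 := ((matLinf_K31' R).mul (hG.k10.snd R.mu)).matL2.neg.add h22
  have h21 := ((matLinf_K32' R).mul (hG.k20.snd R.mu)).matL2.neg.add h22
  exact
  { n00 := matLinf_const _ _
    n10 := matL2_const _ 0
    n20 := matL2_const _ 0
    n01 := matL2_const _ 0
    n02 := matL2_const _ 0
    n11 := (((matLinf_K33 R).matL2.add h21).add h12).sub h22
    n21 := h21
    n12 := h12
    n22 := h22 }

/-- The kernel of `P2D R (TMat R B Eh)`. -/
theorem TMat_kernel {z : ℝ × ℝ} (hz : z ∈ R.dom) (p : ℝ × ℝ) :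
    (if p.1 ≤ z.1 then if p.2 ≤ z.2 then T11 R B Eh z.1 z.2 p.1 p.2 else T12 R B Eh z.1 z.2 p.1 p.2
      else if p.2 ≤ z.2 then T21 R B Eh z.1 z.2 p.1 p.2 else T22 R B Eh z.1 z.2 p.1 p.2 :
      Matrix (State n0 n1 n2) (State n0 n1 n2) ℝ) =
    K33cut z p - rowKer R (K30 R z.1 z.2) (K31cut R z) (K32cut R z) (GParam R B Eh) p.1 p.2 := by
  have h : rowKer R (K30 R z.1 z.2) (K31cut R z) (K32cut R z) (GParam R B Eh) p.1 p.2 =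
      -(T22 R B Eh z.1 z.2 p.1 p.2 : Matrix (State n0 n1 n2) (State n0 n1 n2) ℝ) +
      (K31cut R z p.1 * G10 R B Eh p.1 p.2 + K32cut R z p.2 * G20 R B Eh p.1 p.2) := by
    rw [T22_eq hz, neg_neg]
    exact rowKer_eq_add _ _ _ _ _ _
  have c1 : K31cut R z p.1 * G10 R B Eh p.1 p.2 =
      if p.1 ≤ z.1 then K31 R z.1 z.2 p.1 * G10 R B Eh p.1 p.2 else
        (0 : Matrix (State n0 n1 n2) (State n0 n1 n2) ℝ) := ite_mul_zero _ _ _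
  have c2 : K32cut R z p.2 * G20 R B Eh p.1 p.2 =
      if p.2 ≤ z.2 then K32 R z.1 z.2 p.2 * G20 R B Eh p.1 p.2 else
        (0 : Matrix (State n0 n1 n2) (State n0 n1 n2) ℝ) := ite_mul_zero _ _ _
  rw [h, c1, c2]
  by_cases h1 : p.1 ≤ z.1 <;> by_cases h2 : p.2 ≤ z.2 <;>
    simp only [h1, h2, if_true, if_false, K33cut, T11, T12, T21, and_self, and_false,
      false_and] <;> abel

/-- The four quadrant integrals combine into one integral over the rectangle, with the kernel found
in `TMat_kernel`. Its second term is the row kernel of `K` composed with `G`. -/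
theorem P2D_TMat_ae (hB : IsN011 R B) (hE : IsN011 R Eh) (hu : MemL2 R.mu uh) : ∀ᵐ z ∂ R.mu,
    P2D R (TMat R B Eh) uh z = stateDiag 1 0 0 *ᵥ uh z + (∫ p, K33cut z p *ᵥ uh p ∂ R.mu -
      ∫ p, rowKer R (K30 R z.1 z.2) (K31cut R z) (K32cut R z) (GParam R B Eh) p.1 p.2 *ᵥ uh p
        ∂ R.mu) := by
  have hT := isN2D_TMat (n0 := n0) hB hE
  have hG := isDParam_GParam (n0 := n0) hB hE
  have hr := matL2_rowKer_K (n0 := n0) hG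
  filter_upwards [R.mu_ae_mem, hT.n11.fiber, hT.n12.fiber, hT.n21.fiber, hT.n22.fiber, hr.fiber,
    (matLinf_K33cut R (n0 := n0) (n1 := n1) (n2 := n2)).matL2.fiber] with z hz h11 h12 h21 h22 h h33
  have e := integral_quadrants hz (h11.mulVec_integrable hu) (h12.mulVec_integrable hu)
    (h21.mulVec_integrable hu) (h22.mulVec_integrable hu)
  rw [← integral_sub (h33.mulVec_integrable hu) (h.mulVec_integrable hu)]
  simp only [← Matrix.sub_mulVec, ← TMat_kernel hz]
  refine Eq.trans ?_ (congrArg _ (e.trans (integral_congr_ae (ae_of_all _ fun p => ?_))))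
  · simp [P2D, TMat, add_assoc]
  · simp only [TMat]
    split_ifs <;> rfl

theorem integral_mulVec_neg {α ι κ : Type*} [MeasurableSpace α] [Fintype ι] [Fintype κ]
    {μ : Measure α} {M : α → Matrix ι κ ℝ} {v w : α → κ → ℝ} (h : v =ᵐ[μ] fun x => -w x) :
    ∫ x, M x *ᵥ v x ∂μ = -∫ x, M x *ᵥ w x ∂μ := by
  rw [← integral_neg]
  refine integral_congr_ae (h.mono fun x hx => ?_)
  simp only [hx, Matrix.mulVec_neg]

/-- The operator `T` reconstructs the state whose core boundary values are determined by the
boundary conditions. -/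
theorem stateRep_ae_eq_P2D (hB : IsN011 R B) (hE : IsN011 R Eh) (hu : MemL2 R.mu uh)
    {v : RL (Core 4 n1 n2) (Core 2 n1 n2)} (hv : MemRL R v)
    (e : EqRL R v (-PD R (GParam R B Eh) uh)) :
    stateRep R v uh =ᵐ[R.mu] P2D R (TMat R B Eh) uh := by
  have hG := isDParam_GParam (n0 := n0) hB hE
  filter_upwards [stateRep_ae hv hu, P2D_TMat_ae hB hE hu,
    (matLinf_K31cut R (n0 := n0) (n1 := n1) (n2 := n2)).matL2.fiber,
    (matLinf_K32cut R (n0 := n0) (n1 := n1) (n2 := n2)).matL2.fiber] with z h1 h2 h3 h4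
  rw [h1, h2, ← row_PD hG hu (K30 R z.1 z.2) h3 h4, e.1, integral_mulVec_neg e.2.1,
    integral_mulVec_neg e.2.2, Prod.fst_neg, Matrix.mulVec_neg]
  abel

end TMat

/-! ## The map from the fundamental state to the state -/

section congr

variable {R : Rect} {n0 n1 n2 : ℕ} {u u' uh : ℝ × ℝ → State n0 n1 n2 → ℝ}

theorem MemH.congr {k : ℕ} {f g : ℝ × ℝ → ℝ} (h : MemH R k f) (e : f =ᵐ[R.mu] g) : MemH R k g :=
  ⟨h.1.ae_eq e, fun i j hi hj => (h.2 i j hi hj).imp fun _ hv => hv.congr e .rfl⟩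

theorem comp0_ae (e : u =ᵐ[R.mu] u') (i : Fin n0) : comp0 u i =ᵐ[R.mu] comp0 u' i :=
  e.mono fun p hp => by simp only [comp0, hp]

theorem IsD.congr (h : IsD R u uh) (e : u =ᵐ[R.mu] u') : IsD R u' uh :=
  ⟨h.1, fun i => (h.2.1 i).trans (comp0_ae e i), fun i => (h.2.2.1 i).congr (comp1_ae e i) .rfl,
    fun i => (h.2.2.2 i).congr (comp2_ae e i) .rfl⟩

theorem exists_isD (h0 : ∀ i, MemLp (comp0 u i) 2 R.mu) (h1 : ∀ i, MemH R 1 (comp1 u i))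
    (h2 : ∀ i, MemH R 2 (comp2 u i)) : ∃ uh, IsD R u uh := by
  choose w1 hw1 using fun i => (h1 i).2 1 1 le_rfl le_rfl
  choose w2 hw2 using fun i => (h2 i).2 2 2 le_rfl le_rfl
  let uh : ℝ × ℝ → State n0 n1 n2 → ℝ := fun z j => match j with
    | .inl i => comp0 u i z
    | .inr (.inl i) => w1 i z
    | .inr (.inr i) => w2 i z
  refine ⟨uh, ?_, fun i => .rfl, hw1, hw2⟩
  rintro (i | i | i)
  · exact h0 i
  · exact (hw1 i).1
  · exact (hw2 i).1

end congr

section BH1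

variable {R : Rect} {n0 n1 n2 : ℕ} {B : BCParam n1 n2} {Eh : CoreParam n1 n2}
  {g h : RL (Core 4 n1 n2) (Core 2 n1 n2)} {uh : ℝ × ℝ → State n0 n1 n2 → ℝ}

theorem memRL_P011_H1 (hg : MemRL R g) : MemRL R (P011 R (H1 R) g) :=
  memRL_P011 isN011_H1 separable_H1 hg

theorem BH1_congr (hB : IsN011 R B) (hs : B.Separable R) (hg : MemRL R g) (e : EqRL R g h) :
    EqRL R (BH1 R B g) (BH1 R B h) :=
  P011_congr hB hs (memRL_P011_H1 hg) (P011_congr isN011_H1 separable_H1 hg e)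

theorem memRL_BH1 (hB : IsN011 R B) (hs : B.Separable R) (hg : MemRL R g) :
    MemRL R (BH1 R B g) :=
  memRL_P011 hB hs (memRL_P011_H1 hg)

theorem BH1_eq (hB : IsN011 R B) (hs : B.Separable R) (hg : MemRL R g) :
    EqRL R (BH1 R B g) (S011 R B (S011 R (H1 R) g)) :=
  (P011_eq hB hs (memRL_P011_H1 hg)).trans
    (S011_congr B (P011_eq isN011_H1 separable_H1 hg))

theorem S011_boundaryD (hB : IsN011 R B) (hu : MemL2 R.mu uh) :
    EqRL R (S011 R B (boundaryD R uh)) (PD R (FParam R B) uh) := by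
  rw [← PD_HParam, FParam_eq]
  exact S011_PD hB (isDParam_HParam R) hu

theorem memRL_PD_FParam (hB : IsN011 R B) (hu : MemL2 R.mu uh) :
    MemRL R (PD R (FParam R B) uh) :=
  (memRL_S011 hB (memRL_boundaryD hu)).congr (S011_boundaryD hB hu)

theorem P011_PD_FParam (hB : IsN011 R B) (hE : IsN011 R Eh) (hs : Eh.Separable R)
    (hu : MemL2 R.mu uh) :
    EqRL R (P011 R Eh (-PD R (FParam R B) uh)) (-PD R (GParam R B Eh) uh) := by
  have hF : IsDParam R (FParam R B : DParam _ _ (State n0 n1 n2)) := by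
    rw [FParam_eq]
    exact isDParam_compD hB (isDParam_HParam R)
  refine (P011_eq hE hs (memRL_PD_FParam hB hu).neg).trans ?_
  rw [S011_neg, GParam_eq]
  exact (S011_PD hE hF hu).neg

/-- The boundary conditions as an equation for the core boundary values. -/
theorem P011_boundary (hB : IsN011 R B) (hs : B.Separable R) (hg : MemRL R g)
    (hu : MemL2 R.mu uh) :
    EqRL R (P011 R B (S011 R (H1 R) g + boundaryD R uh))
      (BH1 R B g + PD R (FParam R B) uh) :=
  have h1 := memRL_S011 isN011_H1 hg
  have h2 := memRL_boundaryD hu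
  ((P011_eq hB hs (h1.add h2)).trans (S011_add hB h1 h2)).trans
    ((BH1_eq hB hs hg).symm.add (S011_boundaryD hB hu))

theorem EqRL.eq_neg (e : EqRL R (g + h) 0) : EqRL R g (-h) := by
  have := e.add (EqRL.refl (-h))
  rwa [add_neg_cancel_right, zero_add] at this

/-- Let `v` be the core data of `u`. The boundary condition says that `BH₁` maps `v` to `-Fû`, and
the left inverse property of `Eh` gives `v = -Gû`. -/
theorem ae_eq_P2D_of_memX (hB : IsN011 R B) (hs : B.Separable R) (hE : IsInverse R B Eh)
    {u : ℝ × ℝ → State n0 n1 n2 → ℝ} (hX : MemX R B u) (hD : IsD R u uh) :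
    u =ᵐ[R.mu] P2D R (TMat R B Eh) uh := by
  obtain ⟨-, h1, h2, β, hβ, hβ0⟩ := hX
  obtain ⟨v, hv, e⟩ := exists_stateRep h1 h2 hD
  have hb := (isBoundary_stateRep hv hD.1).congr e.symm
  have h0 := ((P011_boundary hB hs hv hD.1).symm.trans
    (P011_congr hB hs hb.mem (hb.unique hβ))).trans hβ0
  refine e.trans (stateRep_ae_eq_P2D hB hE.mem hD.1 hv ?_)
  exact ((hE.left v hv).symm.trans (P011_congr hE.mem hE.sep (memRL_BH1 hB hs hv)
    h0.eq_neg)).trans (P011_PD_FParam hB hE.mem hE.sep hD.1)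

/-- Prescribe the core data `v = -Gû`. The right inverse property of `Eh` makes `BH₁v + Fû` vanish,
so the state with core data `v` and fundamental state `û` satisfies the boundary conditions. -/
theorem memX_P2D (hB : IsN011 R B) (hs : B.Separable R) (hE : IsInverse R B Eh)
    (hu : MemL2 R.mu uh) :
    MemX R B (P2D R (TMat R B Eh) uh) ∧ IsD R (P2D R (TMat R B Eh) uh) uh := by
  have hF := (memRL_PD_FParam hB hu).neg
  have eG := P011_PD_FParam hB hE.mem hE.sep hu
  have hv := (memRL_P011 hE.mem hE.sep hF).congr eG
  have e := stateRep_ae_eq_P2D hB hE.mem hu hv (EqRL.refl _)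
  have hD := (isD_stateRep hv hu).congr e
  refine ⟨⟨fun i => (hu (Sum.inl i)).ae_eq (hD.2.1 i), fun i => (memH_rep1 hv hu i).congr
    (comp1_ae e i), fun i => (memH_rep2 hv hu i).congr (comp2_ae e i), _,
    (isBoundary_stateRep hv hu).congr e, ?_⟩, hD⟩
  have h1 := (BH1_congr hB hs hv eG.symm).trans (hE.right _ hF)
  have h2 := (P011_boundary hB hs hv hu).trans (h1.add (EqRL.refl _))
  rwa [neg_add_cancel] at h2

end BH1

/-! ## Integral operators between `L2` spaces -/

section kernel

variable {α β : Type*} [MeasurableSpace α] [MeasurableSpace β] {μ : Measure α} {ν : Measure β}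

/-- The integral operator whose kernel has the columns `b`. -/
def kerOp (b : Lp (Lp ℝ 2 μ) 2 ν) : Lp ℝ 2 ν →L[ℝ] Lp ℝ 2 μ :=
  ((ContinuousLinearMap.lsmul ℝ ℝ : ℝ →L[ℝ] Lp ℝ 2 μ →L[ℝ] Lp ℝ 2 μ).lpPairing ν 2 2).flip b

/-- As a Bochner integral of columns, the operator can be composed with any bounded operator column
by column. -/
theorem kerOp_apply (b : Lp (Lp ℝ 2 μ) 2 ν) (u : Lp ℝ 2 ν) : kerOp b u = ∫ t, u t • b t ∂ν := by
  rw [kerOp, ContinuousLinearMap.flip_apply, ContinuousLinearMap.lpPairing_eq_integral]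
  rfl

theorem integrable_smul_columns (b : Lp (Lp ℝ 2 μ) 2 ν) (u : Lp ℝ 2 ν) :
    Integrable (fun t => u t • b t) ν :=
  memLp_one_iff_integrable.1 ((Lp.memLp b).smul (Lp.memLp u))

theorem exists_columns [MeasurableSpace.CountablyGenerated α] [SFinite μ] [SFinite ν]
    {k : α × β → ℝ} (hk : MemLp k 2 (μ.prod ν)) :
    ∃ b : Lp (Lp ℝ 2 μ) 2 ν, ∀ᵐ t ∂ν, b t =ᵐ[μ] fun s => k (s, t) := by
  obtain ⟨b, hb, h⟩ := exists_curry (memLp_two_swap hk)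
  refine ⟨hb.toLp b, ?_⟩
  filter_upwards [h, hb.coeFn_toLp] with t h1 h2
  rwa [h2]

/-- Both sides have the same inner product with every `w`: on the left it passes under the Bochner
integral, and on the right Fubini (`integral_comp_swap`) applies. -/
theorem kerOp_ae [MeasurableSpace.CountablyGenerated β] [SFinite μ] [SFinite ν]
    {k : α × β → ℝ} (hk : MemLp k 2 (μ.prod ν)) {b : Lp (Lp ℝ 2 μ) 2 ν}
    (hb : ∀ᵐ t ∂ν, b t =ᵐ[μ] fun s => k (s, t)) (u : Lp ℝ 2 ν) :
    kerOp b u =ᵐ[μ] fun s => ∫ t, k (s, t) * u t ∂ν := by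
  have h2 := memLp_integral_mul hk (Lp.memLp u)
  refine EventuallyEq.trans ?_ h2.coeFn_toLp
  suffices h : kerOp b u = h2.toLp _ by rw [h]
  refine ext_inner_left ℝ fun w => ?_
  have e1 : inner ℝ w (kerOp b u) = ∫ t, inner ℝ w (u t • b t) ∂ν := by
    rw [kerOp_apply]
    exact ((innerSL ℝ w).integral_comp_comm (integrable_smul_columns b u)).symm
  have e2 : ∫ t, inner ℝ w (u t • b t) ∂ν = ∫ t, (∫ s, w s * k (s, t) ∂μ) * u t ∂ν := by
    refine integral_congr_ae ?_
    filter_upwards [hb] with t ht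
    rw [inner_smul_right, L2.inner_def, mul_comm]
    congr 1
    refine integral_congr_ae ?_
    filter_upwards [ht] with s hs
    simp [hs, mul_comm]
  rw [e1, e2, ← (integral_comp_swap (Lp.memLp w) hk (Lp.memLp u)).2, L2.inner_def]
  refine integral_congr_ae ?_
  filter_upwards [h2.coeFn_toLp] with s hs
  simp [hs, mul_comm]

/-- Integral operators with square-integrable kernels are small on functions that are constant on a
set of small measure and vanish elsewhere. -/
theorem exists_norm_kerOp_indicator_le [IsFiniteMeasure ν] (b : Lp (Lp ℝ 2 μ) 2 ν) {ε : ℝ}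
    (hε : 0 < ε) : ∃ δ > 0, ∀ (D : Set β) (hD : MeasurableSet D) (c : ℝ),
      ν D ≤ ENNReal.ofReal δ →
      ‖kerOp b (indicatorConstLp 2 hD (measure_ne_top ν D) c)‖ ≤
        ε * ‖indicatorConstLp 2 hD (measure_ne_top ν D) c‖ := by
  set P := (ContinuousLinearMap.lsmul ℝ ℝ : ℝ →L[ℝ] Lp ℝ 2 μ →L[ℝ] Lp ℝ 2 μ).lpPairing ν 2 2
    with hP
  have hC : 0 < ‖P‖ + 1 := by positivity
  -- Absolute continuity of the integral: the columns restricted to a small set `D` have small norm,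
  -- and a function supported in `D` sees only these columns.
  obtain ⟨δ, hδ, h⟩ := (Lp.memLp b).eLpNorm_indicator_le one_le_two ENNReal.ofNat_ne_top
    (div_pos hε hC)
  refine ⟨δ, hδ, fun D hD c hDδ => ?_⟩
  set e := indicatorConstLp 2 hD (measure_ne_top ν D) c with he
  have hb' := (Lp.memLp b).indicator hD
  have e1 : kerOp b e = P e (hb'.toLp _) := by
    rw [kerOp_apply, hP, ContinuousLinearMap.lpPairing_eq_integral]
    refine integral_congr_ae ?_
    have h1 : e =ᵐ[ν] D.indicator fun _ => c := indicatorConstLp_coeFn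
    filter_upwards [h1, hb'.coeFn_toLp] with t h1 h2
    rw [h1, h2]
    by_cases ht : t ∈ D <;> simp [ht]
  have e2 : ‖hb'.toLp _‖ ≤ ε / (‖P‖ + 1) := by
    rw [Lp.norm_toLp]
    exact ENNReal.toReal_le_of_le_ofReal (by positivity) (h D hD hDδ)
  rw [e1]
  calc _ ≤ ‖P‖ * ‖e‖ * ‖hb'.toLp _‖ := P.le_opNorm₂ _ _
    _ ≤ (‖P‖ + 1) * ‖e‖ * (ε / (‖P‖ + 1)) := by gcongr; linarith
    _ = ε * ‖e‖ := by field_simp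

/-- Multiplication by an essentially bounded function. -/
def mulOp {r : α → ℝ} (hr : MemLp r ⊤ μ) : Lp ℝ 2 μ →L[ℝ] Lp ℝ 2 μ :=
  (ContinuousLinearMap.mul ℝ ℝ).holderL μ ⊤ 2 2 (hr.toLp r)

theorem mulOp_ae {r : α → ℝ} (hr : MemLp r ⊤ μ) (u : Lp ℝ 2 μ) :
    mulOp hr u =ᵐ[μ] fun s => r s * u s := by
  have h : mulOp hr u =ᵐ[μ] fun s => (ContinuousLinearMap.mul ℝ ℝ) (hr.toLp r s) (u s) :=
    (ContinuousLinearMap.mul ℝ ℝ).coeFn_holder (r := 2) _ _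
  filter_upwards [h, hr.coeFn_toLp] with s h1 h2
  rw [h1, h2]
  rfl

end kernel

/-! ### The inverse of the identity plus a Hilbert-Schmidt operator -/

section inverse

variable {J : Type*} [Fintype J] {m : J → Measure ℝ}

/-- The integral operator with columns `b` on a finite product of `L2` spaces. -/
def kerOpPi (b : ∀ i j, Lp (Lp ℝ 2 (m i)) 2 (m j)) :
    (∀ j, Lp ℝ 2 (m j)) →L[ℝ] ∀ j, Lp ℝ 2 (m j) :=
  ContinuousLinearMap.pi fun i => ∑ j, kerOp (b i j) ∘L ContinuousLinearMap.proj j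

theorem kerOpPi_apply (b : ∀ i j, Lp (Lp ℝ 2 (m i)) 2 (m j)) (u : ∀ j, Lp ℝ 2 (m j)) (i : J) :
    kerOpPi b u i = ∑ j, kerOp (b i j) (u j) := by
  simp [kerOpPi]

theorem coeFn_sum {ι α : Type*} [MeasurableSpace α] {μ : Measure α} (s : Finset ι)
    (f : ι → Lp ℝ 2 μ) : (∑ i ∈ s, f i : Lp ℝ 2 μ) =ᵐ[μ] fun x => ∑ i ∈ s, f i x := by
  classical
  induction s using Finset.induction_on with
  | empty => simp only [Finset.sum_empty]; exact Lp.coeFn_zero ℝ 2 μ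
  | insert i s hi ih =>
    rw [Finset.sum_insert hi]
    filter_upwards [Lp.coeFn_add (f i) (∑ i ∈ s, f i), ih] with x h1 h2
    rw [h1, Pi.add_apply, h2, Finset.sum_insert hi]

variable [∀ j, IsFiniteMeasure (m j)]

theorem kerOpPi_ae {k : J → J → ℝ × ℝ → ℝ} (hk : ∀ i j, MemLp (k i j) 2 ((m i).prod (m j)))
    {b : ∀ i j, Lp (Lp ℝ 2 (m i)) 2 (m j)}
    (hb : ∀ i j, ∀ᵐ t ∂m j, b i j t =ᵐ[m i] fun s => k i j (s, t)) (u : ∀ j, Lp ℝ 2 (m j))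
    (i : J) : kerOpPi b u i =ᵐ[m i] fun s => ∑ j, ∫ t, k i j (s, t) * u j t ∂m j := by
  rw [kerOpPi_apply]
  filter_upwards [coeFn_sum Finset.univ fun j => kerOp (b i j) (u j),
    ae_all_iff.2 fun j => kerOp_ae (hk i j) (hb i j) (u j)] with s h1 h2
  rw [h1]
  exact Finset.sum_congr rfl fun j _ => h2 j

/-- The inverse of the identity plus an integral operator is the identity plus an integral
operator. -/
theorem exists_kernel_inverse {k : J → J → ℝ × ℝ → ℝ}
    (hk : ∀ i j, MemLp (k i j) 2 ((m i).prod (m j)))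
    (hinj : ∀ u : ∀ j, Lp ℝ 2 (m j),
      (∀ i, ∀ᵐ s ∂m i, u i s + ∑ j, ∫ t, k i j (s, t) * u j t ∂m j = 0) → u = 0)
    (hsurj : ∀ f : ∀ j, Lp ℝ 2 (m j), ∃ u : ∀ j, Lp ℝ 2 (m j),
      ∀ i, ∀ᵐ s ∂m i, u i s + ∑ j, ∫ t, k i j (s, t) * u j t ∂m j = f i s) :
    ∃ w : J → J → ℝ × ℝ → ℝ, (∀ i j, MemLp (w i j) 2 ((m i).prod (m j))) ∧
      (∀ u f : ∀ j, Lp ℝ 2 (m j),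
        (∀ i, ∀ᵐ s ∂m i, u i s + ∑ j, ∫ t, k i j (s, t) * u j t ∂m j = f i s) →
        ∀ i, ∀ᵐ s ∂m i, f i s + ∑ j, ∫ t, w i j (s, t) * f j t ∂m j = u i s) := by
  choose b hb using fun i j => exists_columns (hk i j)
  choose a ha hak using fun i j => exists_curry (hk i j)
  set K := kerOpPi b with hK
  have hKae := kerOpPi_ae hk hb
  have hiff : ∀ u f : ∀ j, Lp ℝ 2 (m j), u + K u = f ↔
      ∀ i, ∀ᵐ s ∂m i, u i s + ∑ j, ∫ t, k i j (s, t) * u j t ∂m j = f i s := by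
    intro u f
    rw [funext_iff]
    refine forall_congr' fun i => ?_
    have e : ⇑((u + K u) i) =ᵐ[m i] fun s => u i s + ∑ j, ∫ t, k i j (s, t) * u j t ∂m j := by
      filter_upwards [Lp.coeFn_add (u i) (K u i), hKae u i] with s h1 h2
      rw [Pi.add_apply, h1, Pi.add_apply, h2]
    rw [Lp.ext_iff]
    exact ⟨fun h => e.symm.trans h, fun h => e.trans h⟩
  have hbij : Function.Bijective (1 + K : (∀ j, Lp ℝ 2 (m j)) →L[ℝ] ∀ j, Lp ℝ 2 (m j)) := by
    constructor
    · refine (injective_iff_map_eq_zero _).2 fun u hu => hinj u fun i => ?_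
      filter_upwards [(hiff u 0).1 hu i, Lp.coeFn_zero ℝ 2 (m i)] with s h1 h2
      exact h1.trans h2
    · exact fun f => (hsurj f).imp fun u hu => (hiff u f).2 hu
  -- The inverse `L` of `1 + K` is bounded by the open mapping theorem.
  let e := ContinuousLinearEquiv.ofBijective (1 + K)
    (LinearMap.ker_eq_bot.2 hbij.1) (LinearMap.range_eq_top.2 hbij.2)
  set L : (∀ j, Lp ℝ 2 (m j)) →L[ℝ] ∀ j, Lp ℝ 2 (m j)   := e.symm.toContinuousLinearMap
  have hLK : ∀ u, L (u + K u) = u := fun u => e.symm_apply_apply u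
  have hKL : ∀ f, L f + K (L f) = f := fun f => e.apply_symm_apply f
  -- The columns of `LK`: the bounded operator `L` applied to the columns of `K`.
  let c : ∀ (l j : J), ℝ → Lp ℝ 2 (m l) := fun l j t => L (fun i => b i j t) l
  have hc : ∀ l j, MemLp (c l j) 2 (m j) := fun l j => by
    have h : MemLp (fun t => fun i => b i j t) 2 (m j) :=
      MemLp.of_eval fun i => Lp.memLp (b i j)
    exact ((ContinuousLinearMap.proj l).comp L).comp_memLp' h
  have hLKf : ∀ (f : ∀ j, Lp ℝ 2 (m j)) l, L (K f) l = ∑ j, ∫ t, f j t • c l j t ∂m j := by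
    intro f l
    have e1 : K f = ∑ j, ∫ t, f j t • (fun i => b i j t) ∂m j := by
      funext i
      rw [hK, kerOpPi_apply, Finset.sum_apply]
      refine Finset.sum_congr rfl fun j _ => ?_
      rw [kerOp_apply]
      exact (eval_integral (fun i => integrable_smul_columns (b i j) (f j)) i).symm
    rw [e1, map_sum, Finset.sum_apply]
    refine Finset.sum_congr rfl fun j _ => ?_
    have hi : Integrable (fun t => f j t • (fun i => b i j t)) (m j) :=
      Integrable.of_eval fun i => integrable_smul_columns (b i j) (f j)
    have := (((ContinuousLinearMap.proj l).comp L).integral_comp_comm hi).symm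
    refine this.trans (integral_congr_ae (ae_of_all _ fun t => ?_))
    simp [c]
  -- The kernel of `-K + KLK`, since `L = 1 - K + KLK`. The second term pairs rows `a` of `K` with
  -- columns `c` of `LK`, which makes it square-integrable although `L` itself has no kernel.
  refine ⟨fun i j p => -k i j p + ∑ l, inner ℝ (a i l p.1) (c l j p.2), fun i j =>
    (hk i j).neg.add (memLp_finsetSum _ fun l _ => memLp_two_inner (ha i l) (hc l j)), ?_⟩
  intro u f huf i
  -- From `L + KL = 1` follows `L = 1 - KL`, and from `L + LK = 1` follows `KL = K - KLK`.
  have hu : u = f - K f + K (L (K f)) := by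
    have h1 : L f = u := by rw [← (hiff u f).2 huf, hLK]
    have h2 := hKL f
    have h3 := hLK f
    rw [map_add] at h3
    have h4 : K (L f) + K (L (K f)) = K f := by rw [← map_add, h3]
    rw [← h1, sub_add, sub_eq_of_eq_add h4.symm]
    exact eq_sub_of_add_eq h2
  have e1 : K (L (K f)) i =ᵐ[m i] fun s =>
      ∑ j, ∫ t, (∑ l, inner ℝ (a i l s) (c l j t)) * f j t ∂m j := by
    filter_upwards [hKae (L (K f)) i, ae_all_iff.2 fun j => hak i j] with s h1 h2
    have hi : ∀ l j, Integrable (fun t => f j t • c l j t) (m j) := fun l j =>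
      memLp_one_iff_integrable.1 ((hc l j).smul (Lp.memLp (f j)))
    have e2 : ∀ l, ∫ t, k i l (s, t) * L (K f) l t ∂m l =
        ∑ j, ∫ t, inner ℝ (a i l s) (c l j t) * f j t ∂m j := fun l => by
      have e3 : ∫ t, k i l (s, t) * L (K f) l t ∂m l = inner ℝ (a i l s) (L (K f) l) := by
        rw [L2.inner_def]
        refine integral_congr_ae ?_
        filter_upwards [h2 l] with t ht
        simp [ht, mul_comm]
      rw [e3, hLKf, inner_sum]
      refine Finset.sum_congr rfl fun j _ => ?_
      have e4 := ((innerSL ℝ (a i l s)).integral_comp_comm (hi l j)).symm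
      refine e4.trans (integral_congr_ae (ae_of_all _ fun t => ?_))
      simp [mul_comm]
    rw [h1]
    simp only [e2]
    rw [Finset.sum_comm]
    refine Finset.sum_congr rfl fun j _ => ?_
    simp only [Finset.sum_mul]
    rw [integral_finsetSum]
    intro l _
    refine ((hi l j).const_inner (a i l s)).congr (ae_of_all _ fun t => ?_)
    simp [inner_smul_right, mul_comm]
  have hfib := ae_all_iff.2 fun j => memLp_two_fiber (hk i j)
  have hfib' := ae_all_iff.2 fun j => memLp_two_fiber (memLp_finsetSum (μ := (m i).prod (m j))
    (p := 2) Finset.univ fun l _ => memLp_two_inner (ha i l) (hc l j))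
  rw [hu]
  filter_upwards [e1, hKae f i, hfib, hfib', Lp.coeFn_add ((f - K f) i) (K (L (K f)) i),
    Lp.coeFn_sub (f i) (K f i)] with s h1 h2 h3 h4 h5 h6
  have h7 : ((f - K f + K (L (K f))) i) s = f i s - K f i s + K (L (K f)) i s :=
    h5.trans (congrArg₂ (· + ·) h6 rfl)
  rw [h7, h1, h2, sub_add, ← Finset.sum_sub_distrib, sub_eq_add_neg, ← Finset.sum_neg_distrib]
  congr 1
  refine Finset.sum_congr rfl fun j _ => ?_
  rw [neg_sub, sub_eq_neg_add, ← integral_neg, ← integral_add]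
  · refine integral_congr_ae (ae_of_all _ fun t => ?_)
    simp only
    ring
  · exact (memLp_two_mul_integrable (h3 j) (Lp.memLp (f j))).neg
  · exact memLp_two_mul_integrable (h4 j) (Lp.memLp (f j))

end inverse

/-! ## 011-PI operators on a product of scalar `L2` spaces -/

section components

variable {R : Rect} {ι₀ ι₁ : Type*}

/-- The measures of the components of `RL ι₀ ι₁`. -/
def muJ (R : Rect) : ι₀ ⊕ (ι₁ ⊕ ι₁) → Measure ℝ
  | .inl _ => Measure.dirac 0
  | .inr (.inl _) => R.mux
  | .inr (.inr _) => R.muy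

instance (j : ι₀ ⊕ (ι₁ ⊕ ι₁)) : IsFiniteMeasure (muJ R j) :=
  match j with
  | .inl _ => inferInstanceAs (IsFiniteMeasure (Measure.dirac (0 : ℝ)))
  | .inr (.inl _) => inferInstanceAs (IsFiniteMeasure R.mux)
  | .inr (.inr _) => inferInstanceAs (IsFiniteMeasure R.muy)

/-- The scalar components. -/
def comp (g : RL ι₀ ι₁) : ι₀ ⊕ (ι₁ ⊕ ι₁) → ℝ → ℝ
  | .inl i => fun _ => g.1 i
  | .inr (.inl i) => fun x => g.2.1 x i
  | .inr (.inr i) => fun y => g.2.2 y i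

/-- The triple with given scalar components. -/
def ofComp (u : ι₀ ⊕ (ι₁ ⊕ ι₁) → ℝ → ℝ) : RL ι₀ ι₁ :=
  (fun i => u (.inl i) 0, fun x i => u (.inr (.inl i)) x, fun y i => u (.inr (.inr i)) y)

/-- A scalar is modelled as an `L2` function for the point mass at `0`, so that vector entries and
edge functions become components of the same kind. Values away from `0` are irrelevant there. -/
theorem comp_ofComp (u : ι₀ ⊕ (ι₁ ⊕ ι₁) → ℝ → ℝ) (j : ι₀ ⊕ (ι₁ ⊕ ι₁)) :
    comp (ofComp u) j =ᵐ[muJ R j] u j := by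
  rcases j with j | j | j
  · rw [EventuallyEq, muJ, ae_dirac_eq]
    exact eventually_pure.2 rfl
  · exact .rfl
  · exact .rfl

theorem eqRL_iff_comp [Finite ι₁] {f g : RL ι₀ ι₁} :
    EqRL R f g ↔ ∀ j, comp f j =ᵐ[muJ R j] comp g j := by
  constructor
  · rintro ⟨h0, h1, h2⟩ (j | j | j)
    · exact ae_of_all _ fun _ => congrFun h0 j
    · exact h1.mono fun x hx => congrFun hx j
    · exact h2.mono fun x hx => congrFun hx j
  · intro h
    refine ⟨funext fun i => ?_, ?_, ?_⟩
    · have h0 : ∀ᵐ _ ∂Measure.dirac (0 : ℝ), f.1 i = g.1 i := h (.inl i)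
      exact h0.exists.choose_spec
    · filter_upwards [ae_all_iff.2 fun i => h (.inr (.inl i))] with x hx
      exact funext hx
    · filter_upwards [ae_all_iff.2 fun i => h (.inr (.inr i))] with x hx
      exact funext hx

theorem memRL_iff_comp {g : RL ι₀ ι₁} : MemRL R g ↔ ∀ j, MemLp (comp g j) 2 (muJ R j) := by
  constructor
  · rintro ⟨h1, h2⟩ (j | j | j)
    · exact memLp_const _
    · exact h1 j
    · exact h2 j
  · exact fun h => ⟨fun i => h (.inr (.inl i)), fun i => h (.inr (.inr i))⟩

theorem memRL_ofComp (u : ∀ j : ι₀ ⊕ (ι₁ ⊕ ι₁), Lp ℝ 2 (muJ R j)) :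
    MemRL R (ofComp fun j => u j) :=
  memRL_iff_comp.2 fun j => (Lp.memLp (u j)).ae_eq (comp_ofComp _ j).symm

theorem exists_lp (g : RL ι₀ ι₁) (hg : MemRL R g) :
    ∃ u : ∀ j : ι₀ ⊕ (ι₁ ⊕ ι₁), Lp ℝ 2 (muJ R j), ∀ j, u j =ᵐ[muJ R j] comp g j :=
  ⟨fun j => (memRL_iff_comp.1 hg j).toLp _, fun _ => MemLp.coeFn_toLp _⟩

/-- The scalar kernels of 011-PI parameters. -/
def kerJ (N : N011 ι₀ ι₁ ι₀ ι₁) : ι₀ ⊕ (ι₁ ⊕ ι₁) → ι₀ ⊕ (ι₁ ⊕ ι₁) → ℝ × ℝ → ℝ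
  | .inl i, .inl j => fun _ => N.z00 i j
  | .inl i, .inr (.inl j) => fun p => N.z0x p.2 i j
  | .inl i, .inr (.inr j) => fun p => N.z0y p.2 i j
  | .inr (.inl i), .inl j => fun p => N.x0 p.1 i j
  | .inr (.inl i), .inr (.inl j) => fun p => N.xx.r1 p.1 p.2 i j
  | .inr (.inl i), .inr (.inr j) => fun p => N.xy p.1 p.2 i j
  | .inr (.inr i), .inl j => fun p => N.y0 p.1 i j
  | .inr (.inr i), .inr (.inl j) => fun p => N.yx p.2 p.1 i j
  | .inr (.inr i), .inr (.inr j) => fun p => N.yy.r1 p.1 p.2 i j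

variable {N : N011 ι₀ ι₁ ι₀ ι₁} {g : RL ι₀ ι₁}

theorem memLp_kerJ (hN : IsN011 R N) (i j : ι₀ ⊕ (ι₁ ⊕ ι₁)) :
    MemLp (kerJ N i j) 2 ((muJ R i).prod (muJ R j)) := by
  rcases i with i | i | i <;> rcases j with j | j | j
  · exact memLp_const _
  · exact (hN.z0x i j).comp_snd _
  · exact (hN.z0y i j).comp_snd _
  · exact (hN.x0 i j).comp_fst _
  · exact hN.xx.2.1 i j
  · exact hN.xy i j
  · exact (hN.y0 i j).comp_fst _
  · exact MatL2.swap hN.yx i j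
  · exact hN.yy.2.1 i j

variable [Fintype ι₁]

/-- The multiplicative part of a 011-PI operator. -/
def mulJ (N : N011 ι₀ ι₁ ι₀ ι₁) (g : RL ι₀ ι₁) : RL ι₀ ι₁ :=
  (0, fun x => N.xx.r0 x *ᵥ g.2.1 x, fun y => N.yy.r0 y *ᵥ g.2.2 y)

/-- The multiplicative part of a 011-PI operator as a bounded operator. -/
def mulOpJ (hN : IsN011 R N) :
    (∀ j : ι₀ ⊕ (ι₁ ⊕ ι₁), Lp ℝ 2 (muJ R j)) →L[ℝ] ∀ j : ι₀ ⊕ (ι₁ ⊕ ι₁), Lp ℝ 2 (muJ R j) :=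
  ContinuousLinearMap.pi fun i => match i with
    | .inl _ => 0
    | .inr (.inl i) => ∑ j, mulOp (hN.xx.1 i j) ∘L
        (ContinuousLinearMap.proj (φ := fun j : ι₀ ⊕ (ι₁ ⊕ ι₁) => Lp ℝ 2 (muJ R j)) (.inr (.inl j)))
    | .inr (.inr i) => ∑ j, mulOp (hN.yy.1 i j) ∘L
        (ContinuousLinearMap.proj (φ := fun j : ι₀ ⊕ (ι₁ ⊕ ι₁) => Lp ℝ 2 (muJ R j)) (.inr (.inr j)))

theorem mulOpJ_ae (hN : IsN011 R N) (u : ∀ j : ι₀ ⊕ (ι₁ ⊕ ι₁), Lp ℝ 2 (muJ R j))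
    (i : ι₀ ⊕ (ι₁ ⊕ ι₁)) :
    mulOpJ hN u i =ᵐ[muJ R i] comp (mulJ N (ofComp fun j => u j)) i := by
  rcases i with i | i | i
  · exact Lp.coeFn_zero _ _ _
  · have e : mulOpJ hN u (.inr (.inl i)) = ∑ j, mulOp (hN.xx.1 i j) (u (.inr (.inl j))) := by
      simp only [mulOpJ, ContinuousLinearMap.pi_apply]
      exact sum_apply _ _ _
    have h1 := coeFn_sum Finset.univ fun j => mulOp (hN.xx.1 i j) (u (.inr (.inl j)))
    have h2 := ae_all_iff.2 fun j => mulOp_ae (hN.xx.1 i j) (u (.inr (.inl j)))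
    rw [e]
    exact h1.trans (h2.mono fun s h2 => Finset.sum_congr rfl fun j _ => h2 j)
  · have e : mulOpJ hN u (.inr (.inr i)) = ∑ j, mulOp (hN.yy.1 i j) (u (.inr (.inr j))) := by
      simp only [mulOpJ, ContinuousLinearMap.pi_apply]
      exact sum_apply _ _ _
    have h1 := coeFn_sum Finset.univ fun j => mulOp (hN.yy.1 i j) (u (.inr (.inr j)))
    have h2 := ae_all_iff.2 fun j => mulOp_ae (hN.yy.1 i j) (u (.inr (.inr j)))
    rw [e]
    exact h1.trans (h2.mono fun s h2 => Finset.sum_congr rfl fun j _ => h2 j)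

variable [Fintype ι₀]

theorem comp_S011 (hN : IsN011 R N) (hg : MemRL R g) (i : ι₀ ⊕ (ι₁ ⊕ ι₁)) :
    comp (S011 R N g) i =ᵐ[muJ R i] fun s => comp (mulJ N g) i s +
      ∑ j, ∫ t, kerJ N i j (s, t) * comp g j t ∂muJ R j := by
  rcases i with i | i | i
  · refine ae_of_all _ fun s => ?_
    simp only [Fintype.sum_sum_type]
    simp only [comp, S011, mulJ, kerJ, muJ, Pi.add_apply, Pi.zero_apply, integral_dirac, zero_add]
    rw [integral_mulVec_apply hN.z0x hg.1, integral_mulVec_apply hN.z0y hg.2, add_assoc]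
    rfl
  · have h1 := hN.xx.2.1.fiber
    filter_upwards [h1, MatL2.fiber hN.xy] with s h1 h2
    have h1 : MatL2 R.mux fun t => N.xx.r1 s t := h1
    simp only [Fintype.sum_sum_type]
    simp only [comp, S011, mulJ, kerJ, muJ, Pi.add_apply, integral_dirac]
    rw [integral_mulVec_apply h1 hg.1, integral_mulVec_apply h2 hg.2]
    simp only [Matrix.mulVec, dotProduct]
    abel
  · have h1 := hN.yy.2.1.fiber
    filter_upwards [h1, (MatL2.swap hN.yx).fiber] with s h1 h2
    have h1 : MatL2 R.muy fun t => N.yy.r1 s t := h1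
    simp only [Fintype.sum_sum_type]
    simp only [comp, S011, mulJ, kerJ, muJ, Pi.add_apply, integral_dirac]
    rw [integral_mulVec_apply h1 hg.2, integral_mulVec_apply h2 hg.1]
    simp only [Matrix.mulVec, dotProduct]
    abel

/-- The operator `S011 R N` is bijective. -/
structure BijS011 (R : Rect) (N : N011 ι₀ ι₁ ι₀ ι₁) : Prop where
  inj : ∀ g, MemRL R g → EqRL R (S011 R N g) 0 → EqRL R g 0
  surj : ∀ f, MemRL R f → ∃ g, MemRL R g ∧ EqRL R (S011 R N g) f

/-- A bijective 011-PI operator is bounded below. -/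
theorem exists_norm_le (hN : IsN011 R N) (hb : BijS011 R N) :
    ∃ (b : ∀ i j : ι₀ ⊕ (ι₁ ⊕ ι₁), Lp (Lp ℝ 2 (muJ R i)) 2 (muJ R j)) (C : ℝ), 0 < C ∧
      ∀ u, ‖u‖ ≤ C * ‖mulOpJ hN u + kerOpPi b u‖ := by
  choose b hbk using fun i j => exists_columns (memLp_kerJ (R := R) hN i j)
  refine ⟨b, ?_⟩
  set E := mulOpJ hN + kerOpPi b with hE
  have hEu : ∀ u i, E u i =ᵐ[muJ R i] comp (S011 R N (ofComp fun j => u j)) i := by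
    intro u i
    have hu := memRL_ofComp u
    filter_upwards [Lp.coeFn_add (mulOpJ hN u i) (kerOpPi b u i), mulOpJ_ae hN u i,
      kerOpPi_ae (memLp_kerJ hN) hbk u i, comp_S011 hN hu i] with s h1 h2 h3 h4
    rw [h4, ← h2]
    refine h1.trans ?_
    rw [Pi.add_apply, h3]
    congr 1
    refine Finset.sum_congr rfl fun j _ => integral_congr_ae ?_
    filter_upwards [comp_ofComp (R := R) (fun j => u j) j] with t ht
    rw [ht]
  have hbij : Function.Bijective E := by
    constructor
    · refine (injective_iff_map_eq_zero _).2 fun u hu => ?_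
      have h := hb.inj _ (memRL_ofComp u) (eqRL_iff_comp.2 fun i => by
        refine (hEu u i).symm.trans ?_
        rw [hu]
        refine (Lp.coeFn_zero _ _ _).trans ?_
        rcases i with i | i | i <;> rfl)
      funext i
      refine Lp.ext (((comp_ofComp _ i).symm.trans (eqRL_iff_comp.1 h i)).trans ?_)
      refine EventuallyEq.trans ?_ (Lp.coeFn_zero _ _ _).symm
      rcases i with i | i | i <;> rfl
    · intro f
      obtain ⟨g, hg, hgf⟩ := hb.surj _ (memRL_ofComp f)
      obtain ⟨u, hu⟩ := exists_lp g hg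
      have hug : EqRL R (ofComp fun j => u j) g :=
        eqRL_iff_comp.2 fun j => (comp_ofComp _ j).trans (hu j)
      refine ⟨u, funext fun i => Lp.ext ?_⟩
      exact ((hEu u i).trans (eqRL_iff_comp.1 ((S011_congr N hug).trans hgf) i)).trans
        (comp_ofComp _ i)
  -- By the open mapping theorem the inverse is bounded; its norm, increased by one to be positive,
  -- is the constant `C`.
  let e := ContinuousLinearEquiv.ofBijective E
    (LinearMap.ker_eq_bot.2 hbij.1) (LinearMap.range_eq_top.2 hbij.2)
  refine ⟨‖e.symm.toContinuousLinearMap‖ + 1, by positivity, fun u => ?_⟩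
  have h1 : e.symm.toContinuousLinearMap (E u) = u := e.symm_apply_apply u
  calc ‖u‖ = ‖e.symm.toContinuousLinearMap (E u)‖ := by rw [h1]
    _ ≤ ‖e.symm.toContinuousLinearMap‖ * ‖E u‖ := ContinuousLinearMap.le_opNorm _ _
    _ ≤ _ := mul_le_mul_of_nonneg_right (le_add_of_nonneg_right zero_le_one) (norm_nonneg _)

end components

/-! ## The multipliers of a bijective 011-PI operator -/

section small

variable {J : Type*} [Fintype J] {m : J → Measure ℝ} [∀ j, IsFiniteMeasure (m j)]

theorem exists_norm_kerOpPi_le (b : ∀ i j, Lp (Lp ℝ 2 (m i)) 2 (m j)) {ε : ℝ} (hε : 0 < ε) :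
    ∃ δ > 0, ∀ (D : Set ℝ) (hD : MeasurableSet D) (c : J → ℝ),
      (∀ j, c j ≠ 0 → m j D ≤ ENNReal.ofReal δ) →
      ‖kerOpPi b fun j => indicatorConstLp 2 hD (measure_ne_top (m j) D) (c j)‖ ≤
        ε * ‖fun j => indicatorConstLp 2 hD (measure_ne_top (m j) D) (c j)‖ := by
  have hc : 0 < (Fintype.card J : ℝ) + 1 := by positivity
  have h : ∀ i j, ∀ᶠ δ in 𝓝[>] (0 : ℝ), ∀ (D : Set ℝ) (hD : MeasurableSet D) (c : ℝ),
      m j D ≤ ENNReal.ofReal δ →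
      ‖kerOp (b i j) (indicatorConstLp 2 hD (measure_ne_top (m j) D) c)‖ ≤
        ε / (Fintype.card J + 1) * ‖indicatorConstLp 2 hD (measure_ne_top (m j) D) c‖ := by
    intro i j
    obtain ⟨δ, hδ, h⟩ := exists_norm_kerOp_indicator_le (b i j) (div_pos hε hc)
    filter_upwards [Ioo_mem_nhdsGT hδ] with δ' hδ' D hD c hDδ
    exact h D hD c (hDδ.trans (ENNReal.ofReal_le_ofReal hδ'.2.le))
  obtain ⟨δ, hδ, hδ0⟩ :=
    ((eventually_all.2 fun i => eventually_all.2 (h i)).and self_mem_nhdsWithin).exists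
  refine ⟨δ, hδ0, fun D hD c hD' => ?_⟩
  set u : ∀ j, Lp ℝ 2 (m j) := fun j => indicatorConstLp 2 hD (measure_ne_top (m j) D) (c j)
    with hu
  refine (pi_norm_le_iff_of_nonneg (by positivity)).2 fun i => ?_
  rw [kerOpPi_apply]
  calc _ ≤ ∑ j : J, ε / (Fintype.card J + 1) * ‖u‖ := by
        refine norm_sum_le_of_le _ fun j _ => ?_
        by_cases hj : c j = 0
        · have : u j = 0 := norm_eq_zero.1 (by
            rw [hu, norm_indicatorConstLp two_ne_zero ENNReal.ofNat_ne_top, hj, norm_zero, zero_mul])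
          rw [this, map_zero, norm_zero]
          positivity
        · refine (hδ i j D hD (c j) (hD' j hj)).trans ?_
          gcongr
          exact norm_le_pi_norm u j
    _ = Fintype.card J / (Fintype.card J + 1) * (ε * ‖u‖) := by
        rw [Finset.sum_const, nsmul_eq_mul, Finset.card_univ]
        ring
    _ ≤ 1 * (ε * ‖u‖) := by
        gcongr
        exact (div_le_one hc).2 (by linarith)
    _ = ε * ‖u‖ := one_mul _

end small

/-- Some point of the set has the property that each of its neighbourhoods meets the set in positive
measure; the ball of radius `δ / 2` about it has Lebesgue measure `δ`. -/
theorem exists_subset_small {s t : ℝ} {A : Set ℝ} (hA : NullMeasurableSet A (muI s t))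
    (h0 : muI s t A ≠ 0) {δ : ℝ} (hδ : 0 < δ) :
    ∃ D ⊆ A, MeasurableSet D ∧ muI s t D ≠ 0 ∧ muI s t D ≤ ENNReal.ofReal δ := by
  obtain ⟨D, hDA, hm, he⟩ := hA.exists_measurable_subset_ae_eq
  rw [← measure_congr he] at h0
  obtain ⟨x, -, hx⟩ := exists_mem_forall_mem_nhdsWithin_pos_measure h0
  refine ⟨D ∩ Metric.closedBall x (δ / 2), inter_subset_left.trans hDA,
    hm.inter Metric.isClosed_closedBall.measurableSet,
    (hx _ (inter_mem_nhdsWithin _ (Metric.closedBall_mem_nhds x (half_pos hδ)))).ne', ?_⟩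
  refine ((measure_mono inter_subset_right).trans (Measure.restrict_apply_le _ _)).trans ?_
  rw [Real.volume_closedBall, mul_div_cancel₀ δ two_ne_zero]

section inv

variable {ι : Type*} [Fintype ι] {α : Type*} [MeasurableSpace α] {μ : Measure α}

/-- A lower bound that holds almost everywhere for every fixed vector. -/
theorem ae_forall_of_forall_ae {M : α → Matrix ι ι ℝ} {c : ℝ}
    (h : ∀ v, ∀ᵐ x ∂μ, ‖v‖ ≤ c * ‖M x *ᵥ v‖) : ∀ᵐ x ∂μ, ∀ v, ‖v‖ ≤ c * ‖M x *ᵥ v‖ := by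
  -- A countable dense set of vectors costs only a null set, and for fixed `x` the inequality is a
  -- closed condition on `v`.
  filter_upwards [ae_all_iff.2 fun n => h (TopologicalSpace.denseSeq (ι → ℝ) n)] with x hx v
  have hc : IsClosed {v : ι → ℝ | ‖v‖ ≤ c * ‖M x *ᵥ v‖} :=
    isClosed_le continuous_norm (by fun_prop)
  exact hc.closure_subset_iff.2 (range_subset_iff.2 hx)
    (TopologicalSpace.denseRange_denseSeq (ι → ℝ) v)

variable [DecidableEq ι]

theorem isUnit_det_of_norm_le {A : Matrix ι ι ℝ} {c : ℝ} (h : ∀ v, ‖v‖ ≤ c * ‖A *ᵥ v‖) :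
    IsUnit A.det := by
  rw [← Matrix.isUnit_iff_isUnit_det, ← Matrix.mulVec_injective_iff_isUnit]
  refine (injective_iff_map_eq_zero A.mulVecLin).2 fun v hv => ?_
  have h1 := h v
  rw [show A *ᵥ v = 0 from hv, norm_zero, mul_zero] at h1
  exact norm_le_zero_iff.1 h1

theorem abs_inv_apply_le {A : Matrix ι ι ℝ} {c : ℝ} (h : ∀ v, ‖v‖ ≤ c * ‖A *ᵥ v‖) (i j : ι) :
    |A⁻¹ i j| ≤ c := by
  have h1 := h (A⁻¹ *ᵥ Pi.single j 1)
  rw [Matrix.mulVec_mulVec, Matrix.mul_nonsing_inv _ (isUnit_det_of_norm_le h),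
    Matrix.one_mulVec, Pi.norm_single, norm_one, mul_one] at h1
  refine le_trans ?_ h1
  refine le_trans (le_of_eq ?_) (norm_le_pi_norm _ i)
  simp

/-- The entries are bounded by applying the lower bound to the columns of the inverse, and
measurable by Cramer's rule. -/
theorem matLinf_inv {M : α → Matrix ι ι ℝ} (hM : MatLinf μ M) {c : ℝ}
    (h : ∀ᵐ x ∂μ, ∀ v, ‖v‖ ≤ c * ‖M x *ᵥ v‖) : MatLinf μ fun x => (M x)⁻¹ := fun i j => by
  refine memLp_top_of_bound ?_ c (h.mono fun x hx => abs_inv_apply_le hx i j)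
  have hm : AEMeasurable (fun x => (fun i j => M x i j : ι → ι → ℝ)) μ :=
    aemeasurable_pi_iff.2 fun i => aemeasurable_pi_iff.2 fun j => (hM i j).1.aemeasurable
  have hc : Continuous fun A : ι → ι → ℝ => Matrix.of A := continuous_id
  have hd : Measurable fun A : ι → ι → ℝ => (Matrix.of A).det := hc.matrix_det.measurable
  have ha : Measurable fun A : ι → ι → ℝ => (Matrix.of A).adjugate i j :=
    (hc.matrix_adjugate.matrix_elem i j).measurable
  have := (hd.inv.mul ha).comp_aemeasurable hm
  refine (this.congr (ae_of_all _ fun x => ?_)).aestronglyMeasurable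
  simp [Matrix.inv_def, Ring.inverse_eq_inv']
  rfl

end inv

section bounded

variable {R : Rect} {ι₀ ι₁ : Type*} [Fintype ι₀] [Fintype ι₁] {N : N011 ι₀ ι₁ ι₀ ι₁}

/-- If the bound failed for a vector `v` on a set of positive measure, consider `v` times the
indicator of a small subset `D`. The multiplier is small on it by assumption and the integral
operator because `D` is small, which contradicts `exists_norm_le`. -/
theorem exists_norm_le_mulVec_xx (hN : IsN011 R N) (hb : BijS011 R N) :
    ∃ c, ∀ᵐ x ∂ R.mux, ∀ v, ‖v‖ ≤ c * ‖N.xx.r0 x *ᵥ v‖ := by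
  classical
  obtain ⟨b, C, hC, hle⟩ := exists_norm_le hN hb
  -- With `1 / (2C)` for the integral part and `1 / (4C)` for the multiplier, the lower bound
  -- becomes `‖u‖ ≤ 3/4 ‖u‖`, which is absurd for `u ≠ 0`.
  have hε : 0 < 1 / (2 * C) := by positivity
  obtain ⟨δ, hδ, hK⟩ := exists_norm_kerOpPi_le b hε
  refine ⟨4 * C, ae_forall_of_forall_ae fun v => ?_⟩
  by_contra hnot
  set A : Set ℝ := {x | ¬ ‖v‖ ≤ 4 * C * ‖N.xx.r0 x *ᵥ v‖} with hA
  have hv : 0 < ‖v‖ := by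
    by_contra h
    refine hnot (ae_of_all _ fun x => (not_lt.1 h).trans (by positivity))
  have hAm : NullMeasurableSet A R.mux := by
    have h1 : AEMeasurable (fun x => N.xx.r0 x *ᵥ v) R.mux :=
      aemeasurable_pi_iff.2 fun i => ((MatLinf.matL2 hN.xx.1).mulVec_const v i).1.aemeasurable
    exact (nullMeasurableSet_le aemeasurable_const (h1.norm.const_mul _)).compl
  have hA0 : R.mux A ≠ 0 := fun h => hnot h
  obtain ⟨D, hDA, hD, hD0, hDδ⟩ := exists_subset_small hAm hA0 hδ
  let w : ι₀ ⊕ (ι₁ ⊕ ι₁) → ℝ := Sum.elim 0 (Sum.elim v 0)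
  let u : ∀ j : ι₀ ⊕ (ι₁ ⊕ ι₁), Lp ℝ 2 (muJ R j) :=
    fun j => indicatorConstLp 2 hD (measure_ne_top (muJ R j) D) (w j)
  have hKu : ‖kerOpPi b u‖ ≤ 1 / (2 * C) * ‖u‖ := by
    refine hK D hD w ?_
    rintro (j | j | j) hj
    · exact absurd rfl hj
    · exact hDδ
    · exact absurd rfl hj
  set s := R.mux.real D ^ (1 / (2 : ENNReal).toReal) with hs
  have hs0 : 0 < s := Real.rpow_pos_of_pos (ENNReal.toReal_pos hD0 (measure_ne_top _ _)) _
  have hvu : ‖v‖ * s ≤ ‖u‖ := by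
    rw [← le_div_iff₀ hs0]
    refine (pi_norm_le_iff_of_nonneg (by positivity)).2 fun j => ?_
    rw [le_div_iff₀ hs0]
    refine le_trans (le_of_eq ?_) (norm_le_pi_norm u (.inr (.inl j)))
    exact (norm_indicatorConstLp two_ne_zero ENNReal.ofNat_ne_top).symm
  have hMu : ‖mulOpJ hN u‖ ≤ 1 / (4 * C) * (‖v‖ * s) := by
    let e : Lp ℝ 2 R.mux := indicatorConstLp 2 hD (measure_ne_top _ D) 1
    have hu : ∀ j, u (.inr (.inl j)) =ᵐ[R.mux] D.indicator fun _ => v j :=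
      fun j => indicatorConstLp_coeFn
    have hu0 : ∀ j, u (.inr (.inr j)) = 0 := fun j => norm_eq_zero.1 (by
      refine (norm_indicatorConstLp two_ne_zero ENNReal.ofNat_ne_top).trans ?_
      simp [w])
    have he : ‖e‖ = s := by
      rw [norm_indicatorConstLp two_ne_zero ENNReal.ofNat_ne_top, norm_one, one_mul]
    have heD : e =ᵐ[R.mux] D.indicator fun _ => (1 : ℝ) := indicatorConstLp_coeFn
    have hnn : 0 ≤ 1 / (4 * C) * (‖v‖ * s) := by positivity
    refine (pi_norm_le_iff_of_nonneg hnn).2 ?_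
    rintro (i | i | i)
    · exact (norm_zero (E := Lp ℝ 2 (Measure.dirac (0 : ℝ)))).trans_le hnn
    · rw [← he, ← mul_assoc]
      have h1 : mulOpJ hN u (.inr (.inl i)) =ᵐ[R.mux]
          fun x => (N.xx.r0 x *ᵥ fun j => u (.inr (.inl j)) x) i := mulOpJ_ae hN u (.inr (.inl i))
      refine Lp.norm_le_mul_norm_of_ae_le_mul (g := e) ?_
      filter_upwards [h1, ae_all_iff.2 hu, heD] with x h1 h2 h3
      refine (congrArg norm h1).trans_le ?_
      rw [h3]
      simp only [h2]
      by_cases hx : x ∈ D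
      · simp only [indicator_of_mem hx, norm_one, mul_one]
        have h4 : 4 * C * ‖N.xx.r0 x *ᵥ v‖ < ‖v‖ := not_le.1 (hDA hx)
        rw [one_div, ← div_eq_inv_mul, le_div_iff₀' (by positivity)]
        refine le_trans ?_ h4.le
        gcongr
        exact norm_le_pi_norm (N.xx.r0 x *ᵥ v) i
      · simp only [indicator_of_notMem hx, norm_zero, mul_zero]
        exact le_of_eq (by rw [show (fun _ : ι₁ => (0 : ℝ)) = 0 from rfl, Matrix.mulVec_zero]; simp)
    · have h1 : mulOpJ hN u (.inr (.inr i)) = 0 := by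
        change (∑ j, mulOp (hN.yy.1 i j) ∘L _ : _ →L[ℝ] _) u = 0
        rw [sum_apply]
        refine Finset.sum_eq_zero fun j _ => ?_
        exact (congrArg (mulOp (hN.yy.1 i j)) (hu0 j)).trans
          (ContinuousLinearMap.map_zero (mulOp (hN.yy.1 i j)))
      rw [h1, norm_zero]
      exact hnn
  have h1 := hle u
  have h2 : ‖u‖ ≤ C * (1 / (4 * C) * ‖u‖ + 1 / (2 * C) * ‖u‖) := by
    refine h1.trans (mul_le_mul_of_nonneg_left ((norm_add_le _ _).trans (add_le_add ?_ hKu)) hC.le)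
    exact hMu.trans (by gcongr)
  have h3 : C * (1 / (4 * C) * ‖u‖ + 1 / (2 * C) * ‖u‖) = 3 / 4 * ‖u‖ := by
    field_simp; ring
  have : 0 < ‖v‖ * s := by positivity
  linarith

end bounded

/-! ## The inverse of a bijective 011-PI operator -/

section

variable {R : Rect} {ι₀ ι₁ : Type*} [Fintype ι₀] [Fintype ι₁]
  {N M : N011 ι₀ ι₁ ι₀ ι₁} {f g : RL ι₀ ι₁}

/-- The parameters after an exchange of the two variables. -/
def N011.swap {ι₀ ι₁ : Type*} (N : N011 ι₀ ι₁ ι₀ ι₁) : N011 ι₀ ι₁ ι₀ ι₁ where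
  z00 := N.z00
  z0x := N.z0y
  z0y := N.z0x
  x0 := N.y0
  xx := N.yy
  xy x y := N.yx y x
  y0 := N.x0
  yx x y := N.xy y x
  yy := N.xx

/-- The triple after an exchange of the two variables. -/
def swapRL {ι₀ ι₁ : Type*} (g : RL ι₀ ι₁) : RL ι₀ ι₁ := (g.1, g.2.2, g.2.1)

theorem IsN011.swap {ι₀ ι₁ : Type*} {N : N011 ι₀ ι₁ ι₀ ι₁} (hN : IsN011 R N) :
    IsN011 R.swap N.swap where
  z0x := hN.z0y
  z0y := hN.z0x
  x0 := hN.y0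
  xx := hN.yy
  xy := MatL2.swap hN.yx
  y0 := hN.x0
  yx := MatL2.swap hN.xy
  yy := hN.xx

/-- The symmetry that carries the bound for the multiplier in `x` over to the one in `y`. -/
theorem S011_swap (N : N011 ι₀ ι₁ ι₀ ι₁) (g : RL ι₀ ι₁) :
    S011 R.swap N.swap (swapRL g) = swapRL (S011 R N g) := by
  refine Prod.ext ?_ (Prod.ext (funext fun x => ?_) (funext fun x => ?_))
  · exact add_right_comm _ _ _
  · exact add_right_comm _ _ _
  · exact add_right_comm _ _ _

theorem BijS011.swap (hb : BijS011 R N) : BijS011 R.swap N.swap where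
  inj g hg h := by
    have h1 : EqRL R (S011 R N (swapRL g)) 0 := by
      have e : S011 R.swap N.swap g = swapRL (S011 R N (swapRL g)) := S011_swap N (swapRL g)
      rw [e] at h
      exact ⟨h.1, h.2.2, h.2.1⟩
    have h2 := hb.inj (swapRL g) ⟨hg.2, hg.1⟩ h1
    exact ⟨h2.1, h2.2.2, h2.2.1⟩
  surj f hf := by
    obtain ⟨g, hg, h⟩ := hb.surj (swapRL f) ⟨hf.2, hf.1⟩
    refine ⟨swapRL g, ⟨hg.2, hg.1⟩, ?_⟩
    rw [S011_swap]
    exact ⟨h.1, h.2.2, h.2.1⟩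

theorem exists_norm_le_mulVec_yy (hN : IsN011 R N) (hb : BijS011 R N) :
    ∃ c, ∀ᵐ y ∂ R.muy, ∀ v, ‖v‖ ≤ c * ‖N.yy.r0 y *ᵥ v‖ := by
  obtain ⟨c, hc⟩ := exists_norm_le_mulVec_xx hN.swap hb.swap
  exact ⟨c, hc⟩

variable [DecidableEq ι₁]

/-- The multipliers of a bijective 011-PI operator have essentially bounded inverses. -/
theorem BijS011.inv_xx (hN : IsN011 R N) (hb : BijS011 R N) :
    (∀ᵐ x ∂ R.mux, IsUnit (N.xx.r0 x).det) ∧ MatLinf R.mux fun x => (N.xx.r0 x)⁻¹ := by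
  obtain ⟨c, hc⟩ := exists_norm_le_mulVec_xx hN hb
  exact ⟨hc.mono fun x hx => isUnit_det_of_norm_le hx, matLinf_inv hN.xx.1 hc⟩

theorem BijS011.inv_yy (hN : IsN011 R N) (hb : BijS011 R N) :
    (∀ᵐ y ∂ R.muy, IsUnit (N.yy.r0 y).det) ∧ MatLinf R.muy fun y => (N.yy.r0 y)⁻¹ := by
  obtain ⟨c, hc⟩ := exists_norm_le_mulVec_yy hN hb
  exact ⟨hc.mono fun x hx => isUnit_det_of_norm_le hx, matLinf_inv hN.yy.1 hc⟩

/-- Multiplication of the function components by matrix functions. -/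
def mulRL {ι₀ ι₁ : Type*} [Fintype ι₁] (A C : ℝ → Matrix ι₁ ι₁ ℝ) (g : RL ι₀ ι₁) : RL ι₀ ι₁ :=
  (g.1, fun x => A x *ᵥ g.2.1 x, fun y => C y *ᵥ g.2.2 y)

omit [DecidableEq ι₁] [Fintype ι₀] in
theorem memRL_mulRL {A C : ℝ → Matrix ι₁ ι₁ ℝ} (hA : MatLinf R.mux A) (hC : MatLinf R.muy C)
    (hg : MemRL R g) : MemRL R (mulRL A C g) :=
  ⟨hA.mulVec hg.1, hC.mulVec hg.2⟩

theorem mulRL_congr {ι₀ ι₁ : Type*} [Fintype ι₁] (A C : ℝ → Matrix ι₁ ι₁ ℝ) {f g : RL ι₀ ι₁}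
    (e : EqRL R f g) : EqRL R (mulRL A C f) (mulRL A C g) :=
  ⟨e.1, e.2.1.mono fun x hx => by simp only [mulRL, hx],
    e.2.2.mono fun x hx => by simp only [mulRL, hx]⟩

theorem mulRL_mulRL_cancel {ι₀ ι₁ : Type*} [Fintype ι₁] [DecidableEq ι₁]
    {A C A' C' : ℝ → Matrix ι₁ ι₁ ℝ}
    (hA : ∀ᵐ x ∂ R.mux, A x * A' x = 1) (hC : ∀ᵐ y ∂ R.muy, C y * C' y = 1) (g : RL ι₀ ι₁) :
    EqRL R (mulRL A C (mulRL A' C' g)) g :=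
  ⟨rfl, hA.mono fun x hx => by simp only [mulRL, Matrix.mulVec_mulVec, hx, Matrix.one_mulVec],
    hC.mono fun x hx => by simp only [mulRL, Matrix.mulVec_mulVec, hx, Matrix.one_mulVec]⟩

/-- The parameters of `mulRL A C ∘ S011 R N`, for multipliers of `N` that are inverse to `A`, `C`. -/
def N011.normalize (A C : ℝ → Matrix ι₁ ι₁ ℝ) (N : N011 ι₀ ι₁ ι₀ ι₁) : N011 ι₀ ι₁ ι₀ ι₁ where
  z00 := N.z00
  z0x := N.z0x
  z0y := N.z0y
  x0 x := A x * N.x0 x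
  xx := ⟨fun _ => 1, fun x θ => A x * N.xx.r1 x θ, fun x θ => A x * N.xx.r1 x θ⟩
  xy x y := A x * N.xy x y
  y0 y := C y * N.y0 y
  yx x y := C y * N.yx x y
  yy := ⟨fun _ => 1, fun y ν => C y * N.yy.r1 y ν, fun y ν => C y * N.yy.r1 y ν⟩

omit [Fintype ι₀] in
theorem isN011_normalize {A C : ℝ → Matrix ι₁ ι₁ ℝ} (hA : MatLinf R.mux A) (hC : MatLinf R.muy C)
    (hN : IsN011 R N) : IsN011 R (N.normalize A C) where
  z0x := hN.z0x
  z0y := hN.z0y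
  x0 := hA.mul_matL2 hN.x0
  xx := ⟨matLinf_const _ _, (hA.fst R.mux).mul_matL2 hN.xx.2.1, (hA.fst R.mux).mul_matL2 hN.xx.2.1⟩
  xy := (hA.fst R.muy).mul_matL2 hN.xy
  y0 := hC.mul_matL2 hN.y0
  yx := (hC.snd R.mux).mul_matL2 hN.yx
  yy := ⟨matLinf_const _ _, (hC.fst R.muy).mul_matL2 hN.yy.2.1, (hC.fst R.muy).mul_matL2 hN.yy.2.1⟩

theorem S011_normalize {A C : ℝ → Matrix ι₁ ι₁ ℝ} (hN : IsN011 R N)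
    (hAN : ∀ᵐ x ∂ R.mux, A x * N.xx.r0 x = 1) (hCN : ∀ᵐ y ∂ R.muy, C y * N.yy.r0 y = 1)
    (hg : MemRL R g) : EqRL R (S011 R (N.normalize A C) g) (mulRL A C (S011 R N g)) := by
  refine ⟨rfl, ?_, ?_⟩
  · have h1 := hN.xx.2.1.fiber
    filter_upwards [hAN, h1, MatL2.fiber hN.xy] with x h0 h1 h2
    have h1 : MatL2 R.mux fun t => N.xx.r1 x t := h1
    simp only [S011, mulRL, N011.normalize, Matrix.mulVec_add, ← Matrix.mulVec_mulVec,
      mulVec_integral _ (h1.mulVec_integrable hg.1), mulVec_integral _ (h2.mulVec_integrable hg.2)]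
    rw [Matrix.mulVec_mulVec _ (A x) (N.xx.r0 x), h0]
  · have h1 := hN.yy.2.1.fiber
    filter_upwards [hCN, h1, (MatL2.swap hN.yx).fiber] with x h0 h1 h2
    have h1 : MatL2 R.muy fun t => N.yy.r1 x t := h1
    simp only [S011, mulRL, N011.normalize, Matrix.mulVec_add, ← Matrix.mulVec_mulVec,
      mulVec_integral _ (h1.mulVec_integrable hg.2), mulVec_integral _ (h2.mulVec_integrable hg.1)]
    rw [Matrix.mulVec_mulVec _ (C x) (N.yy.r0 x), h0]

/-- The parameters of `S011 R M ∘ mulRL A C`. -/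
def N011.compMul {ι₀ ι₁ : Type*} [Fintype ι₁] (M : N011 ι₀ ι₁ ι₀ ι₁) (A C : ℝ → Matrix ι₁ ι₁ ℝ) :
    N011 ι₀ ι₁ ι₀ ι₁ where
  z00 := M.z00
  z0x x := M.z0x x * A x
  z0y y := M.z0y y * C y
  x0 := M.x0
  xx := ⟨fun x => M.xx.r0 x * A x, fun x θ => M.xx.r1 x θ * A θ, fun x θ => M.xx.r1 x θ * A θ⟩
  xy x y := M.xy x y * C y
  y0 := M.y0
  yx x y := M.yx x y * A x
  yy := ⟨fun y => M.yy.r0 y * C y, fun y ν => M.yy.r1 y ν * C ν, fun y ν => M.yy.r1 y ν * C ν⟩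

theorem isN011_compMul {ι₀ ι₁ : Type*} [Fintype ι₁] {M : N011 ι₀ ι₁ ι₀ ι₁}
    {A C : ℝ → Matrix ι₁ ι₁ ℝ} (hA : MatLinf R.mux A) (hC : MatLinf R.muy C)
    (hM : IsN011 R M) : IsN011 R (M.compMul A C) where
  z0x := hM.z0x.mul_matLinf hA
  z0y := hM.z0y.mul_matLinf hC
  x0 := hM.x0
  xx := ⟨MatLinf.mul hM.xx.1 hA, hM.xx.2.1.mul_matLinf (hA.snd R.mux),
    hM.xx.2.1.mul_matLinf (hA.snd R.mux)⟩
  xy := hM.xy.mul_matLinf (hC.snd R.mux)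
  y0 := hM.y0
  yx := hM.yx.mul_matLinf (hA.fst R.muy)
  yy := ⟨MatLinf.mul hM.yy.1 hC, hM.yy.2.1.mul_matLinf (hC.snd R.muy),
    hM.yy.2.1.mul_matLinf (hC.snd R.muy)⟩

omit [DecidableEq ι₁] in
theorem S011_compMul (A C : ℝ → Matrix ι₁ ι₁ ℝ) (g : RL ι₀ ι₁) :
    S011 R (M.compMul A C) g = S011 R M (mulRL A C g) := by
  simp only [S011, mulRL, N011.compMul, Matrix.mulVec_mulVec]

variable [DecidableEq ι₀]

/-- The 011-PI parameters of the identity plus the integral operator with scalar kernels `w`. -/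
def ofKer {ι₀ ι₁ : Type*} [DecidableEq ι₀] [DecidableEq ι₁]
    (w : ι₀ ⊕ (ι₁ ⊕ ι₁) → ι₀ ⊕ (ι₁ ⊕ ι₁) → ℝ × ℝ → ℝ) : N011 ι₀ ι₁ ι₀ ι₁ where
  z00 := 1 + Matrix.of fun i j => w (.inl i) (.inl j) (0, 0)
  z0x x := Matrix.of fun i j => w (.inl i) (.inr (.inl j)) (0, x)
  z0y y := Matrix.of fun i j => w (.inl i) (.inr (.inr j)) (0, y)
  x0 x := Matrix.of fun i j => w (.inr (.inl i)) (.inl j) (x, 0)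
  xx :=
    { r0 := fun _ => 1
      r1 := fun x θ => Matrix.of fun i j => w (.inr (.inl i)) (.inr (.inl j)) (x, θ)
      r2 := fun x θ => Matrix.of fun i j => w (.inr (.inl i)) (.inr (.inl j)) (x, θ) }
  xy x y := Matrix.of fun i j => w (.inr (.inl i)) (.inr (.inr j)) (x, y)
  y0 y := Matrix.of fun i j => w (.inr (.inr i)) (.inl j) (y, 0)
  yx x y := Matrix.of fun i j => w (.inr (.inr i)) (.inr (.inl j)) (y, x)
  yy :=
    { r0 := fun _ => 1
      r1 := fun y ν => Matrix.of fun i j => w (.inr (.inr i)) (.inr (.inr j)) (y, ν)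
      r2 := fun y ν => Matrix.of fun i j => w (.inr (.inr i)) (.inr (.inr j)) (y, ν) }

theorem memLp_fiber_zero {α : Type*} [MeasurableSpace α] {ν : Measure α} [SFinite ν]
    {k : ℝ × α → ℝ} (hk : MemLp k 2 ((Measure.dirac (0 : ℝ)).prod ν)) :
    MemLp (fun t => k (0, t)) 2 ν := by
  have h := memLp_two_fiber hk
  rw [ae_dirac_eq] at h
  exact h

theorem isN011_ofKer {ι₀ ι₁ : Type*} [DecidableEq ι₀] [DecidableEq ι₁]
    {w : ι₀ ⊕ (ι₁ ⊕ ι₁) → ι₀ ⊕ (ι₁ ⊕ ι₁) → ℝ × ℝ → ℝ}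
    (hw : ∀ i j, MemLp (w i j) 2 ((muJ R i).prod (muJ R j))) : IsN011 R (ofKer w) where
  z0x i j := memLp_fiber_zero (ν := R.mux) (hw (.inl i) (.inr (.inl j)))
  z0y i j := memLp_fiber_zero (ν := R.muy) (hw (.inl i) (.inr (.inr j)))
  x0 i j := memLp_fiber_zero (ν := R.mux) (memLp_two_swap (hw (.inr (.inl i)) (.inl j)))
  xx := ⟨matLinf_const _ _, fun i j => hw (.inr (.inl i)) (.inr (.inl j)),
    fun i j => hw (.inr (.inl i)) (.inr (.inl j))⟩
  xy i j := hw (.inr (.inl i)) (.inr (.inr j))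
  y0 i j := memLp_fiber_zero (ν := R.muy) (memLp_two_swap (hw (.inr (.inr i)) (.inl j)))
  yx i j := memLp_two_swap (hw (.inr (.inr i)) (.inr (.inl j)))
  yy := ⟨matLinf_const _ _, fun i j => hw (.inr (.inr i)) (.inr (.inr j)),
    fun i j => hw (.inr (.inr i)) (.inr (.inr j))⟩

/-- The action of a 011-PI operator with unit multipliers on scalar components. -/
theorem comp_S011_one (hN : IsN011 R N) (hx : ∀ x, N.xx.r0 x = 1) (hy : ∀ y, N.yy.r0 y = 1)
    (hg : MemRL R g) (i : ι₀ ⊕ (ι₁ ⊕ ι₁)) :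
    comp (S011 R N g) i =ᵐ[muJ R i] fun s => comp g i s +
      ∑ j, ∫ t, kerJ { N with z00 := N.z00 - 1 } i j (s, t) * comp g j t ∂muJ R j := by
  have hN' : IsN011 R { N with z00 := N.z00 - 1 } :=
    ⟨hN.z0x, hN.z0y, hN.x0, hN.xx, hN.xy, hN.y0, hN.yx, hN.yy⟩
  filter_upwards [comp_S011 hN' hg i] with s h
  -- The matrix `z00` acts as an integral kernel for the point mass, so splitting off the identity
  -- on the vector component means subtracting `1` from it. On the edge components the identity is
  -- the unit multiplier.
  have e1 : comp (S011 R N g) i s = comp (S011 R { N with z00 := N.z00 - 1 } g) i s +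
      comp (ι₁ := ι₁) (g.1, 0, 0) i s := by
    rcases i with i | i | i
    · simp only [comp, S011, Matrix.sub_mulVec, Matrix.one_mulVec, Pi.add_apply, Pi.sub_apply]
      ring
    · exact (add_zero _).symm
    · exact (add_zero _).symm
  have e2 : comp g i s = comp (mulJ { N with z00 := N.z00 - 1 } g) i s +
      comp (ι₁ := ι₁) (g.1, 0, 0) i s := by
    rcases i with i | i | i
    · exact (zero_add _).symm
    · simp [comp, mulJ, hx]
    · simp [comp, mulJ, hy]
  rw [e1, h, e2]
  ring

theorem comp_S011_ofKer {w : ι₀ ⊕ (ι₁ ⊕ ι₁) → ι₀ ⊕ (ι₁ ⊕ ι₁) → ℝ × ℝ → ℝ}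
    (hw : ∀ i j, MemLp (w i j) 2 ((muJ R i).prod (muJ R j))) (hg : MemRL R g)
    (i : ι₀ ⊕ (ι₁ ⊕ ι₁)) :
    comp (S011 R (ofKer w) g) i =ᵐ[muJ R i] fun s => comp g i s +
      ∑ j, ∫ t, w i j (s, t) * comp g j t ∂muJ R j := by
  have hae : ∀ᵐ s ∂muJ R i, ∀ j, ∫ t, kerJ { ofKer w with z00 := (ofKer w).z00 - 1 } i j (s, t) *
      comp g j t ∂muJ R j = ∫ t, w i j (s, t) * comp g j t ∂muJ R j := by
    rcases i with i | i | i
    · rw [muJ, ae_dirac_eq]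
      refine eventually_pure.2 ?_
      rintro (j | j | j)
      · simp [muJ, kerJ, ofKer]
      · rfl
      · rfl
    · refine ae_of_all _ fun s => ?_
      rintro (j | j | j)
      · simp [muJ, kerJ, ofKer]
      · rfl
      · rfl
    · refine ae_of_all _ fun s => ?_
      rintro (j | j | j)
      · simp [muJ, kerJ, ofKer]
      · rfl
      · rfl
  filter_upwards [comp_S011_one (isN011_ofKer hw) (fun _ => rfl) (fun _ => rfl) hg i, hae] with s h h'
  rw [h]
  simp only [h']

/-- In scalar components the operator is the identity plus a Hilbert-Schmidt operator.
`exists_kernel_inverse` provides the kernels of the inverse, and `ofKer` reassembles them into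
011-PI parameters. -/
theorem exists_inverse_of_one (hN : IsN011 R N) (hx : ∀ x, N.xx.r0 x = 1)
    (hy : ∀ y, N.yy.r0 y = 1) (hb : BijS011 R N) :
    ∃ M : N011 ι₀ ι₁ ι₀ ι₁, IsN011 R M ∧
      ∀ g, MemRL R g → EqRL R (S011 R M (S011 R N g)) g := by
  set k := kerJ { N with z00 := N.z00 - 1 } with hk
  have hN' : IsN011 R { N with z00 := N.z00 - 1 } :=
    ⟨hN.z0x, hN.z0y, hN.x0, hN.xx, hN.xy, hN.y0, hN.yx, hN.yy⟩
  have hcongr : ∀ (k : ι₀ ⊕ (ι₁ ⊕ ι₁) → ι₀ ⊕ (ι₁ ⊕ ι₁) → ℝ × ℝ → ℝ)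
      (u : ∀ j : ι₀ ⊕ (ι₁ ⊕ ι₁), Lp ℝ 2 (muJ R j)) (g : RL ι₀ ι₁),
      (∀ j, u j =ᵐ[muJ R j] comp g j) → ∀ i s,
      ∑ j, ∫ t, k i j (s, t) * u j t ∂muJ R j = ∑ j, ∫ t, k i j (s, t) * comp g j t ∂muJ R j := by
    intro k u g hug i s
    refine Finset.sum_congr rfl fun j _ => integral_congr_ae ?_
    filter_upwards [hug j] with t ht
    rw [ht]
  have hNu : ∀ (u : ∀ j : ι₀ ⊕ (ι₁ ⊕ ι₁), Lp ℝ 2 (muJ R j)) (g : RL ι₀ ι₁), MemRL R g →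
      (∀ j, u j =ᵐ[muJ R j] comp g j) → ∀ i, ∀ᵐ s ∂muJ R i,
      u i s + ∑ j, ∫ t, k i j (s, t) * u j t ∂muJ R j = comp (S011 R N g) i s := by
    intro u g hg hug i
    filter_upwards [comp_S011_one hN hx hy hg i, hug i] with s h1 h2
    rw [h1, h2, hcongr k u g hug]
  obtain ⟨w, hw, hwk⟩ := exists_kernel_inverse (m := muJ R) (memLp_kerJ hN')
    (fun u hu => by
      have h := hb.inj _ (memRL_ofComp u) (eqRL_iff_comp.2 fun i => by
        filter_upwards [hu i, hNu u _ (memRL_ofComp u) 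
            (fun j => (comp_ofComp (fun j => u j) j).symm) i] with s h1 h2
        rw [← h2, h1]
        rcases i with i | i | i <;> rfl)
      funext i
      refine Lp.ext (((comp_ofComp _ i).symm.trans (eqRL_iff_comp.1 h i)).trans ?_)
      refine EventuallyEq.trans ?_ (Lp.coeFn_zero _ _ _).symm
      rcases i with i | i | i <;> rfl)
    (fun f => by
      obtain ⟨g, hg, hgf⟩ := hb.surj _ (memRL_ofComp f)
      obtain ⟨u, hu⟩ := exists_lp g hg
      refine ⟨u, fun i => ?_⟩
      filter_upwards [hNu u g hg hu i, eqRL_iff_comp.1 hgf i, comp_ofComp (fun j => f j) i]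
        with s h1 h2 h3
      exact h1.trans (h2.trans h3))
  refine ⟨ofKer w, isN011_ofKer hw, fun g hg => eqRL_iff_comp.2 fun i => ?_⟩
  have hf := memRL_S011 hN hg
  obtain ⟨u, hu⟩ := exists_lp g hg
  obtain ⟨f, hfe⟩ := exists_lp _ hf
  have h1 := hwk u f (fun i => by
    filter_upwards [hNu u g hg hu i, hfe i] with s h1 h2
    rw [h2]
    exact h1) i
  filter_upwards [comp_S011_ofKer hw hf i, h1, hu i, hfe i] with s h1 h2 h3 h4
  rw [h1, ← h3, ← h2, hcongr w f _ hfe, h4]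

/-- The inverse of a bijective 011-PI operator with separable diagonal parts is an operator of the
same kind. -/
theorem exists_left_inverse (hN : IsN011 R N) (hb : BijS011 R N) :
    ∃ M : N011 ι₀ ι₁ ι₀ ι₁, IsN011 R M ∧ M.Separable R ∧
      ∀ g, MemRL R g → EqRL R (S011 R M (S011 R N g)) g := by
  obtain ⟨hxu, hxi⟩ := hb.inv_xx hN
  obtain ⟨hyu, hyi⟩ := hb.inv_yy hN
  set A := fun x => (N.xx.r0 x)⁻¹
  set C := fun y => (N.yy.r0 y)⁻¹
  have hA : ∀ᵐ x ∂ R.mux, A x * N.xx.r0 x = 1 := hxu.mono fun x hx => Matrix.nonsing_inv_mul _ hx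
  have hA' : ∀ᵐ x ∂ R.mux, N.xx.r0 x * A x = 1 := hxu.mono fun x hx => Matrix.mul_nonsing_inv _ hx
  have hC : ∀ᵐ y ∂ R.muy, C y * N.yy.r0 y = 1 := hyu.mono fun x hx => Matrix.nonsing_inv_mul _ hx
  have hC' : ∀ᵐ y ∂ R.muy, N.yy.r0 y * C y = 1 := hyu.mono fun x hx => Matrix.mul_nonsing_inv _ hx
  have hS : ∀ g, MemRL R g → EqRL R (S011 R (N.normalize A C) g) (mulRL A C (S011 R N g)) :=
    fun g hg => S011_normalize hN hA hC hg
  -- Multiplication by the multipliers of `N` is a two-sided inverse of `mulRL A C`, so bijectivity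
  -- is preserved when the multipliers are divided out.
  have hb' : BijS011 R (N.normalize A C) := by
    refine ⟨fun g hg h => hb.inj g hg ?_, fun f hf => ?_⟩
    · have h1 := mulRL_congr N.xx.r0 N.yy.r0 ((hS g hg).symm.trans h)
      refine ((mulRL_mulRL_cancel hA' hC' _).symm.trans h1).trans ?_
      refine ⟨rfl, ae_of_all _ fun x => ?_, ae_of_all _ fun x => ?_⟩ <;>
        exact Matrix.mulVec_zero _
    · obtain ⟨g, hg, hgf⟩ := hb.surj (mulRL N.xx.r0 N.yy.r0 f) (memRL_mulRL hN.xx.1 hN.yy.1 hf)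
      exact ⟨g, hg, ((hS g hg).trans (mulRL_congr A C hgf)).trans (mulRL_mulRL_cancel hA hC f)⟩
  obtain ⟨M, hM, hMN⟩ := exists_inverse_of_one (isN011_normalize hxi hyi hN) (fun _ => rfl)
    (fun _ => rfl) hb'
  -- `M` inverts the normalized operator, so the division by the multipliers has to precede it.
  refine ⟨M.compMul A C, isN011_compMul hxi hyi hM, ⟨.rfl, .rfl⟩, fun g hg => ?_⟩
  rw [S011_compMul]
  exact (S011_congr M (hS g hg).symm).trans (hMN g hg)

end

/-! ## The parameters of the composition `P[B] ∘ P[H₁]` -/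

section comp

variable {R : Rect} {ι₀ ι₁ κ₀ κ₁ τ₀ τ₁ : Type*} [Fintype ι₀] [Fintype ι₁] [Fintype κ₀]
  [Fintype κ₁] [Fintype τ₀] [Fintype τ₁] {N : N011 ι₀ ι₁ κ₀ κ₁} {h00 : Matrix κ₀ τ₀ ℝ}
  {h01 h02 : ℝ → Matrix κ₀ τ₁ ℝ} {h11 h22 : Matrix κ₁ τ₁ ℝ} {g : RL τ₀ τ₁}

/-- Upper triangular 011-PI parameters without integral kernels. -/
def upper {κ₀ κ₁ τ₀ τ₁ : Type*} (h00 : Matrix κ₀ τ₀ ℝ) (h01 h02 : ℝ → Matrix κ₀ τ₁ ℝ)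
    (h11 h22 : Matrix κ₁ τ₁ ℝ) : N011 κ₀ κ₁ τ₀ τ₁ where
  z00 := h00
  z0x := h01
  z0y := h02
  x0 := 0
  xx := ⟨fun _ => h11, 0, 0⟩
  xy := 0
  y0 := 0
  yx := 0
  yy := ⟨fun _ => h22, 0, 0⟩

/-- The parameters of `S011 R N ∘ S011 R (upper h00 h01 h02 h11 h22)`. -/
def N011.compUpper {ι₀ ι₁ κ₀ κ₁ τ₀ τ₁ : Type*} [Fintype κ₀] [Fintype κ₁] (N : N011 ι₀ ι₁ κ₀ κ₁)
    (h00 : Matrix κ₀ τ₀ ℝ) (h01 h02 : ℝ → Matrix κ₀ τ₁ ℝ) (h11 h22 : Matrix κ₁ τ₁ ℝ) :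
    N011 ι₀ ι₁ τ₀ τ₁ where
  z00 := N.z00 * h00
  z0x x := N.z00 * h01 x + N.z0x x * h11
  z0y y := N.z00 * h02 y + N.z0y y * h22
  x0 x := N.x0 x * h00
  xx :=
    { r0 := fun x => N.xx.r0 x * h11
      r1 := fun x θ => N.x0 x * h01 θ + N.xx.r1 x θ * h11
      r2 := fun x θ => N.x0 x * h01 θ + N.xx.r1 x θ * h11 }
  xy x y := N.x0 x * h02 y + N.xy x y * h22
  y0 y := N.y0 y * h00
  yx x y := N.y0 y * h01 x + N.yx x y * h11
  yy :=
    { r0 := fun y => N.yy.r0 y * h22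
      r1 := fun y ν => N.y0 y * h02 ν + N.yy.r1 y ν * h22
      r2 := fun y ν => N.y0 y * h02 ν + N.yy.r1 y ν * h22 }

theorem isN011_compUpper {ι₀ ι₁ κ₀ κ₁ τ₀ τ₁ : Type*} [Fintype κ₀] [Fintype κ₁]
    {N : N011 ι₀ ι₁ κ₀ κ₁} {h01 h02 : ℝ → Matrix κ₀ τ₁ ℝ} (hN : IsN011 R N)
    (hh1 : MatL2 R.mux h01) (hh2 : MatL2 R.muy h02) (h00 : Matrix κ₀ τ₀ ℝ)
    (h11 h22 : Matrix κ₁ τ₁ ℝ) : IsN011 R (N.compUpper h00 h01 h02 h11 h22) where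
  z0x := (hh1.const_mul N.z00).add (hN.z0x.mul_const h11)
  z0y := (hh2.const_mul N.z00).add (hN.z0y.mul_const h22)
  x0 := hN.x0.mul_const h00
  xx := ⟨MatLinf.mul hN.xx.1 (matLinf_const _ h11),
    (hN.x0.tensor hh1).add (hN.xx.2.1.mul_const h11),
    (hN.x0.tensor hh1).add (hN.xx.2.1.mul_const h11)⟩
  xy := (hN.x0.tensor hh2).add (hN.xy.mul_const h22)
  y0 := hN.y0.mul_const h00
  yx := (hN.y0.tensor hh1).swap.add (hN.yx.mul_const h11)
  yy := ⟨MatLinf.mul hN.yy.1 (matLinf_const _ h22),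
    (hN.y0.tensor hh2).add (hN.yy.2.1.mul_const h22),
    (hN.y0.tensor hh2).add (hN.yy.2.1.mul_const h22)⟩

theorem integral_mul_add_mul_mulVec {α ι κ κ' τ : Type*} [MeasurableSpace α] {μ : Measure α}
    [Fintype ι] [Fintype κ] [Fintype κ'] [Fintype τ] {P : α → Matrix κ τ ℝ}
    {Q : α → Matrix ι κ' ℝ} {u : α → τ → ℝ} (hP : MatL2 μ P) (hQ : MatL2 μ Q) (hu : MemL2 μ u)
    (A : Matrix ι κ ℝ) (D : Matrix κ' τ ℝ) :
    ∫ t, (A * P t + Q t * D) *ᵥ u t ∂μ = A *ᵥ ∫ t, P t *ᵥ u t ∂μ + ∫ t, Q t *ᵥ D *ᵥ u t ∂μ := by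
  rw [mulVec_integral A (hP.mulVec_integrable hu), ← integral_add]
  · simp only [Matrix.add_mulVec, Matrix.mulVec_mulVec]
  · simpa only [Matrix.mulVec_mulVec] using (hP.const_mul A).mulVec_integrable hu
  · simpa only [Matrix.mulVec_mulVec] using (hQ.mul_const D).mulVec_integrable hu

theorem S011_upper (g : RL τ₀ τ₁) : S011 R (upper h00 h01 h02 h11 h22) g =
    (h00 *ᵥ g.1 + ∫ x, h01 x *ᵥ g.2.1 x ∂ R.mux + ∫ y, h02 y *ᵥ g.2.2 y ∂ R.muy,
      fun x => h11 *ᵥ g.2.1 x, fun y => h22 *ᵥ g.2.2 y) := by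
  simp [S011, upper]

theorem S011_compUpper (hN : IsN011 R N) (hh1 : MatL2 R.mux h01) (hh2 : MatL2 R.muy h02)
    (hg : MemRL R g) : EqRL R (S011 R N (S011 R (upper h00 h01 h02 h11 h22) g))
      (S011 R (N.compUpper h00 h01 h02 h11 h22) g) := by
  rw [S011_upper]
  refine ⟨?_, ?_, ?_⟩
  · simp only [S011, N011.compUpper, integral_mul_add_mul_mulVec hh1 hN.z0x hg.1,
      integral_mul_add_mul_mulVec hh2 hN.z0y hg.2, Matrix.mulVec_add, Matrix.mulVec_mulVec]
    abel
  · have h1 := hN.xx.2.1.fiber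
    filter_upwards [h1, MatL2.fiber hN.xy] with x h1 h2
    have h1 : MatL2 R.mux fun t => N.xx.r1 x t := h1
    simp only [S011, N011.compUpper, integral_mul_add_mul_mulVec hh1 h1 hg.1,
      integral_mul_add_mul_mulVec hh2 h2 hg.2, Matrix.mulVec_add, Matrix.mulVec_mulVec]
    abel
  · have h1 := hN.yy.2.1.fiber
    filter_upwards [h1, (MatL2.swap hN.yx).fiber] with x h1 h2
    have h1 : MatL2 R.muy fun t => N.yy.r1 x t := h1
    simp only [S011, N011.compUpper, integral_mul_add_mul_mulVec hh2 h1 hg.2,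
      integral_mul_add_mul_mulVec hh1 h2 hg.1, Matrix.mulVec_add, Matrix.mulVec_mulVec]
    abel

end comp

section EMat

variable {R : Rect} {n1 n2 : ℕ} {B : BCParam n1 n2} {Eh : CoreParam n1 n2}
  {g : RL (Core 4 n1 n2) (Core 2 n1 n2)}

/-- The formulas for `E` are the composition rule for a right factor that is upper triangular and
has no integral kernels. -/
theorem EMat_eq (B : BCParam n1 n2) :
    EMat R B = B.compUpper (H00 R) (H01 R) (H02 R) (H11 R) (H22 R) := rfl

theorem isN011_EMat (hB : IsN011 R B) : IsN011 R (EMat R B) := by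
  rw [EMat_eq]
  exact isN011_compUpper hB (matLinf_H01 R).matL2 (matLinf_H02 R).matL2 _ _ _

theorem BH1_eq_S011_EMat (hB : IsN011 R B) (hs : B.Separable R) (hg : MemRL R g) :
    EqRL R (BH1 R B g) (S011 R (EMat R B) g) := by
  rw [EMat_eq]
  exact (BH1_eq hB hs hg).trans
    (S011_compUpper hB (matLinf_H01 R).matL2 (matLinf_H02 R).matL2 hg)

theorem bijS011_EMat (hB : IsN011 R B) (hs : B.Separable R) (hw : WellPosed R B) :
    BijS011 R (EMat R B) where
  inj g hg h := hw.1 g hg ((BH1_eq_S011_EMat hB hs hg).trans h)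
  surj f hf := by
    obtain ⟨g, hg, h⟩ := hw.2 f hf
    exact ⟨g, hg, (BH1_eq_S011_EMat hB hs hg).symm.trans h⟩

/-- For well-posed boundary conditions, a left inverse is an inverse. -/
theorem isInverse_of_left (hB : IsN011 R B) (hs : B.Separable R) (hw : WellPosed R B)
    (hE : IsN011 R Eh) (hEs : Eh.Separable R)
    (h : ∀ g, MemRL R g → EqRL R (S011 R Eh (S011 R (EMat R B) g)) g) : IsInverse R B Eh := by
  have hl : ∀ g, MemRL R g → EqRL R (P011 R Eh (BH1 R B g)) g := fun g hg =>
    ((P011_eq hE hEs (memRL_BH1 hB hs hg)).trans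
      (S011_congr Eh (BH1_eq_S011_EMat hB hs hg))).trans (h g hg)
  refine ⟨hE, hEs, hl, fun f hf => ?_⟩
  obtain ⟨g, hg, hgf⟩ := hw.2 f hf
  have h1 := (P011_congr hE hEs (memRL_BH1 hB hs hg) hgf).symm.trans (hl g hg)
  exact (BH1_congr hB hs hg h1.symm).symm.trans hgf

theorem exists_isInverse (hB : IsN011 R B) (hs : B.Separable R) (hw : WellPosed R B) :
    ∃ Eh, IsInverse R B Eh := by
  obtain ⟨M, hM, hMs, h⟩ := exists_left_inverse (isN011_EMat hB) (bijS011_EMat hB hs hw)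
  exact ⟨M, isInverse_of_left hB hs hw hM hMs h⟩

end EMat

/-! ## The explicit inverse -/

section algebra

variable {R : Rect} {q : ℕ} {ι₀ ι₁ : Type*} [Fintype ι₀] [Fintype ι₁] [DecidableEq ι₀]
  [DecidableEq ι₁] {Q : N011 ι₀ ι₁ ι₀ ι₁} {S : SepData q ι₀ ι₁}

theorem neg_mul_inv_mul {κ : Type*} {A : Matrix (Fin q) (Fin q) ℝ} (h : IsUnit A.det)
    (M : Matrix κ (Fin q) ℝ) : -M * A⁻¹ * A = -M :=
  Matrix.nonsing_inv_mul_cancel_right A (-M) h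

theorem Gxxh_mul (h : LinvDefined R Q S) : Gxxh R Q S * SigmaX R Q S =
    -(PIxx Q S + Gxyh R Q S * Kyy R Q S * PIyx Q S) :=
  neg_mul_inv_mul h.sigmaX _

theorem Gyyh_mul (h : LinvDefined R Q S) : Gyyh R Q S * SigmaY R Q S =
    -(PIyy Q S + Gyxh R Q S * Kxx R Q S * PIxy Q S) :=
  neg_mul_inv_mul h.sigmaY _

theorem Gxyh_mul (h : LinvDefined R Q S) : Gxyh R Q S * DeltaY R Q S =
    -(PIxy Q S - PIxx Q S * Exy R Q S) :=
  neg_mul_inv_mul h.deltaY _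

theorem Gyxh_mul (h : LinvDefined R Q S) : Gyxh R Q S * DeltaX R Q S =
    -(PIyx Q S - PIyy Q S * Eyx R Q S) :=
  neg_mul_inv_mul h.deltaX _

theorem H0xh_mul (h : LinvDefined R Q S) : H0xh R Q S * SigmaX R Q S =
    -(Q.z00⁻¹ * S.H0x + H0yh R Q S * Kyy R Q S * PIyx Q S) :=
  neg_mul_inv_mul h.sigmaX _

theorem H0yh_mul (h : LinvDefined R Q S) : H0yh R Q S * DeltaY R Q S =
    -(Q.z00⁻¹ * S.H0y - Q.z00⁻¹ * S.H0x * Exy R Q S) :=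
  neg_mul_inv_mul h.deltaY _

theorem SigmaX_mul_Exy (h : LinvDefined R Q S) :
    SigmaX R Q S * Exy R Q S = Kxx R Q S * PIxy Q S := by
  rw [Exy, Matrix.mul_assoc, Matrix.mul_nonsing_inv_cancel_left _ _ h.sigmaX]

theorem SigmaY_mul_Eyx (h : LinvDefined R Q S) :
    SigmaY R Q S * Eyx R Q S = Kyy R Q S * PIyx Q S := by
  rw [Eyx, Matrix.mul_assoc, Matrix.mul_nonsing_inv_cancel_left _ _ h.sigmaY]

/-- Elimination of the first unknown in a block system. -/
theorem block_elimination {κ : Type*} {Sx Sy Kx Ky Pxy Pyx e : Matrix (Fin q) (Fin q) ℝ}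
    {X Y M₁ M₂ : Matrix κ (Fin q) ℝ} (he : Sx * e = Kx * Pxy)
    (hX : X * Sx = -(M₁ + Y * Ky * Pyx)) (hY : Y * (Sy - Ky * Pyx * e) = -(M₂ - M₁ * e)) :
    M₂ + X * Kx * Pxy + Y * Sy = 0 := by
  have h1 : X * Kx * Pxy = -(M₁ + Y * Ky * Pyx) * e := by
    rw [Matrix.mul_assoc, ← he, ← Matrix.mul_assoc, hX]
  rw [Matrix.mul_sub, sub_eq_iff_eq_add] at hY
  rw [h1, hY]
  simp only [Matrix.neg_mul, Matrix.add_mul, Matrix.mul_assoc]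
  abel

/-- The identities `Linv_**` say that the finite-rank parts of the composition of the two operators
cancel. Those named `xx`, `yy`, `0x` are the defining equations of `Gxxh`, `Gyyh`, `H0xh` multiplied
out; those named `xy`, `yx`, `0y` need the elimination through `Exy` or `Eyx`, and this is where
`DeltaX` and `DeltaY` enter. -/
theorem Linv_xy (h : LinvDefined R Q S) :
    PIxy Q S + Gxxh R Q S * Kxx R Q S * PIxy Q S + Gxyh R Q S * SigmaY R Q S = 0 :=
  block_elimination (SigmaX_mul_Exy h) (Gxxh_mul h) (Gxyh_mul h)

theorem Linv_yx (h : LinvDefined R Q S) :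
    PIyx Q S + Gyyh R Q S * Kyy R Q S * PIyx Q S + Gyxh R Q S * SigmaX R Q S = 0 :=
  block_elimination (SigmaY_mul_Eyx h) (Gyyh_mul h) (Gyxh_mul h)

theorem Linv_0y (h : LinvDefined R Q S) :
    Q.z00⁻¹ * S.H0y + H0xh R Q S * Kxx R Q S * PIxy Q S + H0yh R Q S * SigmaY R Q S = 0 :=
  block_elimination (SigmaX_mul_Exy h) (H0xh_mul h) (H0yh_mul h)

theorem diagonal_row {κ : Type*} {X M₁ : Matrix κ (Fin q) ℝ} {Sx N : Matrix (Fin q) (Fin q) ℝ}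
    {Y : Matrix κ (Fin q) ℝ} {K : Matrix (Fin q) (Fin q) ℝ} (hX : X * Sx = -(M₁ + Y * K * N)) :
    M₁ + X * Sx + Y * K * N = 0 := by
  rw [hX]
  abel

theorem Linv_xx (h : LinvDefined R Q S) :
    PIxx Q S + Gxxh R Q S * SigmaX R Q S + Gxyh R Q S * Kyy R Q S * PIyx Q S = 0 :=
  diagonal_row (Gxxh_mul h)

theorem Linv_yy (h : LinvDefined R Q S) :
    PIyy Q S + Gyyh R Q S * SigmaY R Q S + Gyxh R Q S * Kxx R Q S * PIxy Q S = 0 :=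
  diagonal_row (Gyyh_mul h)

theorem Linv_0x (h : LinvDefined R Q S) :
    Q.z00⁻¹ * S.H0x + H0xh R Q S * SigmaX R Q S + H0yh R Q S * Kyy R Q S * PIyx Q S = 0 :=
  diagonal_row (H0xh_mul h)

/-- The row of a block system in which the first unknown is eliminated by `P`. -/
theorem row_mulVec {κ ι : Type*} [Fintype ι] [DecidableEq ι] {P : Matrix ι ι ℝ}
    (hP : IsUnit P.det) {Kx Ky Gxx Gxy Gyx Gyy : Matrix (Fin q) (Fin q) ℝ}
    {hx hy : Matrix (Fin q) ι ℝ} {h0x h0y : Matrix ι (Fin q) ℝ}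
    {hr : Matrix κ ι ℝ} {Gx Gy : Matrix κ (Fin q) ℝ} {U W : Matrix κ (Fin q) ℝ}
    (e1 : Gx - hr * P⁻¹ * h0x + U * (1 + Kx * (Gxx - hx * P⁻¹ * h0x)) +
      W * Ky * (Gyx - hy * P⁻¹ * h0x) = 0)
    (e2 : Gy - hr * P⁻¹ * h0y + U * Kx * (Gxy - hx * P⁻¹ * h0y) +
      W * (1 + Ky * (Gyy - hy * P⁻¹ * h0y)) = 0) (g : ι → ℝ) (p r : Fin q → ℝ) :
    (-(hr + U * Kx * hx + W * Ky * hy) * P⁻¹) *ᵥ (P *ᵥ g + h0x *ᵥ p + h0y *ᵥ r) +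
      U *ᵥ (Kx *ᵥ (hx *ᵥ g + Gxx *ᵥ p + Gxy *ᵥ r) + p) +
      W *ᵥ (Ky *ᵥ (hy *ᵥ g + Gyx *ᵥ p + Gyy *ᵥ r) + r) + (hr *ᵥ g + Gx *ᵥ p + Gy *ᵥ r) = 0 := by
  -- The two hypotheses are the coefficients of `p` and `r`. The coefficient of `g` vanishes because
  -- `P⁻¹ P = 1`.
  have h := congrArg₂ (· + ·) (congrArg (fun M => M *ᵥ p) e1) (congrArg (fun M => M *ᵥ r) e2)
  have hg : P⁻¹ *ᵥ P *ᵥ g = g := by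
    rw [Matrix.mulVec_mulVec, Matrix.nonsing_inv_mul _ hP, Matrix.one_mulVec]
  refine Eq.trans ?_ (h.trans (by simp))
  simp only [Matrix.neg_mul, Matrix.neg_mulVec, Matrix.mulVec_add, Matrix.add_mulVec,
    Matrix.sub_mulVec, Matrix.mulVec_sub, ← Matrix.mulVec_mulVec, hg, Matrix.one_mulVec]
  abel

end algebra

/-! ### Operators whose integral part has finite rank -/

section factored

variable {R : Rect} {q : ℕ} {ι₀ ι₁ : Type*}

/-- Factorizations of the off-diagonal and integral parameters. -/
structure IsFactored (R : Rect) (N : N011 ι₀ ι₁ ι₀ ι₁) (Ux Uy : ℝ → Matrix (Fin q) ι₁ ℝ)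
    (Vx Vy : ℝ → Matrix ι₁ (Fin q) ℝ) (h0x h0y : Matrix ι₀ (Fin q) ℝ)
    (hx hy : Matrix (Fin q) ι₀ ℝ) (Gxx Gxy Gyx Gyy : Matrix (Fin q) (Fin q) ℝ) : Prop where
  memUx : MatL2 R.mux Ux
  memUy : MatL2 R.muy Uy
  memVx : MatL2 R.mux Vx
  memVy : MatL2 R.muy Vy
  z0x : ∀ᵐ x ∂ R.mux, N.z0x x = h0x * Ux x
  z0y : ∀ᵐ y ∂ R.muy, N.z0y y = h0y * Uy y
  x0 : ∀ᵐ x ∂ R.mux, N.x0 x = Vx x * hx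
  y0 : ∀ᵐ y ∂ R.muy, N.y0 y = Vy y * hy
  xx : ∀ᵐ x ∂ R.mux, ∀ᵐ θ ∂ R.mux, N.xx.r1 x θ = Vx x * Gxx * Ux θ
  xy : ∀ᵐ x ∂ R.mux, ∀ᵐ y ∂ R.muy, N.xy x y = Vx x * Gxy * Uy y
  yx : ∀ᵐ y ∂ R.muy, ∀ᵐ x ∂ R.mux, N.yx x y = Vy y * Gyx * Ux x
  yy : ∀ᵐ y ∂ R.muy, ∀ᵐ ν ∂ R.muy, N.yy.r1 y ν = Vy y * Gyy * Uy ν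

variable [Fintype ι₀] [Fintype ι₁] {N : N011 ι₀ ι₁ ι₀ ι₁} {Ux Uy : ℝ → Matrix (Fin q) ι₁ ℝ}
  {Vx Vy : ℝ → Matrix ι₁ (Fin q) ℝ} {h0x h0y : Matrix ι₀ (Fin q) ℝ}
  {hx hy : Matrix (Fin q) ι₀ ℝ} {Gxx Gxy Gyx Gyy : Matrix (Fin q) (Fin q) ℝ} {g : RL ι₀ ι₁}

theorem integral_mulVec_of_ae_eq {α ι κ τ : Type*} [MeasurableSpace α] {μ : Measure α} [Fintype ι]
    [Fintype κ] [Fintype τ] {U : α → Matrix κ τ ℝ} {u : α → τ → ℝ} (hU : MatL2 μ U)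
    (hu : MemL2 μ u) {W : α → Matrix ι τ ℝ} {C : Matrix ι κ ℝ} (h : ∀ᵐ t ∂μ, W t = C * U t) :
    ∫ t, W t *ᵥ u t ∂μ = C *ᵥ ∫ t, U t *ᵥ u t ∂μ := by
  rw [mulVec_integral C (hU.mulVec_integrable hu)]
  refine integral_congr_ae ?_
  filter_upwards [h] with t ht
  rw [ht, Matrix.mulVec_mulVec]

/-- Apart from the multipliers, the operator depends on the edge functions only through the moments
`p` and `r`, which reduces its composition with another one to matrix algebra. -/
theorem IsFactored.S011_eq (h : IsFactored R N Ux Uy Vx Vy h0x h0y hx hy Gxx Gxy Gyx Gyy)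
    (hg : MemRL R g) {p r : Fin q → ℝ} (hp : ∫ x, Ux x *ᵥ g.2.1 x ∂ R.mux = p)
    (hr : ∫ y, Uy y *ᵥ g.2.2 y ∂ R.muy = r) : EqRL R (S011 R N g)
      (N.z00 *ᵥ g.1 + h0x *ᵥ p + h0y *ᵥ r,
        fun x => Vx x *ᵥ (hx *ᵥ g.1 + Gxx *ᵥ p + Gxy *ᵥ r) + N.xx.r0 x *ᵥ g.2.1 x,
        fun y => Vy y *ᵥ (hy *ᵥ g.1 + Gyx *ᵥ p + Gyy *ᵥ r) + N.yy.r0 y *ᵥ g.2.2 y) := by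
  subst hp hr
  refine ⟨?_, ?_, ?_⟩
  · simp only [S011, integral_mulVec_of_ae_eq h.memUx hg.1 h.z0x,
      integral_mulVec_of_ae_eq h.memUy hg.2 h.z0y]
  · filter_upwards [h.x0, h.xx, h.xy] with x h0 h1 h2
    simp only [S011, h0, integral_mulVec_of_ae_eq h.memUx hg.1 h1,
      integral_mulVec_of_ae_eq h.memUy hg.2 h2, Matrix.mulVec_add, Matrix.mulVec_mulVec]
    abel
  · filter_upwards [h.y0, h.yx, h.yy] with x h0 h1 h2
    simp only [S011, h0, integral_mulVec_of_ae_eq h.memUx hg.1 h1,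
      integral_mulVec_of_ae_eq h.memUy hg.2 h2, Matrix.mulVec_add, Matrix.mulVec_mulVec]
    abel

end factored

section Linv

variable {R : Rect} {q : ℕ} {ι₀ ι₁ : Type*} [Fintype ι₀] [Fintype ι₁] [DecidableEq ι₀]
  [DecidableEq ι₁] {Q : N011 ι₀ ι₁ ι₀ ι₁} {S : SepData q ι₀ ι₁} {g : RL ι₀ ι₁}

omit [Fintype ι₀] [Fintype ι₁] [DecidableEq ι₀] [DecidableEq ι₁] in
theorem IsDecomp.isFactored (hS : IsDecomp R Q S) : IsFactored R Q S.Z S.Z (fun x => (S.Z x)ᵀ)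
    (fun y => (S.Z y)ᵀ) S.H0x S.H0y S.Hx0 S.Hy0 S.Gxx S.Gxy S.Gyx S.Gyy where
  memUx := hS.Zx
  memUy := hS.Zy
  memVx := hS.Zx.transpose
  memVy := hS.Zy.transpose
  z0x := hS.z0x
  z0y := hS.z0y
  x0 := hS.x0
  y0 := hS.y0
  xx := Measure.ae_ae_of_ae_prod hS.xx
  xy := Measure.ae_ae_of_ae_prod hS.xy
  yx := ae_ae_y hS.yx
  yy := Measure.ae_ae_of_ae_prod hS.yy

theorem isFactored_Linv (hS : IsDecomp R Q S) (hx : MatLinf R.mux fun x => (Q.xx.r0 x)⁻¹)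
    (hy : MatLinf R.muy fun y => (Q.yy.r0 y)⁻¹) : IsFactored R (Linv R Q S)
    (fun x => S.Z x * (Q.xx.r0 x)⁻¹) (fun y => S.Z y * (Q.yy.r0 y)⁻¹)
    (fun x => (Q.xx.r0 x)⁻¹ * (S.Z x)ᵀ) (fun y => (Q.yy.r0 y)⁻¹ * (S.Z y)ᵀ)
    (H0xh R Q S) (H0yh R Q S) (Hx0h R Q S) (Hy0h R Q S) (Gxxh R Q S) (Gxyh R Q S) (Gyxh R Q S)
    (Gyyh R Q S) where
  memUx := hS.Zx.mul_matLinf hx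
  memUy := hS.Zy.mul_matLinf hy
  memVx := hx.mul_matL2 hS.Zx.transpose
  memVy := hy.mul_matL2 hS.Zy.transpose
  z0x := ae_of_all _ fun _ => rfl
  z0y := ae_of_all _ fun _ => rfl
  x0 := ae_of_all _ fun _ => rfl
  y0 := ae_of_all _ fun _ => rfl
  xx := ae_of_all _ fun _ => ae_of_all _ fun _ => rfl
  xy := ae_of_all _ fun _ => ae_of_all _ fun _ => rfl
  yx := ae_of_all _ fun _ => ae_of_all _ fun _ => rfl
  yy := ae_of_all _ fun _ => ae_of_all _ fun _ => rfl

theorem isN011_Linv (hS : IsDecomp R Q S) (hx : MatLinf R.mux fun x => (Q.xx.r0 x)⁻¹)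
    (hy : MatLinf R.muy fun y => (Q.yy.r0 y)⁻¹) : IsN011 R (Linv R Q S) := by
  have h := isFactored_Linv hS hx hy
  exact
  { z0x := h.memUx.const_mul _
    z0y := h.memUy.const_mul _
    x0 := h.memVx.mul_const _
    xx := ⟨hx, (h.memVx.mul_const _).tensor h.memUx, (h.memVx.mul_const _).tensor h.memUx⟩
    xy := (h.memVx.mul_const _).tensor h.memUy
    y0 := h.memVy.mul_const _
    yx := ((h.memVy.mul_const _).tensor h.memUx).swap
    yy := ⟨hy, (h.memVy.mul_const _).tensor h.memUy, (h.memVy.mul_const _).tensor h.memUy⟩ }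

/-- The moments of `r₀⁻¹ f` for `f = Zᵀ a + r₀ g`. -/
theorem integral_moment {s t : ℝ} (hst : s ≤ t) {Z : ℝ → Matrix (Fin q) ι₁ ℝ} {r : ℝ → Matrix ι₁ ι₁ ℝ}
    {u : ℝ → ι₁ → ℝ} (hZ : MatL2 (muI s t) Z) (hr : MatLinf (muI s t) fun x => (r x)⁻¹)
    (hru : ∀ᵐ x ∂muI s t, IsUnit (r x).det) (hu : MemL2 (muI s t) u) (a : Fin q → ℝ) :
    ∫ x, (Z x * (r x)⁻¹) *ᵥ ((Z x)ᵀ *ᵥ a + r x *ᵥ u x) ∂muI s t =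
      matInt s t (fun x => Z x * (r x)⁻¹ * (Z x)ᵀ) *ᵥ a + ∫ x, Z x *ᵥ u x ∂muI s t := by
  have hU := hZ.mul_matLinf hr
  have hi : Integrable (fun x => (Z x * (r x)⁻¹ * (Z x)ᵀ) *ᵥ a) (muI s t) := by
    simpa only [Matrix.mulVec_mulVec] using
      hU.mulVec_integrable (hZ.transpose.mulVec_const a)
  have e : matInt s t (fun x => Z x * (r x)⁻¹ * (Z x)ᵀ) *ᵥ a =
      ∫ x, (Z x * (r x)⁻¹ * (Z x)ᵀ) *ᵥ a ∂muI s t := by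
    have hij := fun i j => hU.mul_entry_integrable hZ.transpose i j
    rw [matInt_eq hst]
    funext i
    rw [eval_integral fun i => hi.eval i]
    simp only [Matrix.mulVec, dotProduct, matIntegral, Matrix.of_apply]
    rw [integral_finsetSum _ fun j _ => (hij i j).mul_const _]
    exact Finset.sum_congr rfl fun j _ => (integral_mul_const _ _).symm
  rw [e, ← integral_add hi (hZ.mulVec_integrable hu)]
  refine integral_congr_ae ?_
  filter_upwards [hru] with x hx
  rw [Matrix.mulVec_add, Matrix.mulVec_mulVec, Matrix.mulVec_mulVec,
    Matrix.nonsing_inv_mul_cancel_right _ _ hx]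

theorem cancel_row {A : Matrix ι₁ ι₁ ℝ} (hA : IsUnit A.det) {W : Matrix ι₁ (Fin q) ℝ}
    {a a' : Fin q → ℝ} (h : a' = -a) (v : ι₁ → ℝ) :
    (A⁻¹ * W) *ᵥ a' + A⁻¹ *ᵥ (W *ᵥ a + A *ᵥ v) = v := by
  rw [h, Matrix.mulVec_add, Matrix.mulVec_mulVec, Matrix.mulVec_mulVec, Matrix.mulVec_neg,
    neg_add_cancel_left, Matrix.nonsing_inv_mul _ hA, Matrix.one_mulVec]

/-- Both operators are factored. By `integral_moment` the moments of the first output, weighted by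
the inverse multipliers, are `Kxx a + p` and `Kyy b + r`. The three components of the composition
then reduce to three instances of `row_mulVec`. -/
theorem S011_Linv_S011 (hQ : IsN011 R Q) (hS : IsDecomp R Q S) (hL : LinvDefined R Q S)
    (hx : MatLinf R.mux fun x => (Q.xx.r0 x)⁻¹) (hy : MatLinf R.muy fun y => (Q.yy.r0 y)⁻¹)
    (hg : MemRL R g) : EqRL R (S011 R (Linv R Q S) (S011 R Q g)) g := by
  set p := ∫ x, S.Z x *ᵥ g.2.1 x ∂ R.mux with hp
  set r := ∫ y, S.Z y *ᵥ g.2.2 y ∂ R.muy with hr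
  have e1 := hS.isFactored.S011_eq hg hp.symm hr.symm
  set a := S.Hx0 *ᵥ g.1 + S.Gxx *ᵥ p + S.Gxy *ᵥ r
  set b := S.Hy0 *ᵥ g.1 + S.Gyx *ᵥ p + S.Gyy *ᵥ r
  have e2 := (isFactored_Linv hS hx hy).S011_eq ((memRL_S011 hQ hg).congr e1)
    (integral_moment R.hab.le hS.Zx hx hL.xx hg.1 a)
    (integral_moment R.hcd.le hS.Zy hy hL.yy hg.2 b)
  refine ((S011_congr _ e1).trans e2).trans ?_
  -- The vector row fits the same pattern: with `hr = -1` and `Gx = Gy = 0`, the vanishing sum says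
  -- that this row reproduces `g.1`, and the coefficient of `Q.z00⁻¹` is that in `(Linv R Q S).z00`.
  have e0 := row_mulVec hL.z00 (hr := -1) (Gx := 0) (Gy := 0) (U := H0xh R Q S)
    (W := H0yh R Q S) (Kx := Kxx R Q S) (Ky := Kyy R Q S) (hx := S.Hx0) (hy := S.Hy0)
    (h0x := S.H0x) (h0y := S.H0y) (Gxx := S.Gxx) (Gxy := S.Gxy) (Gyx := S.Gyx) (Gyy := S.Gyy)
    (by simpa [PIxx, PIyx, SigmaX] using Linv_0x hL)
    (by simpa [PIxy, PIyy, SigmaY] using Linv_0y hL) g.1 p r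
  have ex := row_mulVec hL.z00 (Linv_xx hL) (Linv_xy hL) g.1 p r
  have ey := row_mulVec hL.z00 (Linv_yy hL) (Linv_yx hL) g.1 r p
  -- The row for `y` is the row for `x` with the roles of the variables exchanged; the summands are
  -- put back into the common order.
  rw [add_right_comm _ (S.H0y *ᵥ r), add_right_comm _ (S.Gyy *ᵥ r),
    add_right_comm _ (S.Gxy *ᵥ r), add_right_comm _ (Gyyh R Q S *ᵥ _)] at ey
  refine ⟨?_, ?_, ?_⟩
  · simp only [Matrix.zero_mulVec, add_zero, Matrix.neg_mulVec, Matrix.one_mulVec] at e0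
    rw [← sub_eq_add_neg, sub_eq_zero] at e0
    refine Eq.trans ?_ e0
    simp only [Linv, neg_add, neg_neg, sub_eq_add_neg]
    rfl
  · filter_upwards [hL.xx] with x hx
    exact cancel_row hx (eq_neg_of_add_eq_zero_left ex) _
  · filter_upwards [hL.yy] with y hy
    exact cancel_row hy (eq_neg_of_add_eq_zero_left ey) _

end Linv

section

variable {R : Rect} {n1 n2 q : ℕ} {B : BCParam n1 n2}
  {S : SepData q (Core 4 n1 n2) (Core 2 n1 n2)}

/-- `LinvDefined` makes the multipliers invertible only pointwise almost everywhere. That the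
inverses are essentially bounded, and that the left inverse is two-sided, comes from well-posedness.
-/
theorem isInverse_Linv (hB : IsN011 R B) (hs : B.Separable R) (hw : WellPosed R B)
    (hS : IsDecomp R (EMat R B) S) (hL : LinvDefined R (EMat R B) S) :
    IsInverse R B (Linv R (EMat R B) S) := by
  have hE := isN011_EMat hB
  have hb := bijS011_EMat hB hs hw
  have hx := (hb.inv_xx hE).2
  have hy := (hb.inv_yy hE).2
  exact isInverse_of_left hB hs hw (isN011_Linv hS hx hy) ⟨.rfl, .rfl⟩
    fun g hg => S011_Linv_S011 hE hS hL hx hy hg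

end

end PI2D

end

/-! ### Assembly of the three assertions -/

theorem mainTheorem1 (R : PI2D.Rect) (n0 n1 n2 : ℕ) (B : PI2D.BCParam n1 n2)
    (hB : PI2D.IsN011 R B) (hsep : B.Separable R) (hwp : PI2D.WellPosed R B) :
    -- the inverse of `P[B] ∘ P[H₁]` is a 011-PI operator with separable diagonal parts
    (∃ Eh, PI2D.IsInverse R B Eh) ∧
    -- it is given by the explicit formula whenever that formula is defined
    (∀ (q : ℕ) (S : PI2D.SepData q (PI2D.Core 4 n1 n2) (PI2D.Core 2 n1 n2)),
      PI2D.IsDecomp R (PI2D.EMat R B) S → PI2D.LinvDefined R (PI2D.EMat R B) S →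
        PI2D.IsInverse R B (PI2D.Linv R (PI2D.EMat R B) S)) ∧
    -- the operator `P[T]` built from the parameters of the inverse is inverse to `D`
    (∀ Eh, PI2D.IsInverse R B Eh →
      let T : PI2D.N2D (PI2D.State n0 n1 n2) (PI2D.State n0 n1 n2) := PI2D.TMat R B Eh
      PI2D.IsN2D R T ∧
      (∀ u, PI2D.MemX R B u →
        (∃ uh, PI2D.IsD R u uh) ∧ ∀ uh, PI2D.IsD R u uh → u =ᵐ[R.mu] PI2D.P2D R T uh) ∧
      (∀ uh, PI2D.MemL2 R.mu uh →
        PI2D.MemX R B (PI2D.P2D R T uh) ∧ PI2D.IsD R (PI2D.P2D R T uh) uh)) :=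
  ⟨PI2D.exists_isInverse hB hsep hwp,
    fun _ _ hS hL => PI2D.isInverse_Linv hB hsep hwp hS hL,
    fun _ hE => ⟨PI2D.isN2D_TMat hB hE.mem,
      fun _ hX => ⟨PI2D.exists_isD hX.1 hX.2.1 hX.2.2.1,
        fun _ hD => PI2D.ae_eq_P2D_of_memX hB hsep hE hX hD⟩,
      fun _ hu => PI2D.memX_P2D hB hsep hE hu⟩⟩
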